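/- Let $(M,g)$ be a complete (connected) smooth Riemannian manifold of dimension $n$, let $\varphi:M\to\mathbb R$ be smooth, let $p>1$, $q>0$ and suppose $\delta:=q(p-1)-1\ge 0$. Write $u^q:=|u|^{q-1}u$ and $\mathcal L_{p,\varphi}v=e^{\varphi}\operatorname{div}\big(e^{-\varphi}|\nabla v|^{p-2}\nabla v\big)$ (in the weak sense, tested against $C_c^\infty(M)$). Let $L^r_\varphi(M)$ be the Lebesgue space of the measure $e^{-\varphi}dV_g$, and let $W^{1,r}_{0;\varphi}(M)$ be the closure of $C_c^\infty(M)$ in the Sobolev space of functions $f\in L^r_\varphi(M)$ with weak gradient in $L^r_\varphi$. Let $-\infty\le a<b<\infty$ (for $a=-\infty$ read $[a,b]$ as $(-\infty,b]$), let $C:(a,b)\to[0,\infty)$ be smooth with $\int_a^b C(s)^2\,ds<\infty$, and let $u:M\times[a,b]\to\mathbb R$ be such that for every $t\in[a,b]$ the derivative $u_t(\cdot,t)=\partial_tu(\cdot,t)$ of the curve $t\mapsto u(\cdot,t)$ exists in $L^{q+1}_\varphi(M)$ (one-sided at end points), with $$u(\cdot,t),\;u_t(\cdot,t)\in W^{1,q+1}_{0;\varphi}(M),\qquad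 \nabla u^q(\cdot,t)\in L^p_\varphi(M).$$ Suppose that for every $t\in(a,b)$, almost everywhere on $M$, $$\big|\partial_tu-\mathcal L_{p,\varphi}u^q\big|\le\begin{cases}C(t)\big(|u|+|\nabla u^q|^{p/(q+1)}\big)&\text{if }q\ge1,\\ C(t)\big(|u|+|u|^{1/2}|\nabla u^q|^{p/(2q+2)}\big)&\text{if }0<q<1.\end{cases}$$ Then backward uniqueness holds: if $u(\cdot,b)=0$ almost everywhere on $M$, then $u(\cdot,t)=0$ almost everywhere on $M$ for every $t\in[a,b]$. -/

import Mathlib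

open MeasureTheory Filter Set Bundle Manifold
open scoped Topology ContDiff

noncomputable section

namespace ParabolicFrequency

section Geometry

variable {n : ℕ} {M : Type*} [TopologicalSpace M] [ChartedSpace (EuclideanSpace ℝ (Fin n)) M]

/-- The `i`-th coordinate vector field `∂_i` of the chart `c`, at the point with coordinates `y`. -/
def coordVec (c : OpenPartialHomeomorph M (EuclideanSpace ℝ (Fin n)))
    (y : EuclideanSpace ℝ (Fin n)) (i : Fin n) : TangentSpace (𝓡 n) (c.symm y) :=
  mfderiv (𝓡 n) (𝓡 n) c.symm y
    ((NormedSpace.fromTangentSpace (𝕜 := ℝ) y).symm (EuclideanSpace.single i (1 : ℝ)))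

variable [RiemannianBundle (fun x : M => TangentSpace (𝓡 n) x)]

/-- The matrix `g_ij = ⟨∂_i, ∂_j⟩` of the metric in the chart `c`. -/
def gramMatrix (c : OpenPartialHomeomorph M (EuclideanSpace ℝ (Fin n)))
    (y : EuclideanSpace ℝ (Fin n)) : Matrix (Fin n) (Fin n) ℝ :=
  Matrix.of fun i j => inner ℝ (coordVec c y i) (coordVec c y j)

variable (n M) in
/-- The Riemannian volume `dV_g`. For a chart `c` the measure `√(det g_ij) dy` on `c.target`,
transported to `M`, is the Riemannian volume restricted to `c.source`; any two of these measures
agree where both charts are defined, so that their supremum (the least measure that dominates all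
of them) is the Riemannian volume of `M`. -/
def riemannianVolume [MeasurableSpace M] : Measure M :=
  ⨆ c ∈ atlas (EuclideanSpace ℝ (Fin n)) M,
    ((volume.restrict c.target).withDensity
      (fun y => ENNReal.ofReal (Real.sqrt (gramMatrix c y).det))).map c.symm

/-- The weighted measure `e^{-φ} dV_g`. -/
def weightedVolume (n : ℕ) {M : Type*} [TopologicalSpace M]
    [ChartedSpace (EuclideanSpace ℝ (Fin n)) M]
    [RiemannianBundle (fun x : M => TangentSpace (𝓡 n) x)] [MeasurableSpace M]
    (φ : M → ℝ) : Measure M :=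
  (riemannianVolume n M).withDensity (fun x => ENNReal.ofReal (Real.exp (-φ x)))

/-- The Riemannian gradient of a differentiable function: `⟨∇ψ, w⟩ = dψ(w)`. -/
def grad (ψ : M → ℝ) (x : M) : TangentSpace (𝓡 n) x :=
  haveI : FiniteDimensional ℝ (TangentSpace (𝓡 n) x) :=
    inferInstanceAs (FiniteDimensional ℝ (EuclideanSpace ℝ (Fin n)))
  haveI : CompleteSpace (TangentSpace (𝓡 n) x) := FiniteDimensional.complete ℝ _
  (InnerProductSpace.toDual ℝ (TangentSpace (𝓡 n) x)).symm
    (mvfderiv (𝓡 n) ψ x)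

theorem inner_grad (ψ : M → ℝ) (x : M) (w : TangentSpace (𝓡 n) x) :
    inner ℝ (grad ψ x) w = mvfderiv (𝓡 n) ψ x w := by
  simp [grad, InnerProductSpace.toDual_symm_apply]

/-- `ψ ∈ C_c^∞(M)`. -/
def IsTestFunction (n : ℕ) {M : Type*} [TopologicalSpace M]
    [ChartedSpace (EuclideanSpace ℝ (Fin n)) M] (ψ : M → ℝ) : Prop :=
  ContMDiff (𝓡 n) 𝓘(ℝ, ℝ) ∞ ψ ∧ HasCompactSupport ψ

/-- The vector field `G` is the weak gradient of `f`: both are locally integrable, and in every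
chart the functions `⟨G, ∂_i⟩` are the weak partial derivatives of `f`. -/
def HasWeakGradient (f : M → ℝ) (G : (x : M) → TangentSpace (𝓡 n) x) : Prop :=
  ∀ c ∈ atlas (EuclideanSpace ℝ (Fin n)) M,
    LocallyIntegrableOn (fun y => f (c.symm y)) c.target ∧
    ∀ i : Fin n,
      LocallyIntegrableOn (fun y => inner ℝ (G (c.symm y)) (coordVec c y i)) c.target ∧
      ∀ ψ : EuclideanSpace ℝ (Fin n) → ℝ, ContDiff ℝ ∞ ψ → HasCompactSupport ψ →
        tsupport ψ ⊆ c.target →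
        ∫ y, f (c.symm y) * fderiv ℝ ψ y (EuclideanSpace.single i (1 : ℝ)) =
          - ∫ y, inner ℝ (G (c.symm y)) (coordVec c y i) * ψ y

variable [MeasurableSpace M]

/-- `f ∈ W^{1,r}_{0;φ}(M)`: `f` and its weak gradient are in `L^r_φ(M)`, and `f` is a limit of
functions in `C_c^∞(M)` for the norm of `W^{1,r}_φ(M)`. -/
def MemW10 (n : ℕ) {M : Type*} [TopologicalSpace M]
    [ChartedSpace (EuclideanSpace ℝ (Fin n)) M]
    [RiemannianBundle (fun x : M => TangentSpace (𝓡 n) x)] [MeasurableSpace M]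
    (φ : M → ℝ) (r : ℝ) (f : M → ℝ) : Prop :=
  ∃ G : (x : M) → TangentSpace (𝓡 n) x, HasWeakGradient f G ∧
    MemLp f (ENNReal.ofReal r) (weightedVolume n φ) ∧
    MemLp (fun x => ‖G x‖) (ENNReal.ofReal r) (weightedVolume n φ) ∧
    ∀ ε : ENNReal, 0 < ε → ∃ ψ : M → ℝ, IsTestFunction n ψ ∧
      eLpNorm (fun x => f x - ψ x) (ENNReal.ofReal r) (weightedVolume n φ) ≤ ε ∧
      eLpNorm (fun x => ‖G x - grad ψ x‖) (ENNReal.ofReal r) (weightedVolume n φ) ≤ ε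

/-- `F = 𝓛_{p,φ} v = e^φ div(e^{-φ} |∇v|^{p-2} ∇v)` in the weak sense, where `G = ∇v`:
`∫ F ψ e^{-φ} dV = - ∫ |∇v|^{p-2} ⟨∇v, ∇ψ⟩ e^{-φ} dV` for all `ψ ∈ C_c^∞(M)`. -/
def HasWeakPLaplacian (φ : M → ℝ) (p : ℝ) (G : (x : M) → TangentSpace (𝓡 n) x)
    (F : M → ℝ) : Prop :=
  LocallyIntegrable F (weightedVolume n φ) ∧
  LocallyIntegrable (fun x => ‖G x‖ ^ (p - 1)) (weightedVolume n φ) ∧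
  ∀ ψ : M → ℝ, IsTestFunction n ψ →
    ∫ x, F x * ψ x ∂(weightedVolume n φ) =
      - ∫ x, ‖G x‖ ^ (p - 2) * inner ℝ (G x) (grad ψ x) ∂(weightedVolume n φ)

/-- The signed power `u^q = |u|^{q-1} u`. -/
def spow (q s : ℝ) : ℝ := |s| ^ (q - 1) * s

/-- The standing assumption on a time slice `u = u(·,t)`, `ut = u_t(·,t)`:
`u, u_t ∈ W^{1,q+1}_{0;φ}(M)` and `∇u^q ∈ L^p_φ(M)`. -/
def StandingAssumption (n : ℕ) {M : Type*} [TopologicalSpace M]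
    [ChartedSpace (EuclideanSpace ℝ (Fin n)) M]
    [RiemannianBundle (fun x : M => TangentSpace (𝓡 n) x)] [MeasurableSpace M]
    (φ : M → ℝ) (p q : ℝ) (u ut : M → ℝ) : Prop :=
  MemW10 n φ (q + 1) u ∧ MemW10 n φ (q + 1) ut ∧
  ∃ G : (x : M) → TangentSpace (𝓡 n) x, HasWeakGradient (fun x => spow q (u x)) G ∧
    MemLp (fun x => ‖G x‖) (ENNReal.ofReal p) (weightedVolume n φ)

/-- The right-hand side of the perturbed inequality, with `s = u`, `m = |∇u^q|` and `C = C(t)`. -/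
def errorBound (p q C s m : ℝ) : ℝ :=
  if 1 ≤ q then C * (|s| + m ^ (p / (q + 1)))
  else C * (|s| + |s| ^ ((1 : ℝ) / 2) * m ^ (p / (2 * q + 2)))

/-- The perturbed inequality `|u_t - 𝓛_{p,φ} u^q| ≤ C(t) (…)` on one time slice, with `C = C(t)`;
the operator is understood in the weak sense and the inequality almost everywhere. -/
def PerturbedInequality (n : ℕ) {M : Type*} [TopologicalSpace M]
    [ChartedSpace (EuclideanSpace ℝ (Fin n)) M]
    [RiemannianBundle (fun x : M => TangentSpace (𝓡 n) x)] [MeasurableSpace M]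
    (φ : M → ℝ) (p q C : ℝ) (u ut : M → ℝ) : Prop :=
  ∃ (G : (x : M) → TangentSpace (𝓡 n) x) (F : M → ℝ),
    HasWeakGradient (fun x => spow q (u x)) G ∧ HasWeakPLaplacian φ p G F ∧
    ∀ᵐ x ∂(weightedVolume n φ), |ut x - F x| ≤ errorBound p q C (u x) ‖G x‖

/-- `u_t = ∂_t u` at the time `t`, as the derivative along `T ⊆ ℝ` of the curve `s ↦ u(·,s)` in
`L^r_φ(M)` (one-sided at an end point of `T`). -/
def HasTimeDerivAt (n : ℕ) {M : Type*} [TopologicalSpace M]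
    [ChartedSpace (EuclideanSpace ℝ (Fin n)) M]
    [RiemannianBundle (fun x : M => TangentSpace (𝓡 n) x)] [MeasurableSpace M]
    (φ : M → ℝ) (r : ℝ) (u : ℝ → M → ℝ) (ut : M → ℝ) (T : Set ℝ) (t : ℝ) : Prop :=
  Tendsto (fun s => eLpNorm (fun x => (s - t)⁻¹ * (u s x - u t x) - ut x)
    (ENNReal.ofReal r) (weightedVolume n φ)) (𝓝[T \ {t}] t) (𝓝 0)

end Geometry

end ParabolicFrequency

end

namespace ParabolicFrequency

/-! ### Signed powers and the Bregman distance. -/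

section SignedPower

/-! Write H = ∫|u|^{q+1}, E = (1/p)∫|∇u^q|^p, e = u_t - 𝓛u^q and b = ∫u^q e, all for the measure
e^{-φ}dV. The operator -𝓛 is the differential of the convex, p-homogeneous functional E, so formally
H' = (q+1)(b - pE) and E' = -∫q|u|^{q-1} u_t(u_t - e). Completing the square, u_t(u_t - e) = (u_t -
e/2)² - e²/4, and Cauchy-Schwarz bounds ∫q|u|^{q-1}(u_t - e/2)² below by q(pE - b/2)²/H. The
left-over term ∫|u|^{q-1}e² is at most a multiple of C²(H + E); the two shapes of the error bound,
for q ≥ 1 and for q < 1, are what this requires (`weighted_error_le`). The hypothesis δ ≥ 0 says q+1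
≤ qp, and then (q+1)E(pE - b) ≤ q max(pE - b/2, 0)² (`quadratic_le_sq_max`). Together these give the
almost monotonicity (E/H)' ≤ K C²(E/H + 1). As C² is integrable, the frequency E/H stays bounded as
long as H > 0. Hence H' ≥ -K(1 + C²)H, so H cannot reach zero in finite time unless it was zero
before.

The obstacle is that E need not be differentiable, or even known to be bounded, along the curve:
only u is differentiable in time, in L^{q+1}. So E is replaced by the envelope inf_v { E(v) +
(1/l)∫B(u,v) }, where B is the Bregman distance of s ↦ |s|^{q+1}/(q+1) and v is a dual variable
competing with u^q. The curve enters only through ∫B(u,v), so for a frozen almost minimizer v the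
upper right slope of the envelope is at most (1/l)∫(u^q - v)u_t up to a small error
(`HasPowDerivAt.slope_envelope_lt`). With w = v^{1/q}, the approximate Euler-Lagrange inequality
makes (u - w)/l an approximate subgradient of E at v, a substitute for -𝓛u^q. The formal computation
is then carried out pointwise with difference quotients of s ↦ s^q in place of derivatives
(`frequency_pointwise`), and `IsSlice.exists_sharp_slope_bound` gives the formal differential
inequality for the envelope, up to an error that vanishes as l → 0. Comparison theorems for Dini
derivatives bound the envelope by a multiple of H, and the subgradient inequality at u^q transfers
the bound to E (`IsSlice.energy_le_of_envelope_le`). A rougher slope estimate first supplies local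
boundedness of E (`IsSolution.exists_bound`).

The geometric half shows that a time slice fits the abstract scheme: -𝓛u^q must be a subgradient of
E at u^q and satisfy the Euler identity. Both follow from ∫w𝓛u^q = -∫|∇u^q|^{p-2}⟨∇u^q,∇w⟩ for every
w in L^{1+1/q} with gradient in L^p (`HasWeakPLaplacian.integral_mul_eq`). That identity is obtained
from test functions by smooth truncation of w, Lipschitz cutoffs of small gradient (available since
a complete manifold is proper), a partition of unity, and mollification in charts. Here δ ≥ 0 enters
a second time, as 1 + 1/q ≤ p. -/

theorem spow_of_nonneg {q x : ℝ} (hq : 0 < q) (hx : 0 ≤ x) : spow q x = x ^ q := by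
  rcases hx.eq_or_lt with rfl | hx
  · simp [spow, Real.zero_rpow hq.ne']
  · rw [spow, abs_of_pos hx, Real.rpow_sub_one hx.ne']
    field_simp

theorem spow_zero (q : ℝ) : spow q 0 = 0 := by simp [spow]

theorem spow_one (q : ℝ) : spow q 1 = 1 := by simp [spow]

theorem spow_neg (q x : ℝ) : spow q (-x) = -spow q x := by simp [spow]

theorem spow_mul (q x y : ℝ) : spow q (x * y) = spow q x * spow q y := by
  simp only [spow, abs_mul]
  rw [Real.mul_rpow (abs_nonneg _) (abs_nonneg _)]
  ring

theorem abs_spow {q : ℝ} (hq : 0 < q) (x : ℝ) : |spow q x| = |x| ^ q := by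
  rw [← spow_of_nonneg hq (abs_nonneg x)]
  simp [spow, abs_mul, abs_of_nonneg (Real.rpow_nonneg (abs_nonneg x) _)]

theorem spow_mul_self {q : ℝ} (hq : 0 < q) (x : ℝ) : spow q x * x = |x| ^ (q + 1) := by
  rw [Real.rpow_add_one' (abs_nonneg x) (by positivity), ← spow_of_nonneg hq (abs_nonneg x), spow,
    spow, abs_abs, mul_assoc, mul_assoc, abs_mul_abs_self]

theorem spow_strictMono {q : ℝ} (hq : 0 < q) : StrictMono (spow q) := by
  have key : ∀ x y : ℝ, 0 ≤ x → x < y → spow q x < spow q y := by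
    intro x y hx hxy
    rw [spow_of_nonneg hq hx, spow_of_nonneg hq (hx.trans hxy.le)]
    exact Real.rpow_lt_rpow hx hxy hq
  intro x y hxy
  rcases le_total 0 x with hx | hx
  · exact key x y hx hxy
  rcases le_total 0 y with hy | hy
  · rcases hx.eq_or_lt with rfl | hx
    · exact key _ _ le_rfl hxy
    · have := key 0 (-x) le_rfl (by linarith)
      rw [spow_neg, spow_zero] at this
      have h2 : 0 ≤ spow q y := by
        rw [spow_of_nonneg hq hy]; positivity
      linarith
  · have := key (-y) (-x) (by linarith) (by linarith)
    rw [spow_neg, spow_neg] at this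
    linarith

theorem spow_spow_inv {q : ℝ} (hq : 0 < q) (x : ℝ) : spow q (spow q⁻¹ x) = x := by
  have key : ∀ x : ℝ, 0 ≤ x → spow q (spow q⁻¹ x) = x := by
    intro x hx
    rw [spow_of_nonneg (inv_pos.2 hq) hx, spow_of_nonneg hq (by positivity), ← Real.rpow_mul hx,
      inv_mul_cancel₀ hq.ne', Real.rpow_one]
  rcases le_total 0 x with hx | hx
  · exact key x hx
  · have := key (-x) (by linarith)
    rw [spow_neg, spow_neg] at this
    linarith

theorem continuous_spow {q : ℝ} (hq : 0 < q) : Continuous (spow q) := by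
  have h1 : spow q = fun x => (max x 0) ^ q - (max (-x) 0) ^ q := by
    funext x
    rcases le_total 0 x with hx | hx
    · rw [spow_of_nonneg hq hx, max_eq_left hx, max_eq_right (by linarith), Real.zero_rpow hq.ne']
      ring
    · have := spow_of_nonneg hq (show 0 ≤ -x by linarith)
      rw [spow_neg] at this
      rw [max_eq_right hx, max_eq_left (by linarith), Real.zero_rpow hq.ne', ← this]
      ring
  rw [h1]
  have h3 : Continuous fun x : ℝ => x ^ q := Real.continuous_rpow_const hq.le
  exact (h3.comp (continuous_id.max continuous_const)).sub
    (h3.comp (continuous_neg.max continuous_const))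

/-- The pointwise Bregman distance of `s ↦ |s|^{q+1}/(q+1)`, where the second point is given by its
dual variable `v`. -/
noncomputable def breg (q u v : ℝ) : ℝ := |u| ^ (q + 1) / (q + 1) + |v| ^ (q⁻¹ + 1) / (q⁻¹ + 1) - v * u

theorem breg_nonneg {q : ℝ} (hq : 0 < q) (u v : ℝ) : 0 ≤ breg q u v := by
  have hc : (q + 1).HolderConjugate (q⁻¹ + 1) := by
    rw [Real.holderConjugate_iff]
    refine ⟨by linarith, ?_⟩
    field_simp
    ring
  have := Real.young_inequality u v hc
  unfold breg
  linarith [mul_comm u v]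

/-- Since w ↦ w^q is the Legendre transform map, Young's defect turns into the excess of the convex
function at u over its tangent at w. -/
theorem breg_spow {q : ℝ} (hq : 0 < q) (u w : ℝ) : breg q u (spow q w) =
    |u| ^ (q + 1) / (q + 1) - |w| ^ (q + 1) / (q + 1) - spow q w * (u - w) := by
  unfold breg
  rw [abs_spow hq, ← Real.rpow_mul (abs_nonneg w), mul_sub, spow_mul_self hq]
  have : q * (q⁻¹ + 1) = q + 1 := by field_simp; ring
  rw [this]
  field_simp
  ring

theorem breg_spow_self {q : ℝ} (hq : 0 < q) (u : ℝ) : breg q u (spow q u) = 0 := by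
  rw [breg_spow hq]; ring

/-- Homogeneity of degree q+1; it reduces comparisons of two points to the case where the second one
is 1. -/
theorem breg_mul {q : ℝ} (hq : 0 < q) (w x : ℝ) :
    breg q (w * x) (spow q w) = |w| ^ (q + 1) * breg q x 1 := by
  have h1 := breg_spow hq x 1
  rw [spow_one] at h1
  rw [breg_spow hq, h1, abs_mul, Real.mul_rpow (abs_nonneg _) (abs_nonneg _), ← spow_mul_self hq w]
  simp
  ring

/-- Convexity of `s ↦ |s|^{q+1}/(q+1)`. -/
theorem rpow_subgradient {q : ℝ} (hq : 0 < q) (x y : ℝ) :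
    |x| ^ (q + 1) / (q + 1) + spow q x * (y - x) ≤ |y| ^ (q + 1) / (q + 1) := by
  have := breg_nonneg hq y (spow q x)
  rw [breg_spow hq] at this
  linarith

/-- For equal signs this is Bernoulli's inequality at the point of larger modulus; for opposite
signs each power is at most that modulus to the q-1 times the base. -/
theorem abs_spow_sub_le_of_one_le {q : ℝ} (hq : 1 ≤ q) (a b : ℝ) :
    |spow q a - spow q b| ≤ q * max |a| |b| ^ (q - 1) * |a - b| := by
  have hq0 : 0 < q := by linarith
  have bern : ∀ a b : ℝ, 0 ≤ b → b ≤ a → a ^ q - b ^ q ≤ q * a ^ (q - 1) * (a - b) := by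
    intro a b hb hab
    rcases (hb.trans hab).eq_or_lt with ha | ha
    · have : b = 0 := by linarith
      subst this; subst ha; simp
    · have := one_add_mul_self_le_rpow_one_add (s := b / a - 1)
        (by have : 0 ≤ b / a := by positivity
            linarith) hq
      rw [add_sub_cancel, Real.div_rpow hb ha.le, le_div_iff₀ (by positivity)] at this
      have e : a ^ q = a ^ (q - 1) * a := by
        rw [Real.rpow_sub_one ha.ne']; field_simp
      have e2 : (1 + q * (b / a - 1)) * a ^ q = a ^ q + q * a ^ (q - 1) * (b - a) := by
        rw [e]; field_simp
      linarith
  have key : ∀ a b : ℝ, b ≤ a → 0 ≤ a → |b| ≤ a →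
      spow q a - spow q b ≤ q * a ^ (q - 1) * (a - b) := by
    intro a b hab ha hba
    rw [spow_of_nonneg hq0 ha]
    rcases le_total 0 b with hb | hb
    · rw [spow_of_nonneg hq0 hb]
      exact bern a b hb hab
    · rw [abs_of_nonpos hb] at hba
      have h1 : spow q b = -(-b) ^ q := by
        rw [← spow_of_nonneg hq0 (by linarith : 0 ≤ -b), spow_neg]; ring
      rw [h1]
      rcases ha.eq_or_lt with ha | ha
      · have : b = 0 := by linarith
        subst this; subst ha; simp [Real.zero_rpow hq0.ne']
      · have e : a ^ q = a ^ (q - 1) * a := by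
          rw [Real.rpow_sub_one ha.ne']; field_simp
        have h2 : (-b) ^ q ≤ a ^ (q - 1) * (-b) := by
          rcases hb.eq_or_lt with hb | hb
          · subst hb; simp [Real.zero_rpow hq0.ne']
          · have e' : (-b) ^ q = (-b) ^ (q - 1) * (-b) := by
              rw [Real.rpow_sub_one (by linarith), div_mul_cancel₀ _ (by linarith)]
            rw [e']
            have := Real.rpow_le_rpow (by linarith) hba (by linarith : 0 ≤ q - 1)
            nlinarith
        have h3 : 0 ≤ a ^ (q - 1) := by positivity
        have h4 : 0 ≤ a ^ (q - 1) * (a - b) := mul_nonneg h3 (by linarith)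
        nlinarith
  have key2 : ∀ a b : ℝ, |b| ≤ |a| →
      |spow q a - spow q b| ≤ q * |a| ^ (q - 1) * |a - b| := by
    intro a b hba
    rcases le_total 0 a with ha | ha
    · rw [abs_of_nonneg ha] at hba ⊢
      have hb : b ≤ a := (le_abs_self b).trans hba
      have := (spow_strictMono hq0).monotone hb
      rw [abs_of_nonneg (by linarith), abs_of_nonneg (by linarith)]
      exact key a b hb ha hba
    · rw [abs_of_nonpos ha] at hba ⊢
      have hb : -b ≤ -a := (neg_le_abs b).trans hba
      have := (spow_strictMono hq0).monotone (show a ≤ b by linarith)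
      rw [abs_of_nonpos (by linarith), abs_of_nonpos (by linarith)]
      have := key (-a) (-b) hb (by linarith) (by rwa [abs_neg])
      rw [spow_neg, spow_neg] at this
      linarith
  rcases le_total |b| |a| with h | h
  · rw [max_eq_left h]; exact key2 a b h
  · rw [max_eq_right h, abs_sub_comm, abs_sub_comm a b]; exact key2 b a h

/-- Subadditivity of x ↦ x^q for q ≤ 1; the factor 2 covers points of opposite sign. -/
theorem abs_spow_sub_le_of_le_one {q : ℝ} (hq0 : 0 < q) (hq : q ≤ 1) (a b : ℝ) :
    |spow q a - spow q b| ≤ 2 * |a - b| ^ q := by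
  have sub : ∀ a b : ℝ, 0 ≤ b → b ≤ a → spow q a - spow q b ≤ 2 * (a - b) ^ q := by
    intro a b hb hab
    rw [spow_of_nonneg hq0 hb, spow_of_nonneg hq0 (hb.trans hab)]
    have := Real.rpow_add_le_add_rpow hb (sub_nonneg.2 hab) hq0.le hq
    rw [add_sub_cancel] at this
    have : 0 ≤ (a - b) ^ q := Real.rpow_nonneg (by linarith) _
    linarith
  have key : ∀ a b : ℝ, b ≤ a → spow q a - spow q b ≤ 2 * (a - b) ^ q := by
    intro a b hab
    rcases le_total 0 b with hb | hb
    · exact sub a b hb hab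
    rcases le_total 0 a with ha | ha
    · have h1 : spow q b = -(-b) ^ q := by
        rw [← spow_of_nonneg hq0 (by linarith : 0 ≤ -b), spow_neg]; ring
      rw [spow_of_nonneg hq0 ha, h1]
      have h2 := Real.rpow_le_rpow ha (by linarith : a ≤ a - b) hq0.le
      have h3 := Real.rpow_le_rpow (by linarith) (by linarith : -b ≤ a - b) hq0.le
      linarith
    · have := sub (-b) (-a) (by linarith) (by linarith)
      rw [spow_neg, spow_neg] at this
      rw [show a - b = -b - -a by ring]
      linarith
  rcases le_total b a with h | h
  · have := (spow_strictMono hq0).monotone h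
    rw [abs_of_nonneg (by linarith), abs_of_nonneg (by linarith)]
    exact key a b h
  · have := (spow_strictMono hq0).monotone h
    rw [abs_of_nonpos (by linarith), abs_of_nonpos (by linarith)]
    have := key b a h
    rw [show -(a - b) = b - a by ring]
    linarith

/-- Local Hölder continuity of the signed power. -/
theorem abs_spow_add_sub_le {q : ℝ} (hq : 0 < q) {κ : ℝ} (h0 : 0 ≤ κ) (h1 : κ ≤ 1) (x y : ℝ) :
    |spow q (x + κ * y) - spow q x| ≤ (q + 2) * κ ^ min 1 q * (|x| + |y|) ^ q := by
  have hxy : |x + κ * y| ≤ |x| + |y| := by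
    refine (abs_add_le _ _).trans ?_
    rw [abs_mul, abs_of_nonneg h0]
    nlinarith [abs_nonneg y]
  have hx0 := abs_nonneg x
  have hy0 := abs_nonneg y
  rcases le_total 1 q with h | h
  · rw [min_eq_left h, Real.rpow_one]
    refine (abs_spow_sub_le_of_one_le h _ _).trans ?_
    rw [add_sub_cancel_left, abs_mul, abs_of_nonneg h0]
    have h2 : max |x + κ * y| |x| ^ (q - 1) ≤ (|x| + |y|) ^ (q - 1) :=
      Real.rpow_le_rpow (by positivity) (max_le hxy (by linarith)) (by linarith)
    have h3 : (|x| + |y|) ^ q = (|x| + |y|) ^ (q - 1) * (|x| + |y|) := by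
      rw [← Real.rpow_add_one' (by positivity) (by linarith)]; ring_nf
    rw [h3]
    have h4 : 0 ≤ (|x| + |y|) ^ (q - 1) := by positivity
    calc q * max |x + κ * y| |x| ^ (q - 1) * (κ * |y|)
        ≤ q * (|x| + |y|) ^ (q - 1) * (κ * |y|) := by gcongr
      _ ≤ (q + 2) * (|x| + |y|) ^ (q - 1) * (κ * (|x| + |y|)) := by
          gcongr <;> linarith
      _ = _ := by ring
  · rw [min_eq_right h]
    refine (abs_spow_sub_le_of_le_one hq h _ _).trans ?_
    rw [add_sub_cancel_left, abs_mul, abs_of_nonneg h0, Real.mul_rpow h0 hy0, ← mul_assoc]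
    have : |y| ^ q ≤ (|x| + |y|) ^ q := Real.rpow_le_rpow hy0 (by linarith) hq.le
    gcongr
    linarith

/-- By convexity the increment is at most the derivative at the far end point, and Hölder continuity
of the derivative moves it back to x. The remainder has order κ^{1+min(1,q)}, which is all the
smoothness available for small q. -/
theorem rpow_abs_taylor {q : ℝ} (hq : 0 < q) {κ : ℝ} (h0 : 0 ≤ κ) (h1 : κ ≤ 1) (x y : ℝ) :
    |x + κ * y| ^ (q + 1) / (q + 1) - |x| ^ (q + 1) / (q + 1) - κ * (y * spow q x) ≤
      κ * ((q + 2) * κ ^ min 1 q * (|x| + |y|) ^ (q + 1)) := by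
  have h2 := rpow_subgradient hq (x + κ * y) x
  have h3 := abs_spow_add_sub_le hq h0 h1 x y
  have h4 : κ * (y * (spow q (x + κ * y) - spow q x)) ≤
      κ * ((q + 2) * κ ^ min 1 q * (|x| + |y|) ^ (q + 1)) := by
    refine mul_le_mul_of_nonneg_left ?_ h0
    calc y * (spow q (x + κ * y) - spow q x) ≤ |y| * |spow q (x + κ * y) - spow q x| := by
          rw [← abs_mul]; exact le_abs_self _
      _ ≤ (|x| + |y|) * ((q + 2) * κ ^ min 1 q * (|x| + |y|) ^ q) := by
          gcongr
          linarith [abs_nonneg x]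
      _ = _ := by
          rw [Real.rpow_add_one' (by positivity) (by positivity)]; ring
  have e : spow q (x + κ * y) * (x - (x + κ * y)) = -(κ * (y * spow q (x + κ * y))) := by ring
  rw [e] at h2
  linarith [mul_sub κ (y * spow q (x + κ * y)) (y * spow q x), mul_sub y (spow q (x + κ * y)) (spow q x)]

/-- A small Bregman distance makes the dual variables close. -/
theorem mul_sub_spow_le_breg {q : ℝ} (hq : 0 < q) {κ : ℝ} (h0 : 0 < κ) (h1 : κ ≤ 1)
    (u v y : ℝ) :
    |y * (v - spow q u)| ≤ breg q u v / κ + (q + 2) * κ ^ min 1 q * (|u| + |y|) ^ (q + 1) := by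
  have key : ∀ y : ℝ, y * (v - spow q u) ≤
      breg q u v / κ + (q + 2) * κ ^ min 1 q * (|u| + |y|) ^ (q + 1) := by
    intro y
    -- The distance stays nonnegative when u moves to u + κy with v fixed. Expanding to first order
    -- in κ and dividing by κ bounds the pairing of y with v - u^q.
    have h2 := breg_nonneg hq (u + κ * y) v
    have h3 := rpow_abs_taylor hq h0.le h1 u y
    have h4 : κ * (y * (v - spow q u)) ≤
        breg q u v + κ * ((q + 2) * κ ^ min 1 q * (|u| + |y|) ^ (q + 1)) := by
      unfold breg at h2 ⊢
      linarith [mul_sub κ (y * v) (y * spow q u), mul_sub y v (spow q u), mul_add v u (κ * y),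
        show v * (κ * y) = κ * (y * v) by ring]
    rw [div_add' _ _ _ h0.ne', le_div_iff₀ h0]
    linarith
  rw [abs_le']
  refine ⟨key y, ?_⟩
  have := key (-y)
  rw [abs_neg] at this
  linarith

/-- Either |v|^{1/q} ≤ L|u| and the first term suffices, or the cross term vu absorbs at most half
of |v|^{1+1/q}/(1+1/q); L = 2(1/q+1) is tuned to that half. This keeps almost minimizers bounded in
L^{1+1/q}. -/
theorem rpow_le_breg {q : ℝ} (hq : 0 < q) : ∃ c : ℝ, 0 ≤ c ∧ ∀ u v : ℝ,
    |v| ^ (q⁻¹ + 1) ≤ c * (|u| ^ (q + 1) + breg q u v) := by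
  set θ := q⁻¹ with hθ
  have hθ0 : 0 < θ := inv_pos.2 hq
  set L := 2 * (θ + 1) with hL
  have hL0 : 0 < L := by positivity
  refine ⟨L + L ^ (q + 1), by positivity, fun u v => ?_⟩
  have hB := breg_nonneg hq u v
  have hu : 0 ≤ |u| ^ (q + 1) := by positivity
  have hv : 0 ≤ |v| ^ (θ + 1) := by positivity
  have hLq : 0 ≤ L ^ (q + 1) := by positivity
  rcases le_total (L * |u|) (|v| ^ θ) with h | h
  · have h2 : |v| ^ (θ + 1) = |v| ^ θ * |v| := by
      rw [Real.rpow_add_one' (abs_nonneg _) (by positivity)]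
    have h3 : v * u ≤ |v| * |u| := by rw [← abs_mul]; exact le_abs_self _
    have h4 : L * (|v| * |u|) ≤ |v| ^ (θ + 1) := by
      rw [h2]
      nlinarith [abs_nonneg v]
    have h5 : |v| ^ (θ + 1) / (θ + 1) = 2 * |v| ^ (θ + 1) / L := by rw [hL]; field_simp
    have h6 : v * u ≤ |v| ^ (θ + 1) / L := by
      rw [le_div_iff₀ hL0]; nlinarith
    have h7 : |v| ^ (θ + 1) / L ≤ breg q u v := by
      have : 0 ≤ |u| ^ (q + 1) / (q + 1) := by positivity
      unfold breg
      rw [← hθ, h5]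
      have : 2 * |v| ^ (θ + 1) / L = |v| ^ (θ + 1) / L + |v| ^ (θ + 1) / L := by ring
      linarith
    rw [div_le_iff₀ hL0] at h7
    nlinarith
  · have h2 : |v| ^ (θ + 1) ≤ L ^ (q + 1) * |u| ^ (q + 1) := by
      have := Real.rpow_le_rpow (by positivity) h (by positivity : 0 ≤ q + 1)
      rw [← Real.rpow_mul (abs_nonneg v), Real.mul_rpow hL0.le (abs_nonneg u)] at this
      have e : θ * (q + 1) = θ + 1 := by rw [hθ]; field_simp; ring
      rwa [e] at this
    nlinarith [mul_nonneg hL0.le hu, mul_nonneg hL0.le hB, mul_nonneg hLq hB]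

/-- Near x = 1 the ratio |x-1|/|x^q-1| tends to 1/q while |x|^{q+1} tends to 1, so the factor 1+η is
enough. Away from 1 the Bregman distance grows linearly and |x^q-1| is bounded below, so a large
multiple of it suffices. The sharp constant 1/q is essential: it becomes the constant in the
frequency inequality. -/
theorem exists_near_far {q : ℝ} (hq : 0 < q) {η : ℝ} (hη : 0 < η) :
    ∃ K : ℝ, 0 ≤ K ∧ ∀ x : ℝ,
      |x - 1| ≤ |spow q x - 1| * (q⁻¹ * ((1 + η) * |x| ^ (q + 1) + K * breg q x 1)) := by
  have hd : HasDerivAt (fun x : ℝ => x ^ q) q 1 := by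
    simpa using Real.hasDerivAt_rpow_const (x := 1) (p := q) (Or.inl one_ne_zero)
  -- Chosen so that (1 - η')(1 + η/2) = 1.
  set η' := η / (2 + η) with hη'
  have hη'0 : 0 < η' := by positivity
  have ev1 : ∀ᶠ x in 𝓝 (1 : ℝ), (q - q * η') * |x - 1| ≤ |x ^ q - 1| := by
    have := hd.isLittleO.def (c := q * η') (by positivity)
    filter_upwards [this] with x hx
    simp only [Real.one_rpow, smul_eq_mul, Real.norm_eq_abs] at hx
    have h2 : |(x - 1) * q| ≤ |x ^ q - 1| + |x ^ q - 1 - (x - 1) * q| := by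
      have := abs_sub (x ^ q - 1) (x ^ q - 1 - (x - 1) * q)
      rwa [sub_sub_cancel] at this
    rw [abs_mul, abs_of_pos hq] at h2
    linarith
  have ev2 : ∀ᶠ x in 𝓝 (1 : ℝ), 1 + η / 2 ≤ (1 + η) * |x| ^ (q + 1) := by
    have hc : ContinuousAt (fun x : ℝ => (1 + η) * |x| ^ (q + 1)) 1 := by
      refine continuousAt_const.mul (ContinuousAt.rpow_const continuous_abs.continuousAt ?_)
      right; positivity
    have : (1 + η / 2) < (fun x : ℝ => (1 + η) * |x| ^ (q + 1)) 1 := by simp; linarith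
    exact (hc.eventually (lt_mem_nhds this)).mono fun x hx => le_of_lt hx
  have ev3 : ∀ᶠ x in 𝓝 (1 : ℝ), 0 < x := lt_mem_nhds one_pos
  obtain ⟨θ₀, hθ₀, hnear⟩ := Metric.eventually_nhds_iff.1 (ev1.and (ev2.and ev3))
  obtain ⟨θ, hθ, hθ1, hθ2⟩ : ∃ θ : ℝ, 0 < θ ∧ θ < 1 ∧ θ < θ₀ :=
    ⟨min 1 θ₀ / 2, by positivity, by linarith [min_le_left 1 θ₀, lt_min one_pos hθ₀],
      by linarith [min_le_right 1 θ₀, lt_min one_pos hθ₀]⟩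
  have hm := spow_strictMono hq
  set y₁ := spow q (1 + θ / 2) - 1 with hy₁
  set y₂ := 1 - spow q (1 - θ / 2) with hy₂
  have hy1 : 0 < y₁ := by
    have := hm (show 1 < 1 + θ / 2 by linarith)
    rw [spow_one] at this; linarith
  have hy2 : 0 < y₂ := by
    have := hm (show 1 - θ / 2 < 1 by linarith)
    rw [spow_one] at this; linarith
  -- The supporting line at y of the convex function x ↦ `breg q x 1`, whose value at y is
  -- nonnegative and is dropped.
  have hb : ∀ x y : ℝ, (spow q y - 1) * (x - y) ≤ breg q x 1 := by
    intro x y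
    have h1 := rpow_subgradient hq y x
    have h2 := breg_nonneg hq y 1
    unfold breg at h2 ⊢
    linarith
  set m := min y₁ y₂ with hm'
  have hm0 : 0 < m := lt_min hy1 hy2
  -- In the far region |x^q - 1| ≥ m and the Bregman distance is at least m|x-1|/2; this constant
  -- cancels both factors m, the 2 and the 1/q.
  refine ⟨2 * q / m ^ 2, by positivity, fun x => ?_⟩
  have hB := breg_nonneg hq x 1
  have hX : 0 ≤ |x| ^ (q + 1) := by positivity
  by_cases hx : |x - 1| < θ
  · obtain ⟨h1, h2, h3⟩ := hnear (show dist x 1 < θ₀ by rw [Real.dist_eq]; linarith)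
    rw [spow_of_nonneg hq h3.le]
    have h4 : 1 + η / 2 ≤ (1 + η) * |x| ^ (q + 1) + 2 * q / m ^ 2 * breg q x 1 := by
      have : 0 ≤ 2 * q / m ^ 2 * breg q x 1 := by positivity
      linarith
    have h5 : (q - q * η') * (q⁻¹ * (1 + η / 2)) = 1 := by
      rw [hη']; field_simp; ring
    calc |x - 1| = (q - q * η') * |x - 1| * (q⁻¹ * (1 + η / 2)) := by
          rw [mul_right_comm, h5, one_mul]
      _ ≤ |x ^ q - 1| * (q⁻¹ * ((1 + η) * |x| ^ (q + 1) + 2 * q / m ^ 2 * breg q x 1)) := by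
          gcongr
  · have hfar : m ≤ |spow q x - 1| ∧ m * |x - 1| / 2 ≤ breg q x 1 := by
      rw [not_lt, le_abs] at hx
      rcases hx with hx | hx
      · have h1 := hm (show 1 + θ / 2 < x by linarith)
        have h2 := hb x (1 + θ / 2)
        have h3 : m ≤ y₁ := min_le_left _ _
        constructor
        · exact h3.trans (by rw [hy₁]; linarith [le_abs_self (spow q x - 1)])
        · rw [abs_of_nonneg (by linarith)]
          rw [← hy₁] at h2
          nlinarith
      · have h1 := hm (show x < 1 - θ / 2 by linarith)
        have h2 := hb x (1 - θ / 2)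
        have h3 : m ≤ y₂ := min_le_right _ _
        constructor
        · exact h3.trans (by rw [hy₂]; linarith [neg_le_abs (spow q x - 1)])
        · rw [abs_of_nonpos (by linarith)]
          have : (spow q (1 - θ / 2) - 1) * (x - (1 - θ / 2)) = y₂ * (1 - θ / 2 - x) := by
            rw [hy₂]; ring
          rw [this] at h2
          nlinarith
    obtain ⟨h1, h2⟩ := hfar
    calc |x - 1| = m * (q⁻¹ * (2 * q / m ^ 2 * (m * |x - 1| / 2))) := by field_simp
      _ ≤ |spow q x - 1| * (q⁻¹ * (2 * q / m ^ 2 * breg q x 1)) := by gcongr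
      _ ≤ |spow q x - 1| * (q⁻¹ * ((1 + η) * |x| ^ (q + 1) + 2 * q / m ^ 2 * breg q x 1)) := by
          gcongr
          have : 0 ≤ (1 + η) * |x| ^ (q + 1) := by positivity
          linarith

/-- The sharp comparison between the difference quotient of `s ↦ s^q` and its derivative. -/
theorem sq_spow_mul_le {q : ℝ} (hq : 0 < q) {η : ℝ} (hη : 0 < η) :
    ∃ K : ℝ, 0 ≤ K ∧ ∀ u w : ℝ, spow q w ^ 2 * |u - w| ≤ |spow q u - spow q w| *
      (q⁻¹ * ((1 + η) * |u| ^ (q + 1) + K * breg q u (spow q w))) := by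
  obtain ⟨K, hK, h⟩ := exists_near_far hq hη
  refine ⟨K, hK, fun u w => ?_⟩
  by_cases hw : w = 0
  · subst hw
    rw [spow_zero]
    have := breg_nonneg hq u 0
    simp only [ne_eq, OfNat.ofNat_ne_zero, not_false_eq_true, zero_pow, zero_mul]
    positivity
  -- Both sides are homogeneous in (u, w), which leaves the comparison with w = 1.
  obtain ⟨x, rfl⟩ : ∃ x, u = w * x := ⟨u / w, by field_simp⟩
  have hx := h x
  rw [breg_mul hq, spow_mul, abs_mul w x, Real.mul_rpow (abs_nonneg _) (abs_nonneg _),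
    show w * x - w = w * (x - 1) by ring, abs_mul,
    show spow q w * spow q x - spow q w = spow q w * (spow q x - 1) by ring, abs_mul]
  have e : |w| ^ (q + 1) = |spow q w| * |w| := by
    rw [← abs_mul, spow_mul_self hq, abs_of_nonneg (Real.rpow_nonneg (abs_nonneg w) _)]
  rw [← sq_abs, e]
  have : 0 ≤ |spow q w| ^ 2 * |w| := by positivity
  calc |spow q w| ^ 2 * (|w| * |x - 1|) = |spow q w| ^ 2 * |w| * |x - 1| := by ring
    _ ≤ |spow q w| ^ 2 * |w| *
        (|spow q x - 1| * (q⁻¹ * ((1 + η) * |x| ^ (q + 1) + K * breg q x 1))) := by gcongr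
    _ = _ := by ring

end SignedPower

end ParabolicFrequency

namespace ParabolicFrequency

/-! ### The pointwise frequency inequality. -/

section Pointwise

/-- The bound on the error term at one point, with `h = |∇u^q|^{p/(q+1)}`. -/
noncomputable def errorMajorant (q C s h : ℝ) : ℝ :=
  if 1 ≤ q then C * (|s| + h) else C * (|s| + |s| ^ ((1 : ℝ) / 2) * h ^ ((1 : ℝ) / 2))

theorem errorBound_eq (p q C s m : ℝ) (hm : 0 ≤ m) :
    errorBound p q C s m = errorMajorant q C s (m ^ (p / (q + 1))) := by
  unfold errorBound errorMajorant
  rw [← Real.rpow_mul hm, div_mul_div_comm, mul_one, show (q + 1) * 2 = 2 * q + 2 by ring]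

theorem errorMajorant_le {q C s h : ℝ} (hC : 0 ≤ C) (hh : 0 ≤ h) :
    errorMajorant q C s h ≤ 2 * C * (|s| + h) := by
  unfold errorMajorant
  have hs := abs_nonneg s
  split_ifs
  · nlinarith [mul_nonneg hC hs, mul_nonneg hC hh]
  · have h1 : |s| ^ ((1 : ℝ) / 2) * h ^ ((1 : ℝ) / 2) ≤ |s| + h := by
      rw [← Real.sqrt_eq_rpow, ← Real.sqrt_eq_rpow]
      nlinarith [Real.sq_sqrt hs, Real.sq_sqrt hh, sq_nonneg (√|s| - √h)]
    nlinarith [mul_nonneg hC hs, mul_nonneg hC hh]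

/-- For q < 1 the square keeps a factor |s|, which will compensate the singular weight |s|^{q-1}. -/
theorem sq_errorMajorant_le {q C s h : ℝ} (hh : 0 ≤ h) (hq : q < 1) :
    errorMajorant q C s h ^ 2 ≤ 2 * C ^ 2 * (|s| * (|s| + h)) := by
  unfold errorMajorant
  rw [if_neg (not_le.2 hq), ← Real.sqrt_eq_rpow, ← Real.sqrt_eq_rpow]
  have hs := abs_nonneg s
  have h1 : (√|s| * √h) ^ 2 = |s| * h := by rw [mul_pow, Real.sq_sqrt hs, Real.sq_sqrt hh]
  have h2 : (|s| + √|s| * √h) ^ 2 ≤ 2 * (|s| * (|s| + h)) := by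
    nlinarith [sq_nonneg (|s| - √|s| * √h)]
  rw [mul_pow]
  nlinarith [sq_nonneg C]

/-- For q ≤ 1 difference quotients of s ↦ s^q based at u are at most 2|u|^{q-1}, whatever the second
point; scaling reduces this to u = 1. Only the weight at u appears, which matches an error bound
formulated in terms of u. -/
theorem abs_spow_sub_mul_abs_le {q : ℝ} (hq0 : 0 < q) (hq : q ≤ 1) {u : ℝ} (hu : u ≠ 0) (w : ℝ) :
    |spow q u - spow q w| ≤ 2 * |u| ^ (q - 1) * |u - w| := by
  have key : ∀ x : ℝ, |1 - spow q x| ≤ 2 * |1 - x| := by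
    intro x
    rcases le_total 0 x with hx | hx
    · rw [spow_of_nonneg hq0 hx]
      have h0 := abs_nonneg (1 - x)
      suffices |1 - x ^ q| ≤ |1 - x| by linarith
      rcases le_total x 1 with h1 | h1
      · have h2 : x ^ q ≤ 1 := Real.rpow_le_one hx h1 hq0.le
        have h3 : x ≤ x ^ q := by
          rcases hx.eq_or_lt with rfl | hx
          · exact Real.rpow_nonneg le_rfl _
          · simpa using Real.rpow_le_rpow_of_exponent_ge hx h1 hq
        rw [abs_of_nonneg (by linarith), abs_of_nonneg (by linarith)]
        linarith
      · have h2 : 1 ≤ x ^ q := Real.one_le_rpow h1 hq0.le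
        have h3 : x ^ q ≤ x := by simpa using Real.rpow_le_rpow_of_exponent_le h1 hq
        rw [abs_of_nonpos (by linarith), abs_of_nonpos (by linarith)]
        linarith
    · have h1 : spow q x = -(-x) ^ q := by
        rw [← spow_of_nonneg hq0 (by linarith : 0 ≤ -x), spow_neg]; ring
      have h2 : 0 ≤ (-x) ^ q := Real.rpow_nonneg (by linarith) _
      have h3 : (-x) ^ q ≤ 1 + -x := by
        rcases le_total (-x) 1 with h | h
        · linarith [Real.rpow_le_one (by linarith) h hq0.le]
        · have : (-x) ^ q ≤ -x := by simpa using Real.rpow_le_rpow_of_exponent_le h hq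
          linarith
      rw [h1, abs_of_nonneg (by linarith), abs_of_nonneg (by linarith)]
      linarith
  obtain ⟨x, rfl⟩ : ∃ x, w = u * x := ⟨w / u, by field_simp⟩
  have hx := key x
  rw [spow_mul, show spow q u - spow q u * spow q x = spow q u * (1 - spow q x) by ring, abs_mul,
    abs_spow hq0, show u - u * x = u * (1 - x) by ring, abs_mul]
  have e : |u| ^ q = |u| ^ (q - 1) * |u| := by
    rw [Real.rpow_sub_one (abs_ne_zero.2 hu), div_mul_cancel₀ _ (abs_ne_zero.2 hu)]
  rw [e]
  have : 0 ≤ |u| ^ (q - 1) * |u| := by positivity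
  nlinarith

/-- The square of the error, weighted by the difference quotient of s ↦ s^q between u and w, or by
|u|^{q-1} on the diagonal, is controlled by C² times quantities of degree q+1. For q ≥ 1 the weight
is a multiple of N^{q-1} with N the maximum of |u|, |w| and h, and e² is a multiple of C²N². For q <
1 the weight may blow up at u = 0, and the factor |u| in e² removes the singularity. -/
theorem weighted_error_le {q : ℝ} (hq : 0 < q) : ∃ K : ℝ, 0 ≤ K ∧ ∀ u w e h C : ℝ, 0 ≤ h → 0 ≤ C →
    |e| ≤ errorMajorant q C u h →
    |spow q u - spow q w| * e ^ 2 ≤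
      K * C ^ 2 * (|u| ^ (q + 1) + |w| ^ (q + 1) + h ^ (q + 1)) * |u - w| ∧
    (u ≠ 0 → |u| ^ (q - 1) * e ^ 2 ≤
      K * C ^ 2 * (|u| ^ (q + 1) + |w| ^ (q + 1) + h ^ (q + 1))) := by
  refine ⟨16 * q + 16, by positivity, fun u w e h C hh hC he => ?_⟩
  have hu0 := abs_nonneg u
  have hw0 := abs_nonneg w
  obtain ⟨N, hN0, huN, hwN, hhN, hNT⟩ : ∃ N : ℝ, 0 ≤ N ∧ |u| ≤ N ∧ |w| ≤ N ∧ h ≤ N ∧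
      N ^ (q + 1) ≤ |u| ^ (q + 1) + |w| ^ (q + 1) + h ^ (q + 1) := by
    have a1 : 0 ≤ |u| ^ (q + 1) := by positivity
    have a2 : 0 ≤ |w| ^ (q + 1) := by positivity
    have a3 : 0 ≤ h ^ (q + 1) := by positivity
    rcases le_total |u| |w| with h1 | h1 <;> rcases le_total |w| h with h2 | h2
    · exact ⟨h, hh, h1.trans h2, h2, le_rfl, by linarith⟩
    · exact ⟨|w|, hw0, h1, le_rfl, h2, by linarith⟩
    · rcases le_total |u| h with h3 | h3
      · exact ⟨h, hh, h3, h2, le_rfl, by linarith⟩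
      · exact ⟨|u|, hu0, le_rfl, h1, h3, by linarith⟩
    · exact ⟨|u|, hu0, le_rfl, h1, h2.trans h1, by linarith⟩
  set T := |u| ^ (q + 1) + |w| ^ (q + 1) + h ^ (q + 1) with hT
  have he2 : e ^ 2 ≤ errorMajorant q C u h ^ 2 := by
    rw [← sq_abs]
    exact pow_le_pow_left₀ (abs_nonneg e) he 2
  have hd := abs_nonneg (u - w)
  rcases le_or_gt 1 q with h1 | h1
  · have h2 : e ^ 2 ≤ 16 * C ^ 2 * N ^ 2 := by
      have : |e| ≤ 4 * C * N := he.trans ((errorMajorant_le hC hh).trans (by nlinarith))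
      have := pow_le_pow_left₀ (abs_nonneg e) this 2
      rw [sq_abs] at this
      nlinarith
    have h3 : N ^ (q - 1) * e ^ 2 ≤ 16 * C ^ 2 * T := by
      have h4 : N ^ (q - 1) * N ^ 2 = N ^ (q + 1) := by
        rw [← Real.rpow_natCast N 2, ← Real.rpow_add' hN0 (by push_cast; linarith)]
        congr 1; push_cast; ring
      have h5 : 0 ≤ N ^ (q - 1) := by positivity
      calc N ^ (q - 1) * e ^ 2 ≤ N ^ (q - 1) * (16 * C ^ 2 * N ^ 2) := by gcongr
        _ = 16 * C ^ 2 * (N ^ (q - 1) * N ^ 2) := by ring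
        _ ≤ _ := by rw [h4]; gcongr
    have hT0 : 0 ≤ C ^ 2 * T := mul_nonneg (sq_nonneg C) (le_trans (by positivity) hNT)
    constructor
    · have h6 := abs_spow_sub_le_of_one_le h1 u w
      have h7 : max |u| |w| ^ (q - 1) ≤ N ^ (q - 1) :=
        Real.rpow_le_rpow (le_max_of_le_left hu0) (max_le huN hwN) (by linarith)
      calc |spow q u - spow q w| * e ^ 2 ≤ q * N ^ (q - 1) * |u - w| * e ^ 2 := by
            gcongr
            exact h6.trans (by gcongr)
        _ = q * |u - w| * (N ^ (q - 1) * e ^ 2) := by ring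
        _ ≤ q * |u - w| * (16 * C ^ 2 * T) := by gcongr
        _ ≤ _ := by nlinarith [mul_nonneg hT0 hd]
    · intro _
      have h7 : |u| ^ (q - 1) ≤ N ^ (q - 1) := Real.rpow_le_rpow hu0 huN (by linarith)
      calc |u| ^ (q - 1) * e ^ 2 ≤ N ^ (q - 1) * e ^ 2 := by gcongr
        _ ≤ _ := by nlinarith [mul_nonneg hT0 hq.le]
  · have hsq := he2.trans (sq_errorMajorant_le hh h1)
    have hT0 : 0 ≤ C ^ 2 * T := mul_nonneg (sq_nonneg C) (le_trans (by positivity) hNT)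
    by_cases hu : u = 0
    · subst hu
      have : e ^ 2 = 0 := le_antisymm (by simpa using hsq) (sq_nonneg e)
      rw [this]
      refine ⟨?_, fun h => absurd rfl h⟩
      rw [mul_zero, mul_assoc (16 * q + 16)]
      positivity
    · have h3 : |u| ^ (q - 1) * e ^ 2 ≤ 4 * C ^ 2 * T := by
        have e1 : |u| ^ (q - 1) * |u| = |u| ^ q := by
          rw [Real.rpow_sub_one (abs_ne_zero.2 hu), div_mul_cancel₀ _ (abs_ne_zero.2 hu)]
        have e2 : |u| ^ q * (|u| + h) ≤ N ^ q * (2 * N) := by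
          have := Real.rpow_le_rpow hu0 huN hq.le
          gcongr
          linarith
        have e3 : N ^ q * N = N ^ (q + 1) := by
          rw [Real.rpow_add_one' hN0 (by positivity)]
        calc |u| ^ (q - 1) * e ^ 2 ≤ |u| ^ (q - 1) * (2 * C ^ 2 * (|u| * (|u| + h))) := by gcongr
          _ = 2 * C ^ 2 * (|u| ^ q * (|u| + h)) := by rw [← e1]; ring
          _ ≤ 2 * C ^ 2 * (N ^ q * (2 * N)) := by gcongr
          _ = 4 * C ^ 2 * N ^ (q + 1) := by rw [← e3]; ring
          _ ≤ _ := by gcongr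
      constructor
      · have h6 := abs_spow_sub_mul_abs_le hq h1.le hu w
        calc |spow q u - spow q w| * e ^ 2 ≤ 2 * |u| ^ (q - 1) * |u - w| * e ^ 2 := by gcongr
          _ = 2 * |u - w| * (|u| ^ (q - 1) * e ^ 2) := by ring
          _ ≤ 2 * |u - w| * (4 * C ^ 2 * T) := by gcongr
          _ ≤ _ := by nlinarith [mul_nonneg hT0 hd, mul_nonneg (mul_nonneg hT0 hd) hq.le]
      · intro _
        nlinarith [mul_nonneg hT0 hq.le]

/-- The pointwise inequality behind the monotonicity of the frequency. -/
theorem frequency_pointwise {q : ℝ} (hq : 0 < q) : ∃ K₀ : ℝ, 0 ≤ K₀ ∧ ∀ η : ℝ, 0 < η →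
    ∃ K : ℝ, 0 ≤ K ∧ ∀ u w e h C l σ : ℝ, 0 ≤ h → 0 ≤ C → 0 < l →
    |e| ≤ errorMajorant q C u h →
    2 * σ * (spow q w * ((u - w) / l - e / 2))
      - σ ^ 2 * (q⁻¹ * ((1 + η) * |u| ^ (q + 1) + K * breg q u (spow q w)))
      - K₀ * C ^ 2 * (|u| ^ (q + 1) + |w| ^ (q + 1) + h ^ (q + 1)) ≤
    (spow q u - spow q w) / l * ((u - w) / l - e) := by
  obtain ⟨K₁, hK₁, hE⟩ := weighted_error_le hq
  refine ⟨K₁ * (1 + q), by positivity, fun η hη => ?_⟩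
  obtain ⟨K, hK, hS⟩ := sq_spow_mul_le hq hη
  refine ⟨K, hK, fun u w e h C l σ hh hC hl he => ?_⟩
  obtain ⟨h1, h2⟩ := hE u w e h C hh hC he
  have h3 := hS u w
  have hB := breg_nonneg hq u (spow q w)
  set T := |u| ^ (q + 1) + |w| ^ (q + 1) + h ^ (q + 1) with hT
  have hT0 : 0 ≤ T := by positivity
  have hKT : 0 ≤ K₁ * C ^ 2 * T := by positivity
  set S := q⁻¹ * ((1 + η) * |u| ^ (q + 1) + K * breg q u (spow q w)) with hSdef
  -- On the diagonal there is no difference quotient and the right-hand side vanishes; the term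
  -- linear in σ is absorbed by Young's inequality with weight |u|^{q-1}. This is the source of the
  -- summand q in the constant.
  rcases eq_or_ne u w with huw | huw
  · subst huw
    simp only [sub_self, zero_div, zero_mul, zero_sub]
    by_cases hu : u = 0
    · rw [show spow q u = 0 by rw [hu, spow_zero]]
      have : 0 ≤ S := by positivity
      have := mul_nonneg (sq_nonneg σ) this
      nlinarith
    · have h4 := h2 hu
      have hS' : q⁻¹ * |u| ^ (q + 1) ≤ S := by
        rw [hSdef]
        gcongr
        nlinarith [mul_nonneg hK hB, (by positivity : 0 ≤ |u| ^ (q + 1))]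
      have e1 : spow q u ^ 2 = |u| ^ (q + 1) * |u| ^ (q - 1) := by
        rw [← sq_abs, abs_spow hq, ← Real.rpow_add (abs_pos.2 hu), ← Real.rpow_natCast,
          ← Real.rpow_mul (abs_nonneg u)]
        congr 1; push_cast; ring
      set A := |u| ^ (q + 1)
      set D := |u| ^ (q - 1)
      have hA : 0 < A := Real.rpow_pos_of_pos (abs_pos.2 hu) _
      have hD : 0 ≤ D := Real.rpow_nonneg (abs_nonneg u) _
      have h5 : -(σ * spow q u * e) ≤ σ ^ 2 * (q⁻¹ * A) + q * (D * e ^ 2) := by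
        have h6 : (σ ^ 2 * (q⁻¹ * A) + q * (D * e ^ 2) + σ * spow q u * e) * (A * q⁻¹) =
          (σ * q⁻¹ * A + spow q u * e / 2) ^ 2 + 3 / 4 * (spow q u * e) ^ 2 := by
            have : (spow q u * e) ^ 2 = A * D * e ^ 2 := by rw [mul_pow, e1]
            rw [add_sq, div_pow, this]
            field_simp
            ring
        have h7 : 0 ≤ (σ ^ 2 * (q⁻¹ * A) + q * (D * e ^ 2) + σ * spow q u * e) * (A * q⁻¹) := by
          rw [h6]; positivity
        have := nonneg_of_mul_nonneg_left h7 (by positivity)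
        linarith
      have h8 : σ ^ 2 * (q⁻¹ * A) ≤ σ ^ 2 * S := by gcongr
      have h9 : q * (D * e ^ 2) ≤ q * (K₁ * C ^ 2 * T) := by gcongr
      nlinarith
  · have hd : 0 < |u - w| := abs_pos.2 (sub_ne_zero.2 huw)
    obtain ⟨ℓ, hℓ, hℓD⟩ : ∃ ℓ : ℝ, 0 < ℓ ∧ spow q u - spow q w = ℓ * (u - w) := by
      refine ⟨(spow q u - spow q w) / (u - w), ?_, by
        rw [div_mul_cancel₀ _ (sub_ne_zero.2 huw)]⟩
      rcases lt_or_gt_of_ne huw with h | h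
      · have := spow_strictMono hq h
        exact div_pos_of_neg_of_neg (by linarith) (by linarith)
      · have := spow_strictMono hq h
        exact div_pos (by linarith) (by linarith)
    rw [hℓD, abs_mul, abs_of_pos hℓ] at h1 h3
    have h4 : spow q w ^ 2 ≤ ℓ * S := by
      refine le_of_mul_le_mul_right ?_ hd
      linarith
    have h5 : ℓ * e ^ 2 ≤ K₁ * C ^ 2 * T := by
      refine le_of_mul_le_mul_right ?_ hd
      linarith
    rw [hℓD, mul_div_assoc]
    set X := (u - w) / l
    -- With the quotient ℓ the right-hand side is ℓX(X - e) = ℓ(X - e/2)² - ℓe²/4. After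
    -- multiplication by ℓ and w^{2q} ≤ ℓS, the claim is the square of ℓ(X - e/2) - σw^q:
    -- Cauchy-Schwarz in parametric form, so that σ may be chosen after integration.
    have h6 : 0 ≤ ℓ * (X - e / 2) ^ 2 - 2 * σ * (spow q w * (X - e / 2)) + σ ^ 2 * S := by
      have h7 : 0 ≤ ℓ * (ℓ * (X - e / 2) ^ 2 - 2 * σ * (spow q w * (X - e / 2)) + σ ^ 2 * S) := by
        nlinarith [sq_nonneg (ℓ * (X - e / 2) - σ * spow q w),
          mul_le_mul_of_nonneg_left h4 (sq_nonneg σ)]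
      exact nonneg_of_mul_nonneg_right h7 hℓ
    nlinarith [mul_nonneg hKT hq.le, mul_nonneg hℓ.le (sq_nonneg e)]

end Pointwise

end ParabolicFrequency

/-! ### Integrability of powers and Hölder pairings. -/

namespace ParabolicFrequency

theorem add_rpow_le_two_mul {r x y : ℝ} (hr : 0 ≤ r) (hx : 0 ≤ x) (hy : 0 ≤ y) :
    (x + y) ^ r ≤ 2 ^ r * (x ^ r + y ^ r) := by
  have hx' : 0 ≤ x ^ r := by positivity
  have hy' : 0 ≤ y ^ r := by positivity
  rcases le_total x y with h | h
  · calc (x + y) ^ r ≤ (2 * y) ^ r := Real.rpow_le_rpow (by positivity) (by linarith) hr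
      _ = 2 ^ r * y ^ r := Real.mul_rpow (by norm_num) hy
      _ ≤ _ := by gcongr; linarith
  · calc (x + y) ^ r ≤ (2 * x) ^ r := Real.rpow_le_rpow (by positivity) (by linarith) hr
      _ = 2 ^ r * x ^ r := Real.mul_rpow (by norm_num) hx
      _ ≤ _ := by gcongr; linarith

section PowIntegrable

variable {α : Type*} [MeasurableSpace α] {μ : Measure α}

/-- `f` is measurable and `|f|^r` is integrable. -/
def PowIntegrable (μ : Measure α) (r : ℝ) (f : α → ℝ) : Prop :=
  AEStronglyMeasurable f μ ∧ Integrable (fun x => |f x| ^ r) μ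

theorem memLp_iff_powIntegrable {r : ℝ} (hr : 0 < r) {f : α → ℝ} :
    MemLp f (ENNReal.ofReal r) μ ↔ PowIntegrable μ r f := by
  have h0 : ENNReal.ofReal r ≠ 0 := by simpa using hr
  constructor
  · intro h
    refine ⟨h.1, ?_⟩
    have := (integrable_norm_rpow_iff h.1 h0 ENNReal.ofReal_ne_top).2 h
    simpa [ENNReal.toReal_ofReal hr.le] using this
  · rintro ⟨h, hi⟩
    refine (integrable_norm_rpow_iff h h0 ENNReal.ofReal_ne_top).1 ?_
    simpa [ENNReal.toReal_ofReal hr.le] using hi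

namespace PowIntegrable

variable {r : ℝ} {f g : α → ℝ}

theorem mono (hr : 0 ≤ r) (hg : PowIntegrable μ r g) (hf : AEStronglyMeasurable f μ) {c : ℝ}
    (hc : 0 ≤ c) (h : ∀ᵐ x ∂μ, |f x| ≤ c * |g x|) : PowIntegrable μ r f := by
  refine ⟨hf, (hg.2.const_mul (c ^ r)).mono' ?_ ?_⟩
  · exact (hf.norm.aemeasurable.pow_const r).aestronglyMeasurable
  · filter_upwards [h] with x hx
    rw [Real.norm_of_nonneg (by positivity), ← Real.mul_rpow hc (abs_nonneg _)]
    exact Real.rpow_le_rpow (abs_nonneg _) hx hr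

theorem abs_add (hr : 0 ≤ r) (hf : PowIntegrable μ r f) (hg : PowIntegrable μ r g) :
    PowIntegrable μ r (fun x => |f x| + |g x|) := by
  have hm : AEStronglyMeasurable (fun x => |f x| + |g x|) μ := hf.1.norm.add hg.1.norm
  refine ⟨hm, ((hf.2.add hg.2).const_mul (2 ^ r)).mono' ?_ ?_⟩
  · exact (hm.norm.aemeasurable.pow_const r).aestronglyMeasurable
  · refine Eventually.of_forall fun x => ?_
    rw [Real.norm_of_nonneg (by positivity), abs_of_nonneg (by positivity)]
    exact add_rpow_le_two_mul hr (abs_nonneg _) (abs_nonneg _)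

theorem integral_add_le (hr : 0 ≤ r) (hf : PowIntegrable μ r f) (hg : PowIntegrable μ r g) :
    ∫ x, (|f x| + |g x|) ^ r ∂μ ≤ 2 ^ r * (∫ x, |f x| ^ r ∂μ + ∫ x, |g x| ^ r ∂μ) := by
  rw [← integral_add hf.2 hg.2, ← integral_const_mul]
  refine integral_mono_of_nonneg (Eventually.of_forall fun x => by positivity)
    ((hf.2.add hg.2).const_mul _) (Eventually.of_forall fun x => ?_)
  exact add_rpow_le_two_mul hr (abs_nonneg _) (abs_nonneg _)

theorem integrable_add_rpow (hr : 0 ≤ r) (hf : PowIntegrable μ r f) (hg : PowIntegrable μ r g) :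
    Integrable (fun x => (|f x| + |g x|) ^ r) μ := by
  refine (hf.abs_add hr hg).2.congr (Eventually.of_forall fun x => ?_)
  simp only
  rw [abs_of_nonneg (by positivity)]

theorem add (hr : 0 ≤ r) (hf : PowIntegrable μ r f) (hg : PowIntegrable μ r g) :
    PowIntegrable μ r (fun x => f x + g x) := by
  refine (hf.abs_add hr hg).mono hr (hf.1.add hg.1) zero_le_one (Eventually.of_forall fun x => ?_)
  rw [one_mul, abs_of_nonneg (a := |f x| + |g x|) (by positivity)]
  exact abs_add_le _ _

theorem const_mul (hr : 0 ≤ r) (hf : PowIntegrable μ r f) (c : ℝ) :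
    PowIntegrable μ r (fun x => c * f x) := by
  refine hf.mono hr (hf.1.const_mul c) (abs_nonneg c) (Eventually.of_forall fun x => ?_)
  rw [abs_mul]

theorem sub (hr : 0 ≤ r) (hf : PowIntegrable μ r f) (hg : PowIntegrable μ r g) :
    PowIntegrable μ r (fun x => f x - g x) := by
  refine (hf.add hr (hg.const_mul hr (-1))).mono hr (hf.1.sub hg.1) zero_le_one
    (Eventually.of_forall fun x => ?_)
  rw [one_mul]
  exact le_of_eq (congrArg _ (by ring))

theorem integral_sub_le (hr : 0 ≤ r) (hf : PowIntegrable μ r f) (hg : PowIntegrable μ r g) :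
    ∫ x, |f x - g x| ^ r ∂μ ≤ 2 ^ r * (∫ x, |f x| ^ r ∂μ + ∫ x, |g x| ^ r ∂μ) := by
  refine le_trans ?_ (hf.integral_add_le hr hg)
  refine integral_mono_of_nonneg (Eventually.of_forall fun x => by positivity)
    (hf.integrable_add_rpow hr hg) (Eventually.of_forall fun x => ?_)
  exact Real.rpow_le_rpow (abs_nonneg _) (abs_sub _ _) hr

variable {q : ℝ} {u v : α → ℝ}

theorem spow (hq : 0 < q) (hu : PowIntegrable μ (q + 1) u) :
    PowIntegrable μ (q⁻¹ + 1) (fun x => ParabolicFrequency.spow q (u x)) := by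
  refine ⟨(continuous_spow hq).comp_aestronglyMeasurable hu.1, hu.2.congr ?_⟩
  refine Eventually.of_forall fun x => ?_
  simp only
  rw [abs_spow hq, ← Real.rpow_mul (abs_nonneg _)]
  congr 1
  field_simp
  ring

theorem spow_inv (hq : 0 < q) (hv : PowIntegrable μ (q⁻¹ + 1) v) :
    PowIntegrable μ (q + 1) (fun x => ParabolicFrequency.spow q⁻¹ (v x)) := by
  have := hv.spow (inv_pos.2 hq)
  rwa [inv_inv] at this

/-- Young's inequality, read off from the nonnegativity of `breg` at both v and -v, dominates the
product. -/
theorem integrable_mul (hq : 0 < q) (hv : PowIntegrable μ (q⁻¹ + 1) v)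
    (hu : PowIntegrable μ (q + 1) u) : Integrable (fun x => v x * u x) μ := by
  refine ((hu.2.div_const (q + 1)).add (hv.2.div_const (q⁻¹ + 1))).mono' (hv.1.mul hu.1) ?_
  refine Eventually.of_forall fun x => ?_
  have h1 := breg_nonneg hq (u x) (v x)
  have h2 := breg_nonneg hq (u x) (-v x)
  unfold breg at h1 h2
  rw [abs_neg] at h2
  rw [Real.norm_eq_abs, Pi.add_apply, abs_le]
  constructor <;> linarith

theorem integrable_breg (hq : 0 < q) (hv : PowIntegrable μ (q⁻¹ + 1) v)
    (hu : PowIntegrable μ (q + 1) u) : Integrable (fun x => breg q (u x) (v x)) μ :=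
  ((hu.2.div_const (q + 1)).add (hv.2.div_const (q⁻¹ + 1))).sub (hv.integrable_mul hq hu)

theorem integral_breg (hq : 0 < q) (hv : PowIntegrable μ (q⁻¹ + 1) v)
    (hu : PowIntegrable μ (q + 1) u) : ∫ x, breg q (u x) (v x) ∂μ =
      (∫ x, |u x| ^ (q + 1) ∂μ) / (q + 1) + (∫ x, |v x| ^ (q⁻¹ + 1) ∂μ) / (q⁻¹ + 1)
        - ∫ x, v x * u x ∂μ := by
  unfold breg
  rw [integral_sub (f := fun x => |u x| ^ (q + 1) / (q + 1) + |v x| ^ (q⁻¹ + 1) / (q⁻¹ + 1))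
    ((hu.2.div_const (q + 1)).add (hv.2.div_const (q⁻¹ + 1))) (hv.integrable_mul hq hu), integral_add (hu.2.div_const (q + 1)) (hv.2.div_const (q⁻¹ + 1)),
    integral_div, integral_div]

theorem abs_integral_mul_le (hq : 0 < q) (hv : PowIntegrable μ (q⁻¹ + 1) v)
    (hu : PowIntegrable μ (q + 1) u) : |∫ x, v x * u x ∂μ| ≤
      (∫ x, |v x| ^ (q⁻¹ + 1) ∂μ) ^ (1 / (q⁻¹ + 1)) * (∫ x, |u x| ^ (q + 1) ∂μ) ^ (1 / (q + 1)) := by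
  have hc : (q⁻¹ + 1).HolderConjugate (q + 1) := by
    have : 0 < q⁻¹ := inv_pos.2 hq
    rw [Real.holderConjugate_iff]
    refine ⟨by linarith, ?_⟩
    field_simp
    ring
  have := integral_mul_norm_le_Lp_mul_Lq hc ((memLp_iff_powIntegrable (by positivity)).2 hv)
    ((memLp_iff_powIntegrable (by positivity)).2 hu)
  simp only [Real.norm_eq_abs] at this
  refine le_trans (le_trans (abs_integral_le_integral_abs) (le_of_eq ?_)) this
  simp only [abs_mul]

theorem abs_integral_mul_le_add (hq : 0 < q) (hv : PowIntegrable μ (q⁻¹ + 1) v)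
    (hu : PowIntegrable μ (q + 1) u) : |∫ x, v x * u x ∂μ| ≤
      ∫ x, |v x| ^ (q⁻¹ + 1) ∂μ + ∫ x, |u x| ^ (q + 1) ∂μ := by
  rw [← integral_add hv.2 hu.2]
  refine abs_integral_le_integral_abs.trans (integral_mono_of_nonneg
    (Eventually.of_forall fun x => abs_nonneg _) (hv.2.add hu.2) (Eventually.of_forall fun x => ?_))
  have h1 := breg_nonneg hq (u x) (v x)
  have h2 := breg_nonneg hq (u x) (-v x)
  unfold breg at h1 h2
  rw [abs_neg] at h2
  have h3 : |u x| ^ (q + 1) / (q + 1) ≤ |u x| ^ (q + 1) :=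
    div_le_self (by positivity) (by linarith)
  have h4 : |v x| ^ (q⁻¹ + 1) / (q⁻¹ + 1) ≤ |v x| ^ (q⁻¹ + 1) :=
    div_le_self (by positivity) (by linarith [inv_pos.2 hq])
  simp only
  rw [abs_le]
  constructor <;> linarith

end PowIntegrable

end PowIntegrable

/-! ### The regularized energy and its almost minimizers. -/

section Envelope

variable {α : Type*} [MeasurableSpace α] {μ : Measure α} {p q : ℝ}
  {V : Set (α → ℝ)} {E : (α → ℝ) → ℝ}

/-- `E` is a nonnegative convex `p`-homogeneous functional on the convex cone `V ⊆ L^{1+1/q}`. -/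
structure IsEnergy (μ : Measure α) (p q : ℝ) (V : Set (α → ℝ)) (E : (α → ℝ) → ℝ) : Prop where
  pow_integrable : ∀ v ∈ V, PowIntegrable μ (q⁻¹ + 1) v
  nonempty : V.Nonempty
  nonneg : ∀ v ∈ V, 0 ≤ E v
  convex : ∀ v ∈ V, ∀ z ∈ V, ∀ τ : ℝ, 0 ≤ τ → τ ≤ 1 →
    (fun x => v x + τ * (z x - v x)) ∈ V ∧
      E (fun x => v x + τ * (z x - v x)) ≤ (1 - τ) * E v + τ * E z
  smul : ∀ v ∈ V, ∀ τ : ℝ, 0 ≤ τ →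
    (fun x => τ * v x) ∈ V ∧ E (fun x => τ * v x) = τ ^ p * E v

/-- The penalized functional whose infimum is the regularized energy of `u`. -/
noncomputable def penalized (μ : Measure α) (q : ℝ) (E : (α → ℝ) → ℝ) (l : ℝ) (u v : α → ℝ) : ℝ :=
  E v + (∫ x, breg q (u x) (v x) ∂μ) / l

/-- The regularized energy of `u`, an inf-convolution with a Bregman distance. -/
noncomputable def envelope (μ : Measure α) (q : ℝ) (V : Set (α → ℝ)) (E : (α → ℝ) → ℝ) (l : ℝ)
    (u : α → ℝ) : ℝ :=
  sInf (penalized μ q E l u '' V)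

theorem integral_breg_nonneg (hq : 0 < q) (u v : α → ℝ) : 0 ≤ ∫ x, breg q (u x) (v x) ∂μ :=
  integral_nonneg fun _ => breg_nonneg hq _ _

theorem IsEnergy.penalized_nonneg (hE : IsEnergy μ p q V E) (hq : 0 < q) {l : ℝ} (hl : 0 < l)
    (u : α → ℝ) {v : α → ℝ} (hv : v ∈ V) : 0 ≤ penalized μ q E l u v :=
  add_nonneg (hE.nonneg v hv) (div_nonneg (integral_breg_nonneg hq u v) hl.le)

theorem IsEnergy.envelope_le (hE : IsEnergy μ p q V E) (hq : 0 < q) {l : ℝ} (hl : 0 < l)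
    (u : α → ℝ) {v : α → ℝ} (hv : v ∈ V) : envelope μ q V E l u ≤ penalized μ q E l u v :=
  csInf_le ⟨0, by rintro _ ⟨v, hv, rfl⟩; exact hE.penalized_nonneg hq hl u hv⟩
    (mem_image_of_mem _ hv)

theorem IsEnergy.envelope_nonneg (hE : IsEnergy μ p q V E) (hq : 0 < q) {l : ℝ} (hl : 0 < l)
    (u : α → ℝ) : 0 ≤ envelope μ q V E l u :=
  le_csInf (hE.nonempty.image _)
    (by rintro _ ⟨v, hv, rfl⟩; exact hE.penalized_nonneg hq hl u hv)

/-- Working with almost minimizers avoids any closedness of V or lower semicontinuity of E, which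
existence of a minimizer would require. -/
theorem IsEnergy.exists_penalized_lt (hE : IsEnergy μ p q V E) (l : ℝ) (u : α → ℝ) {ε : ℝ}
    (hε : 0 < ε) : ∃ v ∈ V, penalized μ q E l u v < envelope μ q V E l u + ε := by
  obtain ⟨_, ⟨v, hv, rfl⟩, h⟩ := exists_lt_of_csInf_lt (hE.nonempty.image (penalized μ q E l u))
    (lt_add_of_pos_right (sInf (penalized μ q E l u '' V)) hε)
  exact ⟨v, hv, h⟩

theorem IsEnergy.envelope_le_energy (hE : IsEnergy μ p q V E) (hq : 0 < q) {l : ℝ} (hl : 0 < l)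
    {u : α → ℝ} (hv : (fun x => spow q (u x)) ∈ V) :
    envelope μ q V E l u ≤ E (fun x => spow q (u x)) := by
  refine (hE.envelope_le hq hl u hv).trans (le_of_eq ?_)
  simp [penalized, breg_spow_self hq]

/-- The competitor is zero, which lies in the cone with zero energy by homogeneity. -/
theorem IsEnergy.envelope_le_norm (hE : IsEnergy μ p q V E) (hp : 0 < p) (hq : 0 < q) {l : ℝ}
    (hl : 0 < l) (u : α → ℝ) :
    envelope μ q V E l u ≤ (∫ x, |u x| ^ (q + 1) ∂μ) / (q + 1) / l := by
  obtain ⟨v, hv⟩ := hE.nonempty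
  obtain ⟨h1, h2⟩ := hE.smul v hv 0 le_rfl
  refine (hE.envelope_le hq hl u h1).trans (le_of_eq ?_)
  have : q⁻¹ + 1 ≠ 0 := by positivity
  rw [penalized, h2, Real.zero_rpow hp.ne']
  simp [breg, Real.zero_rpow this, integral_div]

/-- Almost minimizers are bounded. -/
theorem IsEnergy.integral_rpow_le (hE : IsEnergy μ p q V E) (hp : 0 < p) (hq : 0 < q) :
    ∃ c : ℝ, 0 ≤ c ∧ ∀ (l : ℝ) (u v : α → ℝ), 0 < l → PowIntegrable μ (q + 1) u → v ∈ V →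
      (∫ x, |v x| ^ (q⁻¹ + 1) ∂μ ≤
        c * (∫ x, |u x| ^ (q + 1) ∂μ + ∫ x, breg q (u x) (v x) ∂μ)) ∧
      ∀ ε : ℝ, penalized μ q E l u v ≤ envelope μ q V E l u + ε →
        ∫ x, |v x| ^ (q⁻¹ + 1) ∂μ ≤ c * (2 * ∫ x, |u x| ^ (q + 1) ∂μ + l * ε) := by
  obtain ⟨c, hc, h⟩ := rpow_le_breg hq
  refine ⟨c, hc, fun l u v hl hu hv => ?_⟩
  have hv' := hE.pow_integrable v hv
  have hB := hv'.integrable_breg hq hu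
  have h1 : ∫ x, |v x| ^ (q⁻¹ + 1) ∂μ ≤
        c * (∫ x, |u x| ^ (q + 1) ∂μ + ∫ x, breg q (u x) (v x) ∂μ) := by
    rw [← integral_add hu.2 hB, ← integral_const_mul]
    exact integral_mono hv'.2 ((hu.2.add hB).const_mul c) fun x => h _ _
  refine ⟨h1, fun ε hε => h1.trans ?_⟩
  have h2 := hE.envelope_le_norm hp hq hl u
  have h3 := hE.nonneg v hv
  have h4 : (∫ x, breg q (u x) (v x) ∂μ) / l ≤ (∫ x, |u x| ^ (q + 1) ∂μ) / (q + 1) / l + ε := by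
    unfold penalized at hε; linarith
  rw [div_le_iff₀ hl, add_mul, div_mul_cancel₀ _ hl.ne'] at h4
  have h5 : (∫ x, |u x| ^ (q + 1) ∂μ) / (q + 1) ≤ ∫ x, |u x| ^ (q + 1) ∂μ :=
    div_le_self (integral_nonneg fun x => by positivity) (by linarith)
  exact mul_le_mul_of_nonneg_left (by linarith) hc

/-- The approximate Euler-Lagrange inequality for almost minimizers. -/
theorem IsEnergy.exists_variational (hE : IsEnergy μ p q V E) (hq : 0 < q)
    {l : ℝ} (hl : 0 < l) {u : α → ℝ} (hu : PowIntegrable μ (q + 1) u) (M : ℝ)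
    {ε : ℝ} (hε : 0 < ε) : ∃ ε' : ℝ, 0 < ε' ∧ ∀ v ∈ V, ∀ z ∈ V,
      penalized μ q E l u v ≤ envelope μ q V E l u + ε' →
      ∫ x, |v x| ^ (q⁻¹ + 1) ∂μ ≤ M → ∫ x, |z x| ^ (q⁻¹ + 1) ∂μ ≤ M →
      (∫ x, (z x - v x) * (u x - spow q⁻¹ (v x)) ∂μ) / l ≤ E z - E v + ε := by
  set θ := q⁻¹ with hθ
  have hθ0 : 0 < θ := inv_pos.2 hq
  have hθ1 : 0 ≤ θ + 1 := by positivity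
  set N := 2 ^ (θ + 1) * (M + 2 ^ (θ + 1) * (M + M)) with hN
  have hm : 0 < min 1 θ := lt_min one_pos hθ0
  -- τ is a step length from v towards z. It depends only on the bound M and not on v and z, so the
  -- tolerance ε' can be fixed before the almost minimizer.
  obtain ⟨τ, hτ0, hτ1, hτ⟩ : ∃ τ : ℝ, 0 < τ ∧ τ ≤ 1 ∧ ((θ + 2) * τ ^ min 1 θ * N) / l < ε / 2 := by
    have h1 : Tendsto (fun τ : ℝ => ((θ + 2) * τ ^ min 1 θ * N) / l) (𝓝[>] 0) (𝓝 0) := by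
      have h2 : Tendsto (fun τ : ℝ => τ ^ min 1 θ) (𝓝 0) (𝓝 0) := by
        have := (Real.continuous_rpow_const hm.le).tendsto 0
        rwa [Real.zero_rpow hm.ne'] at this
      have h3 := (((h2.const_mul (θ + 2)).mul_const N).div_const l)
      simp only [mul_zero, zero_mul, zero_div] at h3
      exact h3.mono_left nhdsWithin_le_nhds
    have h4 : ∀ᶠ τ : ℝ in 𝓝[>] 0, τ ≤ 1 :=
      nhdsWithin_le_nhds ((gt_mem_nhds one_pos).mono fun x hx => le_of_lt hx)
    obtain ⟨τ, h5, h6, h7⟩ := ((h1.eventually (gt_mem_nhds (half_pos hε))).and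
      (h4.and self_mem_nhdsWithin)).exists
    exact ⟨τ, h7, h6, h5⟩
  -- The tolerance carries a factor τ because the first-order comparison is divided by τ at the end.
  refine ⟨τ * (ε / 2), by positivity, fun v hv z hz hJ hvM hzM => ?_⟩
  have hvP := hE.pow_integrable v hv
  have hzP := hE.pow_integrable z hz
  have hhP := hzP.sub hθ1 hvP
  have hwP := hvP.spow_inv hq
  obtain ⟨hV, hEc⟩ := hE.convex v hv z hz τ hτ0.le hτ1
  have h1 := hE.envelope_le hq hl u hV
  have hVP := hE.pow_integrable _ hV
  have hint : ∫ x, (|v x| + |z x - v x|) ^ (θ + 1) ∂μ ≤ N := by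
    refine (hvP.integral_add_le hθ1 hhP).trans ?_
    rw [hN]
    have := hzP.integral_sub_le hθ1 hvP
    gcongr
    exact this.trans (by gcongr)
  -- The derivative of `breg` in its dual variable is v^{1/q} - u; the Taylor remainder is taken
  -- with exponent 1/q.
  have h2 : ∫ x, breg q (u x) (v x + τ * (z x - v x)) ∂μ - ∫ x, breg q (u x) (v x) ∂μ ≤
      τ * (-(∫ x, (z x - v x) * (u x - spow q⁻¹ (v x)) ∂μ) + (θ + 2) * τ ^ min 1 θ * N) := by
    have i1 := hVP.integrable_breg hq hu
    have i2 := hvP.integrable_breg hq hu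
    have i3 := hhP.integrable_mul hq (hu.sub (by positivity) hwP)
    have i4 := hvP.integrable_add_rpow hθ1 hhP
    rw [← integral_sub i1 i2]
    calc ∫ x, (breg q (u x) (v x + τ * (z x - v x)) - breg q (u x) (v x)) ∂μ ≤
        ∫ x, τ * (-((z x - v x) * (u x - spow q⁻¹ (v x))) +
          (θ + 2) * τ ^ min 1 θ * (|v x| + |z x - v x|) ^ (θ + 1)) ∂μ := by
          refine integral_mono (i1.sub i2) ((i3.neg.add (i4.const_mul _)).const_mul _) fun x => ?_
          have := rpow_abs_taylor hθ0 hτ0.le hτ1 (v x) (z x - v x)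
          simp only [breg]
          rw [← hθ]
          linarith [mul_sub (τ * (z x - v x)) (u x) (spow θ (v x)),
            add_mul (v x) (τ * (z x - v x)) (u x),
            show τ * ((z x - v x) * spow θ (v x)) = τ * (z x - v x) * spow θ (v x) by ring,
            show τ * (-((z x - v x) * (u x - spow θ (v x))) +
              (θ + 2) * τ ^ min 1 θ * (|v x| + |z x - v x|) ^ (θ + 1)) =
              -(τ * (z x - v x) * (u x - spow θ (v x))) +
              τ * ((θ + 2) * τ ^ min 1 θ * (|v x| + |z x - v x|) ^ (θ + 1)) by ring]
      _ = τ * (-(∫ x, (z x - v x) * (u x - spow q⁻¹ (v x)) ∂μ) + (θ + 2) * τ ^ min 1 θ *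
          ∫ x, (|v x| + |z x - v x|) ^ (θ + 1) ∂μ) := by
          have i5 : Integrable (fun x => -((z x - v x) * (u x - spow q⁻¹ (v x)))) μ := i3.neg
          rw [integral_const_mul, integral_add i5 (i4.const_mul _), integral_neg,
            integral_const_mul]
      _ ≤ _ := by gcongr
  unfold penalized at h1 hJ
  set I := ∫ x, (z x - v x) * (u x - spow q⁻¹ (v x)) ∂μ
  have h3 : (∫ x, breg q (u x) (v x + τ * (z x - v x)) ∂μ) / l - (∫ x, breg q (u x) (v x) ∂μ) / l ≤
      τ * (-(I / l) + (θ + 2) * τ ^ min 1 θ * N / l) := by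
    rw [← sub_div, div_le_iff₀ hl]
    refine h2.trans (le_of_eq ?_)
    field_simp
  have h4 : τ * (I / l) ≤ τ * (E z - E v + ε) := by nlinarith
  exact le_of_mul_le_mul_left h4 hτ0

/-- Almost minimizers that almost satisfy the two consequences of the Euler-Lagrange equation that
are used below. -/
theorem IsEnergy.exists_almost_minimizer (hE : IsEnergy μ p q V E) (hp : 1 < p) (hq : 0 < q)
    {l : ℝ} (hl : 0 < l) {u : α → ℝ} (hu : PowIntegrable μ (q + 1) u)
    (huV : (fun x => spow q (u x)) ∈ V) {ε : ℝ} (hε : 0 < ε) :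
    ∃ v ∈ V, penalized μ q E l u v ≤ envelope μ q V E l u + ε ∧
      (∫ x, (spow q (u x) - v x) * (u x - spow q⁻¹ (v x)) ∂μ) / l ≤
        E (fun x => spow q (u x)) - E v + ε ∧
      p * E v - ε ≤ (∫ x, v x * (u x - spow q⁻¹ (v x)) ∂μ) / l := by
  have hp0 : 0 < p := by linarith
  obtain ⟨c, hc, hbd⟩ := hE.integral_rpow_le hp0 hq
  set Eu := E (fun x => spow q (u x)) with hEu
  have hEu0 : 0 ≤ Eu := hE.nonneg _ huV
  have huP := hE.pow_integrable _ huV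
  -- The Euler identity comes from the competitor (1-s)v, whose energy is (1-s)^p E(v), since
  -- (1-(1-s)^p)/s → p as s → 0. The factor E(u^q)+1 bounds E(v) beforehand, so that s does not
  -- depend on v.
  obtain ⟨s, hs0, hs1, hs⟩ : ∃ s : ℝ, 0 < s ∧ s ≤ 1 ∧
      (p - (1 - (1 - s) ^ p) / s) * (Eu + 1) ≤ ε / 2 := by
    have hd : HasDerivAt (fun s : ℝ => (1 - s) ^ p) (-p) 0 := by
      have h1 : HasDerivAt (fun s : ℝ => 1 - s) (-1) 0 := by
        simpa using (hasDerivAt_id (0 : ℝ)).const_sub 1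
      have := h1.rpow_const (p := p) (Or.inl (by norm_num))
      simpa using this
    have h1 := (hasDerivAt_iff_tendsto_slope_zero.1 hd).mono_left
      (nhdsWithin_mono 0 (show Ioi (0 : ℝ) ⊆ {0}ᶜ from fun x hx => ne_of_gt hx))
    have h2 : Tendsto (fun s : ℝ => (p - (1 - (1 - s) ^ p) / s) * (Eu + 1)) (𝓝[>] 0) (𝓝 0) := by
      have h3 : Tendsto (fun s : ℝ => (p + s⁻¹ • ((1 - (0 + s)) ^ p - (1 - 0) ^ p)) * (Eu + 1))
        (𝓝[>] 0) (𝓝 ((p + -p) * (Eu + 1))) := (h1.const_add p).mul_const _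
      rw [add_neg_cancel, zero_mul] at h3
      refine h3.congr fun s => ?_
      simp only [zero_add, sub_zero, Real.one_rpow, smul_eq_mul]
      ring
    have h4 : ∀ᶠ τ : ℝ in 𝓝[>] 0, τ ≤ 1 :=
      nhdsWithin_le_nhds ((gt_mem_nhds one_pos).mono fun x hx => le_of_lt hx)
    obtain ⟨τ, h5, h6, h7⟩ := ((h2.eventually (gt_mem_nhds (half_pos hε))).and
      (h4.and self_mem_nhdsWithin)).exists
    exact ⟨τ, h7, h6, h5.le⟩
  set M := max (c * (2 * ∫ x, |u x| ^ (q + 1) ∂μ + l * 1))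
    (∫ x, |spow q (u x)| ^ (q⁻¹ + 1) ∂μ) with hM
  -- The factor s anticipates the division by s in the ray comparison.
  have hε2 : 0 < min ε (ε / 2 * s) := lt_min hε (by positivity)
  obtain ⟨ε', hε', hvar⟩ := hE.exists_variational hq hl hu M hε2
  have hε3 : 0 < min ε' (min ε 1) := lt_min hε' (lt_min hε one_pos)
  obtain ⟨v, hv, hJ⟩ := hE.exists_penalized_lt l u hε3
  have hJ1 : penalized μ q E l u v ≤ envelope μ q V E l u + ε' :=
    hJ.le.trans (by gcongr; exact min_le_left _ _)
  have hJ2 : penalized μ q E l u v ≤ envelope μ q V E l u + ε :=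
    hJ.le.trans (by gcongr; exact (min_le_right _ _).trans (min_le_left _ _))
  have hJ3 : penalized μ q E l u v ≤ envelope μ q V E l u + 1 :=
    hJ.le.trans (by gcongr; exact (min_le_right _ _).trans (min_le_right _ _))
  have hvM : ∫ x, |v x| ^ (q⁻¹ + 1) ∂μ ≤ M :=
    ((hbd l u v hl hu hv).2 1 hJ3).trans (le_max_left _ _)
  refine ⟨v, hv, hJ2, ?_, ?_⟩
  · refine (hvar v hv _ huV hJ1 hvM (le_max_right _ _)).trans ?_
    gcongr
    exact min_le_left _ _
  · obtain ⟨hz, hEz⟩ := hE.smul v hv (1 - s) (by linarith)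
    have hzM : ∫ x, |(1 - s) * v x| ^ (q⁻¹ + 1) ∂μ ≤ M := by
      refine le_trans ?_ hvM
      refine integral_mono (hE.pow_integrable _ hz).2 (hE.pow_integrable _ hv).2 fun x => ?_
      refine Real.rpow_le_rpow (abs_nonneg _) ?_ (by positivity)
      rw [abs_mul, abs_of_nonneg (by linarith)]
      nlinarith [abs_nonneg (v x)]
    have h1 := hvar v hv _ hz hJ1 hvM hzM
    rw [hEz] at h1
    have h2 : ∫ x, ((1 - s) * v x - v x) * (u x - spow q⁻¹ (v x)) ∂μ =
        -s * ∫ x, v x * (u x - spow q⁻¹ (v x)) ∂μ := by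
      rw [← integral_const_mul]
      congr 1; funext x; ring
    rw [h2] at h1
    set I := ∫ x, v x * (u x - spow q⁻¹ (v x)) ∂μ
    have h3 : -s * I / l = -s * (I / l) := by ring
    rw [h3] at h1
    have h4 : min ε (ε / 2 * s) ≤ ε / 2 * s := min_le_right _ _
    have hEv : E v ≤ Eu + 1 := by
      have h5 := hE.envelope_le_energy hq hl huV
      have h6 : 0 ≤ (∫ x, breg q (u x) (v x) ∂μ) / l :=
        div_nonneg (integral_breg_nonneg hq u v) hl.le
      unfold penalized at hJ3
      linarith
    have hEv0 := hE.nonneg v hv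
    have h5 : (p - (1 - (1 - s) ^ p) / s) * E v ≤ ε / 2 := by
      rcases le_total 0 (p - (1 - (1 - s) ^ p) / s) with h | h
      · exact (mul_le_mul_of_nonneg_left hEv h).trans hs
      · have := mul_nonpos_of_nonpos_of_nonneg h hEv0
        linarith
    have h6 : s * (p * E v - ε) ≤ s * (I / l) := by
      have h7 : s * ((p - (1 - (1 - s) ^ p) / s) * E v) = s * (p * E v) - (1 - (1 - s) ^ p) * E v := by
        field_simp
      have h8 := mul_le_mul_of_nonneg_left h5 hs0.le
      rw [h7] at h8
      nlinarith
    exact le_of_mul_le_mul_left h6 hs0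

end Envelope

end ParabolicFrequency

namespace ParabolicFrequency

/-! ### Estimates on one time slice. -/

section Slice

variable {α : Type*} [MeasurableSpace α] {μ : Measure α} {p q C : ℝ}
  {V : Set (α → ℝ)} {E : (α → ℝ) → ℝ} {u ut F h : α → ℝ}

/-- One time slice of a solution of the perturbed equation `u_t = F + error`, where `-F` is the
subgradient of the energy at `u^q`. -/
structure IsSlice (μ : Measure α) (p q C : ℝ) (V : Set (α → ℝ)) (E : (α → ℝ) → ℝ)
    (u ut F h : α → ℝ) : Prop where
  const_nonneg : 0 ≤ C
  pow_u : PowIntegrable μ (q + 1) u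
  pow_ut : PowIntegrable μ (q + 1) ut
  pow_F : PowIntegrable μ (q + 1) F
  pow_h : PowIntegrable μ (q + 1) h
  h_nonneg : ∀ x, 0 ≤ h x
  mem : (fun x => spow q (u x)) ∈ V
  integral_h : ∫ x, h x ^ (q + 1) ∂μ = p * E (fun x => spow q (u x))
  subgradient : ∀ v ∈ V, E (fun x => spow q (u x)) - ∫ x, (v x - spow q (u x)) * F x ∂μ ≤ E v
  pairing : p * E (fun x => spow q (u x)) = -∫ x, spow q (u x) * F x ∂μ
  error : ∀ᵐ x ∂μ, |ut x - F x| ≤ errorMajorant q C (u x) (h x)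

theorem errorMajorant_mul {q C s h c : ℝ} : c * errorMajorant q C s h = errorMajorant q (c * C) s h := by
  unfold errorMajorant
  split_ifs <;> ring

theorem integral_abs_spow_rpow (hq : 0 < q) (u : α → ℝ) :
    ∫ x, |spow q (u x)| ^ (q⁻¹ + 1) ∂μ = ∫ x, |u x| ^ (q + 1) ∂μ := by
  congr 1
  funext x
  rw [abs_spow hq, ← Real.rpow_mul (abs_nonneg _)]
  congr 1
  field_simp
  ring

theorem integral_abs_spow_inv_rpow (hq : 0 < q) (v : α → ℝ) :
    ∫ x, |spow q⁻¹ (v x)| ^ (q + 1) ∂μ = ∫ x, |v x| ^ (q⁻¹ + 1) ∂μ := by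
  have := integral_abs_spow_rpow (μ := μ) (inv_pos.2 hq) v
  rwa [inv_inv] at this

/-- The integrated form of the pointwise frequency inequality. -/
theorem frequency_integrated (hq : 0 < q) : ∃ K₀ : ℝ, 0 ≤ K₀ ∧ ∀ η : ℝ, 0 < η →
    ∃ K : ℝ, 0 ≤ K ∧ ∀ (C l σ : ℝ) (u v e h : α → ℝ), 0 ≤ C → 0 < l →
    PowIntegrable μ (q + 1) u → PowIntegrable μ (q⁻¹ + 1) v → PowIntegrable μ (q + 1) e →
    PowIntegrable μ (q + 1) h → (∀ x, 0 ≤ h x) →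
    (∀ᵐ x ∂μ, |e x| ≤ errorMajorant q C (u x) (h x)) →
    2 * σ * ((∫ x, v x * (u x - spow q⁻¹ (v x)) ∂μ) / l - (∫ x, v x * e x ∂μ) / 2)
      - σ ^ 2 * (q⁻¹ * ((1 + η) * ∫ x, |u x| ^ (q + 1) ∂μ + K * ∫ x, breg q (u x) (v x) ∂μ))
      - K₀ * C ^ 2 * (∫ x, |u x| ^ (q + 1) ∂μ + ∫ x, |v x| ^ (q⁻¹ + 1) ∂μ
          + ∫ x, h x ^ (q + 1) ∂μ) ≤
    (∫ x, (spow q (u x) - v x) * (u x - spow q⁻¹ (v x)) ∂μ) / l / l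
      - (∫ x, (spow q (u x) - v x) * e x ∂μ) / l := by
  obtain ⟨K₀, hK₀, hf⟩ := frequency_pointwise hq
  refine ⟨K₀, hK₀, fun η hη => ?_⟩
  obtain ⟨K, hK, hP⟩ := hf η hη
  refine ⟨K, hK, fun C l σ u v e h hC hl hu hv he hh hh0 hb => ?_⟩
  have hq1 : 0 ≤ q + 1 := by positivity
  have hq2 : 0 ≤ q⁻¹ + 1 := by positivity
  have hw := hv.spow_inv hq
  have hd := hu.sub hq1 hw
  have hD := (hu.spow hq).sub hq2 hv
  have i1 := hv.integrable_mul hq hd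
  have i2 := hv.integrable_mul hq he
  have i3 := hD.integrable_mul hq hd
  have i4 := hD.integrable_mul hq he
  have i5 := hv.integrable_breg hq hu
  have i6 : Integrable (fun x => h x ^ (q + 1)) μ :=
    hh.2.congr (Eventually.of_forall fun x => by simp only [abs_of_nonneg (hh0 x)])
  have key : ∫ x, (2 * σ * ((v x * (u x - spow q⁻¹ (v x))) / l - (v x * e x) / 2)
      - σ ^ 2 * (q⁻¹ * ((1 + η) * |u x| ^ (q + 1) + K * breg q (u x) (v x)))
      - K₀ * C ^ 2 * (|u x| ^ (q + 1) + |spow q⁻¹ (v x)| ^ (q + 1) + h x ^ (q + 1))) ∂μ ≤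
    ∫ x, (((spow q (u x) - v x) * (u x - spow q⁻¹ (v x))) / l / l
      - ((spow q (u x) - v x) * e x) / l) ∂μ := by
    refine integral_mono_ae ?_ ?_ ?_
    · exact ((((i1.div_const l).sub (i2.div_const 2)).const_mul _).sub
        ((((hu.2.const_mul _).add (i5.const_mul K)).const_mul _).const_mul _)).sub
        (((hu.2.add hw.2).add i6).const_mul _)
    · exact ((i3.div_const l).div_const l).sub (i4.div_const l)
    · filter_upwards [hb] with x hx
      -- The pointwise inequality is used at w = v^{1/q}, for which w^q = v.
      have := hP (u x) (spow q⁻¹ (v x)) (e x) (h x) C l σ (hh0 x) hC hl hx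
      rw [spow_spow_inv hq] at this
      refine le_trans (le_of_eq ?_) (this.trans (le_of_eq ?_)) <;> ring
  have j1 : Integrable (fun x => v x * (u x - spow q⁻¹ (v x)) / l - v x * e x / 2) μ :=
    (i1.div_const l).sub (i2.div_const 2)
  have j2 : Integrable (fun x => (1 + η) * |u x| ^ (q + 1) + K * breg q (u x) (v x)) μ :=
    (hu.2.const_mul _).add (i5.const_mul K)
  have j3 : Integrable (fun x => 2 * σ * (v x * (u x - spow q⁻¹ (v x)) / l - v x * e x / 2) -
      σ ^ 2 * (q⁻¹ * ((1 + η) * |u x| ^ (q + 1) + K * breg q (u x) (v x)))) μ :=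
    (j1.const_mul _).sub ((j2.const_mul _).const_mul _)
  have j4 : Integrable (fun x => |u x| ^ (q + 1) + |spow q⁻¹ (v x)| ^ (q + 1)) μ := hu.2.add hw.2
  have j5 : Integrable (fun x => |u x| ^ (q + 1) + |spow q⁻¹ (v x)| ^ (q + 1) + h x ^ (q + 1)) μ :=
    j4.add i6
  rw [integral_sub j3 (j5.const_mul _), integral_sub (j1.const_mul _)
      ((j2.const_mul _).const_mul _), integral_const_mul, integral_sub (i1.div_const l)
      (i2.div_const 2), integral_const_mul, integral_const_mul, integral_add (hu.2.const_mul _)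
      (i5.const_mul K), integral_const_mul, integral_const_mul, integral_const_mul,
    integral_add j4 i6, integral_add hu.2 hw.2,
    integral_sub ((i3.div_const l).div_const l) (i4.div_const l), integral_div, integral_div,
    integral_div, integral_div, integral_div, integral_abs_spow_inv_rpow hq] at key
  exact key

theorem IsSlice.pow_error (hq : 0 < q) (hS : IsSlice μ p q C V E u ut F h) :
    PowIntegrable μ (q + 1) (fun x => ut x - F x) :=
  hS.pow_ut.sub (by positivity) hS.pow_F

theorem IsSlice.integral_error_le (hq : 0 < q) (hS : IsSlice μ p q C V E u ut F h) :
    ∫ x, |ut x - F x| ^ (q + 1) ∂μ ≤ (2 * C) ^ (q + 1) * (2 ^ (q + 1) *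
      (∫ x, |u x| ^ (q + 1) ∂μ + p * E (fun x => spow q (u x)))) := by
  have hq1 : 0 ≤ q + 1 := by positivity
  have hC := hS.const_nonneg
  have h1 := hS.pow_u.integral_add_le hq1 hS.pow_h
  have h2 : ∫ x, |h x| ^ (q + 1) ∂μ = p * E (fun x => spow q (u x)) := by
    rw [← hS.integral_h]
    congr 1; funext x; rw [abs_of_nonneg (hS.h_nonneg x)]
  rw [h2] at h1
  refine le_trans ?_ (mul_le_mul_of_nonneg_left h1 (by positivity))
  rw [← integral_const_mul]
  refine integral_mono_ae (hS.pow_error hq).2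
    ((hS.pow_u.integrable_add_rpow hq1 hS.pow_h).const_mul _) ?_
  filter_upwards [hS.error] with x hx
  rw [← Real.mul_rpow (by positivity) (by positivity)]
  refine Real.rpow_le_rpow (abs_nonneg _) (hx.trans ?_) hq1
  have := hS.h_nonneg x
  rw [abs_of_nonneg this]
  exact errorMajorant_le hC this

theorem IsSlice.integral_mul_ut (hq : 0 < q) (hS : IsSlice μ p q C V E u ut F h) {v : α → ℝ}
    (hv : PowIntegrable μ (q⁻¹ + 1) v) : ∫ x, v x * ut x ∂μ =
      ∫ x, v x * F x ∂μ + ∫ x, v x * (ut x - F x) ∂μ := by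
  rw [← integral_add (hv.integrable_mul hq hS.pow_F) (hv.integrable_mul hq (hS.pow_error hq))]
  congr 1; funext x; ring

/-- The inequalities satisfied by a suitable almost minimizer at one time. -/
theorem IsSlice.exists_almost_minimizer (hp : 1 < p) (hq : 0 < q) (hE : IsEnergy μ p q V E) :
    ∃ K₀ c₀ : ℝ, 0 ≤ K₀ ∧ 0 ≤ c₀ ∧ ∀ η : ℝ, 0 < η → ∃ K : ℝ, 0 ≤ K ∧
    ∀ (C l δ : ℝ) (u ut F h : α → ℝ), 0 < l → 0 < δ → IsSlice μ p q C V E u ut F h →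
    ∃ v ∈ V, penalized μ q E l u v ≤ envelope μ q V E l u + δ ∧
    ∃ Ev G S x ye ze W B : ℝ,
      0 ≤ Ev ∧ 0 ≤ B ∧ 0 ≤ W ∧
      (∫ x, (spow q (u x) - v x) * ut x ∂μ) / l = -G + ze ∧
      E (fun x => spow q (u x)) - Ev ≤ l * G ∧
      S ≤ (E (fun x => spow q (u x)) - Ev + δ) / l ∧
      p * Ev - δ ≤ x ∧
      Ev + B / l ≤ envelope μ q V E l u + δ ∧
      W ≤ c₀ * (∫ x, |u x| ^ (q + 1) ∂μ + B) ∧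
      (∀ σ : ℝ, 2 * σ * (x - ye / 2) -
        σ ^ 2 * (q⁻¹ * ((1 + η) * ∫ x, |u x| ^ (q + 1) ∂μ + K * B)) -
        K₀ * C ^ 2 * (∫ x, |u x| ^ (q + 1) ∂μ + W + p * E (fun x => spow q (u x))) ≤ S - ze) ∧
      -(4 * K₀ * C ^ 2 * (∫ x, |u x| ^ (q + 1) ∂μ + W + p * E (fun x => spow q (u x)))) ≤
        S - 2 * ze ∧
      (∀ κ : ℝ, 0 < κ → κ ≤ 1 → |ye - ∫ x, spow q (u x) * (ut x - F x) ∂μ| ≤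
        B / κ + (q + 2) * κ ^ min 1 q * ∫ x, (|u x| + |ut x - F x|) ^ (q + 1) ∂μ) := by
  obtain ⟨K₀, hK₀, hf⟩ := frequency_integrated (μ := μ) hq
  obtain ⟨c₀, hc₀, hbd⟩ := hE.integral_rpow_le (by linarith) hq
  refine ⟨K₀, c₀, hK₀, hc₀, fun η hη => ?_⟩
  obtain ⟨K, hK, hf⟩ := hf η hη
  refine ⟨K, hK, fun C l δ u ut F h hl hδ hS => ?_⟩
  obtain ⟨v, hv, hJ, h2, h3⟩ := hE.exists_almost_minimizer hp hq hl hS.pow_u hS.mem hδ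
  have hvP := hE.pow_integrable v hv
  have huP := hS.pow_u.spow hq
  have hD := huP.sub (by positivity) hvP
  have heP := hS.pow_error hq
  have he2 : ∀ᵐ x ∂μ, |2 * (ut x - F x)| ≤ errorMajorant q (2 * C) (u x) (h x) := by
    filter_upwards [hS.error] with x hx
    rw [abs_mul, ← errorMajorant_mul, abs_two]
    linarith
  -- From here on only scalars matter: G pairs (u^q - v)/l with -F, S pairs it with (u - w)/l and ze
  -- with the error; x and ye pair v with (u - w)/l and with the error. W is the power integral of v
  -- and B the Bregman distance. The envelope slope is controlled by -G + ze, while S ≤ G up to δ/l.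
  refine ⟨v, hv, hJ, E v, -((∫ x, (spow q (u x) - v x) * F x ∂μ) / l),
    (∫ x, (spow q (u x) - v x) * (u x - spow q⁻¹ (v x)) ∂μ) / l / l,
    (∫ x, v x * (u x - spow q⁻¹ (v x)) ∂μ) / l, ∫ x, v x * (ut x - F x) ∂μ,
    (∫ x, (spow q (u x) - v x) * (ut x - F x) ∂μ) / l, ∫ x, |v x| ^ (q⁻¹ + 1) ∂μ,
    ∫ x, breg q (u x) (v x) ∂μ, hE.nonneg v hv, integral_breg_nonneg hq u v,
    integral_nonneg fun x => by positivity, ?_, ?_, ?_, h3, hJ,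
    (hbd l u v hl hS.pow_u hv).1, ?_, ?_, ?_⟩
  · rw [hS.integral_mul_ut hq hD]; ring
  · have h4 := hS.subgradient v hv
    have h5 : ∫ x, (v x - spow q (u x)) * F x ∂μ = -∫ x, (spow q (u x) - v x) * F x ∂μ := by
      rw [← integral_neg]; congr 1; funext x; ring
    rw [h5] at h4
    rw [mul_neg, mul_div_cancel₀ _ hl.ne']
    linarith
  · exact div_le_div_of_nonneg_right h2 hl.le
  · intro σ
    have := hf C l σ u v _ h hS.const_nonneg hl hS.pow_u hvP heP hS.pow_h hS.h_nonneg hS.error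
    rwa [hS.integral_h] at this
  -- With σ = 0 and the error doubled, the same inequality bounds ze by S/2 plus a term of order C²;
  -- the 4 in front is the square of the 2.
  · have := hf (2 * C) l 0 u v _ h (by linarith [hS.const_nonneg]) hl hS.pow_u hvP
      (heP.const_mul (by positivity) 2) hS.pow_h hS.h_nonneg he2
    rw [hS.integral_h] at this
    have h4 : ∫ x, (spow q (u x) - v x) * (2 * (ut x - F x)) ∂μ =
        2 * ∫ x, (spow q (u x) - v x) * (ut x - F x) ∂μ := by
      rw [← integral_const_mul]; congr 1; funext x; ring
    rw [h4] at this
    ring_nf at this ⊢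
    linarith
  · intro κ hκ hκ1
    rw [← integral_sub (hvP.integrable_mul hq heP) (huP.integrable_mul hq heP)]
    have i1 := hvP.integrable_breg hq hS.pow_u
    have i2 := hS.pow_u.integrable_add_rpow (by positivity) heP
    refine abs_integral_le_integral_abs.trans ?_
    rw [← integral_div, ← integral_const_mul, ← integral_add (i1.div_const κ) (i2.const_mul _)]
    refine integral_mono_of_nonneg (Eventually.of_forall fun x => abs_nonneg _)
      ((i1.div_const κ).add (i2.const_mul _)) (Eventually.of_forall fun x => ?_)
    have := mul_sub_spow_le_breg hq hκ hκ1 (u x) (v x) (ut x - F x)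
    rwa [mul_comm, sub_mul] at this

/-- A rough bound for the slope of the regularized energy. -/
theorem IsSlice.exists_rough_slope_bound (hp : 1 < p) (hq : 0 < q) (hE : IsEnergy μ p q V E) :
    ∃ K : ℝ, 0 ≤ K ∧ ∀ (C l ε : ℝ) (u ut F h : α → ℝ), 0 < l → l ≤ 1 → 0 < ε →
    IsSlice μ p q C V E u ut F h →
    ∃ v ∈ V, penalized μ q E l u v ≤ envelope μ q V E l u + ε ∧
      (∫ x, (spow q (u x) - v x) * ut x ∂μ) / l ≤
        K * C ^ 2 * (∫ x, |u x| ^ (q + 1) ∂μ + E (fun x => spow q (u x))) + ε := by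
  obtain ⟨K₀, c₀, hK₀, hc₀, h⟩ := IsSlice.exists_almost_minimizer hp hq hE
  obtain ⟨K₁, _, h⟩ := h 1 one_pos
  refine ⟨2 * K₀ * (1 + 2 * c₀ + p), by positivity, fun C l ε u ut F hh hl hl1 hε hS => ?_⟩
  -- Dividing the tolerance by D keeps the losses δ/l and 2K₀C²c₀δ together below ε.
  set D := 1 + 1 / l + 2 * K₀ * C ^ 2 * c₀ with hD
  have hD1 : 1 ≤ D := by
    have : 0 ≤ 1 / l + 2 * K₀ * C ^ 2 * c₀ := by positivity
    linarith
  have hδ : 0 < ε / D := by positivity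
  obtain ⟨v, hv, hJ, Ev, G, S, x, ye, ze, W, B, hEv, hB, hW, e0, e1, e2, -, e4, e5, -, e6, -⟩ :=
    h C l (ε / D) u ut F hh hl hδ hS
  set δ := ε / D with hδD
  have hδε : δ ≤ ε := div_le_self hε.le hD1
  refine ⟨v, hv, hJ.trans (by linarith), ?_⟩
  rw [e0]
  set Eu := E (fun x => spow q (u x)) with hEu
  set H := ∫ x, |u x| ^ (q + 1) ∂μ
  have hH : 0 ≤ H := integral_nonneg fun x => by positivity
  have hEu0 : 0 ≤ Eu := hE.nonneg _ hS.mem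
  have hf := hE.envelope_le_energy hq hl hS.mem
  have hBl : 0 ≤ B / l := by positivity
  have h1 : -δ ≤ l * G := by linarith
  have h2 : B ≤ l * (Eu + δ) := by
    have : B / l ≤ Eu + δ := by linarith
    rw [div_le_iff₀ hl] at this
    linarith
  have h3 : B ≤ Eu + δ := h2.trans (by nlinarith)
  have h4 : S ≤ G + δ / l := by
    refine e2.trans ?_
    rw [add_div]
    gcongr
    rw [div_le_iff₀ hl]; linarith
  have h5 : -(δ / l) ≤ G := by
    rw [neg_le, div_eq_mul_inv]
    rw [← div_eq_mul_inv, le_div_iff₀ hl]; linarith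
  have h6 : W ≤ c₀ * (H + (Eu + δ)) := e5.trans (by gcongr)
  have h7 : K₀ * C ^ 2 * (H + W + p * Eu) ≤
      K₀ * C ^ 2 * ((1 + 2 * c₀ + p) * (H + Eu) + c₀ * δ) := by
    refine mul_le_mul_of_nonneg_left ?_ (by positivity)
    nlinarith [mul_nonneg hc₀ hH, mul_nonneg hc₀ hEu0, mul_nonneg (by linarith : 0 ≤ p) hH]
  have h8 : δ / l + 2 * K₀ * C ^ 2 * (c₀ * δ) ≤ ε := by
    have : δ * D = ε := by rw [hδD]; field_simp
    have e : δ / l = δ * (1 / l) := by ring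
    rw [e]
    rw [hD] at this
    linarith only [this, hδ]
  -- ze is at most half of S plus a term of order C², and S ≤ G + δ/l, so -G + ze is at most -G/2
  -- plus controlled terms; finally G ≥ -δ/l.
  linarith only [h4, h5, h7, h8, e6]

end Slice

end ParabolicFrequency

/-! ### The sharp slope bound. -/

namespace ParabolicFrequency

/-- The condition δ ≥ 0 allows q+1 to be replaced by qp when pE ≥ b, and then pE(pE - b) = (pE -
b/2)² - b²/4. This says that the dissipation dominates the decay of H in the derivative of the
quotient E/H. -/
theorem quadratic_le_sq_max {p q E : ℝ} (hp : 0 < p) (hq : 0 < q) (hpq : q + 1 ≤ q * p)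
    (hE : 0 ≤ E) (b : ℝ) : (q + 1) * E * (p * E - b) ≤ q * max (p * E - b / 2) 0 ^ 2 := by
  have hpE : 0 ≤ p * E := by positivity
  rcases le_total (p * E - b) 0 with h | h
  · have : (q + 1) * E * (p * E - b) ≤ 0 := mul_nonpos_of_nonneg_of_nonpos (by positivity) h
    exact this.trans (by positivity)
  · have h3 : (q + 1) * E * (p * E - b) ≤ q * p * E * (p * E - b) := by gcongr
    have h6 : 0 ≤ p * E - b / 2 := by linarith
    rw [max_eq_left h6]
    nlinarith [mul_nonneg hq.le (sq_nonneg b)]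

set_option maxHeartbeats 2000000 in
/-- The algebraic core of the sharp slope bound. -/
theorem sharp_slope_bound_aux {p q K₀ c₀ K η : ℝ} (hp : 1 < p) (hq : 0 < q) (hpq : q + 1 ≤ q * p)
    (hK₀ : 0 ≤ K₀) (hc₀ : 0 ≤ c₀) (hK : 0 ≤ K) (hη : 0 < η) {M M₁ h₀ G₀ σ₁ l : ℝ} (hM : 1 ≤ M)
    (hM₁ : 0 ≤ M₁) (hh₀ : 0 < h₀) (hσ₁ : σ₁ = q * (p * M + M₁) / h₀)
    (hG₀ : G₀ = 2 * (1 / 2 + 2 * K₀ * M ^ 2 * (M + c₀ * (2 * M + 1) + p * M) +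
      M * (q + 1) * (p * M + M₁) / h₀)) (hl : 0 < l) (hl1 : l ≤ 1)
    {C δ H Eu f b Ev G S x ye ze W B : ℝ} (hC : 0 ≤ C) (hCM : C ≤ M) (hδl : δ ≤ l ^ 2)
    (hH : h₀ ≤ H) (hHM : H ≤ M) (hEu : 0 ≤ Eu) (hEM : Eu ≤ M) (hf : 0 ≤ f) (hfE : f ≤ Eu)
    (hb : |b| ≤ M₁) (hEv : 0 ≤ Ev) (hB : 0 ≤ B)
    (e1 : Eu - Ev ≤ l * G) (e2 : S ≤ (Eu - Ev + δ) / l) (e3 : p * Ev - δ ≤ x)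
    (e4 : Ev + B / l ≤ f + δ) (e5 : W ≤ c₀ * (H + B))
    (e6 : ∀ σ : ℝ, 2 * σ * (x - ye / 2) - σ ^ 2 * (q⁻¹ * ((1 + η) * H + K * B)) -
        K₀ * C ^ 2 * (H + W + p * Eu) ≤ S - ze)
    (e7 : -(4 * K₀ * C ^ 2 * (H + W + p * Eu)) ≤ S - 2 * ze)
    (e8 : |ye - b| ≤ B / l + (q + 2) * l ^ min 1 q * M₁) :
    -G + ze ≤ f * ((q + 1) * (-(p * Eu) + b)) / H + K₀ * (1 + c₀ + p) * C ^ 2 * (f + H) +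
      ((q + 1) * (l * (G₀ + 1)) * (p * M + M₁) / h₀ + 2 * σ₁ * (l * (p * G₀ + 1) +
        (l * (G₀ + 1) + (q + 2) * l ^ min 1 q * M₁) / 2) +
        σ₁ ^ 2 * q⁻¹ * (η * M + K * (l ^ 2 * (G₀ + 1))) + l +
        K₀ * M ^ 2 * ((c₀ + p) * (l * (G₀ + 1)))) := by
  have hp0 : 0 < p := by linarith
  have hH0 : 0 < H := by linarith
  have hM0 : 0 < M := by linarith
  have hG0 : 0 ≤ G₀ := by rw [hG₀]; positivity
  have hσ0 : 0 ≤ σ₁ := by rw [hσ₁]; positivity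
  have hC2 : C ^ 2 ≤ M ^ 2 := pow_le_pow_left₀ hC hCM 2
  have hδl1 : δ / l ≤ l := by rw [div_le_iff₀ hl]; linarith only [hδl, sq l]
  have hSG : S ≤ G + l := by
    refine e2.trans ?_
    rw [add_div]
    have : (Eu - Ev) / l ≤ G := by rw [div_le_iff₀ hl]; linarith
    linarith
  have hδ1 : δ ≤ l := hδl.trans (by nlinarith only [hl, hl1])
  have hBE : B ≤ l * (Eu - Ev + δ) := by
    have : B / l ≤ Eu - Ev + δ := by linarith
    rw [div_le_iff₀ hl] at this
    linarith
  have hbb := abs_le.1 hb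
  have hlm : 0 ≤ l ^ min 1 q := by positivity
  have habs : |(p * Eu) - b| ≤ p * M + M₁ := by
    have := mul_le_mul_of_nonneg_left hEM hp0.le
    have h2 : 0 ≤ p * Eu := by positivity
    have h3 : 0 ≤ p * M := by positivity
    rw [abs_le]
    constructor
    · linarith only [h2, h3, hbb.2]
    · linarith only [this, hbb.1]
  have hab := abs_le.1 habs
  have hdiv : ∀ X Y : ℝ, 0 ≤ Y → X ≤ Y → X / H ≤ Y / h₀ := by
    intro X Y hY hXY
    exact (div_le_div_of_nonneg_right hXY hH0.le).trans (div_le_div_of_nonneg_left hY hh₀ hH)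
  have hrem0 : 0 ≤ (q + 1) * (l * (G₀ + 1)) * (p * M + M₁) / h₀ := by positivity
  have hrem1 : 0 ≤ 2 * σ₁ * (l * (p * G₀ + 1) +
        (l * (G₀ + 1) + (q + 2) * l ^ min 1 q * M₁) / 2) := by positivity
  have hrem2 : 0 ≤ σ₁ ^ 2 * q⁻¹ * (η * M + K * (l ^ 2 * (G₀ + 1))) := by positivity
  have hrem3 : 0 ≤ K₀ * M ^ 2 * ((c₀ + p) * (l * (G₀ + 1))) := by positivity
  have hmain : 0 ≤ K₀ * (1 + c₀ + p) * C ^ 2 * (f + H) := by positivity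
  -- If G is large, then -G/2 plus bounded terms already lies below the right-hand side, which is
  -- bounded from below; G₀ is the threshold for this. Otherwise E(u^q) - E(v) ≤ lG₀, so v is close
  -- to u^q and all approximations converge as l → 0.
  by_cases hG : G₀ ≤ G
  · have hT : H + W + p * Eu ≤ M + c₀ * (2 * M + 1) + p * M := by
      have h1 : B ≤ M + 1 := by
        have h2 : l * (Eu - Ev + δ) ≤ l * (M + 1) := by
          refine mul_le_mul_of_nonneg_left ?_ hl.le
          linarith only [hEM, hEv, hδ1, hl1]
        have h3 : l * (M + 1) ≤ 1 * (M + 1) := by gcongr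
        linarith only [h2, h3, hBE]
      have h2 : W ≤ c₀ * (2 * M + 1) := e5.trans (mul_le_mul_of_nonneg_left (by linarith only [h1, hHM]) hc₀)
      have h3 := mul_le_mul_of_nonneg_left hEM hp0.le
      linarith only [h2, h3, hHM]
    have hKT : K₀ * C ^ 2 * (H + W + p * Eu) ≤
        K₀ * M ^ 2 * (M + c₀ * (2 * M + 1) + p * M) := by
      have h1 : K₀ * C ^ 2 ≤ K₀ * M ^ 2 := mul_le_mul_of_nonneg_left hC2 hK₀
      have h2 : 0 ≤ M + c₀ * (2 * M + 1) + p * M := by positivity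
      exact (mul_le_mul_of_nonneg_left hT (by positivity)).trans (mul_le_mul_of_nonneg_right h1 h2)
    have hfr : -(M * (q + 1) * (p * M + M₁) / h₀) ≤ f * ((q + 1) * (-(p * Eu) + b)) / H := by
      have h1 : f * ((q + 1) * (p * Eu - b)) ≤ M * (q + 1) * (p * M + M₁) := by
        calc f * ((q + 1) * (p * Eu - b)) ≤ f * ((q + 1) * (p * M + M₁)) := by
              gcongr; exact hab.2
          _ ≤ M * ((q + 1) * (p * M + M₁)) := by gcongr; linarith
          _ = _ := by ring
      have h2 := hdiv _ _ (by positivity) h1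
      rw [show f * ((q + 1) * (-(p * Eu) + b)) / H = -(f * ((q + 1) * (p * Eu - b)) / H) by ring]
      linarith
    linarith only [e7, hSG, hl1, hfr, hKT, hG, hG₀, hmain, hrem0, hrem1, hrem2, hrem3, hl]
  · rw [not_le] at hG
    have hlG : l * G ≤ l * G₀ := by gcongr
    have hd : Eu - f ≤ l * (G₀ + 1) := by
      have : 0 ≤ B / l := by positivity
      linarith
    have hBl : B ≤ l ^ 2 * (G₀ + 1) := by
      refine hBE.trans ?_
      calc l * (Eu - Ev + δ) ≤ l * (l * G₀ + l) := by gcongr; linarith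
        _ = _ := by ring
    have hBl2 : B ≤ l * (G₀ + 1) := hBl.trans (by
      have : 0 ≤ G₀ + 1 := by linarith
      nlinarith only [mul_nonneg hl.le this, hl1, hl])
    have hBdl : B / l ≤ l * (G₀ + 1) := by
      rw [div_le_iff₀ hl]; linarith
    have hx : p * Eu - l * (p * G₀ + 1) ≤ x := by
      linarith only [e3, hδ1, mul_le_mul_of_nonneg_left (e1.trans hlG) hp0.le]
    have hye : ye ≤ b + (l * (G₀ + 1) + (q + 2) * l ^ min 1 q * M₁) := by
      linarith [(abs_le.1 e8).2]
    set r₂ := l * (p * G₀ + 1) + (l * (G₀ + 1) + (q + 2) * l ^ min 1 q * M₁) / 2 with hr₂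
    have hr0 : 0 ≤ r₂ := by positivity
    have hxy : (p * Eu - b / 2) - r₂ ≤ x - ye / 2 := by rw [hr₂]; linarith
    set A := max (p * Eu - b / 2) 0 with hA
    have hA0 : 0 ≤ A := le_max_right _ _
    have hAM : A ≤ p * M + M₁ := by
      have := mul_le_mul_of_nonneg_left hEM hp0.le
      exact max_le (by linarith [hbb.1]) (by positivity)
    -- The maximizer of 2σA - σ²H/q, with maximal value qA²/H. The positive part in A keeps σ
    -- nonnegative.
    set σ := q * A / H with hσ
    have hs0 : 0 ≤ σ := by positivity
    have hs1 : σ ≤ σ₁ := by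
      rw [hσ₁, hσ]
      exact hdiv _ _ (by positivity) (by gcongr)
    have hσx : σ * A - σ₁ * r₂ ≤ σ * (x - ye / 2) := by
      have h1 : σ * A = σ * (p * Eu - b / 2) := by
        rcases le_total (p * Eu - b / 2) 0 with h | h
        · have : A = 0 := max_eq_right h
          rw [hσ, this]; simp
        · rw [hA, max_eq_left h]
      rw [h1]
      linarith only [mul_le_mul_of_nonneg_left hxy hs0, mul_le_mul_of_nonneg_right hs1 hr0]
    have h6 := e6 σ
    have hσ2 : σ ^ 2 * (q⁻¹ * ((1 + η) * H + K * B)) ≤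
        q * A ^ 2 / H + σ₁ ^ 2 * q⁻¹ * (η * M + K * (l ^ 2 * (G₀ + 1))) := by
      have h1 : σ ^ 2 * (q⁻¹ * H) = q * A ^ 2 / H := by rw [hσ]; field_simp
      have h2 : σ ^ 2 * q⁻¹ * (η * H + K * B) ≤
          σ₁ ^ 2 * q⁻¹ * (η * M + K * (l ^ 2 * (G₀ + 1))) := by gcongr
      linarith [show σ ^ 2 * (q⁻¹ * ((1 + η) * H + K * B)) =
        σ ^ 2 * (q⁻¹ * H) + σ ^ 2 * q⁻¹ * (η * H + K * B) by ring]
    have hσA : 2 * (σ * A) = 2 * (q * A ^ 2 / H) := by rw [hσ]; ring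
    have hT : K₀ * C ^ 2 * (H + W + p * Eu) ≤ K₀ * (1 + c₀ + p) * C ^ 2 * (f + H) +
        K₀ * M ^ 2 * ((c₀ + p) * (l * (G₀ + 1))) := by
      have h1 : H + W + p * Eu ≤ (1 + c₀ + p) * (f + H) + (c₀ + p) * (l * (G₀ + 1)) := by
        linarith only [e5, hf, hd, mul_le_mul_of_nonneg_left hBl2 hc₀, mul_nonneg hc₀ hf, mul_nonneg hp0.le hH0.le,
          mul_le_mul_of_nonneg_left hd hp0.le]
      have h2 : K₀ * C ^ 2 ≤ K₀ * M ^ 2 := mul_le_mul_of_nonneg_left hC2 hK₀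
      have h3 : 0 ≤ (c₀ + p) * (l * (G₀ + 1)) := by positivity
      calc K₀ * C ^ 2 * (H + W + p * Eu) ≤
          K₀ * C ^ 2 * ((1 + c₀ + p) * (f + H) + (c₀ + p) * (l * (G₀ + 1))) := by gcongr
        _ = K₀ * (1 + c₀ + p) * C ^ 2 * (f + H) + K₀ * C ^ 2 * ((c₀ + p) * (l * (G₀ + 1))) := by
          ring
        _ ≤ _ := by gcongr
    -- The quadratic inequality is applied to E(u^q); passing to the envelope f costs E(u^q) - f,
    -- which is of order l.
    have hfr : -(q * A ^ 2 / H) - (q + 1) * (l * (G₀ + 1)) * (p * M + M₁) / h₀ ≤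
        f * ((q + 1) * (-(p * Eu) + b)) / H := by
      have h1 : (q + 1) * f * (p * Eu - b) ≤
          q * A ^ 2 + (q + 1) * (l * (G₀ + 1)) * (p * M + M₁) := by
        have h2 : (q + 1) * Eu * (p * Eu - b) ≤ q * A ^ 2 := quadratic_le_sq_max hp0 hq hpq hEu b
        have h3 : -((q + 1) * (Eu - f) * (p * Eu - b)) ≤
            (q + 1) * (l * (G₀ + 1)) * (p * M + M₁) := by
          have h4 : 0 ≤ Eu - f := by linarith
          calc -((q + 1) * (Eu - f) * (p * Eu - b)) = (q + 1) * (Eu - f) * -(p * Eu - b) := by ring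
            _ ≤ (q + 1) * (Eu - f) * (p * M + M₁) := by gcongr; linarith [hab.1]
            _ ≤ _ := by gcongr
        linarith [show (q + 1) * f * (p * Eu - b) = (q + 1) * Eu * (p * Eu - b) +
          -((q + 1) * (Eu - f) * (p * Eu - b)) by ring]
      have h2 := div_le_div_of_nonneg_right h1 hH0.le
      rw [add_div] at h2
      have h3 := hdiv ((q + 1) * (l * (G₀ + 1)) * (p * M + M₁)) _ (by positivity) le_rfl
      rw [show f * ((q + 1) * (-(p * Eu) + b)) / H = -((q + 1) * f * (p * Eu - b) / H) by ring]
      linarith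
    linarith only [hSG, hfr, hT, hσA, hσ2, h6, hσx]

section Slice

variable {α : Type*} [MeasurableSpace α] {μ : Measure α} {p q C : ℝ}
  {V : Set (α → ℝ)} {E : (α → ℝ) → ℝ} {u ut F h : α → ℝ}

set_option maxHeartbeats 1000000 in
/-- The sharp bound for the slope of the regularized energy. -/
theorem IsSlice.exists_sharp_slope_bound (hp : 1 < p) (hq : 0 < q) (hpq : q + 1 ≤ q * p)
    (hE : IsEnergy μ p q V E) :
    ∃ K : ℝ, 0 ≤ K ∧ ∀ M h₀ ε : ℝ, 1 ≤ M → 0 < h₀ → 0 < ε → ∃ l₀ : ℝ, 0 < l₀ ∧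
    ∀ l : ℝ, 0 < l → l ≤ l₀ → ∀ (C : ℝ) (u ut F h : α → ℝ), IsSlice μ p q C V E u ut F h →
    h₀ ≤ ∫ x, |u x| ^ (q + 1) ∂μ → ∫ x, |u x| ^ (q + 1) ∂μ ≤ M →
    E (fun x => spow q (u x)) ≤ M → C ≤ M → ∀ ε' : ℝ, 0 < ε' →
    ∃ v ∈ V, penalized μ q E l u v ≤ envelope μ q V E l u + ε' ∧
      (∫ x, (spow q (u x) - v x) * ut x ∂μ) / l ≤
        envelope μ q V E l u * ((q + 1) * ∫ x, spow q (u x) * ut x ∂μ) /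
            (∫ x, |u x| ^ (q + 1) ∂μ) +
          K * C ^ 2 * (envelope μ q V E l u + ∫ x, |u x| ^ (q + 1) ∂μ) + ε := by
  obtain ⟨K₀, c₀, hK₀, hc₀, hη⟩ := IsSlice.exists_almost_minimizer hp hq hE
  refine ⟨K₀ * (1 + c₀ + p), by positivity, fun M h₀ ε hM hh₀ hε => ?_⟩
  -- A common bound for |∫u^q e| and for ∫(|u|+|e|)^{q+1}.
  set M₁ := 2 ^ (q + 1) * (M + (2 * M) ^ (q + 1) * (2 ^ (q + 1) * (M + p * M))) with hM₁
  have hM₁0 : 0 ≤ M₁ := by positivity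
  obtain ⟨σ₁, hσ₁⟩ : ∃ σ₁, σ₁ = q * (p * M + M₁) / h₀ := ⟨_, rfl⟩
  obtain ⟨G₀, hG₀⟩ : ∃ G₀, G₀ = 2 * (1 / 2 + 2 * K₀ * M ^ 2 * (M + c₀ * (2 * M + 1) + p * M) +
      M * (q + 1) * (p * M + M₁) / h₀) := ⟨_, rfl⟩
  have hσ0 : 0 ≤ σ₁ := by rw [hσ₁]; positivity
  -- The only remainder that does not vanish with l is the one carrying η. It is fixed first; the
  -- resulting constant K, however large, is multiplied by l².
  obtain ⟨η, hη0, hηε⟩ : ∃ η : ℝ, 0 < η ∧ σ₁ ^ 2 * q⁻¹ * (η * M) < ε := by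
    refine ⟨ε / (σ₁ ^ 2 * q⁻¹ * M + 1), by positivity, ?_⟩
    have h1 : 0 ≤ σ₁ ^ 2 * q⁻¹ * M := by positivity
    rw [show σ₁ ^ 2 * q⁻¹ * (ε / (σ₁ ^ 2 * q⁻¹ * M + 1) * M) =
      ε * (σ₁ ^ 2 * q⁻¹ * M) / (σ₁ ^ 2 * q⁻¹ * M + 1) by ring, div_lt_iff₀ (by positivity)]
    nlinarith
  obtain ⟨K, hK, hmin⟩ := hη η hη0
  set rem : ℝ → ℝ := fun l => (q + 1) * (l * (G₀ + 1)) * (p * M + M₁) / h₀ +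
    2 * σ₁ * (l * (p * G₀ + 1) + (l * (G₀ + 1) + (q + 2) * l ^ min 1 q * M₁) / 2) +
    σ₁ ^ 2 * q⁻¹ * (η * M + K * (l ^ 2 * (G₀ + 1))) + l +
    K₀ * M ^ 2 * ((c₀ + p) * (l * (G₀ + 1))) with hrem
  have hm : 0 < min 1 q := lt_min one_pos hq
  have hcont : Continuous rem := by
    have := Real.continuous_rpow_const hm.le
    fun_prop
  have hrem0 : rem 0 < ε := by
    simp only [hrem, Real.zero_rpow hm.ne']
    ring_nf at hηε ⊢
    exact hηε
  obtain ⟨l₁, hl₁, hl₁r⟩ := Metric.eventually_nhds_iff.1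
    ((hcont.tendsto 0).eventually (gt_mem_nhds hrem0))
  refine ⟨min 1 (l₁ / 2), by positivity, fun l hl hll C u ut F h hS hHh hHM hEM hCM ε' hε' => ?_⟩
  have hl1 : l ≤ 1 := hll.trans (min_le_left _ _)
  have hlr : rem l < ε := hl₁r (by
    rw [Real.dist_eq, sub_zero, abs_of_pos hl]
    have := hll.trans (min_le_right _ _)
    linarith)
  -- A tolerance of order l² makes the loss δ/l at most l.
  have hδ : 0 < min (l ^ 2) ε' := lt_min (by positivity) hε'
  obtain ⟨v, hv, hJ, Ev, G, S, x, ye, ze, W, B, hEv, hB, hW, e0, e1, e2, e3, e4, e5, e6, e7, e8⟩ :=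
    hmin C l (min (l ^ 2) ε') u ut F h hl hδ hS
  refine ⟨v, hv, hJ.trans (by gcongr; exact min_le_right _ _), ?_⟩
  have hC := hS.const_nonneg
  have hH0 : 0 ≤ ∫ x, |u x| ^ (q + 1) ∂μ := hh₀.le.trans hHh
  have hEu0 : 0 ≤ E (fun x => spow q (u x)) := hE.nonneg _ hS.mem
  have heb : ∫ x, |ut x - F x| ^ (q + 1) ∂μ ≤
      (2 * M) ^ (q + 1) * (2 ^ (q + 1) * (M + p * M)) := by
    refine (hS.integral_error_le hq).trans ?_
    gcongr
  have h21 : (1 : ℝ) ≤ 2 ^ (q + 1) := Real.one_le_rpow (by norm_num) (by positivity)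
  have hb : |∫ x, spow q (u x) * (ut x - F x) ∂μ| ≤ M₁ := by
    refine ((hS.pow_u.spow hq).abs_integral_mul_le_add hq (hS.pow_error hq)).trans ?_
    rw [integral_abs_spow_rpow hq]
    have h1 : 0 ≤ M + (2 * M) ^ (q + 1) * (2 ^ (q + 1) * (M + p * M)) := by positivity
    rw [hM₁]
    exact le_trans (by linarith only [heb, hHM]) (le_mul_of_one_le_left h1 h21)
  have hR : ∫ x, (|u x| + |ut x - F x|) ^ (q + 1) ∂μ ≤ M₁ := by
    refine (hS.pow_u.integral_add_le (by positivity) (hS.pow_error hq)).trans ?_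
    rw [hM₁]
    gcongr
  -- The choice κ = l: the Bregman integral is of order l² when v is near u^q, so its quotient by κ
  -- is still of order l.
  have e8' := (e8 l hl hl1).trans (add_le_add le_rfl
    (mul_le_mul_of_nonneg_left hR (by positivity : 0 ≤ (q + 2) * l ^ min 1 q)))
  have := sharp_slope_bound_aux hp hq hpq hK₀ hc₀ hK hη0 hM hM₁0 hh₀ hσ₁ hG₀ hl hl1 hC hCM
    (min_le_left _ _) hHh hHM hEu0 hEM (hE.envelope_nonneg hq hl u)
    (hE.envelope_le_energy hq hl hS.mem) hb hEv hB e1 e2 e3 e4 e5 e6 e7 e8'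
  rw [e0, hS.integral_mul_ut hq (hS.pow_u.spow hq), eq_neg_of_add_eq_zero_left
    (by linarith [hS.pairing] : ∫ x, spow q (u x) * F x ∂μ + p * E (fun x => spow q (u x)) = 0)]
  exact this.trans (add_le_add le_rfl hlr.le)

end Slice

end ParabolicFrequency

namespace ParabolicFrequency

/-! ### Differentiation along the curve in time. -/

section Curve

variable {α : Type*} [MeasurableSpace α] {μ : Measure α} {p q : ℝ}
  {V : Set (α → ℝ)} {E : (α → ℝ) → ℝ} {U : ℝ → α → ℝ} {ut : α → ℝ} {T : Set ℝ} {t : ℝ}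

/-- `ut` is the derivative of `U` along `T` at `t` in `L^{q+1}`. -/
def HasPowDerivAt (μ : Measure α) (q : ℝ) (U : ℝ → α → ℝ) (ut : α → ℝ) (T : Set ℝ) (t : ℝ) :
    Prop :=
  Tendsto (fun s => ∫ x, |(s - t)⁻¹ * (U s x - U t x) - ut x| ^ (q + 1) ∂μ) (𝓝[T \ {t}] t) (𝓝 0)

theorem powIntegrable_slope (hq : 0 < q) (hU : ∀ s ∈ T, PowIntegrable μ (q + 1) (U s))
    (ht : t ∈ T) {s : ℝ} (hs : s ∈ T) :
    PowIntegrable μ (q + 1) (fun x => (s - t)⁻¹ * (U s x - U t x)) :=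
  ((hU s hs).sub (by positivity) (hU t ht)).const_mul (by positivity) _

theorem HasPowDerivAt.tendsto_rpow (hD : HasPowDerivAt μ q U ut T t) (hq : 0 < q) : Tendsto (fun s =>
    (∫ x, |(s - t)⁻¹ * (U s x - U t x) - ut x| ^ (q + 1) ∂μ) ^ (1 / (q + 1)))
    (𝓝[T \ {t}] t) (𝓝 0) := by
  have h : 0 < 1 / (q + 1) := by positivity
  have := (Real.continuous_rpow_const h.le).tendsto 0
  rw [Real.zero_rpow h.ne'] at this
  exact this.comp hD

theorem HasPowDerivAt.eventually_bounded (hD : HasPowDerivAt μ q U ut T t) (hq : 0 < q)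
    (hU : ∀ s ∈ T, PowIntegrable μ (q + 1) (U s)) (hut : PowIntegrable μ (q + 1) ut) (ht : t ∈ T) : ∃ M : ℝ, 0 ≤ M ∧ ∀ᶠ s in 𝓝[T \ {t}] t,
    ∫ x, |(s - t)⁻¹ * (U s x - U t x)| ^ (q + 1) ∂μ ≤ M := by
  have hq1 : 0 ≤ q + 1 := by positivity
  refine ⟨2 ^ (q + 1) * (1 + ∫ x, |ut x| ^ (q + 1) ∂μ), by positivity, ?_⟩
  filter_upwards [hD.eventually (gt_mem_nhds one_pos), self_mem_nhdsWithin] with s hs hsT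
  have hz := powIntegrable_slope hq hU ht hsT.1
  have h1 := (hz.sub hq1 hut).integral_add_le hq1 hut
  refine le_trans ?_ (h1.trans (by gcongr))
  refine integral_mono hz.2 ((hz.sub hq1 hut).integrable_add_rpow hq1 hut) fun x => ?_
  refine Real.rpow_le_rpow (abs_nonneg _) ?_ hq1
  have := abs_add_le ((s - t)⁻¹ * (U s x - U t x) - ut x) (ut x)
  rwa [sub_add_cancel] at this

theorem HasPowDerivAt.tendsto_sub (hD : HasPowDerivAt μ q U ut T t) (hq : 0 < q)
    (hU : ∀ s ∈ T, PowIntegrable μ (q + 1) (U s)) (hut : PowIntegrable μ (q + 1) ut) (ht : t ∈ T) : Tendsto (fun s => ∫ x, |U s x - U t x| ^ (q + 1) ∂μ)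
    (𝓝[T] t) (𝓝 0) := by
  have hq1 : 0 < q + 1 := by positivity
  obtain ⟨M, hM, hev⟩ := hD.eventually_bounded hq hU hut ht
  have h1 : Tendsto (fun s => ∫ x, |U s x - U t x| ^ (q + 1) ∂μ) (𝓝[T \ {t}] t) (𝓝 0) := by
    have h2 : Tendsto (fun s : ℝ => |s - t| ^ (q + 1) * M) (𝓝[T \ {t}] t) (𝓝 0) := by
      have : Continuous (fun s : ℝ => |s - t| ^ (q + 1) * M) :=
        ((Real.continuous_rpow_const hq1.le).comp (by fun_prop : Continuous fun s : ℝ => |s - t|)).mul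
          continuous_const
      have h3 := this.tendsto t
      simp only [sub_self, abs_zero, Real.zero_rpow hq1.ne', zero_mul] at h3
      exact h3.mono_left nhdsWithin_le_nhds
    refine squeeze_zero' (Eventually.of_forall fun s => integral_nonneg fun x => by positivity) ?_ h2
    filter_upwards [hev, self_mem_nhdsWithin] with s hs hsT
    refine le_trans (le_of_eq ?_) (mul_le_mul_of_nonneg_left hs (by positivity))
    rw [← integral_const_mul]
    congr 1; funext x
    have hst : s - t ≠ 0 := sub_ne_zero.2 hsT.2
    rw [← Real.mul_rpow (by positivity) (by positivity), ← abs_mul, mul_inv_cancel_left₀ hst]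
  have h0 : (∫ x, |U t x - U t x| ^ (q + 1) ∂μ) = 0 := by simp [Real.zero_rpow hq1.ne']
  have : insert t (T \ {t}) = T := by simp [ht]
  rw [← this, nhdsWithin_insert, tendsto_sup]
  refine ⟨?_, h1⟩
  rw [tendsto_pure_left]
  intro s hs
  show (∫ x, |U t x - U t x| ^ (q + 1) ∂μ) ∈ s
  rw [h0]
  exact mem_of_mem_nhds hs

theorem HasPowDerivAt.tendsto_integral_mul (hD : HasPowDerivAt μ q U ut T t) (hq : 0 < q)
    (hU : ∀ s ∈ T, PowIntegrable μ (q + 1) (U s)) (hut : PowIntegrable μ (q + 1) ut) (ht : t ∈ T)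
    {v : α → ℝ} (hv : PowIntegrable μ (q⁻¹ + 1) v) :
    Tendsto (fun s => ∫ x, v x * ((s - t)⁻¹ * (U s x - U t x)) ∂μ) (𝓝[T \ {t}] t)
      (𝓝 (∫ x, v x * ut x ∂μ)) := by
  have hq1 : 0 ≤ q + 1 := by positivity
  rw [tendsto_iff_dist_tendsto_zero]
  have h1 := (hD.tendsto_rpow hq).const_mul
    ((∫ x, |v x| ^ (q⁻¹ + 1) ∂μ) ^ (1 / (q⁻¹ + 1)))
  rw [mul_zero] at h1
  refine squeeze_zero' (Eventually.of_forall fun s => dist_nonneg) ?_ h1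
  filter_upwards [self_mem_nhdsWithin] with s hsT
  have hz := powIntegrable_slope hq hU ht hsT.1
  rw [Real.dist_eq, ← integral_sub (hv.integrable_mul hq hz) (hv.integrable_mul hq hut)]
  refine le_trans (le_of_eq ?_) (hv.abs_integral_mul_le hq (hz.sub hq1 hut))
  congr 2; funext x; ring

/-- The pointwise increment minus its linear part is nonnegative by convexity and of order
|s-t|^{1+min(1,q)} by the Taylor bound. After integration and division by s-t the remainder
disappears; the difference quotients themselves converge in L^{q+1}. -/
theorem HasPowDerivAt.hasDerivWithinAt (hD : HasPowDerivAt μ q U ut T t) (hq : 0 < q)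
    (hU : ∀ s ∈ T, PowIntegrable μ (q + 1) (U s)) (hut : PowIntegrable μ (q + 1) ut) (ht : t ∈ T) : HasDerivWithinAt
    (fun s => ∫ x, |U s x| ^ (q + 1) ∂μ) ((q + 1) * ∫ x, spow q (U t x) * ut x ∂μ) T t := by
  have hq1 : 0 < q + 1 := by positivity
  have hm : 0 < min 1 q := lt_min one_pos hq
  obtain ⟨M, hM, hev⟩ := hD.eventually_bounded hq hU hut ht
  have hvP := (hU t ht).spow hq
  rw [hasDerivWithinAt_iff_tendsto_slope]
  have h1 := (hD.tendsto_integral_mul hq hU hut ht hvP).const_mul (q + 1)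
  set N := (q + 2) * (2 ^ (q + 1) * (∫ x, |U t x| ^ (q + 1) ∂μ + M)) with hN
  have h2 : Tendsto (fun s : ℝ => (q + 1) * (|s - t| ^ min 1 q * N)) (𝓝[T \ {t}] t) (𝓝 0) := by
    have : Continuous (fun s : ℝ => (q + 1) * (|s - t| ^ min 1 q * N)) :=
      continuous_const.mul (((Real.continuous_rpow_const hm.le).comp
        (by fun_prop : Continuous fun s : ℝ => |s - t|)).mul continuous_const)
    have h3 := this.tendsto t
    simp only [sub_self, abs_zero, Real.zero_rpow hm.ne', zero_mul, mul_zero] at h3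
    exact h3.mono_left nhdsWithin_le_nhds
  have h3 : Tendsto (fun s => slope (fun s => ∫ x, |U s x| ^ (q + 1) ∂μ) t s -
      (q + 1) * ∫ x, spow q (U t x) * ((s - t)⁻¹ * (U s x - U t x)) ∂μ) (𝓝[T \ {t}] t) (𝓝 0) := by
    refine squeeze_zero_norm' ?_ h2
    have hnear : ∀ᶠ s in 𝓝[T \ {t}] t, |s - t| ≤ 1 := by
      refine nhdsWithin_le_nhds ?_
      filter_upwards [Metric.closedBall_mem_nhds t one_pos] with s hs
      simpa [Real.dist_eq] using hs
    filter_upwards [hev, self_mem_nhdsWithin, hnear] with s hs hsT hs1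
    have hst : s - t ≠ 0 := sub_ne_zero.2 hsT.2
    have hst' : 0 < |s - t| := abs_pos.2 hst
    have hz := powIntegrable_slope hq hU ht hsT.1
    set z : α → ℝ := fun x => (s - t)⁻¹ * (U s x - U t x) with hzdef
    have hUs : ∀ x, U s x = U t x + (s - t) * z x := fun x => by
      simp only [hzdef]; rw [mul_inv_cancel_left₀ hst]; ring
    have hpt : ∀ x, 0 ≤ |U s x| ^ (q + 1) / (q + 1) - |U t x| ^ (q + 1) / (q + 1) -
        (s - t) * (spow q (U t x) * z x) ∧
        |U s x| ^ (q + 1) / (q + 1) - |U t x| ^ (q + 1) / (q + 1) -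
        (s - t) * (spow q (U t x) * z x) ≤
        |s - t| * ((q + 2) * |s - t| ^ min 1 q * (|U t x| + |z x|) ^ (q + 1)) := by
      intro x
      constructor
      · have := rpow_subgradient hq (U t x) (U s x)
        have e : spow q (U t x) * (U s x - U t x) = (s - t) * (spow q (U t x) * z x) := by
          rw [hUs]; ring
        linarith
      · rcases lt_or_gt_of_ne hst with h | h
        · have := rpow_abs_taylor hq hst'.le hs1 (U t x) (-z x)
          rw [abs_neg, show U t x + |s - t| * -z x = U s x by rw [hUs, abs_of_neg h]; ring] at this
          rw [abs_of_neg h] at this ⊢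
          linarith
        · have := rpow_abs_taylor hq hst'.le hs1 (U t x) (z x)
          rw [show U t x + |s - t| * z x = U s x by rw [hUs, abs_of_pos h]] at this
          rw [abs_of_pos h] at this ⊢
          linarith
    have i1 := (hU s hsT.1).2.div_const (q + 1)
    have i2 := (hU t ht).2.div_const (q + 1)
    have i3 := hvP.integrable_mul hq hz
    have i4 := (hU t ht).integrable_add_rpow hq1.le hz
    have hI : ∫ x, (|U s x| ^ (q + 1) / (q + 1) - |U t x| ^ (q + 1) / (q + 1) -
        (s - t) * (spow q (U t x) * z x)) ∂μ = (∫ x, |U s x| ^ (q + 1) ∂μ) / (q + 1) -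
        (∫ x, |U t x| ^ (q + 1) ∂μ) / (q + 1) - (s - t) * ∫ x, spow q (U t x) * z x ∂μ := by
      have i5 : Integrable (fun x => |U s x| ^ (q + 1) / (q + 1) - |U t x| ^ (q + 1) / (q + 1)) μ :=
        i1.sub i2
      rw [integral_sub i5 (i3.const_mul _), integral_sub i1 i2, integral_div, integral_div,
        integral_const_mul]
    have hlow : 0 ≤ ∫ x, (|U s x| ^ (q + 1) / (q + 1) - |U t x| ^ (q + 1) / (q + 1) -
        (s - t) * (spow q (U t x) * z x)) ∂μ := integral_nonneg fun x => (hpt x).1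
    have hupp : ∫ x, (|U s x| ^ (q + 1) / (q + 1) - |U t x| ^ (q + 1) / (q + 1) -
        (s - t) * (spow q (U t x) * z x)) ∂μ ≤ |s - t| * (|s - t| ^ min 1 q * N) := by
      have h4 := integral_mono ((i1.sub i2).sub (i3.const_mul (s - t)))
        ((i4.const_mul _).const_mul _) fun x => (hpt x).2
      refine h4.trans ?_
      rw [integral_const_mul, integral_const_mul]
      have h5 : ∫ x, (|U t x| + |z x|) ^ (q + 1) ∂μ ≤
          2 ^ (q + 1) * (∫ x, |U t x| ^ (q + 1) ∂μ + M) :=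
        ((hU t ht).integral_add_le hq1.le hz).trans (by gcongr)
      calc _ ≤ |s - t| * ((q + 2) * |s - t| ^ min 1 q *
            (2 ^ (q + 1) * (∫ x, |U t x| ^ (q + 1) ∂μ + M))) := by gcongr
        _ = _ := by rw [hN]; ring
    rw [hI] at hlow hupp
    set Hs := ∫ x, |U s x| ^ (q + 1) ∂μ
    set Ht := ∫ x, |U t x| ^ (q + 1) ∂μ
    set I := ∫ x, spow q (U t x) * z x ∂μ
    have e : (s - t)⁻¹ * (Hs - Ht) - (q + 1) * I =
        (q + 1) * ((s - t)⁻¹ * (Hs / (q + 1) - Ht / (q + 1) - (s - t) * I)) := by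
      field_simp
    rw [slope_def_field, div_eq_inv_mul, e, norm_mul, norm_mul, Real.norm_of_nonneg hq1.le,
      Real.norm_of_nonneg hlow, norm_inv, Real.norm_eq_abs]
    refine mul_le_mul_of_nonneg_left ?_ hq1.le
    rw [← div_eq_inv_mul, div_le_iff₀ hst']
    linarith
  have := h3.add h1
  simp only [sub_add_cancel, zero_add] at this
  exact this

/-- The right slope of the regularized energy is controlled by almost minimizers. -/
theorem HasPowDerivAt.slope_envelope_lt (hD : HasPowDerivAt μ q U ut T t) (hq : 0 < q)
    (hU : ∀ s ∈ T, PowIntegrable μ (q + 1) (U s)) (hut : PowIntegrable μ (q + 1) ut) (ht : t ∈ T)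
    (hp : 1 < p) (hE : IsEnergy μ p q V E) {l ρ : ℝ}
    (hl : 0 < l) (hT : 𝓝[>] t ≤ 𝓝[T \ {t}] t)
    (hmin : ∀ ε : ℝ, 0 < ε → ∃ v ∈ V, penalized μ q E l (U t) v ≤ envelope μ q V E l (U t) + ε ∧
      (∫ x, (spow q (U t x) - v x) * ut x ∂μ) / l ≤ ρ + ε) {r : ℝ} (hr : ρ < r) :
    ∀ᶠ s in 𝓝[>] t, slope (fun s => envelope μ q V E l (U s)) t s < r := by
  have hq1 : 0 < q + 1 := by positivity
  obtain ⟨c, hc, hbd⟩ := hE.integral_rpow_le (by linarith) hq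
  have hvP := (hU t ht).spow hq
  -- A bound valid for every almost minimizer at time t, so that convergence of the difference
  -- quotients is uniform over the competitors.
  set M := c * (2 * ∫ x, |U t x| ^ (q + 1) ∂μ + l * 1) with hM
  have hH : 0 ≤ ∫ x, |U t x| ^ (q + 1) ∂μ := integral_nonneg fun x => by positivity
  have hM0 : 0 ≤ M := by positivity
  have h1 := (((hD.hasDerivWithinAt hq hU hut ht)).div_const (q + 1))
  rw [hasDerivWithinAt_iff_tendsto_slope, mul_div_cancel_left₀ _ hq1.ne'] at h1
  have h2 := (hD.tendsto_rpow hq).const_mul (M ^ (1 / (q⁻¹ + 1)))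
  set Q := ∫ x, spow q (U t x) * ut x ∂μ with hQ
  have h5 := h1.mono_left hT
  have h6 := (h5.add (h2.mono_left hT))
  rw [mul_zero, add_zero] at h6
  have hε : 0 < (r - ρ) / 4 := by linarith
  have h7 := h6.eventually (gt_mem_nhds (show Q < Q + l * ((r - ρ) / 4) by
    have := mul_pos hl hε
    linarith))
  filter_upwards [h7, self_mem_nhdsWithin, hT self_mem_nhdsWithin] with s hs hst hsT
  have hst0 : 0 < s - t := sub_pos.2 hst
  -- The almost minimizer is chosen after s, with tolerance proportional to s - t, because the
  -- defect is divided by s - t in the slope.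
  obtain ⟨v, hv, hJ, hρ⟩ := hmin (min 1 (min ((r - ρ) / 4) ((r - ρ) / 4 * (s - t))))
    (lt_min one_pos (lt_min hε (by positivity)))
  set ε := min 1 (min ((r - ρ) / 4) ((r - ρ) / 4 * (s - t))) with hεdef
  have hε1 : ε ≤ 1 := min_le_left _ _
  have hε2 : ε ≤ (r - ρ) / 4 := (min_le_right _ _).trans (min_le_left _ _)
  have hε3 : ε ≤ (r - ρ) / 4 * (s - t) := (min_le_right _ _).trans (min_le_right _ _)
  have hvI := hE.pow_integrable v hv
  have hvM : ∫ x, |v x| ^ (q⁻¹ + 1) ∂μ ≤ M :=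
    (hbd l (U t) v hl (hU t ht) hv).2 1 (hJ.trans (by linarith))
  have hz := powIntegrable_slope hq hU ht hsT.1
  have hle := hE.envelope_le hq hl (U s) hv
  -- With v frozen neither its energy nor its own power integral changes, so regularity in time is
  -- needed only for u.
  have hJs : penalized μ q E l (U s) v - penalized μ q E l (U t) v = (s - t) / l *
      (slope (fun s => (∫ x, |U s x| ^ (q + 1) ∂μ) / (q + 1)) t s -
        ∫ x, v x * ((s - t)⁻¹ * (U s x - U t x)) ∂μ) := by
    unfold penalized
    rw [hvI.integral_breg hq (hU s hsT.1), hvI.integral_breg hq (hU t ht), slope_def_field]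
    have e : ∫ x, v x * ((s - t)⁻¹ * (U s x - U t x)) ∂μ =
        (s - t)⁻¹ * (∫ x, v x * U s x ∂μ - ∫ x, v x * U t x ∂μ) := by
      rw [← integral_sub (hvI.integrable_mul hq (hU s hsT.1)) (hvI.integrable_mul hq (hU t ht)),
        ← integral_const_mul]
      congr 1; funext x; ring
    rw [e]
    field_simp
    ring
  have hvz : ∫ x, v x * ut x ∂μ - M ^ (1 / (q⁻¹ + 1)) *
      (∫ x, |(s - t)⁻¹ * (U s x - U t x) - ut x| ^ (q + 1) ∂μ) ^ (1 / (q + 1)) ≤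
      ∫ x, v x * ((s - t)⁻¹ * (U s x - U t x)) ∂μ := by
    have h8 := (abs_le.1 (hvI.abs_integral_mul_le hq (hz.sub hq1.le hut))).1
    have e : ∫ x, v x * ((s - t)⁻¹ * (U s x - U t x) - ut x) ∂μ =
        ∫ x, v x * ((s - t)⁻¹ * (U s x - U t x)) ∂μ - ∫ x, v x * ut x ∂μ := by
      rw [← integral_sub (hvI.integrable_mul hq hz) (hvI.integrable_mul hq hut)]
      congr 1; funext x; ring
    rw [e] at h8
    have h9 : (∫ x, |v x| ^ (q⁻¹ + 1) ∂μ) ^ (1 / (q⁻¹ + 1)) ≤ M ^ (1 / (q⁻¹ + 1)) :=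
      Real.rpow_le_rpow (integral_nonneg fun x => by positivity) hvM (by positivity)
    have h10 := mul_le_mul_of_nonneg_right h9 (by positivity :
      0 ≤ (∫ x, |(s - t)⁻¹ * (U s x - U t x) - ut x| ^ (q + 1) ∂μ) ^ (1 / (q + 1)))
    linarith
  have hvQ : Q - ∫ x, v x * ut x ∂μ ≤ l * (ρ + ε) := by
    have e : ∫ x, (spow q (U t x) - v x) * ut x ∂μ = Q - ∫ x, v x * ut x ∂μ := by
      rw [hQ, ← integral_sub (hvP.integrable_mul hq hut) (hvI.integrable_mul hq hut)]
      congr 1; funext x; ring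
    rw [e, div_le_iff₀ hl] at hρ
    linarith
  have hfin : (slope (fun s => (∫ x, |U s x| ^ (q + 1) ∂μ) / (q + 1)) t s -
        ∫ x, v x * ((s - t)⁻¹ * (U s x - U t x)) ∂μ) ≤ l * (ρ + 2 * ((r - ρ) / 4)) := by
    have := mul_le_mul_of_nonneg_left hε2 hl.le
    linarith
  have hJb : penalized μ q E l (U s) v - penalized μ q E l (U t) v ≤
      (s - t) * (ρ + 2 * ((r - ρ) / 4)) := by
    rw [hJs]
    calc _ ≤ (s - t) / l * (l * (ρ + 2 * ((r - ρ) / 4))) := by gcongr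
      _ = _ := by field_simp
  rw [slope_def_field, div_lt_iff₀ hst0]
  nlinarith

end Curve

section Curve

variable {α : Type*} [MeasurableSpace α] {μ : Measure α} {p q : ℝ}
  {V : Set (α → ℝ)} {E : (α → ℝ) → ℝ}

/-- An almost minimizer for u serves as a competitor for w. Used in both directions, this gives
continuity of the envelope along the curve. -/
theorem IsEnergy.envelope_sub_le (hp : 1 < p) (hq : 0 < q) (hE : IsEnergy μ p q V E) : ∃ c : ℝ,
    0 ≤ c ∧ ∀ l : ℝ, 0 < l → ∀ u w : α → ℝ, PowIntegrable μ (q + 1) u → PowIntegrable μ (q + 1) w →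
    envelope μ q V E l w - envelope μ q V E l u ≤
      ((∫ x, |w x| ^ (q + 1) ∂μ) / (q + 1) - (∫ x, |u x| ^ (q + 1) ∂μ) / (q + 1) +
        (c * (2 * ∫ x, |u x| ^ (q + 1) ∂μ + l)) ^ (1 / (q⁻¹ + 1)) *
        (∫ x, |w x - u x| ^ (q + 1) ∂μ) ^ (1 / (q + 1))) / l := by
  obtain ⟨c, hc, hbd⟩ := hE.integral_rpow_le (by linarith) hq
  refine ⟨c, hc, fun l hl u w hu hw => ?_⟩
  refine le_of_forall_pos_le_add fun ε hε => ?_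
  obtain ⟨v, hv, hJ⟩ := hE.exists_penalized_lt l u (lt_min hε one_pos)
  have hvI := hE.pow_integrable v hv
  have hvM := (hbd l u v hl hu hv).2 1 (hJ.le.trans (by gcongr; exact min_le_right _ _))
  rw [mul_one] at hvM
  have hJ2 : penalized μ q E l u v ≤ envelope μ q V E l u + ε :=
    hJ.le.trans (by gcongr; exact min_le_left _ _)
  have h1 := hE.envelope_le hq hl w hv
  have h2 : penalized μ q E l w v - penalized μ q E l u v =
      ((∫ x, |w x| ^ (q + 1) ∂μ) / (q + 1) - (∫ x, |u x| ^ (q + 1) ∂μ) / (q + 1) -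
        ∫ x, v x * (w x - u x) ∂μ) / l := by
    unfold penalized
    rw [hvI.integral_breg hq hu, hvI.integral_breg hq hw]
    have e : ∫ x, v x * (w x - u x) ∂μ = ∫ x, v x * w x ∂μ - ∫ x, v x * u x ∂μ := by
      rw [← integral_sub (hvI.integrable_mul hq hw) (hvI.integrable_mul hq hu)]
      congr 1; funext x; ring
    rw [e]
    ring
  have h3 := (abs_le.1 (hvI.abs_integral_mul_le hq (hw.sub (by positivity) hu))).1
  have h4 : (∫ x, |v x| ^ (q⁻¹ + 1) ∂μ) ^ (1 / (q⁻¹ + 1)) ≤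
      (c * (2 * ∫ x, |u x| ^ (q + 1) ∂μ + l)) ^ (1 / (q⁻¹ + 1)) :=
    Real.rpow_le_rpow (integral_nonneg fun x => by positivity) hvM (by positivity)
  have h5 := mul_le_mul_of_nonneg_right h4 (by positivity :
      0 ≤ (∫ x, |w x - u x| ^ (q + 1) ∂μ) ^ (1 / (q + 1)))
  have h6 : penalized μ q E l w v - penalized μ q E l u v ≤
      ((∫ x, |w x| ^ (q + 1) ∂μ) / (q + 1) - (∫ x, |u x| ^ (q + 1) ∂μ) / (q + 1) +
        (c * (2 * ∫ x, |u x| ^ (q + 1) ∂μ + l)) ^ (1 / (q⁻¹ + 1)) *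
        (∫ x, |w x - u x| ^ (q + 1) ∂μ) ^ (1 / (q + 1))) / l := by
    rw [h2]
    refine div_le_div_of_nonneg_right ?_ hl.le
    linarith
  linarith

theorem HasPowDerivAt.continuousWithinAt_envelope (hp : 1 < p) (hq : 0 < q)
    (hE : IsEnergy μ p q V E) {U : ℝ → α → ℝ} {ut : α → ℝ} {T : Set ℝ} {t : ℝ}
    (hU : ∀ s ∈ T, PowIntegrable μ (q + 1) (U s)) (hut : PowIntegrable μ (q + 1) ut) (ht : t ∈ T)
    (hD : HasPowDerivAt μ q U ut T t) {l : ℝ} (hl : 0 < l) :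
    ContinuousWithinAt (fun s => envelope μ q V E l (U s)) T t := by
  obtain ⟨c, hc, h⟩ := hE.envelope_sub_le hp hq
  have hH := (hD.hasDerivWithinAt hq hU hut ht).continuousWithinAt
  have hs := hD.tendsto_sub hq hU hut ht
  have he : 0 < 1 / (q + 1) := by positivity
  have he' : 0 < 1 / (q⁻¹ + 1) := by positivity
  have hs' : Tendsto (fun s => (∫ x, |U s x - U t x| ^ (q + 1) ∂μ) ^ (1 / (q + 1))) (𝓝[T] t)
      (𝓝 0) := by
    have := (Real.continuous_rpow_const he.le).tendsto 0
    rw [Real.zero_rpow he.ne'] at this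
    exact this.comp hs
  set H : ℝ → ℝ := fun s => ∫ x, |U s x| ^ (q + 1) ∂μ with hHdef
  have hH' : Tendsto H (𝓝[T] t) (𝓝 (H t)) := hH
  have h1 : Tendsto (fun s => (H s / (q + 1) - H t / (q + 1) + (c * (2 * H t + l)) ^ (1 / (q⁻¹ + 1)) *
      (∫ x, |U s x - U t x| ^ (q + 1) ∂μ) ^ (1 / (q + 1))) / l) (𝓝[T] t) (𝓝 0) := by
    have := (((hH'.div_const (q + 1)).sub_const (H t / (q + 1))).add
      (hs'.const_mul ((c * (2 * H t + l)) ^ (1 / (q⁻¹ + 1))))).div_const l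
    simpa using this
  have h2 : Tendsto (fun s => (H t / (q + 1) - H s / (q + 1) + (c * (2 * H s + l)) ^ (1 / (q⁻¹ + 1)) *
      (∫ x, |U s x - U t x| ^ (q + 1) ∂μ) ^ (1 / (q + 1))) / l) (𝓝[T] t) (𝓝 0) := by
    have h3 : Tendsto (fun s => (c * (2 * H s + l)) ^ (1 / (q⁻¹ + 1))) (𝓝[T] t)
        (𝓝 ((c * (2 * H t + l)) ^ (1 / (q⁻¹ + 1)))) :=
      ((Real.continuous_rpow_const he'.le).tendsto _).comp
        (((hH'.const_mul 2).add_const l).const_mul c)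
    have := (((hH'.div_const (q + 1)).const_sub (H t / (q + 1))).add (h3.mul hs')).div_const l
    simpa using this
  have hlow : ∀ᶠ s in 𝓝[T] t, -((H t / (q + 1) - H s / (q + 1) +
      (c * (2 * H s + l)) ^ (1 / (q⁻¹ + 1)) *
      (∫ x, |U s x - U t x| ^ (q + 1) ∂μ) ^ (1 / (q + 1))) / l) ≤
      envelope μ q V E l (U s) - envelope μ q V E l (U t) := by
    filter_upwards [self_mem_nhdsWithin] with s hsT
    have := h l hl (U s) (U t) (hU s hsT) (hU t ht)
    simp only [abs_sub_comm (U t _) (U s _)] at this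
    simp only [hHdef]
    linarith
  have hupp : ∀ᶠ s in 𝓝[T] t, envelope μ q V E l (U s) - envelope μ q V E l (U t) ≤
      (H s / (q + 1) - H t / (q + 1) + (c * (2 * H t + l)) ^ (1 / (q⁻¹ + 1)) *
      (∫ x, |U s x - U t x| ^ (q + 1) ∂μ) ^ (1 / (q + 1))) / l := by
    filter_upwards [self_mem_nhdsWithin] with s hsT
    exact h l hl (U t) (U s) (hU t ht) (hU s hsT)
  have h4 := tendsto_of_tendsto_of_tendsto_of_le_of_le' (by simpa using h2.neg) h1 hlow hupp
  have h5 := h4.add_const (envelope μ q V E l (U t))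
  simpa [ContinuousWithinAt] using h5

end Curve

end ParabolicFrequency

namespace ParabolicFrequency

/-! ### Recovering the energy from its regularizations. -/

section Slice

variable {α : Type*} [MeasurableSpace α] {μ : Measure α} {p q C : ℝ}
  {V : Set (α → ℝ)} {E : (α → ℝ) → ℝ} {u ut F h : α → ℝ}

/-- The energy is recovered from the regularized energies. -/
theorem IsSlice.energy_le_of_envelope_le (hS : IsSlice μ p q C V E u ut F h) (hq : 0 < q)
    (hE : IsEnergy μ p q V E) {R l₁ : ℝ} (hl₁ : 0 < l₁)
    (hR : ∀ l : ℝ, 0 < l → l ≤ l₁ → envelope μ q V E l u ≤ R) :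
    E (fun x => spow q (u x)) ≤ R := by
  have hq1 : 0 < q + 1 := by positivity
  have hm : 0 < min 1 q := lt_min one_pos hq
  have hR0 : 0 ≤ R := (hE.envelope_nonneg hq hl₁ u).trans (hR l₁ hl₁ le_rfl)
  refine le_of_forall_pos_le_add fun ε hε => ?_
  set N := ∫ x, (|u x| + |F x|) ^ (q + 1) ∂μ with hN
  have hN0 : 0 ≤ N := integral_nonneg fun x => by positivity
  -- First κ makes the remainder small, then l is taken small relative to κ, since the Bregman
  -- integral is of order l and is divided by κ.
  obtain ⟨κ, hκ, hκ1, hκN⟩ : ∃ κ : ℝ, 0 < κ ∧ κ ≤ 1 ∧ (q + 2) * κ ^ min 1 q * N ≤ ε / 2 := by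
    have hc : Tendsto (fun κ : ℝ => (q + 2) * κ ^ min 1 q * N) (𝓝[>] 0) (𝓝 0) := by
      have : Continuous (fun κ : ℝ => (q + 2) * κ ^ min 1 q * N) :=
        (continuous_const.mul (Real.continuous_rpow_const hm.le)).mul continuous_const
      have h3 := this.tendsto 0
      simp only [Real.zero_rpow hm.ne', zero_mul, mul_zero] at h3
      exact h3.mono_left nhdsWithin_le_nhds
    obtain ⟨κ, h1, h2⟩ := ((hc.eventually (gt_mem_nhds (half_pos hε))).and
      (Ioo_mem_nhdsGT (zero_lt_one (α := ℝ)))).exists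
    exact ⟨κ, h2.1, h2.2.le, h1.le⟩
  have hD : 0 < 1 + (R + 1) / κ := by positivity
  set l := min (min l₁ 1) (ε / 2 / (1 + (R + 1) / κ)) with hl
  have hl0 : 0 < l := by positivity
  have hll : l ≤ l₁ := (min_le_left _ _).trans (min_le_left _ _)
  have hl1 : l ≤ 1 := (min_le_left _ _).trans (min_le_right _ _)
  have hlε : l * (1 + (R + 1) / κ) ≤ ε / 2 := (le_div_iff₀ hD).1 (min_le_right _ _)
  obtain ⟨v, hv, hJ⟩ := hE.exists_penalized_lt l u hl0
  have hJR : E v + (∫ x, breg q (u x) (v x) ∂μ) / l ≤ R + l := by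
    have := hR l hl0 hll
    unfold penalized at hJ
    linarith
  have hB0 := integral_breg_nonneg hq u v (μ := μ)
  have hEv := hE.nonneg v hv
  have hvI := hE.pow_integrable v hv
  have hvu := hS.pow_u.spow hq
  have hB : ∫ x, breg q (u x) (v x) ∂μ ≤ l * (R + 1) := by
    have : (∫ x, breg q (u x) (v x) ∂μ) / l ≤ R + 1 := by linarith
    rwa [div_le_iff₀ hl0, mul_comm] at this
  have hEvR : E v ≤ R + l := by
    have : 0 ≤ (∫ x, breg q (u x) (v x) ∂μ) / l := by positivity
    linarith
  have hpt : ∫ x, (v x - spow q (u x)) * F x ∂μ ≤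
      (∫ x, breg q (u x) (v x) ∂μ) / κ + (q + 2) * κ ^ min 1 q * N := by
    rw [hN, ← integral_div, ← integral_const_mul, ← integral_add
      ((hvI.integrable_breg hq hS.pow_u).div_const κ)
      ((hS.pow_u.integrable_add_rpow hq1.le hS.pow_F).const_mul _)]
    refine integral_mono ((hvI.sub (by positivity) hvu).integrable_mul hq hS.pow_F)
      (((hvI.integrable_breg hq hS.pow_u).div_const κ).add
        ((hS.pow_u.integrable_add_rpow hq1.le hS.pow_F).const_mul _)) fun x => ?_
    have := (abs_le.1 (mul_sub_spow_le_breg hq hκ hκ1 (u x) (v x) (F x))).2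
    simp only
    linarith
  -- The subgradient at u^q replaces lower semicontinuity: the energy of u^q exceeds that of v by at
  -- most the pairing of v - u^q with F, which is now small.
  have hsub := hS.subgradient v hv
  have hBκ : (∫ x, breg q (u x) (v x) ∂μ) / κ ≤ l * ((R + 1) / κ) := by
    rw [← mul_div_assoc]
    exact div_le_div_of_nonneg_right hB hκ.le
  linarith

/-- The error term is small compared with the energy. -/
theorem IsSlice.exists_abs_integral_error_le (μ : Measure α) (p : ℝ) (V : Set (α → ℝ))
    (E : (α → ℝ) → ℝ) (hq : 0 < q) {τ : ℝ} (hτ : 0 < τ) :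
    ∃ K : ℝ, 0 ≤ K ∧ ∀ (C : ℝ) (u ut F h : α → ℝ), IsSlice μ p q C V E u ut F h →
      |∫ x, spow q (u x) * (ut x - F x) ∂μ| ≤
        C * (τ * (p * E (fun x => spow q (u x))) + K * ∫ x, |u x| ^ (q + 1) ∂μ) := by
  have hq1 : 0 < q + 1 := by positivity
  have hθ1 : 0 < q⁻¹ + 1 := by positivity
  -- The weight in Young's inequality for |u^q|h: the coefficient of h^{q+1} becomes c^{q+1} = τ/2,
  -- and the factor 2 of the majorant restores τ.
  set c := (τ / 2) ^ (1 / (q + 1)) with hc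
  have hc0 : 0 < c := by positivity
  have hcq : c ^ (q + 1) = τ / 2 := by
    rw [hc, ← Real.rpow_mul (by positivity), one_div_mul_cancel hq1.ne', Real.rpow_one]
  refine ⟨2 * (1 + c⁻¹ ^ (q⁻¹ + 1)), by positivity, fun C u ut F h hS => ?_⟩
  have hC := hS.const_nonneg
  have hvu := hS.pow_u.spow hq
  have hhi : Integrable (fun x => h x ^ (q + 1)) μ := by
    refine hS.pow_h.2.congr (Eventually.of_forall fun x => ?_)
    simp only [abs_of_nonneg (hS.h_nonneg x)]
  have key : ∀ᵐ x ∂μ, ‖spow q (u x) * (ut x - F x)‖ ≤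
      C * (τ * h x ^ (q + 1) + 2 * (1 + c⁻¹ ^ (q⁻¹ + 1)) * |u x| ^ (q + 1)) := by
    filter_upwards [hS.error] with x hx
    have hh := hS.h_nonneg x
    have h1 := hx.trans (errorMajorant_le hC hh)
    have h2 := breg_nonneg hq (c * h x) (c⁻¹ * |spow q (u x)|)
    unfold breg at h2
    rw [abs_of_nonneg (by positivity : 0 ≤ c * h x),
      abs_of_nonneg (by positivity : 0 ≤ c⁻¹ * |spow q (u x)|),
      Real.mul_rpow hc0.le hh, Real.mul_rpow (by positivity) (abs_nonneg _), hcq,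
      show c⁻¹ * |spow q (u x)| * (c * h x) = |spow q (u x)| * h x by field_simp] at h2
    have h3 : |spow q (u x)| ^ (q⁻¹ + 1) = |u x| ^ (q + 1) := by
      rw [abs_spow hq, ← Real.rpow_mul (abs_nonneg _)]
      congr 1; field_simp; ring
    have h4 : |spow q (u x)| * |u x| = |u x| ^ (q + 1) := by
      rw [abs_spow hq, Real.rpow_add_one' (abs_nonneg _) hq1.ne']
    rw [h3] at h2
    have hhp : 0 ≤ h x ^ (q + 1) := by positivity
    have hup : 0 ≤ |u x| ^ (q + 1) := by positivity
    have hcp : 0 ≤ c⁻¹ ^ (q⁻¹ + 1) := by positivity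
    have h5 : τ / 2 * h x ^ (q + 1) / (q + 1) ≤ τ / 2 * h x ^ (q + 1) :=
      div_le_self (by positivity) (by linarith)
    have h6 : c⁻¹ ^ (q⁻¹ + 1) * |u x| ^ (q + 1) / (q⁻¹ + 1) ≤ c⁻¹ ^ (q⁻¹ + 1) * |u x| ^ (q + 1) :=
      div_le_self (by positivity) (by have := inv_pos.2 hq; linarith)
    rw [norm_mul, Real.norm_eq_abs, Real.norm_eq_abs]
    calc |spow q (u x)| * |ut x - F x| ≤ |spow q (u x)| * (2 * C * (|u x| + h x)) := by gcongr
      _ = C * (2 * (|spow q (u x)| * |u x|) + 2 * (|spow q (u x)| * h x)) := by ring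
      _ ≤ _ := by
        refine mul_le_mul_of_nonneg_left ?_ hC
        rw [h4]
        linarith
  have hint := norm_integral_le_of_norm_le
    (((hhi.const_mul τ).add (hS.pow_u.2.const_mul (2 * (1 + c⁻¹ ^ (q⁻¹ + 1))))).const_mul C) key
  refine hint.trans (le_of_eq ?_)
  rw [integral_const_mul]
  simp only [Pi.add_apply]
  rw [integral_add (hhi.const_mul τ) (hS.pow_u.2.const_mul _), integral_const_mul,
    integral_const_mul, hS.integral_h]

theorem IsSlice.integral_spow_mul_ut (hq : 0 < q) (hS : IsSlice μ p q C V E u ut F h) :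
    ∫ x, spow q (u x) * ut x ∂μ = ∫ x, spow q (u x) * (ut x - F x) ∂μ -
      p * E (fun x => spow q (u x)) := by
  rw [hS.integral_mul_ut hq (hS.pow_u.spow hq), hS.pairing]
  ring

end Slice

/-! ### Frequency bound and backward uniqueness for the abstract equation. -/

section Curve

variable {α : Type*} [MeasurableSpace α] {μ : Measure α} {p q : ℝ}
  {V : Set (α → ℝ)} {E : (α → ℝ) → ℝ} {U Ut : ℝ → α → ℝ} {C P : ℝ → ℝ} {t₀ b : ℝ}

theorem nhdsGT_le_nhdsWithin_Icc_diff {t₀ b t : ℝ} (ht : t ∈ Ico t₀ b) :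
    𝓝[>] t ≤ 𝓝[Icc t₀ b \ {t}] t := by
  refine nhdsWithin_le_of_mem ?_
  filter_upwards [Ioc_mem_nhdsGT ht.2] with s hs
  exact ⟨⟨ht.1.trans hs.1.le, hs.2⟩, hs.1.ne'⟩

/-- A solution of the abstract perturbed equation on a time interval. -/
structure IsSolution (μ : Measure α) (p q : ℝ) (V : Set (α → ℝ)) (E : (α → ℝ) → ℝ)
    (U Ut : ℝ → α → ℝ) (C : ℝ → ℝ) (t₀ b : ℝ) : Prop where
  pow_u : ∀ t ∈ Icc t₀ b, PowIntegrable μ (q + 1) (U t)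
  pow_ut : ∀ t ∈ Icc t₀ b, PowIntegrable μ (q + 1) (Ut t)
  hasDeriv : ∀ t ∈ Icc t₀ b, HasPowDerivAt μ q U (Ut t) (Icc t₀ b) t
  slice : ∀ t ∈ Ico t₀ b, ∃ F h, IsSlice μ p q (C t) V E (U t) (Ut t) F h
  continuousOn_coeff : ContinuousOn C (Ico t₀ b)

namespace IsSolution

theorem continuousOn_norm (hU : IsSolution μ p q V E U Ut C t₀ b) (hq : 0 < q) :
    ContinuousOn (fun s => ∫ x, |U s x| ^ (q + 1) ∂μ) (Icc t₀ b) := fun t ht =>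
  ((hU.hasDeriv t ht).hasDerivWithinAt hq hU.pow_u (hU.pow_ut t ht) ht).continuousWithinAt

theorem hasDerivWithinAt_norm (hU : IsSolution μ p q V E U Ut C t₀ b) (hq : 0 < q) {t : ℝ}
    (ht : t ∈ Ico t₀ b) : HasDerivWithinAt (fun s => ∫ x, |U s x| ^ (q + 1) ∂μ)
      ((q + 1) * ∫ x, spow q (U t x) * Ut t x ∂μ) (Ici t) t := by
  have ht' := Ico_subset_Icc_self ht
  refine ((hU.hasDeriv t ht').hasDerivWithinAt hq hU.pow_u (hU.pow_ut t ht') ht').mono_of_mem_nhdsWithin ?_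
  filter_upwards [Icc_mem_nhdsGE ht.2] with s hs
  exact ⟨ht.1.trans hs.1, hs.2⟩

theorem continuousOn_envelope (hU : IsSolution μ p q V E U Ut C t₀ b) (hp : 1 < p) (hq : 0 < q)
    (hE : IsEnergy μ p q V E) {l : ℝ} (hl : 0 < l) :
    ContinuousOn (fun s => envelope μ q V E l (U s)) (Icc t₀ b) := fun t ht =>
  (hU.hasDeriv t ht).continuousWithinAt_envelope hp hq hE hU.pow_u (hU.pow_ut t ht) ht hl

theorem slope_envelope (hU : IsSolution μ p q V E U Ut C t₀ b) (hp : 1 < p) (hq : 0 < q)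
    (hE : IsEnergy μ p q V E) {l ρ t : ℝ} (hl : 0 < l) (ht : t ∈ Ico t₀ b)
    (hmin : ∀ ε : ℝ, 0 < ε → ∃ v ∈ V,
      penalized μ q E l (U t) v ≤ envelope μ q V E l (U t) + ε ∧
      (∫ x, (spow q (U t x) - v x) * Ut t x ∂μ) / l ≤ ρ + ε) {r : ℝ} (hr : ρ < r) :
    ∃ᶠ s in 𝓝[>] t, slope (fun s => envelope μ q V E l (U s)) t s < r := by
  have ht' := Ico_subset_Icc_self ht
  exact ((hU.hasDeriv t ht').slope_envelope_lt hq hU.pow_u (hU.pow_ut t ht') ht' hp hE hl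
    (nhdsGT_le_nhdsWithin_Icc_diff ht) hmin hr).frequently

/-- The rough slope bound for the envelope involves the energy itself, about which nothing is known
yet. But -H' is at least half of (q+1)pE minus a constant, so a multiple of H(t₀) - H(t) in the
barrier absorbs it. -/
theorem exists_bound (hU : IsSolution μ p q V E U Ut C t₀ b) (hp : 1 < p) (hq : 0 < q)
    (hE : IsEnergy μ p q V E) {d : ℝ} (hd : t₀ ≤ d) (hdb : d < b) : ∃ M : ℝ, 1 ≤ M ∧ ∀ t ∈ Icc t₀ d,
      ∫ x, |U t x| ^ (q + 1) ∂μ ≤ M ∧ E (fun x => spow q (U t x)) ≤ M ∧ C t ≤ M := by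
  have hsub : Icc t₀ d ⊆ Ico t₀ b := fun s hs => ⟨hs.1, hs.2.trans_lt hdb⟩
  have hsub' : Icc t₀ d ⊆ Icc t₀ b := hsub.trans Ico_subset_Icc_self
  set H : ℝ → ℝ := fun s => ∫ x, |U s x| ^ (q + 1) ∂μ with hHdef
  have hH0 : ∀ t, 0 ≤ H t := fun t => integral_nonneg fun x => by positivity
  obtain ⟨MH, hMH⟩ := isCompact_Icc.exists_bound_of_continuousOn ((hU.continuousOn_norm hq).mono hsub')
  obtain ⟨MC, hMC⟩ := isCompact_Icc.exists_bound_of_continuousOn (hU.continuousOn_coeff.mono hsub)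
  have hMH' : ∀ t ∈ Icc t₀ d, H t ≤ MH := fun t ht => (le_abs_self _).trans (hMH t ht)
  have hMC' : ∀ t ∈ Icc t₀ d, C t ≤ MC := fun t ht => (le_abs_self _).trans (hMC t ht)
  have ht₀ : t₀ ∈ Icc t₀ d := left_mem_Icc.2 hd
  have hMH0 : 0 ≤ MH := (hH0 t₀).trans (hMH' t₀ ht₀)
  have hMC0 : 0 ≤ MC := (abs_nonneg _).trans (hMC t₀ ht₀)
  obtain ⟨K, hK, hslope⟩ := IsSlice.exists_rough_slope_bound hp hq hE
  -- With this τ the error term in H' consumes at most half of pE.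
  obtain ⟨Kb, hKb, hb⟩ := IsSlice.exists_abs_integral_error_le μ p V E hq
    (τ := 1 / (2 * (MC + 1))) (by positivity)
  -- Chosen so that A(q+1)pE/2 is exactly the term K·MC²·E to be absorbed. The final summand 1 in
  -- the constant `B₀` below makes the comparison strict.
  set A := 2 * (K * MC ^ 2) / ((q + 1) * p) with hA
  have hA0 : 0 ≤ A := by positivity
  set B₀ := K * MC ^ 2 * MH + A * (q + 1) * (MC * (Kb * MH)) + 1 with hB₀
  have hB₀0 : 0 ≤ B₀ := by positivity
  set Bd : ℝ → ℝ := fun t => E (fun x => spow q (U t₀ x)) + A * (H t₀ - H t) + B₀ * (t - t₀)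
    with hBd
  set ρ : ℝ → ℝ := fun t => K * C t ^ 2 * (H t + E (fun x => spow q (U t x))) with hρ
  have hEnn : ∀ t ∈ Ico t₀ b, 0 ≤ E (fun x => spow q (U t x)) := fun t ht => by
    obtain ⟨F, h, hS⟩ := hU.slice t ht
    exact hE.nonneg _ hS.mem
  have main : ∀ l : ℝ, 0 < l → l ≤ 1 → ∀ t ∈ Icc t₀ d, envelope μ q V E l (U t) ≤ Bd t := by
    intro l hl hl1 t ht
    refine image_le_of_liminf_slope_right_lt_deriv_boundary'
      (f := fun s => envelope μ q V E l (U s)) (f' := ρ)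
      (B' := fun t => A * (0 - (q + 1) * ∫ x, spow q (U t x) * Ut t x ∂μ) + B₀ * 1)
      ((hU.continuousOn_envelope hp hq hE hl).mono hsub') ?_ ?_ ?_ ?_ ?_ ht
    · intro x hx r hr
      have hx' := hsub (Ico_subset_Icc_self hx)
      obtain ⟨F, h, hS⟩ := hU.slice x hx'
      exact hU.slope_envelope hp hq hE hl hx'
        (fun ε hε => hslope (C x) l ε _ _ F h hl hl1 hε hS) hr
    · obtain ⟨F, h, hS⟩ := hU.slice t₀ (hsub ht₀)
      have := hE.envelope_le_energy hq hl hS.mem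
      simpa [hBd] using this
    · have := (hU.continuousOn_norm hq).mono hsub'
      exact (continuousOn_const.add (continuousOn_const.mul (continuousOn_const.sub this))).add
        (by fun_prop)
    · intro x hx
      have h1 := hU.hasDerivWithinAt_norm hq (hsub (Ico_subset_Icc_self hx))
      have h2 : HasDerivWithinAt (fun t : ℝ => B₀ * (t - t₀)) (B₀ * 1) (Ici x) x :=
        ((hasDerivWithinAt_id x _).sub_const t₀).const_mul B₀
      have h3 := (((hasDerivWithinAt_const x (Ici x) (H t₀)).sub h1).const_mul A)
      have := (h3.const_add (E (fun x => spow q (U t₀ x)))).add h2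
      exact this
    · intro x hx _
      have hx1 := Ico_subset_Icc_self hx
      have hx' := hsub hx1
      obtain ⟨F, h, hS⟩ := hU.slice x hx'
      have hbx := (abs_le.1 (hb (C x) _ _ F h hS)).2
      have hHx := hMH' x hx1
      have hCx := hMC' x hx1
      have hC0 := hS.const_nonneg
      have hEx := hEnn x hx'
      have hHx0 := hH0 x
      change K * C x ^ 2 * (H x + E (fun y => spow q (U x y))) < _
      rw [hS.integral_spow_mul_ut hq]
      change ∫ y, spow q (U x y) * (Ut x y - F y) ∂μ ≤ C x * (1 / (2 * (MC + 1)) *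
        (p * E (fun y => spow q (U x y))) + Kb * H x) at hbx
      set e := ∫ y, spow q (U x y) * (Ut x y - F y) ∂μ
      set Ex := E (fun y => spow q (U x y))
      have h1 : C x * (1 / (2 * (MC + 1)) * (p * Ex)) ≤ p * Ex / 2 := by
        have : C x * (1 / (2 * (MC + 1))) ≤ 1 / 2 := by
          rw [mul_one_div, div_le_div_iff₀ (by positivity) (by norm_num)]
          linarith
        calc _ = C x * (1 / (2 * (MC + 1))) * (p * Ex) := by ring
          _ ≤ 1 / 2 * (p * Ex) := by gcongr
          _ = _ := by ring
      have h2 : C x * (Kb * H x) ≤ MC * (Kb * MH) := by gcongr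
      have h3 : e ≤ p * Ex / 2 + MC * (Kb * MH) := by linarith
      have h4 : K * C x ^ 2 * (H x + Ex) ≤ K * MC ^ 2 * (MH + Ex) := by gcongr
      have h5 : A * ((q + 1) * (p * Ex / 2)) = K * MC ^ 2 * Ex := by
        rw [hA]; field_simp
      have h6 : A * ((q + 1) * e) ≤ A * ((q + 1) * (p * Ex / 2 + MC * (Kb * MH))) := by gcongr
      have h7 : A * (0 - (q + 1) * (e - p * Ex)) + B₀ * 1 =
        2 * (A * ((q + 1) * (p * Ex / 2))) - A * ((q + 1) * e) + B₀ := by ring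
      rw [h7, h5]
      rw [mul_add, mul_add A, h5] at h6
      rw [hB₀]
      linarith
  refine ⟨1 + MH + MC + (E (fun x => spow q (U t₀ x)) + A * MH + B₀ * (d - t₀)), ?_, fun t ht => ?_⟩
  · have h1 := hEnn t₀ (hsub ht₀)
    have h2 : 0 ≤ B₀ * (d - t₀) := mul_nonneg hB₀0 (by linarith)
    have h3 : 0 ≤ A * MH := by positivity
    linarith
  · have h1 := hEnn t₀ (hsub ht₀)
    have h2 : 0 ≤ B₀ * (d - t₀) := mul_nonneg hB₀0 (by linarith)
    have h3 : 0 ≤ A * MH := by positivity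
    have h4 := hMH' t ht
    have h5 := hMC' t ht
    refine ⟨by change H t ≤ _; linarith, ?_, by linarith⟩
    obtain ⟨F, h, hS⟩ := hU.slice t (hsub ht)
    have h6 := hS.energy_le_of_envelope_le hq hE one_pos fun l hl hl1 => main l hl hl1 t ht
    have h7 : A * (H t₀ - H t) ≤ A * MH := by
      have := hMH' t₀ ht₀
      have := hH0 t
      gcongr
      linarith
    have h8 : B₀ * (t - t₀) ≤ B₀ * (d - t₀) := by
      have := ht.2
      gcongr
    simp only [hBd] at h6
    linarith

/-- The barrier is H(g - 1). Where the envelope touches it, fH'/H cancels the derivative of H in the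
barrier, and f + H = Hg is matched by the exponential of K∫C². The bounds M, h₀ and l₀ depend on the
end point d, but the constant K and hence the resulting N do not, which is what allows t up to t₁.
-/
theorem exists_frequency_bound (hU : IsSolution μ p q V E U Ut C t₀ b) (hp : 1 < p) (hq : 0 < q)
    (hpq : q + 1 ≤ q * p) (hE : IsEnergy μ p q V E)
    (hP : ∀ t ∈ Ico t₀ b, HasDerivWithinAt P (C t ^ 2) (Ici t) t) (hPc : ContinuousOn P (Icc t₀ b))
    (hP0 : P t₀ = 0) (hPm : MonotoneOn P (Icc t₀ b)) {t₁ : ℝ} (ht₁b : t₁ ≤ b)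
    (hpos : ∀ t ∈ Ico t₀ t₁, 0 < ∫ x, |U t x| ^ (q + 1) ∂μ) :
    ∃ N : ℝ, 0 ≤ N ∧ ∀ t ∈ Ico t₀ t₁, E (fun x => spow q (U t x)) ≤
      N * ∫ x, |U t x| ^ (q + 1) ∂μ := by
  obtain ⟨K, hK, hslope⟩ := IsSlice.exists_sharp_slope_bound hp hq hpq hE
  set H : ℝ → ℝ := fun s => ∫ x, |U s x| ^ (q + 1) ∂μ with hHdef
  have hH0 : ∀ t, 0 ≤ H t := fun t => integral_nonneg fun x => by positivity
  rcases le_or_gt t₁ t₀ with h01 | h01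
  · exact ⟨0, le_rfl, fun t ht => absurd (ht.1.trans_lt ht.2) (not_lt.2 h01)⟩
  have ht₀b : t₀ < b := h01.trans_le ht₁b
  have hE0 : 0 ≤ E (fun x => spow q (U t₀ x)) := by
    obtain ⟨F, h, hS⟩ := hU.slice t₀ ⟨le_rfl, ht₀b⟩
    exact hE.nonneg _ hS.mem
  have hHt₀ : 0 < H t₀ := hpos t₀ ⟨le_rfl, h01⟩
  set N₀ := E (fun x => spow q (U t₀ x)) / H t₀ + 1 with hN₀
  have hN₀1 : 1 ≤ N₀ := by
    have : 0 ≤ E (fun x => spow q (U t₀ x)) / H t₀ := by positivity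
    linarith
  -- The linear term t - t₀ yields a surplus H·exp(KP) in the derivative, which exceeds the slack
  -- h₀/2 of the sharp slope bound. At t₀ the barrier equals the energy, since N₀ - 1 is the initial
  -- frequency.
  set g : ℝ → ℝ := fun t => (N₀ + (t - t₀)) * Real.exp (K * P t) with hg
  have hPb : 0 ≤ P b := by
    rw [← hP0]; exact hPm ⟨le_rfl, ht₀b.le⟩ ⟨ht₀b.le, le_rfl⟩ ht₀b.le
  refine ⟨(N₀ + (b - t₀)) * Real.exp (K * P b), ?_, fun d hd => ?_⟩
  · have : 0 ≤ b - t₀ := by linarith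
    positivity
  have hdb : d < b := hd.2.trans_le ht₁b
  have hsub : Icc t₀ d ⊆ Ico t₀ b := fun s hs => ⟨hs.1, hs.2.trans_lt hdb⟩
  have hsub' : Icc t₀ d ⊆ Icc t₀ b := hsub.trans Ico_subset_Icc_self
  have hdd : d ∈ Icc t₀ d := right_mem_Icc.2 hd.1
  obtain ⟨M, hM1, hM⟩ := hU.exists_bound hp hq hE hd.1 hdb
  obtain ⟨m, hm, hmin⟩ := isCompact_Icc.exists_isMinOn ⟨d, hdd⟩ ((hU.continuousOn_norm hq).mono hsub')
  set h₀ := H m with hh₀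
  have hh₀0 : 0 < h₀ := hpos m ⟨hm.1, hm.2.trans_lt hd.2⟩
  have hHh₀ : ∀ t ∈ Icc t₀ d, h₀ ≤ H t := fun t ht => hmin ht
  obtain ⟨l₀, hl₀, hsl⟩ := hslope M h₀ (h₀ / 2) hM1 hh₀0 (by positivity)
  have hP0t : ∀ t ∈ Icc t₀ d, 0 ≤ P t := fun t ht => by
    rw [← hP0]; exact hPm ⟨le_rfl, ht₀b.le⟩ (hsub' ht) ht.1
  have main : ∀ l : ℝ, 0 < l → l ≤ l₀ → envelope μ q V E l (U d) ≤ H d * (g d - 1) := by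
    intro l hl hl1
    refine image_le_of_liminf_slope_right_lt_deriv_boundary'
      (f := fun s => envelope μ q V E l (U s))
      (f' := fun t => envelope μ q V E l (U t) * ((q + 1) * ∫ x, spow q (U t x) * Ut t x ∂μ) /
        H t + K * C t ^ 2 * (envelope μ q V E l (U t) + H t) + h₀ / 2)
      (B := fun t => H t * (g t - 1))
      (B' := fun t => ((q + 1) * ∫ x, spow q (U t x) * Ut t x ∂μ) * (g t - 1) +
        H t * (1 * Real.exp (K * P t) + (N₀ + (t - t₀)) * (Real.exp (K * P t) * (K * C t ^ 2))))
      ((hU.continuousOn_envelope hp hq hE hl).mono hsub') ?_ ?_ ?_ ?_ ?_ hdd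
    · intro x hx r hr
      have hx1 := Ico_subset_Icc_self hx
      have hx' := hsub hx1
      obtain ⟨F, h, hS⟩ := hU.slice x hx'
      obtain ⟨m1, m2, m3⟩ := hM x hx1
      refine hU.slope_envelope hp hq hE hl hx' (fun ε hε => ?_) hr
      obtain ⟨v, hv, h1, h2⟩ := hsl l hl hl1 (C x) _ _ F h hS (hHh₀ x hx1) m1 m2 m3 ε hε
      exact ⟨v, hv, h1, h2.trans (le_add_of_nonneg_right hε.le)⟩
    · obtain ⟨F, h, hS⟩ := hU.slice t₀ ⟨le_rfl, ht₀b⟩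
      refine (hE.envelope_le_energy hq hl hS.mem).trans (le_of_eq ?_)
      simp only [hg, hP0, mul_zero, Real.exp_zero, sub_self, add_zero, mul_one, hN₀, add_sub_cancel_right]
      rw [mul_div_cancel₀ _ hHt₀.ne']
    · refine ((hU.continuousOn_norm hq).mono hsub').mul (ContinuousOn.sub ?_ continuousOn_const)
      exact ContinuousOn.mul (by fun_prop)
        (Real.continuous_exp.comp_continuousOn (continuousOn_const.mul (hPc.mono hsub')))
    · intro x hx
      have hx' := hsub (Ico_subset_Icc_self hx)
      have h1 := hU.hasDerivWithinAt_norm hq hx'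
      have h2 := ((hP x hx').const_mul K).exp
      have h3 : HasDerivWithinAt (fun t => N₀ + (t - t₀)) 1 (Ici x) x :=
        ((hasDerivWithinAt_id x _).sub_const t₀).const_add N₀
      exact h1.mul ((h3.mul h2).sub_const 1)
    · intro x hx hfx
      have hx1 := Ico_subset_Icc_self hx
      have hHx := hHh₀ x hx1
      have hHx0 : 0 < H x := hh₀0.trans_le hHx
      rw [hfx]
      have he : 1 ≤ Real.exp (K * P x) := Real.one_le_exp (mul_nonneg hK (hP0t x hx1))
      have e1 : H x * (g x - 1) * ((q + 1) * ∫ y, spow q (U x y) * Ut x y ∂μ) / H x =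
          ((q + 1) * ∫ y, spow q (U x y) * Ut x y ∂μ) * (g x - 1) := by
        field_simp
      have e2 : H x * (1 * Real.exp (K * P x) + (N₀ + (x - t₀)) * (Real.exp (K * P x) *
          (K * C x ^ 2))) = H x * Real.exp (K * P x) + K * C x ^ 2 * (H x * (g x - 1) + H x) := by
        simp only [hg]; ring
      rw [e1, e2]
      have : h₀ ≤ H x * Real.exp (K * P x) := hHx.trans (le_mul_of_one_le_right hHx0.le he)
      linarith
  obtain ⟨F, h, hS⟩ := hU.slice d (hsub hdd)
  refine (hS.energy_le_of_envelope_le hq hE hl₀ main).trans ?_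
  rw [mul_comm]
  refine mul_le_mul_of_nonneg_right ?_ (hH0 d)
  have h1 : P d ≤ P b := hPm (hsub' hdd) ⟨ht₀b.le, le_rfl⟩ hdb.le
  have h2 : 0 ≤ d - t₀ := sub_nonneg.2 hd.1
  have h3 : g d ≤ (N₀ + (b - t₀)) * Real.exp (K * P b) := by
    simp only [hg]
    gcongr
  linarith

/-- Up to the first zero t₁ of H the frequency is bounded, so H' ≥ -K(1 + C²)H and H·exp(K(t - t₀ +
∫C²)) is nondecreasing. It is positive at t₀, hence cannot vanish at t₁. -/
theorem norm_eq_zero (hU : IsSolution μ p q V E U Ut C t₀ b) (hp : 1 < p) (hq : 0 < q)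
    (hpq : q + 1 ≤ q * p) (hE : IsEnergy μ p q V E) (ht₀b : t₀ ≤ b)
    (hP : ∀ t ∈ Ico t₀ b, HasDerivWithinAt P (C t ^ 2) (Ici t) t) (hPc : ContinuousOn P (Icc t₀ b))
    (hP0 : P t₀ = 0) (hPm : MonotoneOn P (Icc t₀ b)) (hb : ∫ x, |U b x| ^ (q + 1) ∂μ = 0) :
    ∫ x, |U t₀ x| ^ (q + 1) ∂μ = 0 := by
  set H : ℝ → ℝ := fun s => ∫ x, |U s x| ^ (q + 1) ∂μ with hHdef
  have hH0 : ∀ t, 0 ≤ H t := fun t => integral_nonneg fun x => by positivity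
  by_contra hne
  have hHt₀ : 0 < H t₀ := lt_of_le_of_ne (hH0 t₀) (Ne.symm hne)
  have hHc := hU.continuousOn_norm hq
  have hZ : IsCompact (Icc t₀ b ∩ H ⁻¹' {0}) :=
    isCompact_Icc.of_isClosed_subset (hHc.preimage_isClosed_of_isClosed isClosed_Icc
      isClosed_singleton) inter_subset_left
  obtain ⟨t₁, ⟨ht₁, hHt₁⟩, hleast⟩ := hZ.exists_isLeast ⟨b, ⟨ht₀b, le_rfl⟩, hb⟩
  have hpos : ∀ t ∈ Ico t₀ t₁, 0 < H t := fun t ht => by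
    refine lt_of_le_of_ne (hH0 t) fun h => ?_
    exact absurd (hleast ⟨⟨ht.1, ht.2.le.trans ht₁.2⟩, h.symm⟩) (not_le.2 ht.2)
  obtain ⟨N, hN, hEN⟩ := hU.exists_frequency_bound hp hq hpq hE hP hPc hP0 hPm ht₁.2 hpos
  obtain ⟨Kb, hKb, hbd⟩ := IsSlice.exists_abs_integral_error_le μ p V E hq (τ := 1) one_pos
  set K := (q + 1) * (p * N + (p * N + Kb)) with hKdef
  have hp0 : 0 < p := by linarith
  have hK0 : 0 ≤ K := by positivity
  have hsub : Icc t₀ t₁ ⊆ Icc t₀ b := Icc_subset_Icc_right ht₁.2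
  have key := image_le_of_deriv_right_le_deriv_boundary (f := fun _ => H t₀) (f' := fun _ => 0)
    (B := fun t => H t * Real.exp (K * ((t - t₀) + P t)))
    (B' := fun t => ((q + 1) * ∫ x, spow q (U t x) * Ut t x ∂μ) * Real.exp (K * ((t - t₀) + P t)) +
      H t * (Real.exp (K * ((t - t₀) + P t)) * (K * (1 + C t ^ 2)))) (a := t₀) (b := t₁)
    continuousOn_const (fun x _ => hasDerivWithinAt_const _ _ _) (by simp [hP0]) ?_ ?_ ?_
    (right_mem_Icc.2 ht₁.1)
  · rw [show H t₁ = 0 from hHt₁, zero_mul] at key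
    linarith
  · refine (hHc.mono hsub).mul (Real.continuous_exp.comp_continuousOn
      (continuousOn_const.mul (ContinuousOn.add (by fun_prop) (hPc.mono hsub))))
  · intro x hx
    have hx' : x ∈ Ico t₀ b := ⟨hx.1, hx.2.trans_le ht₁.2⟩
    have h1 := hU.hasDerivWithinAt_norm hq hx'
    have h3 : HasDerivWithinAt (fun t => t - t₀) 1 (Ici x) x := (hasDerivWithinAt_id x _).sub_const t₀
    exact h1.mul (((h3.add (hP x hx')).const_mul K).exp)
  · intro x hx
    have hx' : x ∈ Ico t₀ b := ⟨hx.1, hx.2.trans_le ht₁.2⟩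
    obtain ⟨F, h, hS⟩ := hU.slice x hx'
    have h1 := (abs_le.1 (hbd (C x) _ _ F h hS)).1
    have h2 := hEN x hx
    have hC := hS.const_nonneg
    have hHx := hH0 x
    rw [hS.integral_spow_mul_ut hq]
    change -(C x * (1 * (p * E (fun y => spow q (U x y))) + Kb * H x)) ≤ _ at h1
    change E (fun y => spow q (U x y)) ≤ N * H x at h2
    set e := ∫ y, spow q (U x y) * (Ut x y - F y) ∂μ
    set Ex := E (fun y => spow q (U x y))
    -- Thus only the integral of C² is needed, although the error enters H' linearly in C.
    have hC1 : C x ≤ 1 + C x ^ 2 := by nlinarith [sq_nonneg (C x - 1)]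
    have h3 : C x * (1 * (p * Ex) + Kb * H x) ≤ (1 + C x ^ 2) * ((p * N + Kb) * H x) := by
      calc _ ≤ C x * (1 * (p * (N * H x)) + Kb * H x) := by gcongr
        _ = C x * ((p * N + Kb) * H x) := by ring
        _ ≤ _ := by gcongr
    have h4 : p * Ex ≤ (1 + C x ^ 2) * (p * N * H x) := by
      calc p * Ex ≤ p * (N * H x) := by gcongr
        _ = 1 * (p * N * H x) := by ring
        _ ≤ _ := by gcongr; nlinarith [sq_nonneg (C x)]
    have h5 : 0 ≤ (q + 1) * (e - p * Ex) + H x * (K * (1 + C x ^ 2)) := by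
      have : (q + 1) * (e - p * Ex) + H x * (K * (1 + C x ^ 2)) = (q + 1) * (e - p * Ex +
        (1 + C x ^ 2) * (p * N * H x) + (1 + C x ^ 2) * ((p * N + Kb) * H x)) := by rw [hKdef]; ring
      rw [this]
      exact mul_nonneg (by positivity) (by linarith)
    have h6 := mul_nonneg h5 (Real.exp_pos (K * ((x - t₀) + P x))).le
    linarith

end IsSolution

end Curve

end ParabolicFrequency

namespace ParabolicFrequency

/-! ### Mollification in a finite-dimensional space. -/

section Mollify

variable {X : Type*} [NormedAddCommGroup X] [NormedSpace ℝ X] [FiniteDimensional ℝ X]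
  [MeasureSpace X] [BorelSpace X] [(volume : Measure X).IsAddHaarMeasure]

variable (X) in
/-- A sequence of bump functions concentrating at the origin. -/
noncomputable def mollifier (k : ℕ) : ContDiffBump (0 : X) where
  rIn := 1 / (2 * ((k : ℝ) + 1))
  rOut := 1 / ((k : ℝ) + 1)
  rIn_pos := by positivity
  rIn_lt_rOut := by
    apply one_div_lt_one_div_of_lt (by positivity)
    have : (0 : ℝ) ≤ k := Nat.cast_nonneg k
    linarith

/-- The convolution of `f` with the `k`-th mollifier. -/
noncomputable def mollify (k : ℕ) (f : X → ℝ) : X → ℝ :=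
  MeasureTheory.convolution ((mollifier X k).normed volume) f (ContinuousLinearMap.lsmul ℝ ℝ) volume

theorem mollify_apply (k : ℕ) (f : X → ℝ) (x : X) :
    mollify k f x = ∫ y, (mollifier X k).normed volume (x - y) * f y := by
  simp [mollify, convolution_lsmul_swap]

theorem ae_tendsto_mollify {f : X → ℝ} (hf : LocallyIntegrable f) :
    ∀ᵐ x : X, Tendsto (fun k => mollify k f x) atTop (𝓝 (f x)) := by
  -- The outer radius is twice the inner one; a bounded ratio is what makes the bumps comparable to
  -- averages over balls.
  refine ContDiffBump.ae_convolution_tendsto_right_of_locallyIntegrable (K := 2)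
    tendsto_one_div_add_atTop_nhds_zero_nat (Eventually.of_forall fun k => le_of_eq ?_) hf
  simp only [mollifier]
  field_simp

theorem integrable_mollify_integrand (k : ℕ) {f : X → ℝ} (hf : LocallyIntegrable f) (x : X) :
    Integrable (fun y => (mollifier X k).normed volume (x - y) * f y) := by
  have h := (mollifier X k).hasCompactSupport_normed (μ := volume)
  have := (h.convolutionExists_left (ContinuousLinearMap.lsmul ℝ ℝ)
    (mollifier X k).continuous_normed hf) x
  simpa using this.integrable_swap

theorem integrable_mollifier_sub (k : ℕ) (x : X) :
    Integrable (fun y => (mollifier X k).normed volume (x - y)) :=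
  (mollifier X k).integrable_normed.comp_sub_left x

theorem integral_mollifier_sub (k : ℕ) (x : X) :
    ∫ y, (mollifier X k).normed volume (x - y) = 1 := by
  rw [integral_sub_left_eq_self (fun y => (mollifier X k).normed volume y)]
  exact (mollifier X k).integral_normed

theorem contDiff_mollify (k : ℕ) {f : X → ℝ} (hf : LocallyIntegrable f) :
    ContDiff ℝ ∞ (mollify k f) :=
  ((mollifier X k).hasCompactSupport_normed).contDiff_convolution_left _
    (mollifier X k).contDiff_normed hf

theorem mollify_eq_zero (k : ℕ) {f : X → ℝ} {x : X}
    (h : ∀ y, f y ≠ 0 → 1 / ((k : ℝ) + 1) ≤ dist x y) : mollify k f x = 0 := by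
  rw [mollify_apply]
  refine integral_eq_zero_of_ae (Eventually.of_forall fun y => ?_)
  by_cases hy : f y = 0
  · simp [hy]
  have : x - y ∉ Function.support ((mollifier X k).normed (volume : Measure X)) := by
    rw [ContDiffBump.support_normed_eq]
    simpa [mollifier, ← dist_eq_norm] using h y hy
  simp [Function.notMem_support.1 this]

theorem tsupport_mollify_subset (k : ℕ) (f : X → ℝ) :
    tsupport (mollify k f) ⊆ Metric.cthickening (1 / ((k : ℝ) + 1)) (tsupport f) := by
  refine closure_minimal (fun x hx => ?_) Metric.isClosed_cthickening
  by_contra hne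
  refine hx (mollify_eq_zero k fun y hy => ?_)
  by_contra hlt
  exact hne (Metric.mem_cthickening_of_dist_le x y _ _ (subset_tsupport f hy) (not_le.1 hlt).le)

theorem abs_mollify_le (k : ℕ) {f : X → ℝ} {B : ℝ}
    (hB : ∀ y, |f y| ≤ B) (x : X) : |mollify k f x| ≤ B := by
  rw [mollify_apply]
  have h1 := norm_integral_le_of_norm_le ((integrable_mollifier_sub k x).mul_const B)
    (f := fun y => (mollifier X k).normed volume (x - y) * f y) (Eventually.of_forall fun y => by
      rw [norm_mul, Real.norm_of_nonneg ((mollifier X k).nonneg_normed _)]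
      exact mul_le_mul_of_nonneg_left (hB y) ((mollifier X k).nonneg_normed _))
  rwa [integral_mul_const, integral_mollifier_sub, one_mul] at h1

/-- Jensen's inequality: the supporting line of |s|^r/r at the mollified value is integrated against
a kernel of mass one, and its linear part cancels. -/
theorem abs_mollify_rpow_le (k : ℕ) {r : ℝ} (hr : 1 ≤ r) {f : X → ℝ} (hf : LocallyIntegrable f)
    (hfr : LocallyIntegrable fun x => |f x| ^ r) (x : X) :
    |mollify k f x| ^ r ≤ mollify k (fun y => |f y| ^ r) x := by
  have i1 := integrable_mollify_integrand k hf x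
  have i2 := integrable_mollify_integrand k hfr x
  have i3 := integrable_mollifier_sub k x
  have hnn : ∀ y, 0 ≤ (mollifier X k).normed volume (x - y) := fun y =>
    (mollifier X k).nonneg_normed _
  rcases hr.eq_or_lt with rfl | hr
  · simp only [Real.rpow_one] at *
    rw [mollify_apply, mollify_apply]
    refine abs_integral_le_integral_abs.trans (le_of_eq ?_)
    congr 1; funext y
    rw [abs_mul, abs_of_nonneg (hnn y)]
  · have hq : 0 < r - 1 := by linarith
    set m := mollify k f x with hm
    have key : ∀ y, (mollifier X k).normed volume (x - y) * (|m| ^ r / r) +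
        ((mollifier X k).normed volume (x - y) * f y * spow (r - 1) m -
          (mollifier X k).normed volume (x - y) * (m * spow (r - 1) m)) ≤
        (mollifier X k).normed volume (x - y) * |f y| ^ r / r := by
      intro y
      have := mul_le_mul_of_nonneg_left (rpow_subgradient hq m (f y)) (hnn y)
      rw [sub_add_cancel] at this
      rw [mul_div_assoc]
      refine le_trans (le_of_eq ?_) this
      ring
    have i4 : Integrable (fun y => (mollifier X k).normed volume (x - y) * f y * spow (r - 1) m -
          (mollifier X k).normed volume (x - y) * (m * spow (r - 1) m)) :=
      (i1.mul_const _).sub (i3.mul_const _)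
    have := integral_mono ((i3.mul_const (|m| ^ r / r)).add i4) (i2.div_const r) key
    simp only [Pi.add_apply] at this
    rw [integral_add (i3.mul_const _) i4, integral_sub (i1.mul_const _) (i3.mul_const _),
      integral_mul_const, integral_mul_const, integral_mul_const, integral_mollifier_sub,
      ← mollify_apply, integral_div, ← mollify_apply, ← hm, one_mul, one_mul, sub_self, add_zero] at this
    exact (div_le_div_iff_of_pos_right (by linarith)).1 this

theorem integrable_mollify (k : ℕ) {f : X → ℝ} (hf : Integrable f) : Integrable (mollify k f) :=
  (mollifier X k).integrable_normed.integrable_convolution _ hf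

theorem integral_mollify (k : ℕ) {f : X → ℝ} (hf : Integrable f) :
    ∫ x, mollify k f x = ∫ x, f x := by
  have := integral_convolution (ContinuousLinearMap.lsmul ℝ ℝ)
    ((mollifier X k).integrable_normed (μ := volume)) hf
  rw [mollify, this]
  simp [ContDiffBump.integral_normed]

/-- Mollifications converge in `L^r`. -/
theorem tendsto_integral_mollify_sub {r : ℝ} (hr : 1 ≤ r) {f : X → ℝ} (hf : LocallyIntegrable f)
    (hfr : Integrable fun x => |f x| ^ r) :
    Tendsto (fun k => ∫ x, |mollify k f x - f x| ^ r) atTop (𝓝 0) := by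
  have hr0 : 0 < r := by linarith
  set g : X → ℝ := fun x => |f x| ^ r with hg
  set a : ℕ → X → ℝ := fun k x => |mollify k f x - f x| ^ r with ha
  have hg0 : ∀ x, 0 ≤ g x := fun x => by positivity
  have hmg : ∀ k x, 0 ≤ mollify k g x := fun k x => by
    rw [mollify_apply]
    exact integral_nonneg fun y => mul_nonneg ((mollifier X k).nonneg_normed _) (hg0 y)
  have hfm : AEStronglyMeasurable f := hf.aestronglyMeasurable
  have hkm : ∀ k, AEStronglyMeasurable (mollify k f) := fun k =>
    (contDiff_mollify k hf).continuous.aestronglyMeasurable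
  have hgm : AEStronglyMeasurable g := hfr.aestronglyMeasurable
  have hgkm : ∀ k, AEStronglyMeasurable (mollify k g) := fun k =>
    (integrable_mollify k hfr).aestronglyMeasurable
  have ham : ∀ k, AEStronglyMeasurable (a k) := fun k =>
    (((hkm k).sub hfm).norm.aemeasurable.pow_const r).aestronglyMeasurable
  -- Scheffé's argument: this part of the difference is dominated by g, and the opposite part has
  -- the same integral because mollification preserves integrals. So the mollified g converge to g
  -- in L¹.
  have h1 : Tendsto (fun k => ∫ x, max (g x - mollify k g x) 0) atTop (𝓝 0) := by
    have := tendsto_integral_of_dominated_convergence (μ := (volume : Measure X))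
      (F := fun k x => max (g x - mollify k g x) 0)
      (f := fun _ => (0 : ℝ)) g (fun k => (hgm.sub (hgkm k)).sup aestronglyMeasurable_const) hfr
      (fun k => Eventually.of_forall fun x => by
        rw [Real.norm_of_nonneg (le_max_right _ _)]
        exact max_le (by linarith [hmg k x]) (hg0 x)) (by
        filter_upwards [ae_tendsto_mollify hfr.locallyIntegrable] with x hx
        have := (hx.const_sub (g x)).max (tendsto_const_nhds (x := (0 : ℝ)))
        simpa using this)
    simpa using this
  have h2 : Tendsto (fun k => ∫ x, max (mollify k g x - g x) 0) atTop (𝓝 0) := by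
    refine h1.congr fun k => ?_
    have i1 : Integrable (fun x => mollify k g x - g x) := (integrable_mollify k hfr).sub hfr
    have i2 : Integrable (fun x => max (g x - mollify k g x) 0) :=
      (hfr.sub (integrable_mollify k hfr)).pos_part
    have : ∀ x, max (mollify k g x - g x) 0 = (mollify k g x - g x) + max (g x - mollify k g x) 0 := by
      intro x
      rcases le_total (g x) (mollify k g x) with h | h
      · rw [max_eq_left (by linarith), max_eq_right (by linarith)]; ring
      · rw [max_eq_right (by linarith), max_eq_left (by linarith)]; ring
    simp_rw [this]
    rw [integral_add i1 i2, integral_sub (integrable_mollify k hfr) hfr, integral_mollify k hfr,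
      sub_self, zero_add]
  -- By Jensen the integrand is at most 2^r times the sum of g and its mollification. Capped at
  -- 2^r·2g it is handled by dominated convergence, and the excess over the cap by the L¹
  -- convergence.
  have h3 : Tendsto (fun k => ∫ x, min (a k x) (2 ^ r * (2 * g x))) atTop (𝓝 0) := by
    have := tendsto_integral_of_dominated_convergence (μ := (volume : Measure X))
      (F := fun k x => min (a k x) (2 ^ r * (2 * g x)))
      (f := fun _ => (0 : ℝ)) (fun x => 2 ^ r * (2 * g x))
      (fun k => (ham k).inf ((hgm.const_mul 2).const_mul _)) ((hfr.const_mul 2).const_mul _)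
      (fun k => Eventually.of_forall fun x => by
        have h0 : 0 ≤ a k x := by simp only [ha]; positivity
        have h0' := hg0 x
        rw [Real.norm_of_nonneg (le_min h0 (by positivity))]
        exact min_le_right _ _) (by
        filter_upwards [ae_tendsto_mollify hf] with x hx
        have h4 := (Real.continuous_rpow_const hr0.le).tendsto |f x - f x| |>.comp
          (hx.sub_const (f x)).abs
        rw [sub_self, abs_zero, Real.zero_rpow hr0.ne'] at h4
        have h0' := hg0 x
        have h5 := h4.min (tendsto_const_nhds (x := 2 ^ r * (2 * g x)))
        rw [min_eq_left (by positivity)] at h5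
        exact h5)
    simpa using this
  have h4 := h3.add (h2.const_mul (2 ^ r))
  rw [mul_zero, add_zero] at h4
  refine squeeze_zero (fun k => integral_nonneg fun x => by positivity) (fun k => ?_) h4
  have i1 : Integrable (fun x => min (a k x) (2 ^ r * (2 * g x))) :=
    ((hfr.const_mul 2).const_mul (2 ^ r)).mono' ((ham k).inf ((hgm.const_mul 2).const_mul _))
      (Eventually.of_forall fun x => by
        have h0 : 0 ≤ a k x := by simp only [ha]; positivity
        have h0' := hg0 x
        rw [Real.norm_of_nonneg (le_min h0 (by positivity))]
        exact min_le_right _ _)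
  have i2 : Integrable (fun x => max (mollify k g x - g x) 0) :=
    ((integrable_mollify k hfr).sub hfr).pos_part
  rw [← integral_const_mul, ← integral_add i1 (i2.const_mul _)]
  refine integral_mono_of_nonneg (Eventually.of_forall fun x => by positivity)
    (i1.add (i2.const_mul _)) (Eventually.of_forall fun x => ?_)
  have h5 : a k x ≤ 2 ^ r * (mollify k g x + g x) := by
    have e1 : |mollify k f x - f x| ≤ |mollify k f x| + |f x| := abs_sub _ _
    refine (Real.rpow_le_rpow (abs_nonneg _) e1 hr0.le).trans ?_
    refine (add_rpow_le_two_mul hr0.le (abs_nonneg _) (abs_nonneg _)).trans ?_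
    have := abs_mollify_rpow_le k hr hf hfr.locallyIntegrable x
    gcongr
  have h6 : (0 : ℝ) ≤ 2 ^ r := by positivity
  have h7 : mollify k g x + g x ≤ 2 * g x + max (mollify k g x - g x) 0 := by
    linarith [le_max_left (mollify k g x - g x) 0]
  have h8 := mul_le_mul_of_nonneg_left h7 h6
  have h9 : 0 ≤ 2 ^ r * max (mollify k g x - g x) 0 := mul_nonneg h6 (le_max_right _ _)
  rcases le_total (a k x) (2 ^ r * (2 * g x)) with h | h
  · simp only [min_eq_left h]; linarith
  · simp only [min_eq_right h]; linarith

end Mollify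

end ParabolicFrequency

namespace ParabolicFrequency

set_option linter.unusedSectionVars false

/-! ### Weak directional derivatives. -/

section WeakDeriv

variable {X : Type*} [NormedAddCommGroup X] [NormedSpace ℝ X] [FiniteDimensional ℝ X]
  [MeasureSpace X] [BorelSpace X] [(volume : Measure X).IsAddHaarMeasure]
  {Ω : Set X} {v : X} {f g f' g' h j ψ : X → ℝ}

/-- `g` is the weak derivative of `f` in the direction `v` on `Ω`. -/
def HasWeakDeriv (Ω : Set X) (v : X) (f g : X → ℝ) : Prop :=
  LocallyIntegrableOn f Ω ∧ LocallyIntegrableOn g Ω ∧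
    ∀ ψ : X → ℝ, ContDiff ℝ ∞ ψ → HasCompactSupport ψ → tsupport ψ ⊆ Ω →
      ∫ y, f y * fderiv ℝ ψ y v = -∫ y, g y * ψ y

theorem contDiff_of_tsupport {m : ℕ∞} (h : ∀ x ∈ tsupport f, ContDiffAt ℝ m f x) :
    ContDiff ℝ m f := by
  rw [contDiff_iff_contDiffAt]
  intro x
  by_cases hx : x ∈ tsupport f
  · exact h x hx
  · exact contDiffAt_const.congr_of_eventuallyEq (notMem_tsupport_iff_eventuallyEq.1 hx)

theorem hasCompactSupport_fderiv_apply (hc : HasCompactSupport ψ) (v : X) :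
    HasCompactSupport (fun y => fderiv ℝ ψ y v) :=
  hc.fderiv_apply (𝕜 := ℝ) v

theorem tsupport_fderiv_apply_subset' (v : X) :
    tsupport (fun y => fderiv ℝ ψ y v) ⊆ tsupport ψ :=
  tsupport_fderiv_apply_subset ℝ v

theorem integrable_mul_of_tsupport (hf : LocallyIntegrableOn f Ω) (hψ : Continuous ψ)
    (hc : HasCompactSupport ψ) (hs : tsupport ψ ⊆ Ω) : Integrable (fun y => f y * ψ y) := by
  rw [← integrableOn_iff_integrable_of_support_subset (s := tsupport ψ)]
  · exact (hf.integrableOn_compact_subset hs hc).mul_continuousOn hψ.continuousOn hc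
  · intro x hx
    refine subset_tsupport ψ fun h => hx ?_
    simp [h]

theorem locallyIntegrableOn_bdd_mul [LocallyCompactSpace X] (hΩ : IsOpen Ω)
    (hf : LocallyIntegrableOn f Ω) (hg : AEStronglyMeasurable g (volume.restrict Ω)) {B : ℝ}
    (hB : ∀ x, |g x| ≤ B) : LocallyIntegrableOn (fun x => g x * f x) Ω := by
  rw [locallyIntegrableOn_iff hΩ.isLocallyClosed] at hf ⊢
  exact fun k hk hkc => (hf k hk hkc).bdd_mul (hg.mono_measure (Measure.restrict_mono hk le_rfl))
    (Eventually.of_forall hB)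

theorem exists_cutoff (hΩ : IsOpen Ω) {K : Set X} (hK : IsCompact K) (hKΩ : K ⊆ Ω) :
    ∃ η : X → ℝ, ContDiff ℝ ∞ η ∧ HasCompactSupport η ∧ tsupport η ⊆ Ω ∧
      (∀ x, 0 ≤ η x ∧ η x ≤ 1) ∧ ∀ x ∈ K, η =ᶠ[𝓝 x] 1 := by
  have : ProperSpace X := FiniteDimensional.proper ℝ X
  obtain ⟨L, hL, hKL, hLΩ⟩ := exists_compact_between hK hΩ hKΩ
  obtain ⟨η, h1, h2, h3⟩ := exists_contMDiffMap_one_nhds_of_subset_interior (n := ⊤) 𝓘(ℝ, X)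
    hK.isClosed hKL
  have hsup : tsupport η ⊆ L := closure_minimal (fun x hx => by
    by_contra hxL
    exact hx (h2 x hxL)) hL.isClosed
  refine ⟨η, η.contMDiff.contDiff, hL.of_isClosed_subset (isClosed_tsupport _) hsup,
    hsup.trans hLΩ, fun x => h3 x, fun x hx => ?_⟩
  exact (eventually_nhdsSet_iff_forall.1 h1) x hx

namespace HasWeakDeriv

theorem integrable_left (hf : HasWeakDeriv Ω v f g) (hψ : ContDiff ℝ ∞ ψ)
    (hc : HasCompactSupport ψ) (hs : tsupport ψ ⊆ Ω) :
    Integrable (fun y => f y * fderiv ℝ ψ y v) :=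
  integrable_mul_of_tsupport hf.1 ((hψ.continuous_fderiv (by simp)).clm_apply continuous_const)
    (hasCompactSupport_fderiv_apply hc v) ((tsupport_fderiv_apply_subset' v).trans hs)

theorem integrable_right (hf : HasWeakDeriv Ω v f g) (hψ : ContDiff ℝ ∞ ψ)
    (hc : HasCompactSupport ψ) (hs : tsupport ψ ⊆ Ω) : Integrable (fun y => g y * ψ y) :=
  integrable_mul_of_tsupport hf.2.1 hψ.continuous hc hs

theorem add (hf : HasWeakDeriv Ω v f g) (hf' : HasWeakDeriv Ω v f' g') :
    HasWeakDeriv Ω v (fun y => f y + f' y) (fun y => g y + g' y) := by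
  refine ⟨hf.1.add hf'.1, hf.2.1.add hf'.2.1, fun ψ h1 h2 h3 => ?_⟩
  simp only [add_mul]
  rw [integral_add (hf.integrable_left h1 h2 h3) (hf'.integrable_left h1 h2 h3),
    integral_add (hf.integrable_right h1 h2 h3) (hf'.integrable_right h1 h2 h3),
    hf.2.2 ψ h1 h2 h3, hf'.2.2 ψ h1 h2 h3]
  ring

theorem const_mul (hf : HasWeakDeriv Ω v f g) (c : ℝ) :
    HasWeakDeriv Ω v (fun y => c * f y) (fun y => c * g y) := by
  refine ⟨hf.1.smul c, hf.2.1.smul c, fun ψ h1 h2 h3 => ?_⟩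
  simp only [mul_assoc, integral_const_mul]
  rw [hf.2.2 ψ h1 h2 h3]
  ring

theorem aestronglyMeasurable_left (hf : HasWeakDeriv Ω v f g) :
    AEStronglyMeasurable f (volume.restrict Ω) := by
  have : ProperSpace X := FiniteDimensional.proper ℝ X
  exact hf.1.aestronglyMeasurable

theorem aestronglyMeasurable_right (hf : HasWeakDeriv Ω v f g) :
    AEStronglyMeasurable g (volume.restrict Ω) := by
  have : ProperSpace X := FiniteDimensional.proper ℝ X
  exact hf.2.1.aestronglyMeasurable

/-- Weak derivatives are unique. -/
theorem ae_eq (hΩ : IsOpen Ω) (hf : HasWeakDeriv Ω v f g) (hf' : HasWeakDeriv Ω v f g') :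
    ∀ᵐ x, x ∈ Ω → g x = g' x := by
  have := hΩ.ae_eq_zero_of_integral_contDiff_smul_eq_zero (hf.2.1.sub hf'.2.1) fun ψ h1 h2 h3 => by
    have e1 := hf.2.2 ψ h1 h2 h3
    rw [hf'.2.2 ψ h1 h2 h3, neg_inj] at e1
    have e2 : ∀ x, ψ x • (g - g') x = g x * ψ x - g' x * ψ x := fun x => by
      simp only [Pi.sub_apply, smul_eq_mul]; ring
    simp_rw [e2]
    rw [integral_sub (hf.integrable_right h1 h2 h3) (hf'.integrable_right h1 h2 h3), e1, sub_self]
  filter_upwards [this] with x hx hxΩ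
  exact sub_eq_zero.1 (hx hxΩ)

theorem _root_.ParabolicFrequency.contDiff_mul_of_tsupport (hΩ : IsOpen Ω) {ρ : X → ℝ}
    (hρ : ContDiffOn ℝ ∞ ρ Ω) (h1 : ContDiff ℝ ∞ ψ) (h3 : tsupport ψ ⊆ Ω) :
    ContDiff ℝ ∞ (fun y => ρ y * ψ y) :=
  contDiff_of_tsupport fun _ hx =>
    (hρ.contDiffAt (hΩ.mem_nhds (h3 (tsupport_mul_subset_right hx)))).mul h1.contDiffAt

/-- The product rule for a smooth factor. -/
theorem smooth_mul (hΩ : IsOpen Ω) (hf : HasWeakDeriv Ω v f g) {ρ : X → ℝ}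
    (hρ : ContDiffOn ℝ ∞ ρ Ω) :
    HasWeakDeriv Ω v (fun y => ρ y * f y) (fun y => ρ y * g y + fderiv ℝ ρ y v * f y) := by
  have : ProperSpace X := FiniteDimensional.proper ℝ X
  have hc' : ContinuousOn (fun y => fderiv ℝ ρ y v) Ω :=
    ((hρ.continuousOn_fderiv_of_isOpen hΩ (by simp))).clm_apply continuousOn_const
  have hmul : ∀ {a b : X → ℝ}, ContinuousOn a Ω → LocallyIntegrableOn b Ω →
      LocallyIntegrableOn (fun y => a y * b y) Ω := fun {a b} ha hb => by
    rw [locallyIntegrableOn_iff hΩ.isLocallyClosed] at hb ⊢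
    exact fun k hk hkc => (hb k hk hkc).continuousOn_mul (ha.mono hk) hkc
  refine ⟨hmul hρ.continuousOn hf.1, (hmul hρ.continuousOn hf.2.1).add (hmul hc' hf.1),
    fun ψ h1 h2 h3 => ?_⟩
  have hρψ := contDiff_mul_of_tsupport hΩ hρ h1 h3
  have hs : tsupport (fun y => ρ y * ψ y) ⊆ Ω := tsupport_mul_subset_right.trans h3
  have hcs : HasCompactSupport (fun y => ρ y * ψ y) := h2.mul_left
  have key := hf.2.2 _ hρψ hcs hs
  have i1 := integrable_mul_of_tsupport (hmul hρ.continuousOn hf.1)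
    ((h1.continuous_fderiv (by simp)).clm_apply (continuous_const (y := v)))
    (hasCompactSupport_fderiv_apply h2 v) ((tsupport_fderiv_apply_subset' v).trans h3)
  have i2 := integrable_mul_of_tsupport (hmul hc' hf.1) h1.continuous h2 h3
  have i3 := integrable_mul_of_tsupport (hmul hρ.continuousOn hf.2.1) h1.continuous h2 h3
  have e1 : ∀ y, f y * fderiv ℝ (fun y => ρ y * ψ y) y v =
      ρ y * f y * fderiv ℝ ψ y v + fderiv ℝ ρ y v * f y * ψ y := by
    intro y
    by_cases hy : y ∈ tsupport ψ
    · have d1 : DifferentiableAt ℝ ρ y :=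
        (hρ.contDiffAt (hΩ.mem_nhds (h3 hy))).differentiableAt (by simp)
      rw [fderiv_fun_mul d1 (h1.differentiable (by simp) y)]
      simp only [add_apply, smul_apply, smul_eq_mul]
      ring
    · have z1 : fderiv ℝ (fun y => ρ y * ψ y) y = 0 := by
        have := (notMem_tsupport_iff_eventuallyEq.1 (fun h => hy (tsupport_mul_subset_right h)) :
          (fun y => ρ y * ψ y) =ᶠ[𝓝 y] 0)
        rw [this.fderiv_eq]; simp
      have z2 : fderiv ℝ ψ y = 0 := by
        rw [(notMem_tsupport_iff_eventuallyEq.1 hy).fderiv_eq]; simp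
      have z3 : ψ y = 0 := image_eq_zero_of_notMem_tsupport hy
      simp [z1, z2, z3]
  simp_rw [e1] at key
  rw [integral_add i1 i2] at key
  have e2 : ∀ y, g y * (ρ y * ψ y) = ρ y * g y * ψ y := fun y => by ring
  simp_rw [e2] at key
  simp_rw [add_mul]
  rw [integral_add i3 i2]
  linarith

/-- Multiplication with a cutoff function makes weak derivatives global. -/
theorem cutoff (hf : HasWeakDeriv Ω v f g) {η : X → ℝ} (hη : ContDiff ℝ ∞ η)
    (hc : HasCompactSupport η) (hs : tsupport η ⊆ Ω) :
    Integrable (fun y => η y * f y) ∧ Integrable (fun y => η y * g y + fderiv ℝ η y v * f y) ∧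
    HasWeakDeriv univ v (fun y => η y * f y) (fun y => η y * g y + fderiv ℝ η y v * f y) := by
  have hη' : Continuous (fun y => fderiv ℝ η y v) :=
    (hη.continuous_fderiv (by simp)).clm_apply continuous_const
  have i1 : Integrable (fun y => η y * f y) := by
    simpa only [mul_comm] using integrable_mul_of_tsupport hf.1 hη.continuous hc hs
  have i2 : Integrable (fun y => η y * g y + fderiv ℝ η y v * f y) := by
    refine Integrable.add ?_ ?_
    · simpa only [mul_comm] using integrable_mul_of_tsupport hf.2.1 hη.continuous hc hs
    · simpa only [mul_comm] using integrable_mul_of_tsupport hf.1 hη'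
        (hasCompactSupport_fderiv_apply hc v) ((tsupport_fderiv_apply_subset' v).trans hs)
  refine ⟨i1, i2, i1.locallyIntegrable.locallyIntegrableOn _,
    i2.locallyIntegrable.locallyIntegrableOn _, fun ψ h1 h2 _ => ?_⟩
  have hs' : tsupport (fun y => η y * ψ y) ⊆ Ω := tsupport_mul_subset_left.trans hs
  have key := hf.2.2 (fun y => η y * ψ y) (hη.mul h1) h2.mul_left hs'
  have j1 := integrable_mul_of_tsupport (i1.locallyIntegrable.locallyIntegrableOn univ)
    ((h1.continuous_fderiv (by simp)).clm_apply (continuous_const (y := v)))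
    (hasCompactSupport_fderiv_apply h2 v) (subset_univ _)
  have j2 : Integrable (fun y => fderiv ℝ η y v * f y * ψ y) := by
    have := integrable_mul_of_tsupport hf.1 (hη'.mul h1.continuous) h2.mul_left
      ((tsupport_mul_subset_left.trans (tsupport_fderiv_apply_subset' v)).trans hs)
    refine this.congr (Eventually.of_forall fun y => ?_)
    simp only [Pi.mul_apply]; ring
  have j3 : Integrable (fun y => η y * g y * ψ y) := by
    refine (integrable_mul_of_tsupport hf.2.1 (hη.continuous.mul h1.continuous) h2.mul_left
      hs').congr (Eventually.of_forall fun y => ?_)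
    simp only [Pi.mul_apply]; ring
  have e1 : ∀ y, f y * fderiv ℝ (fun y => η y * ψ y) y v =
      η y * f y * fderiv ℝ ψ y v + fderiv ℝ η y v * f y * ψ y := by
    intro y
    rw [fderiv_fun_mul (hη.differentiable (by simp) y) (h1.differentiable (by simp) y)]
    simp only [add_apply, smul_apply, smul_eq_mul]
    ring
  simp_rw [e1] at key
  rw [integral_add j1 j2] at key
  have e2 : ∀ y, g y * (η y * ψ y) = η y * g y * ψ y := fun y => by ring
  simp_rw [e2] at key
  simp_rw [add_mul]
  rw [integral_add j3 j2]
  linarith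

/-- Mollification commutes with weak derivatives. -/
theorem fderiv_mollify (hf : HasWeakDeriv univ v f g) (k : ℕ) (x : X) :
    fderiv ℝ (mollify k f) x v = mollify k g x := by
  have hfl : LocallyIntegrable f := locallyIntegrableOn_univ.1 hf.1
  have hc := (mollifier X k).hasCompactSupport_normed (μ := (volume : Measure X))
  have hsm : ContDiff ℝ ∞ ((mollifier X k).normed (volume : Measure X)) :=
    (mollifier X k).contDiff_normed
  have hsm1 : ContDiff ℝ 1 ((mollifier X k).normed (volume : Measure X)) :=
    (mollifier X k).contDiff_normed
  have hd := hc.hasFDerivAt_convolution_left (ContinuousLinearMap.lsmul ℝ ℝ) hsm1 hfl x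
  have hint : Integrable (fun y => ((ContinuousLinearMap.lsmul ℝ ℝ).precompL X
      (fderiv ℝ ((mollifier X k).normed volume) (x - y))) (f y)) :=
    ((hc.fderiv (𝕜 := ℝ)).convolutionExists_left _ (hsm1.continuous_fderiv (by simp)) hfl
      x).integrable_swap
  rw [mollify, hd.fderiv, convolution_eq_swap, ← ContinuousLinearMap.apply_apply (𝕜 := ℝ) v,
    ← ContinuousLinearMap.integral_comp_comm _ hint]
  have hψ : ContDiff ℝ ∞ (fun y => (mollifier X k).normed (volume : Measure X) (x - y)) :=
    hsm.comp (contDiff_const.sub contDiff_id)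
  have hψc : HasCompactSupport (fun y => (mollifier X k).normed (volume : Measure X) (x - y)) :=
    hc.comp_homeomorph (Homeomorph.subLeft x)
  have key := hf.2.2 _ hψ hψc (subset_univ _)
  have e1 : ∀ y, fderiv ℝ (fun y => (mollifier X k).normed (volume : Measure X) (x - y)) y v =
      -fderiv ℝ ((mollifier X k).normed (volume : Measure X)) (x - y) v := by
    intro y
    have h1 := (hsm.differentiable (by simp) (x - y)).hasFDerivAt.comp y
      ((hasFDerivAt_id y).const_sub x)
    have h2 : HasFDerivAt (fun y => (mollifier X k).normed (volume : Measure X) (x - y)) _ y := h1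
    rw [h2.fderiv]
    simp
  simp_rw [e1, mul_neg] at key
  rw [integral_neg, neg_inj] at key
  have e2 : ∫ y, g y * (mollifier X k).normed (volume : Measure X) (x - y) = mollify k g x := by
    rw [mollify_apply]
    simp_rw [mul_comm]
  rw [mollify, ← mollify, ← e2, ← key]
  congr 1
  funext y
  simp [mul_comm]

theorem of_contDiff {u : X → ℝ} (hu : ContDiff ℝ ∞ u) (v : X) :
    HasWeakDeriv univ v u (fun y => fderiv ℝ u y v) := by
  have hc : Continuous (fun y => fderiv ℝ u y v) :=
    (hu.continuous_fderiv (by simp)).clm_apply continuous_const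
  have : ProperSpace X := FiniteDimensional.proper ℝ X
  refine ⟨hu.continuous.locallyIntegrable.locallyIntegrableOn _,
    hc.locallyIntegrable.locallyIntegrableOn _, fun ψ h1 h2 h3 => ?_⟩
  have hcψ : Continuous (fun y => fderiv ℝ ψ y v) :=
    (h1.continuous_fderiv (by simp)).clm_apply continuous_const
  exact integral_mul_fderiv_eq_neg_fderiv_mul_of_integrable
    (integrable_mul_of_tsupport (hc.locallyIntegrable.locallyIntegrableOn _) h1.continuous h2 h3)
    (integrable_mul_of_tsupport (hu.continuous.locallyIntegrable.locallyIntegrableOn _) hcψ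
      (hasCompactSupport_fderiv_apply h2 v) (subset_univ _))
    (integrable_mul_of_tsupport (hu.continuous.locallyIntegrable.locallyIntegrableOn _)
      h1.continuous h2 h3)
    (fun x _ => hu.differentiable (by simp) x) (fun x _ => h1.differentiable (by simp) x)

/-- Locally Lipschitz functions are weakly differentiable. -/
theorem of_locallyLipschitzOn (hΩ : IsOpen Ω) {u : X → ℝ} (hu : LocallyLipschitzOn Ω u) (v : X) :
    HasWeakDeriv Ω v u (fun y => fderiv ℝ u y v) ∧ ∀ᵐ y, y ∈ Ω → DifferentiableAt ℝ u y := by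
  have : ProperSpace X := FiniteDimensional.proper ℝ X
  -- Locally u agrees with a globally Lipschitz function, to which Rademacher's theorem applies;
  -- countably many such neighbourhoods cover Ω.
  have loc : ∀ x ∈ Ω, ∃ (U : Set X) (H : X → ℝ) (L : NNReal), IsOpen U ∧ x ∈ U ∧ U ⊆ Ω ∧
      LipschitzWith L H ∧ EqOn u H U := by
    intro x hx
    obtain ⟨L, t, ht, hL⟩ := hu hx
    rw [hΩ.nhdsWithin_eq hx] at ht
    obtain ⟨H, hH, hE⟩ := hL.extend_real
    obtain ⟨U, hUt, hU, hxU⟩ := mem_nhds_iff.1 (inter_mem ht (hΩ.mem_nhds hx))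
    exact ⟨U, H, L, hU, hxU, fun y hy => (hUt hy).2, hH, fun y hy => hE (hUt hy).1⟩
  have hdiff : ∀ᵐ y, y ∈ Ω → DifferentiableAt ℝ u y := by
    rw [← ae_restrict_iff' hΩ.measurableSet]
    choose! U H L hU hxU hUΩ hH hE using loc
    obtain ⟨t, htΩ, htc, ht⟩ := TopologicalSpace.countable_cover_nhdsWithin (s := Ω) (f := U)
      (fun x hx => mem_nhdsWithin_of_mem_nhds ((hU x hx).mem_nhds (hxU x hx)))
    rw [ae_restrict_iff' hΩ.measurableSet]
    have : ∀ᵐ y, ∀ x ∈ t, DifferentiableAt ℝ (H x) y :=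
      (ae_ball_iff htc).2 fun x hx => (hH x (htΩ hx)).ae_differentiableAt
    filter_upwards [this] with y hy hyΩ
    obtain ⟨x, hxt, hyU⟩ := mem_iUnion₂.1 (ht hyΩ)
    refine (hy x hxt).congr_of_eventuallyEq ?_
    exact (hE x (htΩ hxt)).eventuallyEq_of_mem ((hU x (htΩ hxt)).mem_nhds hyU)
  have hbd : LocallyIntegrableOn (fun y => fderiv ℝ u y v) Ω := by
    intro x hx
    obtain ⟨U, H, L, hU, hxU, hUΩ, hH, hE⟩ := loc x hx
    obtain ⟨r, hr, hrU⟩ := Metric.isOpen_iff.1 hU x hxU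
    refine ⟨Metric.ball x r, mem_nhdsWithin_of_mem_nhds (Metric.ball_mem_nhds x hr), ?_⟩
    refine Measure.integrableOn_of_bounded (M := L * ‖v‖) measure_ball_lt_top.ne
      ((measurable_fderiv_apply_const ℝ u v).aestronglyMeasurable) ?_
    refine (ae_restrict_iff' measurableSet_ball).2 (Eventually.of_forall fun y hy => ?_)
    have e : u =ᶠ[𝓝 y] H := hE.eventuallyEq_of_mem (hU.mem_nhds (hrU hy))
    rw [e.fderiv_eq]
    exact (ContinuousLinearMap.le_opNorm _ _).trans
      (mul_le_mul_of_nonneg_right (norm_fderiv_le_of_lipschitz ℝ hH) (norm_nonneg _))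
  refine ⟨⟨hu.continuousOn.locallyIntegrableOn hΩ.measurableSet, hbd, fun ψ h1 h2 h3 => ?_⟩, hdiff⟩
  obtain ⟨K, hK, hψK, hKΩ⟩ := exists_compact_between h2 hΩ h3
  obtain ⟨L, hL⟩ := (hu.mono hKΩ).exists_lipschitzOnWith_of_compact hK
  obtain ⟨H, hH, hE⟩ := hL.extend_real
  have hψL : ∃ D, LipschitzWith D ψ :=
    ContDiff.lipschitzWith_of_hasCompactSupport h2 h1 (by simp)
  obtain ⟨D, hD⟩ := hψL
  have key := hH.integral_lineDeriv_mul_eq (μ := volume) hD h2 v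
  have e1 : ∀ y, u y * fderiv ℝ ψ y v = -(lineDeriv ℝ ψ y (-v) * H y) := by
    intro y
    by_cases hy : y ∈ tsupport ψ
    · rw [lineDeriv_neg, (h1.differentiable (by simp) y).lineDeriv_eq_fderiv,
        hE (interior_subset (hψK hy))]
      ring
    · have z2 : fderiv ℝ ψ y = 0 := by
        rw [(notMem_tsupport_iff_eventuallyEq.1 hy).fderiv_eq]; simp
      rw [lineDeriv_neg, (h1.differentiable (by simp) y).lineDeriv_eq_fderiv, z2]
      simp
  simp_rw [e1]
  rw [integral_neg, ← key, neg_inj]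
  refine integral_congr_ae ?_
  filter_upwards [hH.ae_differentiableAt (μ := volume)] with y hy
  by_cases hyt : y ∈ tsupport ψ
  · have e : u =ᶠ[𝓝 y] H := (hE.mono interior_subset).eventuallyEq_of_mem
      (isOpen_interior.mem_nhds (hψK hyt))
    rw [hy.lineDeriv_eq_fderiv, e.fderiv_eq]
  · rw [image_eq_zero_of_notMem_tsupport hyt]; simp

end HasWeakDeriv

end WeakDeriv

end ParabolicFrequency

namespace ParabolicFrequency

/-! ### Product and chain rules by approximation. -/

section Limits

variable {α : Type*} [MeasurableSpace α] {μ : Measure α}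

theorem tendsto_integral_mul_of_bounded {w a : α → ℝ} {s : ℕ → α → ℝ} {B : ℝ}
    (hw : Integrable w μ) (hs : ∀ k, AEStronglyMeasurable (s k) μ) (hB : ∀ k x, |s k x| ≤ B)
    (hl : ∀ᵐ x ∂μ, Tendsto (fun k => s k x) atTop (𝓝 (a x))) :
    Tendsto (fun k => ∫ x, w x * s k x ∂μ) atTop (𝓝 (∫ x, w x * a x ∂μ)) := by
  refine tendsto_integral_of_dominated_convergence (fun x => |w x| * B)
    (fun k => hw.1.mul (hs k)) (hw.abs.mul_const B)
    (fun k => Eventually.of_forall fun x => ?_) ?_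
  · rw [norm_mul, Real.norm_eq_abs, Real.norm_eq_abs]
    exact mul_le_mul_of_nonneg_left (hB k x) (abs_nonneg _)
  · filter_upwards [hl] with x hx using hx.const_mul _

/-- The weights are only bounded and may fail to converge here; L¹ convergence of the other factor
lets it be replaced by its limit. -/
theorem tendsto_integral_bounded_mul {w : ℕ → α → ℝ} {b : α → ℝ} {s : ℕ → α → ℝ} {A : ℝ}
    (hw : ∀ k, AEStronglyMeasurable (w k) μ) (hA : ∀ k x, |w k x| ≤ A) (hb : Integrable b μ)
    (hs : ∀ k, Integrable (s k) μ)
    (hl : Tendsto (fun k => ∫ x, |s k x - b x| ∂μ) atTop (𝓝 0)) :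
    Tendsto (fun k => ∫ x, w k x * s k x ∂μ - ∫ x, w k x * b x ∂μ) atTop (𝓝 0) := by
  have h1 := hl.const_mul A
  rw [mul_zero] at h1
  refine squeeze_zero_norm (fun k => ?_) h1
  have i1 : Integrable (fun x => w k x * s k x) μ := (hs k).bdd_mul (hw k) (Eventually.of_forall (hA k))
  have i2 : Integrable (fun x => w k x * b x) μ := hb.bdd_mul (hw k) (Eventually.of_forall (hA k))
  rw [← integral_sub i1 i2, ← integral_const_mul]
  refine norm_integral_le_of_norm_le ((((hs k).sub hb).abs).const_mul A)
    (Eventually.of_forall fun x => ?_)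
  rw [← mul_sub, norm_mul, Real.norm_eq_abs, Real.norm_eq_abs]
  exact mul_le_mul_of_nonneg_right (hA k x) (abs_nonneg _)

end Limits

section WeakDeriv

variable {X : Type*} [NormedAddCommGroup X] [NormedSpace ℝ X] [FiniteDimensional ℝ X]
  [MeasureSpace X] [BorelSpace X] [(volume : Measure X).IsAddHaarMeasure]
  {Ω : Set X} {v : X} {f g h j : X → ℝ}

theorem tendsto_integral_abs_mollify_sub (hf : Integrable f) :
    Tendsto (fun k => ∫ x, |mollify k f x - f x|) atTop (𝓝 0) := by
  have := tendsto_integral_mollify_sub (r := 1) le_rfl hf.locallyIntegrable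
    (by simpa using hf.abs)
  simpa using this

namespace HasWeakDeriv

/-- The product rule for bounded functions. -/
theorem mul_of_bounded (hΩ : IsOpen Ω) (hf : HasWeakDeriv Ω v f g) (hh : HasWeakDeriv Ω v h j)
    {A B : ℝ} (hA : ∀ x, |f x| ≤ A) (hB : ∀ x, |h x| ≤ B) :
    HasWeakDeriv Ω v (fun y => f y * h y) (fun y => h y * g y + f y * j y) := by
  have : ProperSpace X := FiniteDimensional.proper ℝ X
  have hfm := hf.aestronglyMeasurable_left
  have hhm := hh.aestronglyMeasurable_left
  refine ⟨locallyIntegrableOn_bdd_mul hΩ hh.1 hfm hA,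
    (locallyIntegrableOn_bdd_mul hΩ hf.2.1 hhm hB).add (locallyIntegrableOn_bdd_mul hΩ hh.2.1 hfm hA),
    fun ψ h1 h2 h3 => ?_⟩
  -- Only one factor has to be regularized. It is cut off near the support of ψ, made global and
  -- mollified; its product with ψ is then a test function for f. The values converge boundedly
  -- almost everywhere, the derivatives in L¹.
  obtain ⟨η, η1, η2, η3, η4, η5⟩ := exists_cutoff hΩ h2 h3
  obtain ⟨i1, i2, hw⟩ := hh.cutoff η1 η2 η3
  set h₁ : X → ℝ := fun y => η y * h y with hh₁
  set j₁ : X → ℝ := fun y => η y * j y + fderiv ℝ η y v * h y with hj₁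
  have hB1 : ∀ x, |h₁ x| ≤ B := fun x => by
    rw [hh₁, abs_mul, abs_of_nonneg (η4 x).1]
    exact (mul_le_of_le_one_left (abs_nonneg _) (η4 x).2).trans (hB x)
  have hsm := fun k => contDiff_mollify k i1.locallyIntegrable
  have hcψ : Continuous (fun y => fderiv ℝ ψ y v) :=
    (h1.continuous_fderiv (by simp)).clm_apply continuous_const
  have hcψs : HasCompactSupport (fun y => fderiv ℝ ψ y v) := hasCompactSupport_fderiv_apply h2 v
  have w1 := hf.integrable_left h1 h2 h3
  have w2 := hf.integrable_right h1 h2 h3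
  obtain ⟨D, hD⟩ := h2.exists_bound_of_continuous h1.continuous
  have hfψ : AEStronglyMeasurable (fun y => f y * ψ y) :=
    (integrable_mul_of_tsupport hf.1 h1.continuous h2 h3).1
  have hmm := fun k => (hsm k).continuous.aestronglyMeasurable (μ := (volume : Measure X))
  have hbk := fun k => abs_mollify_le k hB1
  have hae := ae_tendsto_mollify i1.locallyIntegrable
  have t1 := tendsto_integral_mul_of_bounded w1 hmm hbk hae
  have t2 := tendsto_integral_mul_of_bounded w2 hmm hbk hae
  have t3 := tendsto_integral_bounded_mul (w := fun _ y => f y * ψ y) (A := A * D) (fun _ => hfψ)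
    (fun _ x => by
      rw [abs_mul]
      exact mul_le_mul (hA x) (hD x) (abs_nonneg _) ((abs_nonneg _).trans (hA x)))
    i2 (fun k => integrable_mollify k i2) (tendsto_integral_abs_mollify_sub i2)
  have key : ∀ k, (∫ y, f y * fderiv ℝ ψ y v * mollify k h₁ y) +
      ∫ y, f y * ψ y * mollify k j₁ y = -∫ y, g y * ψ y * mollify k h₁ y := by
    intro k
    have e := hf.2.2 (fun y => mollify k h₁ y * ψ y) ((hsm k).mul h1) h2.mul_left
      (tsupport_mul_subset_right.trans h3)
    have e1 : ∀ y, f y * fderiv ℝ (fun y => mollify k h₁ y * ψ y) y v =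
        f y * fderiv ℝ ψ y v * mollify k h₁ y + f y * ψ y * mollify k j₁ y := by
      intro y
      rw [fderiv_fun_mul ((hsm k).differentiable (by simp) y) (h1.differentiable (by simp) y),
        ← hw.fderiv_mollify k y]
      simp only [add_apply, smul_apply, smul_eq_mul]
      ring
    have j1 : Integrable (fun y => f y * fderiv ℝ ψ y v * mollify k h₁ y) :=
      w1.mul_bdd (hmm k) (Eventually.of_forall (hbk k))
    have j2 : Integrable (fun y => f y * ψ y * mollify k j₁ y) :=
      (integrable_mollify k i2).bdd_mul (c := A * D) hfψ (Eventually.of_forall fun x => by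
        rw [norm_mul]
        exact mul_le_mul (hA x) (hD x) (norm_nonneg _) ((abs_nonneg _).trans (hA x)))
    simp_rw [e1] at e
    rw [integral_add j1 j2] at e
    rw [e]
    congr 2; funext y; ring
  have e0 := tendsto_nhds_unique ((t1.add t3).congr fun k => by
    rw [← add_sub_assoc, key k]) (t2.neg.sub_const (∫ y, f y * ψ y * j₁ y))
  have eq1 : ∀ y, ψ y ≠ 0 → h₁ y = h y ∧ j₁ y = j y := fun y hy => by
    have := η5 y (subset_tsupport ψ hy)
    have z : fderiv ℝ η y = 0 := by rw [this.fderiv_eq]; exact fderiv_const_apply _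
    simp [hh₁, hj₁, this.eq_of_nhds, z]
  have eq2 : ∀ y, fderiv ℝ ψ y v ≠ 0 → h₁ y = h y := fun y hy => by
    have hy' : y ∈ tsupport ψ := tsupport_fderiv_apply_subset' v (subset_tsupport (fun y => fderiv ℝ ψ y v) hy)
    simp [hh₁, (η5 y hy').eq_of_nhds]
  have r1 : ∀ y, f y * fderiv ℝ ψ y v * h₁ y = f y * h y * fderiv ℝ ψ y v := fun y => by
    by_cases hy : fderiv ℝ ψ y v = 0
    · simp [hy]
    · rw [eq2 y hy]; ring
  have r2 : ∀ y, g y * ψ y * h₁ y = h y * g y * ψ y := fun y => by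
    by_cases hy : ψ y = 0
    · simp [hy]
    · rw [(eq1 y hy).1]; ring
  have r3 : ∀ y, f y * ψ y * j₁ y = f y * j y * ψ y := fun y => by
    by_cases hy : ψ y = 0
    · simp [hy]
    · rw [(eq1 y hy).2]; ring
  simp_rw [r1, r2, r3] at e0
  have k1 : Integrable (fun y => h y * g y * ψ y) :=
    integrable_mul_of_tsupport (locallyIntegrableOn_bdd_mul hΩ hf.2.1 hhm hB) h1.continuous h2 h3
  have k2 : Integrable (fun y => f y * j y * ψ y) :=
    integrable_mul_of_tsupport (locallyIntegrableOn_bdd_mul hΩ hh.2.1 hfm hA) h1.continuous h2 h3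
  simp_rw [add_mul]
  rw [integral_add k1 k2]
  linarith

/-- The chain rule. -/
theorem comp (hΩ : IsOpen Ω) (hf : HasWeakDeriv Ω v f g) {T : ℝ → ℝ} (hT : ContDiff ℝ ∞ T)
    {B L : ℝ} (hB : ∀ s, |T s| ≤ B) (hL : ∀ s, |deriv T s| ≤ L) :
    HasWeakDeriv Ω v (fun y => T (f y)) (fun y => deriv T (f y) * g y) := by
  have : ProperSpace X := FiniteDimensional.proper ℝ X
  have hfm := hf.aestronglyMeasurable_left
  have hT' : Continuous (deriv T) := hT.continuous_deriv (by simp)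
  have hTf : AEStronglyMeasurable (fun y => T (f y)) (volume.restrict Ω) :=
    hT.continuous.comp_aestronglyMeasurable hfm
  have hT'f : AEStronglyMeasurable (fun y => deriv T (f y)) (volume.restrict Ω) :=
    hT'.comp_aestronglyMeasurable hfm
  have l1 : LocallyIntegrableOn (fun y => T (f y)) Ω := by
    have := locallyIntegrableOn_bdd_mul hΩ (continuous_const (y := (1 : ℝ))
      |>.locallyIntegrable.locallyIntegrableOn Ω) hTf (fun x => hB (f x))
    simpa using this
  refine ⟨l1, locallyIntegrableOn_bdd_mul hΩ hf.2.1 hT'f (fun x => hL (f x)),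
    fun ψ h1 h2 h3 => ?_⟩
  obtain ⟨η, η1, η2, η3, η4, η5⟩ := exists_cutoff hΩ h2 h3
  -- The classical chain rule holds for mollifications of the cut-off function. In the limit T(f)
  -- and T'(f) converge boundedly and the derivative factor in L¹.
  obtain ⟨i1, i2, hw⟩ := hf.cutoff η1 η2 η3
  set h₁ : X → ℝ := fun y => η y * f y with hh₁
  set j₁ : X → ℝ := fun y => η y * g y + fderiv ℝ η y v * f y with hj₁
  have hsm := fun k => contDiff_mollify k i1.locallyIntegrable
  have hcψ : Continuous (fun y => fderiv ℝ ψ y v) :=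
    (h1.continuous_fderiv (by simp)).clm_apply continuous_const
  have hcψs : HasCompactSupport (fun y => fderiv ℝ ψ y v) := hasCompactSupport_fderiv_apply h2 v
  obtain ⟨D, hD⟩ := h2.exists_bound_of_continuous h1.continuous
  have hae := ae_tendsto_mollify i1.locallyIntegrable
  have w2 : Integrable (fun y => j₁ y * ψ y) :=
    i2.mul_bdd h1.continuous.aestronglyMeasurable (Eventually.of_forall hD)
  have hm1 : ∀ k, AEStronglyMeasurable (fun y => T (mollify k h₁ y)) (volume : Measure X) :=
    fun k => (hT.continuous.comp (hsm k).continuous).aestronglyMeasurable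
  have hm2 : ∀ k, AEStronglyMeasurable (fun y => deriv T (mollify k h₁ y)) (volume : Measure X) :=
    fun k => (hT'.comp (hsm k).continuous).aestronglyMeasurable
  have t1 := tendsto_integral_mul_of_bounded (hcψ.integrable_of_hasCompactSupport hcψs)
    hm1 (fun k x => hB _) (a := fun y => T (h₁ y)) (by
      filter_upwards [hae] with x hx using (hT.continuous.tendsto _).comp hx)
  have t2 := tendsto_integral_mul_of_bounded w2 hm2 (fun k x => hL _)
    (a := fun y => deriv T (h₁ y)) (by
      filter_upwards [hae] with x hx using (hT'.tendsto _).comp hx)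
  have t3 := tendsto_integral_bounded_mul (w := fun k y => deriv T (mollify k h₁ y) * ψ y)
    (A := L * D) (fun k => (hm2 k).mul h1.continuous.aestronglyMeasurable)
    (fun k x => by
      rw [abs_mul]
      exact mul_le_mul (hL _) (hD x) (abs_nonneg _) ((abs_nonneg _).trans (hL 0)))
    i2 (fun k => integrable_mollify k i2) (tendsto_integral_abs_mollify_sub i2)
  have key : ∀ k, ∫ y, fderiv ℝ ψ y v * T (mollify k h₁ y) =
      -∫ y, deriv T (mollify k h₁ y) * ψ y * mollify k j₁ y := by
    intro k
    have e := (HasWeakDeriv.of_contDiff (hT.comp (hsm k)) v).2.2 ψ h1 h2 (subset_univ _)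
    have e1 : ∀ y, fderiv ℝ (T ∘ mollify k h₁) y v = deriv T (mollify k h₁ y) * mollify k j₁ y := by
      intro y
      have d1 := (hT.differentiable (by simp) (mollify k h₁ y)).hasDerivAt
      have d2 := ((hsm k).differentiable (by simp) y).hasFDerivAt
      rw [(d1.comp_hasFDerivAt y d2).fderiv, ← hw.fderiv_mollify k y]
      simp
    simp_rw [e1] at e
    have e2 : ∀ y, fderiv ℝ ψ y v * T (mollify k h₁ y) =
      (T ∘ mollify k h₁) y * fderiv ℝ ψ y v := fun y => mul_comm _ _
    simp_rw [e2]
    rw [e]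
    congr 2; funext y; ring
  have e3 : ∀ k, ∫ y, deriv T (mollify k h₁ y) * ψ y * j₁ y =
      ∫ y, j₁ y * ψ y * deriv T (mollify k h₁ y) := fun k => by congr 1; funext y; ring
  simp_rw [e3] at t3
  have e0 := tendsto_nhds_unique t1 (((t3.add t2).neg).congr fun k => by rw [key k]; ring)
  rw [zero_add] at e0
  have r1 : ∀ y, T (f y) * fderiv ℝ ψ y v = fderiv ℝ ψ y v * T (h₁ y) := fun y => by
    by_cases hy : fderiv ℝ ψ y v = 0
    · simp [hy]
    · have hy' : y ∈ tsupport ψ :=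
        tsupport_fderiv_apply_subset' v (subset_tsupport (fun y => fderiv ℝ ψ y v) hy)
      simp [hh₁, (η5 y hy').eq_of_nhds, mul_comm]
  have r2 : ∀ y, deriv T (f y) * g y * ψ y = j₁ y * ψ y * deriv T (h₁ y) := fun y => by
    by_cases hy : ψ y = 0
    · simp [hy]
    · have := η5 y (subset_tsupport ψ hy)
      have z : fderiv ℝ η y = 0 := by rw [this.fderiv_eq]; exact fderiv_const_apply _
      simp [hh₁, hj₁, this.eq_of_nhds, z]
      ring
  simp_rw [r1, r2]
  linarith

end HasWeakDeriv

end WeakDeriv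

end ParabolicFrequency

namespace ParabolicFrequency

set_option linter.unusedSectionVars false

/-! ### Coordinate frames and the metric in charts. -/

section Frame

variable {n : ℕ} {M : Type*} [TopologicalSpace M] [ChartedSpace (EuclideanSpace ℝ (Fin n)) M]
  {c c' : OpenPartialHomeomorph M (EuclideanSpace ℝ (Fin n))} {y : EuclideanSpace ℝ (Fin n)}

/-- The derivative of the inverse chart. -/
noncomputable def frame (c : OpenPartialHomeomorph M (EuclideanSpace ℝ (Fin n)))
    (y : EuclideanSpace ℝ (Fin n)) :
    EuclideanSpace ℝ (Fin n) →L[ℝ] TangentSpace (𝓡 n) (c.symm y) :=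
  mfderiv (𝓡 n) (𝓡 n) c.symm y

theorem coordVec_eq_frame (i : Fin n) :
    coordVec c y i = frame c y (EuclideanSpace.single i (1 : ℝ)) := rfl

theorem frame_eq_sum (ξ : EuclideanSpace ℝ (Fin n)) : frame c y ξ = ∑ i, ξ i • coordVec c y i := by
  have : ξ = ∑ i, ξ i • EuclideanSpace.single i (1 : ℝ) := by
    ext j
    simp [Pi.single_apply]
  conv_lhs => rw [this]
  simp only [map_sum, map_smul, coordVec_eq_frame]

variable [IsManifold (𝓡 n) ∞ M]

theorem mdifferentiable_of_mem (hc : c ∈ atlas (EuclideanSpace ℝ (Fin n)) M) :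
    c.MDifferentiable (𝓡 n) (𝓡 n) :=
  haveI : IsManifold (𝓡 n) 1 M := IsManifold.of_le (n := ∞) (by simp)
  mdifferentiable_of_mem_atlas hc

theorem frame_bijective (hc : c ∈ atlas (EuclideanSpace ℝ (Fin n)) M) (hy : y ∈ c.target) :
    Function.Bijective (frame c y) :=
  (mdifferentiable_of_mem hc).symm.mfderiv_bijective hy

theorem linearIndependent_coordVec (hc : c ∈ atlas (EuclideanSpace ℝ (Fin n)) M)
    (hy : y ∈ c.target) : LinearIndependent ℝ (coordVec c y) := by
  rw [Fintype.linearIndependent_iff]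
  intro g hg i
  have h1 : frame c y (WithLp.toLp 2 g) = frame c y 0 := by
    rw [frame_eq_sum, map_zero]
    exact hg
  have h2 := congrArg (fun ξ : EuclideanSpace ℝ (Fin n) => ξ i) ((frame_bijective hc hy).1 h1)
  simpa using h2

variable [RiemannianBundle (fun x : M => TangentSpace (𝓡 n) x)]

theorem posDef_gramMatrix (hc : c ∈ atlas (EuclideanSpace ℝ (Fin n)) M) (hy : y ∈ c.target) :
    (gramMatrix c y).PosDef :=
  Matrix.posDef_gram_of_linearIndependent (linearIndependent_coordVec hc hy)

theorem det_gramMatrix_pos (hc : c ∈ atlas (EuclideanSpace ℝ (Fin n)) M) (hy : y ∈ c.target) :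
    0 < (gramMatrix c y).det :=
  (posDef_gramMatrix hc hy).det_pos

/-- The inner product in terms of the components in a chart. -/
theorem inner_eq_sum_inv_gramMatrix (hc : c ∈ atlas (EuclideanSpace ℝ (Fin n)) M)
    (hy : y ∈ c.target) (v w : TangentSpace (𝓡 n) (c.symm y)) :
    inner ℝ v w = ∑ i, ∑ j, (gramMatrix c y)⁻¹ i j * inner ℝ v (coordVec c y i) *
      inner ℝ w (coordVec c y j) := by
  obtain ⟨ξ, rfl⟩ := (frame_bijective hc hy).2 v
  obtain ⟨ζ, rfl⟩ := (frame_bijective hc hy).2 w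
  have hdet : IsUnit (gramMatrix c y).det := (det_gramMatrix_pos hc hy).ne'.isUnit
  have hsymm : (gramMatrix c y).transpose = gramMatrix c y := by
    ext i j
    simp [gramMatrix, real_inner_comm]
  have hcomp : ∀ (ξ : EuclideanSpace ℝ (Fin n)) (i : Fin n),
      inner ℝ (frame c y ξ) (coordVec c y i) = (gramMatrix c y).mulVec (fun j => ξ j) i := by
    intro ξ i
    rw [frame_eq_sum, sum_inner]
    simp only [Matrix.mulVec, dotProduct, inner_smul_left]
    refine Finset.sum_congr rfl fun j _ => ?_
    simp [gramMatrix, real_inner_comm, mul_comm]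
  have h1 : inner ℝ (frame c y ξ) (frame c y ζ) =
      ∑ i, ξ i * (gramMatrix c y).mulVec (fun j => ζ j) i := by
    rw [frame_eq_sum ξ, sum_inner]
    refine Finset.sum_congr rfl fun i _ => ?_
    rw [inner_smul_left, real_inner_comm, hcomp]
    rfl
  have h2 : ∀ i, ∑ j, (gramMatrix c y)⁻¹ i j * (gramMatrix c y).mulVec (fun k => ξ k) i *
      (gramMatrix c y).mulVec (fun k => ζ k) j =
      (gramMatrix c y).mulVec (fun k => ξ k) i * ζ i := by
    intro i
    have e : ζ i = ∑ j, (gramMatrix c y)⁻¹ i j * (gramMatrix c y).mulVec (fun k => ζ k) j := by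
      have : (gramMatrix c y)⁻¹.mulVec ((gramMatrix c y).mulVec fun k => ζ k) i = ζ i := by
        rw [Matrix.mulVec_mulVec, Matrix.nonsing_inv_mul _ hdet, Matrix.one_mulVec]
      exact this.symm
    rw [e, Finset.mul_sum]
    refine Finset.sum_congr rfl fun j _ => ?_
    ring
  simp_rw [hcomp, h2]
  rw [h1]
  have h3 := Matrix.dotProduct_mulVec (fun i => ξ i) (gramMatrix c y) (fun i => ζ i)
  rw [← Matrix.mulVec_transpose, hsymm] at h3
  exact h3

end Frame

section Continuity

variable {n : ℕ} {M : Type*} [TopologicalSpace M] [ChartedSpace (EuclideanSpace ℝ (Fin n)) M]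
  {c c' : OpenPartialHomeomorph M (EuclideanSpace ℝ (Fin n))} {y : EuclideanSpace ℝ (Fin n)}
  [IsManifold (𝓡 n) ∞ M]

theorem contMDiffOn_symm_of_mem (hc : c ∈ atlas (EuclideanSpace ℝ (Fin n)) M) :
    ContMDiffOn (𝓡 n) (𝓡 n) ∞ c.symm c.target :=
  contMDiffOn_symm_of_mem_maximalAtlas (IsManifold.subset_maximalAtlas hc)

theorem contMDiffOn_of_mem (hc : c ∈ atlas (EuclideanSpace ℝ (Fin n)) M) :
    ContMDiffOn (𝓡 n) (𝓡 n) ∞ c c.source :=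
  contMDiffOn_of_mem_maximalAtlas (IsManifold.subset_maximalAtlas hc)

/-- The tangent map of the smooth inverse chart is continuous; phrased in the total space so that
continuity of the metric gives continuity of g_ij. -/
theorem continuousOn_coordVec (hc : c ∈ atlas (EuclideanSpace ℝ (Fin n)) M) (i : Fin n) :
    ContinuousOn (fun y => (⟨c.symm y, coordVec c y i⟩ : TangentBundle (𝓡 n) M)) c.target := by
  have h1 := (contMDiffOn_symm_of_mem hc).continuousOn_tangentMapWithin (by simp)
    c.open_target.uniqueMDiffOn
  have h2 : Continuous (fun y : EuclideanSpace ℝ (Fin n) =>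
      ((tangentBundleModelSpaceHomeomorph (𝓡 n)).symm (y, EuclideanSpace.single i (1 : ℝ)))) :=
    (Homeomorph.continuous _).comp (continuous_id.prodMk continuous_const)
  have h3 := h1.comp h2.continuousOn (s := c.target) (fun y hy => hy)
  refine h3.congr fun y hy => ?_
  simp only [Function.comp, tangentMapWithin]
  rw [mfderivWithin_of_isOpen c.open_target]
  · rfl
  · exact hy

variable [RiemannianBundle (fun x : M => TangentSpace (𝓡 n) x)]
  [IsContMDiffRiemannianBundle (𝓡 n) ∞ (EuclideanSpace ℝ (Fin n))
      (fun x : M => TangentSpace (𝓡 n) x)]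

theorem isContinuousRiemannianBundle_tangentSpace :
    IsContinuousRiemannianBundle (EuclideanSpace ℝ (Fin n))
      (fun x : M => TangentSpace (𝓡 n) x) := by
  obtain ⟨g, hg, h⟩ := IsContMDiffRiemannianBundle.exists_contMDiff (IB := 𝓡 n) (n := ∞)
    (F := EuclideanSpace ℝ (Fin n)) (E := fun x : M => TangentSpace (𝓡 n) x)
  exact ⟨g, hg.continuous, h⟩

theorem continuousOn_gramMatrix_apply (hc : c ∈ atlas (EuclideanSpace ℝ (Fin n)) M) (i j : Fin n) :
    ContinuousOn (fun y => gramMatrix c y i j) c.target := by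
  have : IsContinuousRiemannianBundle (EuclideanSpace ℝ (Fin n))
      (fun x : M => TangentSpace (𝓡 n) x) := isContinuousRiemannianBundle_tangentSpace
  exact (continuousOn_coordVec hc i).inner_bundle (continuousOn_coordVec hc j)

theorem continuousOn_gramMatrix (hc : c ∈ atlas (EuclideanSpace ℝ (Fin n)) M) :
    ContinuousOn (gramMatrix (M := M) c) c.target :=
  continuousOn_pi.2 fun i => continuousOn_pi.2 fun j => continuousOn_gramMatrix_apply hc i j

theorem continuousOn_det_gramMatrix (hc : c ∈ atlas (EuclideanSpace ℝ (Fin n)) M) :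
    ContinuousOn (fun y => (gramMatrix c y).det) c.target :=
  (Continuous.matrix_det continuous_id).comp_continuousOn (continuousOn_gramMatrix hc)

theorem continuousOn_inv_gramMatrix_apply (hc : c ∈ atlas (EuclideanSpace ℝ (Fin n)) M)
    (i j : Fin n) : ContinuousOn (fun y => (gramMatrix c y)⁻¹ i j) c.target := by
  simp only [Matrix.inv_def, Ring.inverse_eq_inv, Matrix.smul_apply, smul_eq_mul]
  refine ((continuousOn_det_gramMatrix hc).inv₀ fun y hy => (det_gramMatrix_pos hc hy).ne').mul ?_
  exact ((continuous_id.matrix_adjugate.matrix_elem i j)).comp_continuousOn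
    (continuousOn_gramMatrix hc)

end Continuity

end ParabolicFrequency

namespace ParabolicFrequency

set_option linter.unusedSectionVars false

/-! ### The Riemannian volume in charts. -/

section Volume

variable {n : ℕ} {M : Type*} [TopologicalSpace M] [ChartedSpace (EuclideanSpace ℝ (Fin n)) M]
  {c c' : OpenPartialHomeomorph M (EuclideanSpace ℝ (Fin n))} {y : EuclideanSpace ℝ (Fin n)}
  [IsManifold (𝓡 n) ∞ M]

theorem contDiffOn_transition (hc : c ∈ atlas (EuclideanSpace ℝ (Fin n)) M)
    (hc' : c' ∈ atlas (EuclideanSpace ℝ (Fin n)) M) :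
    ContDiffOn ℝ ∞ (c ∘ c'.symm) (c'.target ∩ c'.symm ⁻¹' c.source) := by
  rw [← contMDiffOn_iff_contDiffOn]
  exact (contMDiffOn_of_mem hc).comp ((contMDiffOn_symm_of_mem hc').mono inter_subset_left)
    fun y hy => hy.2

theorem isOpen_transition_source : IsOpen (c'.target ∩ c'.symm ⁻¹' c.source) :=
  c'.symm.isOpen_inter_preimage c.open_source

theorem hasFDerivAt_transition (hc : c ∈ atlas (EuclideanSpace ℝ (Fin n)) M)
    (hc' : c' ∈ atlas (EuclideanSpace ℝ (Fin n)) M) (hy : y ∈ c'.target ∩ c'.symm ⁻¹' c.source) :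
    HasFDerivAt (c ∘ c'.symm) (fderiv ℝ (c ∘ c'.symm) y) y :=
  (((contDiffOn_transition hc hc').contDiffAt (isOpen_transition_source.mem_nhds hy)).differentiableAt
    (by simp)).hasFDerivAt

/-- The chain rule for the inverse chart of c' written through c. The two sides live in tangent
spaces at points that are only propositionally equal, so the identity is stated in the model space.
-/
theorem frame_transition (hc : c ∈ atlas (EuclideanSpace ℝ (Fin n)) M)
    (hc' : c' ∈ atlas (EuclideanSpace ℝ (Fin n)) M) (hy : y ∈ c'.target ∩ c'.symm ⁻¹' c.source)
    (v : EuclideanSpace ℝ (Fin n)) :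
    (frame c' y v : EuclideanSpace ℝ (Fin n)) =
      frame c ((c ∘ c'.symm) y) (fderiv ℝ (c ∘ c'.symm) y v) := by
  have h1 : c'.symm =ᶠ[𝓝 y] c.symm ∘ (c ∘ c'.symm) := by
    filter_upwards [isOpen_transition_source.mem_nhds hy] with z hz
    exact (c.left_inv hz.2).symm
  have hm : MDifferentiableAt (𝓡 n) (𝓡 n) (c ∘ c'.symm) y :=
    (hasFDerivAt_transition hc hc' hy).differentiableAt.mdifferentiableAt
  have hm' : MDifferentiableAt (𝓡 n) (𝓡 n) c.symm ((c ∘ c'.symm) y) :=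
    (mdifferentiable_of_mem hc).mdifferentiableAt_symm (c.map_source hy.2)
  have h2 := mfderiv_comp y hm' hm
  have h3 := h1.mfderiv_eq (I := 𝓡 n) (I' := 𝓡 n)
  have h4 : mfderiv (𝓡 n) (𝓡 n) (c ∘ c'.symm) y = fderiv ℝ (c ∘ c'.symm) y :=
    mfderiv_eq_fderiv
  unfold frame
  rw [h3, h2, h4]
  rfl

variable [RiemannianBundle (fun x : M => TangentSpace (𝓡 n) x)]

theorem inner_tangentSpace_congr {x x' : M} (h : x = x') (v w : EuclideanSpace ℝ (Fin n)) :
    (inner ℝ (show TangentSpace (𝓡 n) x from v) (show TangentSpace (𝓡 n) x from w) : ℝ) =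
      inner ℝ (show TangentSpace (𝓡 n) x' from v) (show TangentSpace (𝓡 n) x' from w) := by
  subst h; rfl

theorem inner_frame (v w : EuclideanSpace ℝ (Fin n)) :
    (inner ℝ (frame c y v) (frame c y w) : ℝ) = ∑ k, ∑ l, v k * gramMatrix c y k l * w l := by
  rw [frame_eq_sum, frame_eq_sum, sum_inner]
  refine Finset.sum_congr rfl fun k _ => ?_
  rw [inner_sum]
  refine Finset.sum_congr rfl fun l _ => ?_
  rw [inner_smul_left, inner_smul_right]
  simp only [gramMatrix, Matrix.of_apply, conj_trivial]
  ring

theorem gramMatrix_transition (hc : c ∈ atlas (EuclideanSpace ℝ (Fin n)) M)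
    (hc' : c' ∈ atlas (EuclideanSpace ℝ (Fin n)) M) (hy : y ∈ c'.target ∩ c'.symm ⁻¹' c.source) :
    gramMatrix c' y = (LinearMap.toMatrix (EuclideanSpace.basisFun (Fin n) ℝ).toBasis
        (EuclideanSpace.basisFun (Fin n) ℝ).toBasis (fderiv ℝ (c ∘ c'.symm) y)).transpose *
      gramMatrix c ((c ∘ c'.symm) y) * (LinearMap.toMatrix (EuclideanSpace.basisFun (Fin n) ℝ).toBasis
        (EuclideanSpace.basisFun (Fin n) ℝ).toBasis (fderiv ℝ (c ∘ c'.symm) y)) := by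
  ext i j
  have h1 : gramMatrix c' y i j = inner ℝ (frame c ((c ∘ c'.symm) y)
      (fderiv ℝ (c ∘ c'.symm) y (EuclideanSpace.single i 1))) (frame c ((c ∘ c'.symm) y)
      (fderiv ℝ (c ∘ c'.symm) y (EuclideanSpace.single j 1))) := by
    have h2 : c'.symm y = c.symm ((c ∘ c'.symm) y) := (c.left_inv hy.2).symm
    have h3 := inner_tangentSpace_congr (n := n) h2 (frame c' y (EuclideanSpace.single i 1))
      (frame c' y (EuclideanSpace.single j 1))
    rw [frame_transition hc hc' hy, frame_transition hc hc' hy] at h3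
    rw [← h3, ← frame_transition hc hc' hy, ← frame_transition hc hc' hy]
    rfl
  rw [h1, inner_frame, Matrix.mul_apply]
  simp only [Matrix.mul_apply, Matrix.transpose_apply, LinearMap.toMatrix_apply, Finset.sum_mul]
  rw [Finset.sum_comm]
  simp

theorem sqrt_det_gramMatrix_transition (hc : c ∈ atlas (EuclideanSpace ℝ (Fin n)) M)
    (hc' : c' ∈ atlas (EuclideanSpace ℝ (Fin n)) M) (hy : y ∈ c'.target ∩ c'.symm ⁻¹' c.source) :
    Real.sqrt (gramMatrix c' y).det = |(fderiv ℝ (c ∘ c'.symm) y).det| *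
      Real.sqrt (gramMatrix c ((c ∘ c'.symm) y)).det := by
  rw [gramMatrix_transition hc hc' hy, Matrix.det_mul, Matrix.det_mul, Matrix.det_transpose,
    LinearMap.det_toMatrix]
  have : ∀ a b : ℝ, Real.sqrt (a * b * a) = |a| * Real.sqrt b := fun a b => by
    rw [mul_right_comm, Real.sqrt_mul (mul_self_nonneg a), Real.sqrt_mul_self_eq_abs]
  rw [this]

variable [MeasurableSpace M] [BorelSpace M]

/-- The Riemannian volume in a chart, transported to the manifold. -/
noncomputable def chartMeasure (c : OpenPartialHomeomorph M (EuclideanSpace ℝ (Fin n))) : Measure M :=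
  ((volume.restrict c.target).withDensity
    (fun y => ENNReal.ofReal (Real.sqrt (gramMatrix c y).det))).map c.symm

theorem aemeasurable_symm (c : OpenPartialHomeomorph M (EuclideanSpace ℝ (Fin n))) :
    AEMeasurable c.symm (volume.restrict c.target) :=
  c.continuousOn_symm.aemeasurable c.open_target.measurableSet

theorem chartMeasure_apply {A : Set M} (hA : MeasurableSet A) :
    chartMeasure c A = ∫⁻ y in c.symm ⁻¹' A ∩ c.target,
      ENNReal.ofReal (Real.sqrt (gramMatrix c y).det) := by
  rw [chartMeasure, Measure.map_apply_of_aemeasurable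
    ((aemeasurable_symm c).mono_ac (withDensity_absolutelyContinuous _ _)) hA, withDensity_apply',
    Measure.restrict_restrict' c.open_target.measurableSet]

theorem measurableSet_symm_preimage {A : Set M} (hA : MeasurableSet A)
    (c : OpenPartialHomeomorph M (EuclideanSpace ℝ (Fin n))) :
    MeasurableSet (c.symm ⁻¹' A ∩ c.target) := by
  have h1 : Measurable (c.target.domRestrict c.symm) :=
    (continuousOn_iff_continuous_domRestrict.1 c.continuousOn_symm).measurable
  have h2 := (MeasurableEmbedding.subtype_coe c.open_target.measurableSet).measurableSet_image.2
    (h1 hA)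
  convert h2 using 1
  ext y
  exact ⟨fun h => ⟨⟨y, h.2⟩, h.1, rfl⟩, fun ⟨z, h, hz⟩ => hz ▸ ⟨h, z.2⟩⟩

/-- Change of variables under the transition map, the Jacobian being the ratio of the densities.
Only an inequality holds because c' sees just the part of A inside its own source. -/
theorem chartMeasure_le (hc : c ∈ atlas (EuclideanSpace ℝ (Fin n)) M)
    (hc' : c' ∈ atlas (EuclideanSpace ℝ (Fin n)) M) {A : Set M} (hA : MeasurableSet A)
    (hAc : A ⊆ c.source) : chartMeasure c' A ≤ chartMeasure c A := by
  rw [chartMeasure_apply hA, chartMeasure_apply hA]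
  set S := c'.symm ⁻¹' A ∩ c'.target with hS
  have hSm : MeasurableSet S := measurableSet_symm_preimage hA c'
  have hSsub : ∀ y ∈ S, y ∈ c'.target ∩ c'.symm ⁻¹' c.source := fun y hy => ⟨hy.2, hAc hy.1⟩
  have h1 : ∫⁻ y in S, ENNReal.ofReal (Real.sqrt (gramMatrix c' y).det) =
      ∫⁻ y in S, ENNReal.ofReal |(fderiv ℝ (c ∘ c'.symm) y).det| *
        ENNReal.ofReal (Real.sqrt (gramMatrix c ((c ∘ c'.symm) y)).det) := by
    refine setLIntegral_congr_fun hSm fun y hy => ?_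
    rw [sqrt_det_gramMatrix_transition hc hc' (hSsub y hy), ENNReal.ofReal_mul (abs_nonneg _)]
  rw [h1, ← lintegral_image_eq_lintegral_abs_det_fderiv_mul volume hSm
    (fun y hy => (hasFDerivAt_transition hc hc' (hSsub y hy)).hasFDerivWithinAt) ?_
    (fun y => ENNReal.ofReal (Real.sqrt (gramMatrix c y).det))]
  · refine lintegral_mono_set ?_
    rintro _ ⟨y, hy, rfl⟩
    have := hSsub y hy
    refine ⟨?_, c.map_source this.2⟩
    simp only [Function.comp, mem_preimage]
    rw [c.left_inv this.2]
    exact hy.1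
  · intro y hy z hz h
    exact c'.symm.injOn hy.2 hz.2 (c.injOn (hSsub y hy).2 (hSsub z hz).2 h)

theorem restrict_riemannianVolume (hc : c ∈ atlas (EuclideanSpace ℝ (Fin n)) M) :
    (riemannianVolume n M).restrict c.source = chartMeasure c := by
  have hm := c.open_source.measurableSet
  have hle : ∀ c' ∈ atlas (EuclideanSpace ℝ (Fin n)) M, chartMeasure c' ≤ riemannianVolume n M :=
    fun c' hc' => le_iSup₂ (f := fun (c : OpenPartialHomeomorph M (EuclideanSpace ℝ (Fin n)))
      (_ : c ∈ atlas (EuclideanSpace ℝ (Fin n)) M) => chartMeasure c) c' hc'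
  refine le_antisymm ?_ ?_
  -- The right-hand side dominates every chart measure, so it dominates their supremum; on the
  -- source of c its second summand vanishes.
  · have h1 : riemannianVolume n M ≤ chartMeasure c + (riemannianVolume n M).restrict c.sourceᶜ := by
      refine iSup₂_le fun c' hc' => Measure.le_iff.2 fun A hA => ?_
      change chartMeasure c' A ≤ _
      rw [← measure_inter_add_sdiff A hm, Measure.add_apply, Measure.restrict_apply hA]
      refine add_le_add ((chartMeasure_le hc hc' (hA.inter hm) inter_subset_right).trans
        (measure_mono inter_subset_left)) ?_
      exact hle c' hc' _
    refine Measure.le_iff.2 fun A hA => ?_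
    rw [Measure.restrict_apply hA]
    refine (h1 _).trans ?_
    rw [Measure.add_apply, Measure.restrict_apply (hA.inter hm)]
    have : A ∩ c.source ∩ c.sourceᶜ = ∅ := by
      rw [inter_assoc, inter_compl_self, inter_empty]
    rw [this, measure_empty, add_zero]
    exact measure_mono inter_subset_left
  · refine Measure.le_iff.2 fun A hA => ?_
    rw [Measure.restrict_apply hA]
    refine le_trans (le_of_eq ?_) (hle c hc _)
    rw [chartMeasure_apply hA, chartMeasure_apply (hA.inter hm)]
    congr 2
    ext y
    simp only [mem_inter_iff, mem_preimage]
    exact ⟨fun h => ⟨⟨h.1, c.map_target h.2⟩, h.2⟩, fun h => ⟨h.1.1, h.2⟩⟩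

end Volume

end ParabolicFrequency

namespace ParabolicFrequency

set_option linter.unusedSectionVars false

/-! ### The weighted measure in coordinates. -/

section WeightedVolume

variable {n : ℕ} {M : Type*} [TopologicalSpace M] [ChartedSpace (EuclideanSpace ℝ (Fin n)) M]
  {c c' : OpenPartialHomeomorph M (EuclideanSpace ℝ (Fin n))} {y : EuclideanSpace ℝ (Fin n)}
  [IsManifold (𝓡 n) ∞ M] [RiemannianBundle (fun x : M => TangentSpace (𝓡 n) x)]

/-- The density of `e^{-φ} dV` in the chart `c`. -/
noncomputable def chartDensity (φ : M → ℝ) (c : OpenPartialHomeomorph M (EuclideanSpace ℝ (Fin n)))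
    (y : EuclideanSpace ℝ (Fin n)) : ℝ :=
  Real.sqrt (gramMatrix c y).det * Real.exp (-φ (c.symm y))

theorem chartDensity_nonneg (φ : M → ℝ) (c : OpenPartialHomeomorph M (EuclideanSpace ℝ (Fin n)))
    (y : EuclideanSpace ℝ (Fin n)) : 0 ≤ chartDensity φ c y :=
  mul_nonneg (Real.sqrt_nonneg _) (Real.exp_pos _).le

theorem chartDensity_pos (φ : M → ℝ) (hc : c ∈ atlas (EuclideanSpace ℝ (Fin n)) M)
    (hy : y ∈ c.target) : 0 < chartDensity φ c y :=
  mul_pos (Real.sqrt_pos.2 (det_gramMatrix_pos hc hy)) (Real.exp_pos _)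

section
variable [IsContMDiffRiemannianBundle (𝓡 n) ∞ (EuclideanSpace ℝ (Fin n))
      (fun x : M => TangentSpace (𝓡 n) x)] {φ : M → ℝ}

theorem continuousOn_chartDensity (hφ : Continuous φ) (hc : c ∈ atlas (EuclideanSpace ℝ (Fin n)) M) :
    ContinuousOn (chartDensity φ c) c.target :=
  ((continuousOn_det_gramMatrix hc).sqrt).mul
    (Real.continuous_exp.comp_continuousOn (hφ.comp_continuousOn c.continuousOn_symm).neg)

theorem aemeasurable_chartDensity (hφ : Continuous φ)
    (hc : c ∈ atlas (EuclideanSpace ℝ (Fin n)) M) :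
    AEMeasurable (fun y => ENNReal.ofReal (chartDensity φ c y)) (volume.restrict c.target) :=
  ((continuousOn_chartDensity hφ hc).aemeasurable c.open_target.measurableSet).ennreal_ofReal

end

/-- The measure `e^{-φ} dV` in the coordinates of the chart `c`. -/
noncomputable def coordMeasure (φ : M → ℝ) (c : OpenPartialHomeomorph M (EuclideanSpace ℝ (Fin n))) :
    Measure (EuclideanSpace ℝ (Fin n)) :=
  (volume.restrict c.target).withDensity (fun y => ENNReal.ofReal (chartDensity φ c y))

variable [MeasurableSpace M] [BorelSpace M]
  [IsContMDiffRiemannianBundle (𝓡 n) ∞ (EuclideanSpace ℝ (Fin n))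
      (fun x : M => TangentSpace (𝓡 n) x)] {φ : M → ℝ}

theorem coordMeasure_ac (φ : M → ℝ) (c : OpenPartialHomeomorph M (EuclideanSpace ℝ (Fin n))) :
    coordMeasure φ c ≪ volume.restrict c.target := withDensity_absolutelyContinuous _ _

theorem ac_coordMeasure (hφ : Continuous φ) (hc : c ∈ atlas (EuclideanSpace ℝ (Fin n)) M) :
    volume.restrict c.target ≪ coordMeasure φ c := by
  refine withDensity_absolutelyContinuous' (aemeasurable_chartDensity hφ hc) ?_
  filter_upwards [ae_restrict_mem c.open_target.measurableSet] with y hy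
  simpa using chartDensity_pos φ hc hy

theorem restrict_weightedVolume (hφ : Continuous φ) (hc : c ∈ atlas (EuclideanSpace ℝ (Fin n)) M) :
    (weightedVolume n φ).restrict c.source = (coordMeasure φ c).map c.symm := by
  have hm : Measurable (fun x => ENNReal.ofReal (Real.exp (-φ x))) :=
    (Real.measurable_exp.comp hφ.measurable.neg).ennreal_ofReal
  have hs : AEMeasurable c.symm (coordMeasure φ c) := (aemeasurable_symm c).mono_ac (coordMeasure_ac φ c)
  have hd : AEMeasurable (fun y => ENNReal.ofReal (Real.sqrt (gramMatrix c y).det))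
      (volume.restrict c.target) :=
    ((continuousOn_det_gramMatrix hc).sqrt.aemeasurable c.open_target.measurableSet).ennreal_ofReal
  rw [weightedVolume, restrict_withDensity c.open_source.measurableSet, restrict_riemannianVolume hc]
  ext A hA
  rw [withDensity_apply _ hA, Measure.map_apply_of_aemeasurable hs hA]
  have h1 : ∫⁻ x in A, ENNReal.ofReal (Real.exp (-φ x)) ∂chartMeasure c =
      ∫⁻ x, A.indicator (fun x => ENNReal.ofReal (Real.exp (-φ x))) x ∂chartMeasure c :=
    (lintegral_indicator hA _).symm
  have h2 : AEMeasurable (fun y => A.indicator (fun x => ENNReal.ofReal (Real.exp (-φ x))) (c.symm y))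
      (volume.restrict c.target) := (hm.indicator hA).comp_aemeasurable (aemeasurable_symm c)
  rw [h1, chartMeasure, lintegral_map' (hm.indicator hA).aemeasurable
    ((aemeasurable_symm c).mono_ac (withDensity_absolutelyContinuous _ _)),
    lintegral_withDensity_eq_lintegral_mul₀ hd h2, coordMeasure, withDensity_apply']
  have h3 : NullMeasurableSet (c.symm ⁻¹' A) (volume.restrict c.target) :=
    (aemeasurable_symm c).nullMeasurableSet_preimage hA
  rw [← lintegral_indicator₀ h3]
  refine lintegral_congr fun y => ?_
  by_cases hy : c.symm y ∈ A
  · simp [indicator, hy, chartDensity, ENNReal.ofReal_mul, Real.sqrt_nonneg]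
  · simp [indicator, hy]

theorem aemeasurable_symm_coordMeasure (φ : M → ℝ)
    (c : OpenPartialHomeomorph M (EuclideanSpace ℝ (Fin n))) :
    AEMeasurable c.symm (coordMeasure φ c) :=
  (aemeasurable_symm c).mono_ac (coordMeasure_ac φ c)

theorem aemeasurable_chart (c : OpenPartialHomeomorph M (EuclideanSpace ℝ (Fin n))) (μ : Measure M) :
    AEMeasurable c (μ.restrict c.source) :=
  c.continuousOn.aemeasurable c.open_source.measurableSet

theorem map_restrict_weightedVolume (hφ : Continuous φ)
    (hc : c ∈ atlas (EuclideanSpace ℝ (Fin n)) M) :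
    ((weightedVolume n φ).restrict c.source).map c = coordMeasure φ c := by
  have h := aemeasurable_chart c (weightedVolume n φ)
  rw [restrict_weightedVolume hφ hc] at h ⊢
  rw [AEMeasurable.map_map_of_aemeasurable h (aemeasurable_symm_coordMeasure φ c)]
  have : c ∘ c.symm =ᵐ[coordMeasure φ c] id :=
    (coordMeasure_ac φ c).ae_le ((ae_restrict_mem c.open_target.measurableSet).mono
      fun y hy => c.right_inv hy)
  rw [Measure.map_congr this, Measure.map_id]

/-- The coordinate density is positive on the chart domain, so null sets on the manifold and in
coordinates correspond. -/
theorem ae_source_iff (hφ : Continuous φ) (hc : c ∈ atlas (EuclideanSpace ℝ (Fin n)) M)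
    {P : M → Prop} : (∀ᵐ x ∂(weightedVolume n φ), x ∈ c.source → P x) ↔
      ∀ᵐ y ∂volume, y ∈ c.target → P (c.symm y) := by
  rw [← ae_restrict_iff' c.open_source.measurableSet, ← ae_restrict_iff' c.open_target.measurableSet]
  constructor
  · intro h
    rw [restrict_weightedVolume hφ hc] at h
    exact (ac_coordMeasure hφ hc).ae_le (ae_of_ae_map (aemeasurable_symm_coordMeasure φ c) h)
  · intro h
    have h1 := (coordMeasure_ac φ c).ae_le h
    rw [← map_restrict_weightedVolume hφ hc] at h1
    filter_upwards [ae_of_ae_map (aemeasurable_chart c _) h1,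
      ae_restrict_mem c.open_source.measurableSet] with x hx hxs
    rwa [c.left_inv hxs] at hx

theorem aestronglyMeasurable_source_iff (hφ : Continuous φ)
    (hc : c ∈ atlas (EuclideanSpace ℝ (Fin n)) M) {f : M → ℝ} :
    AEStronglyMeasurable f ((weightedVolume n φ).restrict c.source) ↔
      AEStronglyMeasurable (fun y => f (c.symm y)) (volume.restrict c.target) := by
  constructor
  · intro h
    rw [restrict_weightedVolume hφ hc] at h
    exact (h.comp_aemeasurable (aemeasurable_symm_coordMeasure φ c)).mono_ac (ac_coordMeasure hφ hc)
  · intro h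
    have h1 := h.mono_ac (coordMeasure_ac φ c)
    rw [← map_restrict_weightedVolume hφ hc] at h1
    refine (h1.comp_aemeasurable (aemeasurable_chart c _)).congr ?_
    filter_upwards [ae_restrict_mem c.open_source.measurableSet] with x hx
    simp [c.left_inv hx]

theorem integrableOn_source_iff (hφ : Continuous φ)
    (hc : c ∈ atlas (EuclideanSpace ℝ (Fin n)) M) {f : M → ℝ}
    (hf : AEStronglyMeasurable f ((weightedVolume n φ).restrict c.source)) :
    IntegrableOn f c.source (weightedVolume n φ) ↔
      IntegrableOn (fun y => chartDensity φ c y * f (c.symm y)) c.target := by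
  rw [IntegrableOn, restrict_weightedVolume hφ hc] at *
  rw [integrable_map_measure hf (aemeasurable_symm_coordMeasure φ c), coordMeasure,
    integrable_withDensity_iff_integrable_smul₀' (aemeasurable_chartDensity hφ hc) (by simp)]
  simp [ENNReal.toReal_ofReal, chartDensity_nonneg, IntegrableOn]

theorem setIntegral_source (hφ : Continuous φ)
    (hc : c ∈ atlas (EuclideanSpace ℝ (Fin n)) M) {f : M → ℝ}
    (hf : AEStronglyMeasurable f ((weightedVolume n φ).restrict c.source)) :
    ∫ x in c.source, f x ∂(weightedVolume n φ) =
      ∫ y in c.target, chartDensity φ c y * f (c.symm y) := by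
  rw [restrict_weightedVolume hφ hc] at *
  rw [integral_map (aemeasurable_symm_coordMeasure φ c) hf, coordMeasure,
    integral_withDensity_eq_integral_toReal_smul₀ (aemeasurable_chartDensity hφ hc) (by simp)]
  simp [ENNReal.toReal_ofReal, chartDensity_nonneg]

theorem ae_of_forall_ae_source [SecondCountableTopology M] {μ : Measure M} {P : M → Prop}
    (h : ∀ c ∈ atlas (EuclideanSpace ℝ (Fin n)) M, ∀ᵐ x ∂μ, x ∈ c.source → P x) :
    ∀ᵐ x ∂μ, P x := by
  obtain ⟨s, hs, hsu⟩ := TopologicalSpace.countable_cover_nhds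
    (f := fun x : M => (chartAt (EuclideanSpace ℝ (Fin n)) x).source) fun x => chart_source_mem_nhds _ x
  have h1 : ∀ᵐ x ∂μ, ∀ z ∈ s, x ∈ (chartAt (EuclideanSpace ℝ (Fin n)) z).source → P x :=
    (ae_ball_iff hs).2 fun z _ => h _ (chart_mem_atlas _ z)
  filter_upwards [h1] with x hx
  obtain ⟨z, hz, hxz⟩ := mem_iUnion₂.1 (hsu.symm ▸ mem_univ x)
  exact hx z hz hxz

theorem isLocallyFiniteMeasure_weightedVolume (hφ : Continuous φ) :
    IsLocallyFiniteMeasure (weightedVolume n φ) := by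
  refine ⟨fun x => ?_⟩
  set c := chartAt (EuclideanSpace ℝ (Fin n)) x
  have hc : c ∈ atlas (EuclideanSpace ℝ (Fin n)) M := chart_mem_atlas _ x
  have hx : x ∈ c.source := mem_chart_source _ x
  obtain ⟨K, hK, hxK, hKt⟩ := exists_compact_subset c.open_target (c.map_source hx)
  refine ⟨c.source ∩ c ⁻¹' K, ?_, ?_⟩
  · exact c.continuousAt hx |>.preimage_mem_nhds (mem_interior_iff_mem_nhds.1 hxK) |>
      inter_mem (c.open_source.mem_nhds hx)
  · have hm : NullMeasurableSet (c ⁻¹' K) ((weightedVolume n φ).restrict c.source) :=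
      (aemeasurable_chart c _).nullMeasurableSet_preimage hK.measurableSet
    rw [inter_comm, ← Measure.restrict_apply₀ hm,
      ← Measure.map_apply_of_aemeasurable (aemeasurable_chart c _) hK.measurableSet,
      map_restrict_weightedVolume hφ hc, coordMeasure, withDensity_apply _ hK.measurableSet,
      Measure.restrict_restrict hK.measurableSet, inter_eq_left.2 hKt]
    have := ((continuousOn_chartDensity hφ hc).mono hKt).integrableOn_compact hK (μ := volume)
    exact this.lintegral_lt_top

theorem ae_weightedVolume_iff (hφ : Continuous φ) {P : M → Prop} :
    (∀ᵐ x ∂(weightedVolume n φ), P x) ↔ ∀ᵐ x ∂(riemannianVolume n M), P x := by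
  have hm : Measurable (fun x => ENNReal.ofReal (Real.exp (-φ x))) :=
    (Real.measurable_exp.comp hφ.measurable.neg).ennreal_ofReal
  constructor
  · exact fun h => (withDensity_absolutelyContinuous' hm.aemeasurable (Eventually.of_forall
      fun x => by simpa using Real.exp_pos _)).ae_le h
  · exact fun h => (withDensity_absolutelyContinuous _ _).ae_le h

end WeightedVolume

end ParabolicFrequency

/-! ### Completeness implies properness; Lipschitz functions in charts. -/

namespace ParabolicFrequency

set_option linter.unusedSectionVars false

/-- A complete locally compact space in which distances are approximated by splitting is proper. -/
theorem properSpace_of_exists_between {X : Type*} [MetricSpace X] [CompleteSpace X]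
    [LocallyCompactSpace X]
    (hX : ∀ (x y : X) (r s : ℝ), 0 ≤ r → 0 < s → dist x y < r + s →
      ∃ z, dist x z ≤ r ∧ dist z y < s) : ProperSpace X := by
  refine ⟨fun x₀ r₀ => ?_⟩
  by_contra hr₀
  set S : Set ℝ := {r | 0 ≤ r ∧ IsCompact (Metric.closedBall x₀ r)} with hS
  have h0 : (0 : ℝ) ∈ S := ⟨le_rfl, by simp⟩
  have hdown : ∀ r ∈ S, ∀ r' ≤ r, IsCompact (Metric.closedBall x₀ r') := fun r hr r' hr' =>
    hr.2.of_isClosed_subset Metric.isClosed_closedBall (Metric.closedBall_subset_closedBall hr')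
  have hbdd : BddAbove S := ⟨r₀, fun r hr => by
    by_contra! h
    exact hr₀ (hdown r hr r₀ h.le)⟩
  set R := sSup S with hR
  have hR0 : 0 ≤ R := le_csSup hbdd h0
  have hlt : ∀ r, 0 ≤ r → (r = 0 ∨ r < R) → IsCompact (Metric.closedBall x₀ r) := by
    rintro r hr (rfl | h)
    · exact h0.2
    · obtain ⟨r', hr', h'⟩ := exists_lt_of_lt_csSup ⟨0, h0⟩ h
      exact hdown r' hr' r h'.le
  -- R is the supremum of the radii of compact balls. The ball of radius R is totally bounded, since
  -- each of its points lies within ε/2 of the compact ball of radius max(R - ε/4, 0).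
  have hRc : IsCompact (Metric.closedBall x₀ R) := by
    refine isCompact_iff_totallyBounded_isComplete.2 ⟨?_, Metric.isClosed_closedBall.isComplete⟩
    rw [Metric.totallyBounded_iff]
    intro ε hε
    have hr : IsCompact (Metric.closedBall x₀ (max (R - ε / 4) 0)) := by
      refine hlt _ (le_max_right _ _) ?_
      rcases le_total (R - ε / 4) 0 with h | h
      · exact Or.inl (max_eq_right h)
      · exact Or.inr (by rw [max_eq_left h]; linarith)
    obtain ⟨t, ht, htc⟩ := Metric.totallyBounded_iff.1 hr.totallyBounded (ε / 2) (by positivity)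
    refine ⟨t, ht, fun y hy => ?_⟩
    obtain ⟨z, hz, hzy⟩ := hX x₀ y (max (R - ε / 4) 0) (ε / 2) (le_max_right _ _) (by positivity)
      (by
        have := le_max_left (R - ε / 4) 0
        rw [Metric.mem_closedBall, dist_comm] at hy
        linarith)
    obtain ⟨w, hw, hzw⟩ := mem_iUnion₂.1 (htc (by rwa [Metric.mem_closedBall, dist_comm]))
    refine mem_iUnion₂.2 ⟨w, hw, ?_⟩
    rw [Metric.mem_ball] at hzw ⊢
    have := dist_triangle y z w
    rw [dist_comm y z] at this
    linarith
  -- By local compactness a thickening is still compact, and it contains a larger ball,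
  -- contradicting the choice of R.
  obtain ⟨δ, hδ, hδc⟩ := hRc.exists_isCompact_cthickening
  have : R + δ / 2 ∈ S := by
    refine ⟨by positivity, hδc.of_isClosed_subset Metric.isClosed_closedBall fun y hy => ?_⟩
    rw [Metric.mem_closedBall, dist_comm] at hy
    obtain ⟨z, hz, hzy⟩ := hX x₀ y R δ hR0 hδ (by linarith)
    refine Metric.mem_cthickening_of_dist_le y z δ _ (by rwa [Metric.mem_closedBall, dist_comm]) ?_
    rw [dist_comm]
    exact hzy.le
  have := le_csSup hbdd this
  linarith

section Riemannian

variable {n : ℕ} {M : Type*} [MetricSpace M] [ChartedSpace (EuclideanSpace ℝ (Fin n)) M]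
  {c c' : OpenPartialHomeomorph M (EuclideanSpace ℝ (Fin n))} {y y' : EuclideanSpace ℝ (Fin n)}
  [RiemannianBundle (fun x : M => TangentSpace (𝓡 n) x)]

section
variable [IsRiemannianManifold (𝓡 n) M]

theorem edist_le_pathELength {γ : ℝ → M} {a b : ℝ} (hab : a ≤ b)
    (hγ : ContMDiffOn 𝓘(ℝ, ℝ) (𝓡 n) 1 γ (Icc a b)) :
    edist (γ a) (γ b) ≤ pathELength (𝓡 n) γ a b := by
  rw [IsRiemannianManifold.out (I := 𝓡 n) (γ a) (γ b)]
  exact riemannianEDist_le_pathELength hγ rfl rfl hab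

/-- On a path of length below r+s from x to y some point has distance exactly r from x. The path up
to it has length at least r, so less than s remains. -/
theorem exists_between_of_isRiemannianManifold (n : ℕ) {M : Type*} [MetricSpace M]
    [ChartedSpace (EuclideanSpace ℝ (Fin n)) M] [RiemannianBundle (fun x : M => TangentSpace (𝓡 n) x)]
    [IsRiemannianManifold (𝓡 n) M] (x y : M) (r s : ℝ) (hr : 0 ≤ r) (hs : 0 < s)
    (hd : dist x y < r + s) : ∃ z, dist x z ≤ r ∧ dist z y < s := by
  rcases le_or_gt (dist x y) r with h | h
  · exact ⟨y, h, by simpa using hs⟩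
  have h1 : riemannianEDist (𝓡 n) x y < ENNReal.ofReal (r + s) := by
    rw [← IsRiemannianManifold.out (I := 𝓡 n) x y, edist_dist]
    exact (ENNReal.ofReal_lt_ofReal_iff (by positivity)).2 hd
  obtain ⟨γ, h0, h1, hγ, hl⟩ := exists_lt_of_riemannianEDist_lt h1
  have hcont : ContinuousOn (fun t => dist x (γ t)) (Icc 0 1) :=
    continuous_dist.comp_continuousOn (continuousOn_const.prodMk hγ.continuousOn)
  obtain ⟨t, ht, hxt⟩ := intermediate_value_Icc zero_le_one hcont
    (show r ∈ Icc (dist x (γ 0)) (dist x (γ 1)) by simp [h0, h1, hr, h.le])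
  refine ⟨γ t, hxt.le, ?_⟩
  have ha := edist_le_pathELength ht.1 (hγ.mono (Icc_subset_Icc le_rfl ht.2))
  have hb := edist_le_pathELength ht.2 (hγ.mono (Icc_subset_Icc ht.1 le_rfl))
  rw [h0, edist_dist, show dist x (γ t) = r from hxt] at ha
  rw [h1, edist_dist] at hb
  rw [← pathELength_add ht.1 ht.2] at hl
  have hc := (add_le_add ha hb).trans_lt hl
  rw [← ENNReal.ofReal_add hr dist_nonneg, ENNReal.ofReal_lt_ofReal_iff (by positivity)] at hc
  linarith

/-- A complete Riemannian manifold is proper. -/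
theorem properSpace_of_isRiemannianManifold (n : ℕ) (M : Type*) [MetricSpace M]
    [ChartedSpace (EuclideanSpace ℝ (Fin n)) M] [RiemannianBundle (fun x : M => TangentSpace (𝓡 n) x)]
    [IsRiemannianManifold (𝓡 n) M] [CompleteSpace M] : ProperSpace M := by
  have : LocallyCompactSpace M := ChartedSpace.locallyCompactSpace (EuclideanSpace ℝ (Fin n)) M
  exact properSpace_of_exists_between (exists_between_of_isRiemannianManifold n)

end

variable [IsManifold (𝓡 n) ∞ M]

/-- The image of a coordinate segment is an admissible path, and its length is the integral of the
frame norm. -/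
theorem dist_symm_le [IsRiemannianManifold (𝓡 n) M] (hc : c ∈ atlas (EuclideanSpace ℝ (Fin n)) M)
    (hs : segment ℝ y y' ⊆ c.target) {A : ℝ} (hA : ∀ z ∈ segment ℝ y y', ‖frame c z (y' - y)‖ ≤ A) :
    dist (c.symm y) (c.symm y') ≤ A := by
  have hA0 : 0 ≤ A := (norm_nonneg _).trans (hA y (left_mem_segment ℝ y y'))
  set η : ℝ → EuclideanSpace ℝ (Fin n) := fun t => y + t • (y' - y) with hη
  have hηm : ∀ t ∈ Icc (0 : ℝ) 1, η t ∈ segment ℝ y y' := fun t ht => by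
    rw [segment_eq_image']
    exact ⟨t, ht, rfl⟩
  have hηd : ∀ t, HasDerivAt η (y' - y) t := fun t => by
    have := ((hasDerivAt_id t).smul_const (y' - y)).const_add y
    rwa [one_smul] at this
  have hηs : ContDiff ℝ ∞ η := contDiff_const.add (contDiff_id.smul contDiff_const)
  have hγ : ContMDiffOn 𝓘(ℝ, ℝ) (𝓡 n) 1 (c.symm ∘ η) (Icc 0 1) :=
    ((contMDiffOn_symm_of_mem hc).comp hηs.contMDiff.contMDiffOn
      fun t ht => hs (hηm t ht)).of_le (by simp)
  have h1 := edist_le_pathELength zero_le_one hγ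
  have h2 : pathELength (𝓡 n) (c.symm ∘ η) 0 1 ≤ ENNReal.ofReal A := by
    rw [pathELength_eq_lintegral_mfderiv_Icc]
    calc _ ≤ ∫⁻ _ in Icc (0 : ℝ) 1, ENNReal.ofReal A := by
          refine setLIntegral_mono measurable_const fun t ht => ?_
          have hmd : MDifferentiableAt (𝓡 n) (𝓡 n) c.symm (η t) :=
            (mdifferentiable_of_mem hc).symm.mdifferentiableAt (hs (hηm t ht))
          have hmη : MDifferentiableAt 𝓘(ℝ, ℝ) (𝓡 n) η t :=
            (hηd t).differentiableAt.mdifferentiableAt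
          rw [mfderiv_comp t hmd hmη, mfderiv_eq_fderiv, ← ofReal_norm]
          refine ENNReal.ofReal_le_ofReal ?_
          refine le_trans (le_of_eq ?_) (hA _ (hηm t ht))
          congr 1
          change frame c (η t) (fderiv ℝ η t 1) = _
          rw [(hηd t).hasFDerivAt.fderiv]
          simp
      _ = _ := by simp
  have h3 := h1.trans h2
  simp only [Function.comp, hη, zero_smul, add_zero, one_smul, add_sub_cancel] at h3
  rw [edist_dist] at h3
  exact (ENNReal.ofReal_le_ofReal_iff hA0).1 h3

variable [IsContMDiffRiemannianBundle (𝓡 n) ∞ (EuclideanSpace ℝ (Fin n))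
      (fun x : M => TangentSpace (𝓡 n) x)]

theorem continuousOn_norm_frame (hc : c ∈ atlas (EuclideanSpace ℝ (Fin n)) M)
    (ξ : EuclideanSpace ℝ (Fin n)) : ContinuousOn (fun z => ‖frame c z ξ‖) c.target := by
  have h : (fun z => ‖frame c z ξ‖) = fun z =>
      Real.sqrt (∑ k, ∑ l, ξ k * gramMatrix c z k l * ξ l) := by
    ext z
    rw [← inner_frame, real_inner_self_eq_norm_sq, Real.sqrt_sq (norm_nonneg _)]
  rw [h]
  refine ContinuousOn.sqrt (continuousOn_finsetSum _ fun k _ => continuousOn_finsetSum _ fun l _ => ?_)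
  exact (continuousOn_const.mul (continuousOn_gramMatrix_apply hc k l)).mul continuousOn_const

theorem exists_norm_frame_le (hc : c ∈ atlas (EuclideanSpace ℝ (Fin n)) M) (hy : y ∈ c.target) :
    ∃ K, ∀ᶠ z in 𝓝 y, ∀ ξ, ‖frame c z ξ‖ ≤ K * ‖ξ‖ := by
  refine ⟨∑ i, (‖coordVec c y i‖ + 1), ?_⟩
  have h1 : ∀ᶠ z in 𝓝 y, ∀ i, ‖coordVec c z i‖ < ‖coordVec c y i‖ + 1 := by
    refine eventually_all.2 fun i => ?_
    have := (continuousOn_norm_frame hc (EuclideanSpace.single i (1 : ℝ))).continuousAt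
      (c.open_target.mem_nhds hy)
    exact this.eventually_lt_const (lt_add_one _)
  filter_upwards [h1] with z hz ξ
  rw [frame_eq_sum, Finset.sum_mul]
  refine (norm_sum_le _ _).trans (Finset.sum_le_sum fun i _ => ?_)
  rw [norm_smul, mul_comm]
  exact mul_le_mul (hz i).le (PiLp.norm_apply_le ξ i) (norm_nonneg _) (by positivity)

variable [IsRiemannianManifold (𝓡 n) M] {ρ : M → ℝ}

theorem locallyLipschitzOn_comp_symm (hc : c ∈ atlas (EuclideanSpace ℝ (Fin n)) M) {L : NNReal}
    (hρ : LipschitzWith L ρ) : LocallyLipschitzOn c.target (fun y => ρ (c.symm y)) := by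
  intro y hy
  obtain ⟨K, hK⟩ := exists_norm_frame_le hc hy
  obtain ⟨ε, hε, hb⟩ := Metric.mem_nhds_iff.1 (inter_mem (c.open_target.mem_nhds hy) hK)
  refine ⟨L * K.toNNReal, Metric.ball y ε, mem_nhdsWithin_of_mem_nhds (Metric.ball_mem_nhds y hε), ?_⟩
  refine LipschitzOnWith.of_dist_le_mul fun z hz z' hz' => ?_
  have hseg : segment ℝ z z' ⊆ Metric.ball y ε := (convex_ball y ε).segment_subset hz hz'
  have h1 : dist (c.symm z) (c.symm z') ≤ K * ‖z' - z‖ :=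
    dist_symm_le hc (fun w hw => (hb (hseg hw)).1) fun w hw => (hb (hseg hw)).2 _
  refine (hρ.dist_le_mul _ _).trans ?_
  push_cast
  rw [mul_assoc, dist_eq_norm' z z']
  gcongr
  exact h1.trans (mul_le_mul_of_nonneg_right (Real.le_coe_toNNReal K) (norm_nonneg _))

/-- Difference quotients along short segments, with the frame norm nearly constant by continuity.
The bound uses the Riemannian norm and no chart constant, so it yields a global bound for the
gradient. -/
theorem abs_fderiv_comp_symm_le (hc : c ∈ atlas (EuclideanSpace ℝ (Fin n)) M) {L : NNReal}
    (hρ : LipschitzWith L ρ) (hy : y ∈ c.target)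
    (hd : DifferentiableAt ℝ (fun y => ρ (c.symm y)) y) (ξ : EuclideanSpace ℝ (Fin n)) :
    |fderiv ℝ (fun y => ρ (c.symm y)) y ξ| ≤ L * ‖frame c y ξ‖ := by
  refine le_of_forall_pos_le_add fun ε hε => ?_
  set A := ‖frame c y ξ‖ + ε / (L + 1) with hA
  have h1 : ∀ᶠ z in 𝓝 y, z ∈ c.target ∧ ‖frame c z ξ‖ < A :=
    Filter.Eventually.and (c.open_target.mem_nhds hy) (((continuousOn_norm_frame hc ξ).continuousAt
      (c.open_target.mem_nhds hy)).eventually_lt_const (by rw [hA]; simp; positivity))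
  obtain ⟨r, hr, hb⟩ := Metric.mem_nhds_iff.1 h1
  have hlim := (hd.hasFDerivAt.hasLineDerivAt ξ).tendsto_slope_zero_right
  have h2 : ∀ᶠ t : ℝ in 𝓝[>] 0, |t⁻¹ • (ρ (c.symm (y + t • ξ)) - ρ (c.symm y))| ≤ L * A := by
    have hball : ∀ᶠ t : ℝ in 𝓝[>] 0, y + t • ξ ∈ Metric.ball y r := by
      have : Tendsto (fun t : ℝ => y + t • ξ) (𝓝[>] 0) (𝓝 y) := by
        have : Continuous fun t : ℝ => y + t • ξ := by fun_prop
        simpa using (this.tendsto 0).mono_left nhdsWithin_le_nhds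
      exact this (Metric.ball_mem_nhds y hr)
    filter_upwards [hball, self_mem_nhdsWithin] with t ht ht0
    have ht0 : 0 < t := ht0
    have hseg : segment ℝ y (y + t • ξ) ⊆ Metric.ball y r :=
      (convex_ball y r).segment_subset (Metric.mem_ball_self hr) ht
    have h3 : dist (c.symm y) (c.symm (y + t • ξ)) ≤ t * A := by
      refine dist_symm_le hc (fun z hz => (hb (hseg hz)).1) fun z hz => ?_
      rw [add_sub_cancel_left, map_smul, norm_smul, Real.norm_of_nonneg ht0.le]
      exact mul_le_mul_of_nonneg_left (hb (hseg hz)).2.le ht0.le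
    have h4 := hρ.dist_le_mul (c.symm (y + t • ξ)) (c.symm y)
    rw [Real.dist_eq, dist_comm] at h4
    rw [smul_eq_mul, abs_mul, abs_inv, abs_of_pos ht0, inv_mul_le_iff₀ ht0]
    refine h4.trans ?_
    rw [mul_left_comm]
    gcongr
  have h3 := le_of_tendsto hlim.abs h2
  refine h3.trans ?_
  rw [hA, mul_add]
  gcongr
  rw [← mul_div_assoc, div_le_iff₀ (by positivity)]
  nlinarith [L.2]

end Riemannian

end ParabolicFrequency

namespace ParabolicFrequency

set_option linter.unusedSectionVars false

/-! ### Gradients, classical and weak. -/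

section Gradient

variable {n : ℕ} {M : Type*} [TopologicalSpace M] [ChartedSpace (EuclideanSpace ℝ (Fin n)) M]
  {c c' : OpenPartialHomeomorph M (EuclideanSpace ℝ (Fin n))} {y : EuclideanSpace ℝ (Fin n)}
  [IsManifold (𝓡 n) ∞ M] {ψ : M → ℝ}

theorem mdifferentiableAt_of_comp_symm (hc : c ∈ atlas (EuclideanSpace ℝ (Fin n)) M)
    (hy : y ∈ c.target) (hd : DifferentiableAt ℝ (fun z => ψ (c.symm z)) y) :
    MDifferentiableAt (𝓡 n) 𝓘(ℝ, ℝ) ψ (c.symm y) := by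
  have h1 : MDifferentiableAt (𝓡 n) (𝓡 n) c (c.symm y) :=
    (mdifferentiable_of_mem hc).mdifferentiableAt (c.map_target hy)
  have h2 : MDifferentiableAt (𝓡 n) 𝓘(ℝ, ℝ) (fun z => ψ (c.symm z)) (c (c.symm y)) := by
    rw [c.right_inv hy]
    exact hd.mdifferentiableAt
  refine (h2.comp _ h1).congr_of_eventuallyEq ?_
  filter_upwards [c.open_source.mem_nhds (c.map_target hy)] with x hx
  simp [c.left_inv hx]

variable [RiemannianBundle (fun x : M => TangentSpace (𝓡 n) x)]

theorem inner_grad_frame (hc : c ∈ atlas (EuclideanSpace ℝ (Fin n)) M) (hy : y ∈ c.target)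
    (hψ : MDifferentiableAt (𝓡 n) 𝓘(ℝ, ℝ) ψ (c.symm y)) (v : EuclideanSpace ℝ (Fin n)) :
    inner ℝ (grad ψ (c.symm y)) (frame c y v) = fderiv ℝ (fun z => ψ (c.symm z)) y v := by
  have h1 : MDifferentiableAt (𝓡 n) (𝓡 n) c.symm y :=
    (mdifferentiable_of_mem hc).symm.mdifferentiableAt hy
  rw [inner_grad, ← mfderiv_eq_fderiv]
  have h2 := mfderiv_comp y hψ h1
  change _ = mfderiv (𝓡 n) 𝓘(ℝ, ℝ) (ψ ∘ c.symm) y v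
  rw [h2]
  rfl

theorem mdifferentiableAt_symm (hc : c ∈ atlas (EuclideanSpace ℝ (Fin n)) M) (hy : y ∈ c.target) :
    MDifferentiableAt (𝓡 n) (𝓡 n) c.symm y :=
  (mdifferentiable_of_mem hc).symm.mdifferentiableAt hy

theorem eq_of_forall_inner_coordVec (hc : c ∈ atlas (EuclideanSpace ℝ (Fin n)) M)
    (hy : y ∈ c.target) {v w : TangentSpace (𝓡 n) (c.symm y)}
    (h : ∀ i, inner ℝ v (coordVec c y i) = inner ℝ w (coordVec c y i)) : v = w := by
  have h1 : inner ℝ (v - w) (v - w) = (0 : ℝ) := by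
    rw [inner_eq_sum_inv_gramMatrix hc hy]
    refine Finset.sum_eq_zero fun i _ => Finset.sum_eq_zero fun j _ => ?_
    rw [inner_sub_left, h i, sub_self]
    ring
  exact sub_eq_zero.1 (inner_self_eq_zero.1 h1)

theorem grad_congr {ψ' : M → ℝ} {x : M} (h : ψ =ᶠ[𝓝 x] ψ') : grad ψ x = (grad ψ' x : TangentSpace (𝓡 n) x) := by
  have : mvfderiv (𝓡 n) ψ x = mvfderiv (𝓡 n) ψ' x := by
    unfold mvfderiv
    rw [h.mfderiv_eq]
    ext v
    rfl
  unfold grad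
  rw [this]

theorem grad_const (a : ℝ) (x : M) : grad (fun _ : M => a) x = (0 : TangentSpace (𝓡 n) x) := by
  unfold grad
  rw [mvfderiv_const]
  exact map_zero _

theorem grad_eq_zero_of_notMem_tsupport {x : M} (h : x ∉ tsupport ψ) :
    grad ψ x = (0 : TangentSpace (𝓡 n) x) := by
  rw [grad_congr (ψ' := fun _ => 0) (notMem_tsupport_iff_eventuallyEq.1 h), grad_const]

theorem ext_inner_tangentSpace {x : M} {v w : TangentSpace (𝓡 n) x}
    (h : ∀ z : TangentSpace (𝓡 n) x, inner ℝ v z = inner ℝ w z) : v = w := by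
  have h1 : inner ℝ (v - w) (v - w) = (0 : ℝ) := by rw [inner_sub_left, h, sub_self]
  exact sub_eq_zero.1 (inner_self_eq_zero.1 h1)

theorem grad_sum {ι : Type*} (s : Finset ι) {ψ : ι → M → ℝ} {x : M}
    (h : ∀ i ∈ s, MDifferentiableAt (𝓡 n) 𝓘(ℝ, ℝ) (ψ i) x) :
    MDifferentiableAt (𝓡 n) 𝓘(ℝ, ℝ) (fun z => ∑ i ∈ s, ψ i z) x ∧
    grad (fun z => ∑ i ∈ s, ψ i z) x = ∑ i ∈ s, (grad (ψ i) x : TangentSpace (𝓡 n) x) := by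
  classical
  induction s using Finset.induction_on with
  | empty => exact ⟨by simpa using mdifferentiableAt_const, by simpa using grad_const 0 x⟩
  | insert a s ha ih =>
    obtain ⟨h1, h2⟩ := ih fun i hi => h i (Finset.mem_insert_of_mem hi)
    have h3 := h a (Finset.mem_insert_self a s)
    simp only [Finset.sum_insert ha]
    refine ⟨h3.add h1, ?_⟩
    rw [← h2]
    refine ext_inner_tangentSpace fun z => ?_
    rw [inner_add_left, inner_grad, inner_grad, inner_grad]
    have := mvfderiv_add h3 h1
    exact congrArg (fun L => L z) this

/-- A vector field with measurable components in the chart `c`. -/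
def MeasurableInChart (c : OpenPartialHomeomorph M (EuclideanSpace ℝ (Fin n)))
    (X : (x : M) → TangentSpace (𝓡 n) x) : Prop :=
  ∀ i, AEStronglyMeasurable (fun y => inner ℝ (X (c.symm y)) (coordVec c y i))
    (volume.restrict c.target)

theorem MeasurableInChart.add {X Y : (x : M) → TangentSpace (𝓡 n) x} (hX : MeasurableInChart c X)
    (hY : MeasurableInChart c Y) : MeasurableInChart c (fun x => X x + Y x) := fun i => by
  simp only [inner_add_left]
  exact (hX i).add (hY i)

theorem MeasurableInChart.smul {X : (x : M) → TangentSpace (𝓡 n) x} (hX : MeasurableInChart c X)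
    {a : M → ℝ} (ha : AEStronglyMeasurable (fun y => a (c.symm y)) (volume.restrict c.target)) :
    MeasurableInChart c (fun x => a x • X x) := fun i => by
  simp only [inner_smul_left, conj_trivial]
  exact ha.mul (hX i)

/-- The directions in which weak derivatives are taken: `0` and the coordinate directions. -/
noncomputable def direction : Option (Fin n) → EuclideanSpace ℝ (Fin n)
  | none => 0
  | some i => EuclideanSpace.single i (1 : ℝ)

/-- The direction 0 records local integrability of f, which the coordinate directions alone would
lose in dimension 0. -/
theorem hasWeakGradient_iff {f : M → ℝ} {G : (x : M) → TangentSpace (𝓡 n) x} :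
    HasWeakGradient f G ↔ ∀ c ∈ atlas (EuclideanSpace ℝ (Fin n)) M, ∀ o : Option (Fin n),
      HasWeakDeriv c.target (direction o) (fun y => f (c.symm y))
        (fun y => inner ℝ (G (c.symm y)) (frame c y (direction o))) := by
  refine forall₂_congr fun c _ => ?_
  constructor
  · rintro ⟨h1, h2⟩ (_ | i)
    · simp only [direction, map_zero, inner_zero_right]
      exact ⟨h1, locallyIntegrableOn_zero, by simp⟩
    · exact ⟨h1, (h2 i).1, (h2 i).2⟩
  · exact fun h => ⟨(h none).1, fun i => ⟨(h (some i)).2.1, (h (some i)).2.2⟩⟩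

namespace HasWeakGradient

variable {f f' : M → ℝ} {G G' : (x : M) → TangentSpace (𝓡 n) x}

theorem hasWeakDeriv (h : HasWeakGradient f G) (hc : c ∈ atlas (EuclideanSpace ℝ (Fin n)) M)
    (i : Fin n) : HasWeakDeriv c.target (EuclideanSpace.single i (1 : ℝ)) (fun y => f (c.symm y))
      (fun y => inner ℝ (G (c.symm y)) (coordVec c y i)) :=
  hasWeakGradient_iff.1 h c hc (some i)

theorem add (h : HasWeakGradient f G) (h' : HasWeakGradient f' G') :
    HasWeakGradient (fun x => f x + f' x) (fun x => G x + G' x) := by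
  rw [hasWeakGradient_iff] at *
  intro c hc o
  simp only [inner_add_left]
  exact (h c hc o).add (h' c hc o)

theorem const_mul (h : HasWeakGradient f G) (a : ℝ) :
    HasWeakGradient (fun x => a * f x) (fun x => a • G x) := by
  rw [hasWeakGradient_iff] at *
  intro c hc o
  simp only [inner_smul_left, conj_trivial]
  exact (h c hc o).const_mul a

theorem measurableInChart (h : HasWeakGradient f G) (hc : c ∈ atlas (EuclideanSpace ℝ (Fin n)) M) :
    MeasurableInChart c G :=
  fun i => (h.hasWeakDeriv hc i).aestronglyMeasurable_right

end HasWeakGradient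

variable [MeasurableSpace M] [BorelSpace M]
  [IsContMDiffRiemannianBundle (𝓡 n) ∞ (EuclideanSpace ℝ (Fin n))
      (fun x : M => TangentSpace (𝓡 n) x)] {φ : M → ℝ}

theorem MeasurableInChart.inner_field (hφ : Continuous φ) (hc : c ∈ atlas (EuclideanSpace ℝ (Fin n)) M)
    {X Y : (x : M) → TangentSpace (𝓡 n) x} (hX : MeasurableInChart c X)
    (hY : MeasurableInChart c Y) :
    AEStronglyMeasurable (fun x => (inner ℝ (X x) (Y x) : ℝ))
      ((weightedVolume n φ).restrict c.source) := by
  rw [aestronglyMeasurable_source_iff hφ hc]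
  have h : AEStronglyMeasurable (fun y => ∑ i, ∑ j, (gramMatrix c y)⁻¹ i j *
      (inner ℝ (X (c.symm y)) (coordVec c y i) : ℝ) * (inner ℝ (Y (c.symm y)) (coordVec c y j) : ℝ))
      (volume.restrict c.target) := by
    refine Finset.aestronglyMeasurable_fun_sum _ fun i _ =>
      Finset.aestronglyMeasurable_fun_sum _ fun j _ => ?_
    exact (((continuousOn_inv_gramMatrix_apply hc i j).aestronglyMeasurable
      c.open_target.measurableSet).mul (hX i)).mul (hY j)
  refine h.congr ?_
  filter_upwards [ae_restrict_mem c.open_target.measurableSet] with y hy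
  exact (inner_eq_sum_inv_gramMatrix hc hy _ _).symm

theorem MeasurableInChart.norm (hφ : Continuous φ) (hc : c ∈ atlas (EuclideanSpace ℝ (Fin n)) M)
    {X : (x : M) → TangentSpace (𝓡 n) x} (hX : MeasurableInChart c X) :
    AEStronglyMeasurable (fun x => ‖X x‖) ((weightedVolume n φ).restrict c.source) := by
  have h := Real.continuous_sqrt.comp_aestronglyMeasurable (hX.inner_field hφ hc hX)
  refine h.congr (Eventually.of_forall fun x => ?_)
  simp only [real_inner_self_eq_norm_sq, Real.sqrt_sq (norm_nonneg _)]

theorem aestronglyMeasurable_of_forall_source [SecondCountableTopology M] {μ : Measure M} {f : M → ℝ}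
    (h : ∀ c ∈ atlas (EuclideanSpace ℝ (Fin n)) M, AEStronglyMeasurable f (μ.restrict c.source)) :
    AEStronglyMeasurable f μ := by
  obtain ⟨s, hs, hsu⟩ := TopologicalSpace.countable_cover_nhds
    (f := fun x : M => (chartAt (EuclideanSpace ℝ (Fin n)) x).source) fun x => chart_source_mem_nhds _ x
  have := hs.to_subtype
  rw [← Measure.restrict_univ (μ := μ), ← hsu, biUnion_eq_iUnion, aestronglyMeasurable_iUnion_iff]
  exact fun x => h _ (chart_mem_atlas _ _)

theorem aestronglyMeasurable_inner [SecondCountableTopology M] (hφ : Continuous φ)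
    {X Y : (x : M) → TangentSpace (𝓡 n) x}
    (hX : ∀ c ∈ atlas (EuclideanSpace ℝ (Fin n)) M, MeasurableInChart c X)
    (hY : ∀ c ∈ atlas (EuclideanSpace ℝ (Fin n)) M, MeasurableInChart c Y) :
    AEStronglyMeasurable (fun x => (inner ℝ (X x) (Y x) : ℝ)) (weightedVolume n φ) :=
  aestronglyMeasurable_of_forall_source fun _ hc => (hX _ hc).inner_field hφ hc (hY _ hc)

theorem aestronglyMeasurable_norm [SecondCountableTopology M] (hφ : Continuous φ)
    {X : (x : M) → TangentSpace (𝓡 n) x}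
    (hX : ∀ c ∈ atlas (EuclideanSpace ℝ (Fin n)) M, MeasurableInChart c X) :
    AEStronglyMeasurable (fun x => ‖X x‖) (weightedVolume n φ) :=
  aestronglyMeasurable_of_forall_source fun _ hc => (hX _ hc).norm hφ hc

/-- Weak gradients are unique. -/
theorem HasWeakGradient.ae_eq [SecondCountableTopology M] (hφ : Continuous φ) {f f' : M → ℝ}
    {G G' : (x : M) → TangentSpace (𝓡 n) x} (h : HasWeakGradient f G) (h' : HasWeakGradient f' G')
    (hf : f =ᵐ[weightedVolume n φ] f') : ∀ᵐ x ∂(weightedVolume n φ), G x = G' x := by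
  refine ae_of_forall_ae_source fun c hc => (ae_source_iff hφ hc).2 ?_
  have h0 : ∀ᵐ y, y ∈ c.target → f (c.symm y) = f' (c.symm y) :=
    (ae_source_iff (P := fun x => f x = f' x) hφ hc).1 (hf.mono fun x hx _ => hx)
  have h1 : ∀ i, ∀ᵐ y, y ∈ c.target → inner ℝ (G (c.symm y)) (coordVec c y i) =
      inner ℝ (G' (c.symm y)) (coordVec c y i) := by
    intro i
    have h2 := h.hasWeakDeriv hc i
    refine h2.ae_eq c.open_target (f := fun y => f (c.symm y)) ?_
    have h3 := h'.hasWeakDeriv hc i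
    have h4 : ∀ᵐ y ∂volume.restrict c.target, f' (c.symm y) = f (c.symm y) := by
      rw [ae_restrict_iff' c.open_target.measurableSet]
      exact h0.mono fun y hy hyc => (hy hyc).symm
    refine ⟨h2.1, h3.2.1, fun ψ h5 h6 h7 => ?_⟩
    rw [← h3.2.2 ψ h5 h6 h7]
    refine integral_congr_ae ?_
    filter_upwards [h0] with y hy
    by_cases hyt : y ∈ c.target
    · simp only [hy hyt]
    · have : fderiv ℝ ψ y = 0 := by
        rw [(notMem_tsupport_iff_eventuallyEq.1 fun h => hyt (h7 h)).fderiv_eq]; simp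
      simp [this]
  filter_upwards [ae_all_iff.2 h1] with y hy hyt
  exact eq_of_forall_inner_coordVec hc hyt fun i => hy i hyt

end Gradient

end ParabolicFrequency

namespace ParabolicFrequency

set_option linter.unusedSectionVars false

/-! ### Hölder inequalities, extension by zero and transplantation. -/

section Holder

variable {α : Type*} [MeasurableSpace α] {μ : Measure α} {p : ℝ} {a b : α → ℝ}

/-- The conjugate exponent p/(p-1) is written as 1/(p-1)+1 so that the pairing lemmas apply with p-1
in the role of q. -/
theorem PowIntegrable.abs_rpow_sub_one (hp : 1 < p) (ha : PowIntegrable μ p a) :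
    PowIntegrable μ ((p - 1)⁻¹ + 1) (fun x => |a x| ^ (p - 1)) := by
  refine ⟨(ha.1.norm.aemeasurable.pow_const _).aestronglyMeasurable, ha.2.congr ?_⟩
  refine Eventually.of_forall fun x => ?_
  have hp' : p - 1 ≠ 0 := by linarith
  simp only
  rw [abs_of_nonneg (a := |a x| ^ (p - 1)) (by positivity), ← Real.rpow_mul (abs_nonneg _)]
  congr 1
  field_simp
  ring

theorem PowIntegrable.integrable_rpow_sub_one_mul (hp : 1 < p) (ha : PowIntegrable μ p a)
    (hb : PowIntegrable μ p b) : Integrable (fun x => |a x| ^ (p - 1) * |b x|) μ := by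
  have hb' : PowIntegrable μ (p - 1 + 1) (fun x => |b x|) := by
    rw [sub_add_cancel]
    exact ⟨hb.1.norm, by simpa using hb.2⟩
  exact (ha.abs_rpow_sub_one hp).integrable_mul (sub_pos.2 hp) hb'

theorem PowIntegrable.integral_rpow_sub_one_mul_le (hp : 1 < p) (ha : PowIntegrable μ p a)
    (hb : PowIntegrable μ p b) : ∫ x, |a x| ^ (p - 1) * |b x| ∂μ ≤
      (∫ x, |a x| ^ p ∂μ) ^ (1 / ((p - 1)⁻¹ + 1)) * (∫ x, |b x| ^ p ∂μ) ^ (1 / p) := by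
  have hb' : PowIntegrable μ (p - 1 + 1) (fun x => |b x|) := by
    rw [sub_add_cancel]
    exact ⟨hb.1.norm, by simpa using hb.2⟩
  have h := (le_abs_self _).trans
    ((ha.abs_rpow_sub_one hp).abs_integral_mul_le (sub_pos.2 hp) hb')
  refine h.trans (le_of_eq ?_)
  have hp' : p - 1 ≠ 0 := by linarith
  have e : ∀ x, |(|a x| ^ (p - 1))| ^ ((p - 1)⁻¹ + 1) = |a x| ^ p := fun x => by
    rw [abs_of_nonneg (a := |a x| ^ (p - 1)) (by positivity), ← Real.rpow_mul (abs_nonneg _)]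
    congr 1
    field_simp
    ring
  simp only [e, abs_abs, sub_add_cancel]

/-- Where v = 0 the power may be singular for p < 2, but the inner product vanishes there. -/
theorem abs_rpow_mul_inner_le {E : Type*} [NormedAddCommGroup E] [InnerProductSpace ℝ E] (v w : E)
    (p : ℝ) : |‖v‖ ^ (p - 2) * inner ℝ v w| ≤ ‖v‖ ^ (p - 1) * ‖w‖ := by
  rcases eq_or_ne v 0 with rfl | hv
  · simp only [inner_zero_left, mul_zero, abs_zero]
    positivity
  · have h0 : 0 < ‖v‖ := norm_pos_iff.2 hv
    rw [abs_mul, abs_of_nonneg (by positivity)]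
    calc _ ≤ ‖v‖ ^ (p - 2) * (‖v‖ * ‖w‖) :=
          mul_le_mul_of_nonneg_left (abs_real_inner_le_norm v w) (by positivity)
      _ = _ := by
          rw [← mul_assoc, ← Real.rpow_add_one h0.ne']
          congr 2
          ring

end Holder

section Euclidean

variable {X : Type*} [NormedAddCommGroup X] [NormedSpace ℝ X] [FiniteDimensional ℝ X]
  [MeasureSpace X] [BorelSpace X] [(volume : Measure X).IsAddHaarMeasure]
  {Ω K : Set X} {v : X} {f g : X → ℝ}

/-- The extension by zero of a function with compact support is weakly differentiable. -/
theorem HasWeakDeriv.indicator (hΩ : IsOpen Ω) (hf : HasWeakDeriv Ω v f g) (hK : IsCompact K)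
    (hKΩ : K ⊆ Ω) (hf0 : ∀ y ∈ Ω, y ∉ K → f y = 0) (hg0 : ∀ y ∈ Ω, y ∉ K → g y = 0) :
    Integrable (Ω.indicator f) ∧ Integrable (Ω.indicator g) ∧
      HasWeakDeriv univ v (Ω.indicator f) (Ω.indicator g) := by
  obtain ⟨η, h1, h2, h3, -, h5⟩ := exists_cutoff hΩ hK hKΩ
  have e1 : (fun y => η y * f y) = Ω.indicator f := by
    ext y
    by_cases hy : y ∈ Ω
    · rw [indicator_of_mem hy]
      by_cases hyK : y ∈ K
      · rw [(h5 y hyK).eq_of_nhds]; simp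
      · simp [hf0 y hy hyK]
    · rw [indicator_of_notMem hy, image_eq_zero_of_notMem_tsupport fun h => hy (h3 h), zero_mul]
  have e2 : (fun y => η y * g y + fderiv ℝ η y v * f y) = Ω.indicator g := by
    ext y
    by_cases hy : y ∈ Ω
    · rw [indicator_of_mem hy]
      by_cases hyK : y ∈ K
      · rw [(h5 y hyK).eq_of_nhds, (h5 y hyK).fderiv_eq]; simp
      · simp [hf0 y hy hyK, hg0 y hy hyK]
    · have : fderiv ℝ η y = 0 := by
        rw [(notMem_tsupport_iff_eventuallyEq.1 fun h => hy (h3 h)).fderiv_eq]; simp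
      rw [indicator_of_notMem hy, image_eq_zero_of_notMem_tsupport fun h => hy (h3 h), this]
      simp
  have h := hf.cutoff h1 h2 h3
  rwa [e1, e2] at h

end Euclidean

section Transplant

variable {n : ℕ} {M : Type*} [MetricSpace M] [ChartedSpace (EuclideanSpace ℝ (Fin n)) M]
  {c : OpenPartialHomeomorph M (EuclideanSpace ℝ (Fin n))} {y : EuclideanSpace ℝ (Fin n)}
  [IsManifold (𝓡 n) ∞ M] {g : EuclideanSpace ℝ (Fin n) → ℝ} {L : Set (EuclideanSpace ℝ (Fin n))}

/-- The function on the manifold given by `g` in the chart `c`. -/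
noncomputable def transplant (c : OpenPartialHomeomorph M (EuclideanSpace ℝ (Fin n)))
    (g : EuclideanSpace ℝ (Fin n) → ℝ) : M → ℝ :=
  c.source.indicator (fun x => g (c x))

theorem transplant_symm (hy : y ∈ c.target) : transplant c g (c.symm y) = g y := by
  rw [transplant, indicator_of_mem (c.map_target hy), c.right_inv hy]

theorem isCompact_symm_image (hL : IsCompact L) (hLc : L ⊆ c.target) : IsCompact (c.symm '' L) :=
  hL.image_of_continuousOn (c.continuousOn_symm.mono hLc)

theorem symm_image_subset (hLc : L ⊆ c.target) : c.symm '' L ⊆ c.source := by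
  rintro _ ⟨y, hy, rfl⟩
  exact c.map_target (hLc hy)

theorem tsupport_transplant_subset (hL : IsCompact L) (hLc : L ⊆ c.target) (hg : tsupport g ⊆ L) :
    tsupport (transplant c g) ⊆ c.symm '' L := by
  refine closure_minimal (fun x hx => ?_) (isCompact_symm_image hL hLc).isClosed
  have hxs : x ∈ c.source := by
    by_contra h
    exact hx (indicator_of_notMem h _)
  rw [Function.mem_support, transplant, indicator_of_mem hxs] at hx
  exact ⟨c x, hg (subset_tsupport g hx), c.left_inv hxs⟩

theorem isTestFunction_transplant (hc : c ∈ atlas (EuclideanSpace ℝ (Fin n)) M)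
    (hg : ContDiff ℝ ∞ g) (hL : IsCompact L) (hLc : L ⊆ c.target) (hgL : tsupport g ⊆ L) :
    IsTestFunction n (transplant c g) := by
  have hsub := tsupport_transplant_subset hL hLc hgL
  refine ⟨fun x => ?_, (isCompact_symm_image hL hLc).of_isClosed_subset (isClosed_tsupport _) hsub⟩
  by_cases hx : x ∈ c.source
  · have h1 : ContMDiffAt (𝓡 n) 𝓘(ℝ, ℝ) ∞ (g ∘ c) x :=
      hg.contMDiff.contMDiffAt.comp x ((contMDiffOn_of_mem hc).contMDiffAt (c.open_source.mem_nhds hx))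
    refine h1.congr_of_eventuallyEq ?_
    filter_upwards [c.open_source.mem_nhds hx] with z hz
    simp [transplant, hz]
  · refine (contMDiffAt_const (c := (0 : ℝ))).congr_of_eventuallyEq ?_
    exact notMem_tsupport_iff_eventuallyEq.1 fun h => hx (symm_image_subset hLc (hsub h))

end Transplant

section Local

variable {n : ℕ} {M : Type*} [MetricSpace M] [ChartedSpace (EuclideanSpace ℝ (Fin n)) M]
  {c : OpenPartialHomeomorph M (EuclideanSpace ℝ (Fin n))} {y : EuclideanSpace ℝ (Fin n)}
  [IsManifold (𝓡 n) ∞ M] [RiemannianBundle (fun x : M => TangentSpace (𝓡 n) x)]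
  [IsContMDiffRiemannianBundle (𝓡 n) ∞ (EuclideanSpace ℝ (Fin n))
      (fun x : M => TangentSpace (𝓡 n) x)] [MeasurableSpace M] [BorelSpace M]
  {φ : M → ℝ} {L : Set (EuclideanSpace ℝ (Fin n))}

theorem measurableInChart_grad_of_contMDiff (hc : c ∈ atlas (EuclideanSpace ℝ (Fin n)) M) {ψ : M → ℝ}
    (hψ : ContMDiff (𝓡 n) 𝓘(ℝ, ℝ) ∞ ψ) : MeasurableInChart c (grad ψ) := by
  intro i
  have h1 : ContDiffOn ℝ ∞ (fun y => ψ (c.symm y)) c.target := by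
    rw [← contMDiffOn_iff_contDiffOn]
    exact hψ.comp_contMDiffOn (contMDiffOn_symm_of_mem hc)
  have h2 := ((h1.continuousOn_fderiv_of_isOpen c.open_target (by simp)).clm_apply
    (continuousOn_const (c := EuclideanSpace.single i (1 : ℝ)))).aestronglyMeasurable
    (μ := volume) c.open_target.measurableSet
  refine h2.congr ?_
  filter_upwards [ae_restrict_mem c.open_target.measurableSet] with y hy
  exact (inner_grad_frame hc hy (hψ.mdifferentiableAt (by simp)) _).symm

/-- Continuity on a compact set makes the L^p norm of a vector field there comparable with the
Euclidean L^p norms of its components. -/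
theorem exists_chart_bounds (hφ : Continuous φ) (hc : c ∈ atlas (EuclideanSpace ℝ (Fin n)) M)
    (hL : IsCompact L) (hLc : L ⊆ c.target) : ∃ C : ℝ, 0 < C ∧ ∀ y ∈ L,
      chartDensity φ c y ≤ C ∧ 1 ≤ C * chartDensity φ c y ∧
      (∀ v : TangentSpace (𝓡 n) (c.symm y), ∀ i, |(inner ℝ v (coordVec c y i) : ℝ)| ≤ C * ‖v‖) ∧
      ∀ v : TangentSpace (𝓡 n) (c.symm y), ‖v‖ ≤ C * ∑ i, |(inner ℝ v (coordVec c y i) : ℝ)| := by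
  have hD := (continuousOn_chartDensity hφ hc).mono hLc
  obtain ⟨C1, h1⟩ := hL.exists_bound_of_continuousOn hD
  obtain ⟨C2, h2⟩ := hL.exists_bound_of_continuousOn
    (hD.inv₀ fun y hy => (chartDensity_pos φ hc (hLc hy)).ne')
  choose C3 h3 using fun i => hL.exists_bound_of_continuousOn
    ((continuousOn_norm_frame hc (EuclideanSpace.single i (1 : ℝ))).mono hLc)
  choose C4 h4 using fun i j => hL.exists_bound_of_continuousOn
    ((continuousOn_inv_gramMatrix_apply hc i j).mono hLc)
  set C := 1 + |C1| + |C2| + ∑ i, |C3 i| + ∑ i, ∑ j, |C4 i j| with hC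
  have p3 : 0 ≤ ∑ i, |C3 i| := Finset.sum_nonneg fun i _ => abs_nonneg _
  have p4 : 0 ≤ ∑ i, ∑ j, |C4 i j| := Finset.sum_nonneg fun i _ =>
    Finset.sum_nonneg fun j _ => abs_nonneg _
  have hC1 : 1 ≤ C := by have := abs_nonneg C1; have := abs_nonneg C2; linarith
  refine ⟨C, by linarith, fun y hy => ⟨?_, ?_, fun v i => ?_, fun v => ?_⟩⟩
  · have := h1 y hy
    rw [Real.norm_of_nonneg (chartDensity_nonneg φ c y)] at this
    have := le_abs_self C1; have := abs_nonneg C2; linarith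
  · have h : ‖(chartDensity φ c y)⁻¹‖ ≤ C2 := h2 y hy
    have hpos := chartDensity_pos φ hc (hLc hy)
    rw [Real.norm_of_nonneg (by positivity), inv_le_iff_one_le_mul₀ hpos] at h
    refine h.trans (mul_le_mul_of_nonneg_right ?_ hpos.le)
    have := le_abs_self C2; have := abs_nonneg C1; linarith
  · have h := h3 i y hy
    rw [norm_norm] at h
    refine (abs_real_inner_le_norm _ _).trans ?_
    rw [mul_comm]
    refine mul_le_mul_of_nonneg_right (h.trans ?_) (norm_nonneg _)
    have h5 : |C3 i| ≤ ∑ i, |C3 i| := Finset.single_le_sum (f := fun i => |C3 i|)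
      (fun i _ => abs_nonneg _) (Finset.mem_univ i)
    have := le_abs_self (C3 i); have := abs_nonneg C1; have := abs_nonneg C2
    linarith
  · set S := ∑ i, |(inner ℝ v (coordVec c y i) : ℝ)| with hS
    have hS0 : 0 ≤ S := Finset.sum_nonneg fun i _ => abs_nonneg _
    have hle : ∀ i, |(inner ℝ v (coordVec c y i) : ℝ)| ≤ S := fun i =>
      Finset.single_le_sum (f := fun i => |(inner ℝ v (coordVec c y i) : ℝ)|)
        (fun i _ => abs_nonneg _) (Finset.mem_univ i)
    have hsq : ‖v‖ ^ 2 ≤ (C * S) ^ 2 := by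
      rw [← real_inner_self_eq_norm_sq, inner_eq_sum_inv_gramMatrix hc (hLc hy)]
      calc _ ≤ ∑ i, ∑ j, |C4 i j| * S ^ 2 := by
            refine Finset.sum_le_sum fun i _ => Finset.sum_le_sum fun j _ => ?_
            refine (le_abs_self _).trans ?_
            rw [abs_mul, abs_mul, mul_assoc, sq]
            refine mul_le_mul ((h4 i j y hy).trans (le_abs_self _))
              (mul_le_mul (hle i) (hle j) (abs_nonneg _) hS0) (by positivity) (abs_nonneg _)
        _ = (∑ i, ∑ j, |C4 i j|) * S ^ 2 := by simp only [Finset.sum_mul]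
        _ ≤ C * S ^ 2 := by
            refine mul_le_mul_of_nonneg_right ?_ (sq_nonneg _)
            have := abs_nonneg C1; have := abs_nonneg C2; linarith
        _ ≤ C ^ 2 * S ^ 2 := by
            refine mul_le_mul_of_nonneg_right ?_ (sq_nonneg _)
            nlinarith
        _ = _ := by ring
    exact (sq_le_sq₀ (norm_nonneg _) (by positivity)).1 hsq

end Local

end ParabolicFrequency

namespace ParabolicFrequency

set_option linter.unusedSectionVars false

/-! ### The weak formulation inside one chart. -/

section Local

variable {n : ℕ} {M : Type*} [MetricSpace M] [ChartedSpace (EuclideanSpace ℝ (Fin n)) M]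
  {c : OpenPartialHomeomorph M (EuclideanSpace ℝ (Fin n))} {y : EuclideanSpace ℝ (Fin n)}
  [IsManifold (𝓡 n) ∞ M] [RiemannianBundle (fun x : M => TangentSpace (𝓡 n) x)]
  [IsContMDiffRiemannianBundle (𝓡 n) ∞ (EuclideanSpace ℝ (Fin n))
      (fun x : M => TangentSpace (𝓡 n) x)] [MeasurableSpace M] [BorelSpace M]
  [SecondCountableTopology M]
  {φ f F : M → ℝ} {X G : (x : M) → TangentSpace (𝓡 n) x} {K : Set M} {p : ℝ}

/-- The `p`-th power of a function supported in a chart is integrable in the coordinates. -/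
theorem integrable_component_rpow (hφ : Continuous φ) (hc : c ∈ atlas (EuclideanSpace ℝ (Fin n)) M)
    (hp : 1 < p) (hX : PowIntegrable (weightedVolume n φ) p (fun x => ‖X x‖))
    (hK : IsCompact K) (hKc : K ⊆ c.source) (hXK : ∀ x ∉ K, X x = 0) (i : Fin n)
    (hXm : MeasurableInChart c X) :
    Integrable (fun y => |c.target.indicator
      (fun y => (inner ℝ (X (c.symm y)) (coordVec c y i) : ℝ)) y| ^ p) := by
  have hp0 : 0 ≤ p := by linarith
  have hK' : IsCompact (c '' K) := hK.image_of_continuousOn (c.continuousOn.mono hKc)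
  have hKt : c '' K ⊆ c.target := by
    rintro _ ⟨x, hx, rfl⟩
    exact c.map_source (hKc hx)
  obtain ⟨C, hC, hb⟩ := exists_chart_bounds hφ hc hK' hKt
  have h1 : IntegrableOn (fun x => |‖X x‖| ^ p) c.source (weightedVolume n φ) := hX.2.integrableOn
  have h2 := (integrableOn_source_iff hφ hc h1.1).1 h1
  have h3 : IntegrableOn (fun y => |(inner ℝ (X (c.symm y)) (coordVec c y i) : ℝ)| ^ p) c.target := by
    refine (h2.const_mul (C ^ p * C)).mono' ?_ ?_
    · exact ((hXm i).norm.aemeasurable.pow_const p).aestronglyMeasurable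
    · filter_upwards [ae_restrict_mem c.open_target.measurableSet] with y hy
      rw [Real.norm_of_nonneg (by positivity)]
      by_cases hyK : y ∈ c '' K
      · obtain ⟨-, hD, hv, -⟩ := hb y hyK
        have h4 : |(inner ℝ (X (c.symm y)) (coordVec c y i) : ℝ)| ^ p ≤ C ^ p * ‖X (c.symm y)‖ ^ p := by
          rw [← Real.mul_rpow hC.le (norm_nonneg _)]
          exact Real.rpow_le_rpow (abs_nonneg _) (hv _ i) hp0
        rw [abs_norm]
        calc _ ≤ C ^ p * ‖X (c.symm y)‖ ^ p * 1 := by rwa [mul_one]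
          _ ≤ C ^ p * ‖X (c.symm y)‖ ^ p * (C * chartDensity φ c y) :=
              mul_le_mul_of_nonneg_left hD (by positivity)
          _ = _ := by ring
      · have : X (c.symm y) = 0 := hXK _ fun h => hyK ⟨_, h, c.right_inv hy⟩
        rw [this, inner_zero_left, abs_zero, Real.zero_rpow (by linarith)]
        have := chartDensity_nonneg φ c y
        positivity
  rw [← integrable_indicator_iff c.open_target.measurableSet] at h3
  refine h3.congr (Eventually.of_forall fun y => ?_)
  by_cases hy : y ∈ c.target
  · simp [hy]
  · simp [hy, Real.zero_rpow (show p ≠ 0 by linarith)]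

/-- The `L^p`-norm of a vector field supported in a chart is controlled by its components. -/
theorem integral_norm_rpow_le (hφ : Continuous φ) (hc : c ∈ atlas (EuclideanSpace ℝ (Fin n)) M)
    (hp : 1 < p) {L : Set (EuclideanSpace ℝ (Fin n))} (hL : IsCompact L) (hLc : L ⊆ c.target) :
    ∃ C : ℝ, ∀ (X : (x : M) → TangentSpace (𝓡 n) x) (d : Fin n → EuclideanSpace ℝ (Fin n) → ℝ),
      MeasurableInChart c X → (∀ x ∉ c.symm '' L, X x = 0) →
      (∀ y ∈ L, ∀ i, (inner ℝ (X (c.symm y)) (coordVec c y i) : ℝ) = d i y) →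
      (∀ i, Integrable (fun y => |d i y| ^ p)) →
      PowIntegrable (weightedVolume n φ) p (fun x => ‖X x‖) ∧
      ∫ x, |‖X x‖| ^ p ∂(weightedVolume n φ) ≤ C * ∑ i, ∫ y, |d i y| ^ p := by
  obtain ⟨C, hC, hb⟩ := exists_chart_bounds hφ hc hL hLc
  refine ⟨C * (C ^ p * (n : ℝ) ^ (p - 1)), fun X d hXm hX0 hd hdi => ?_⟩
  have hp0 : 0 < p := by linarith
  have hsub : c.symm '' L ⊆ c.source := symm_image_subset hLc
  have hs : ∀ x ∉ c.source, X x = 0 := fun x hx => hX0 x fun h => hx (hsub h)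
  have hm1 := hXm.norm hφ hc
  have hind : c.source.indicator (fun x => ‖X x‖) = fun x => ‖X x‖ := by
    refine indicator_eq_self.2 fun x hx => ?_
    by_contra h
    exact hx (by simp [hs x h])
  have hm : AEStronglyMeasurable (fun x => ‖X x‖) (weightedVolume n φ) := by
    rw [← aestronglyMeasurable_indicator_iff c.open_source.measurableSet, hind] at hm1
    exact hm1
  have hm2 : AEStronglyMeasurable (fun x => |‖X x‖| ^ p) (weightedVolume n φ) :=
    (hm.norm.aemeasurable.pow_const p).aestronglyMeasurable
  have hsum : Integrable (fun y => ∑ i, |d i y| ^ p) := integrable_finsetSum _ fun i _ => hdi i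
  have hle : ∀ y ∈ c.target, chartDensity φ c y * |‖X (c.symm y)‖| ^ p ≤
      C * (C ^ p * (n : ℝ) ^ (p - 1)) * ∑ i, |d i y| ^ p := by
    intro y hy
    have h0 : 0 ≤ ∑ i, |d i y| ^ p := Finset.sum_nonneg fun i _ => by positivity
    by_cases hyL : y ∈ L
    · obtain ⟨hD, -, -, hv⟩ := hb y hyL
      rw [abs_norm]
      have h1 : ‖X (c.symm y)‖ ^ p ≤ C ^ p * (∑ i, |d i y|) ^ p := by
        rw [← Real.mul_rpow hC.le (Finset.sum_nonneg fun i _ => abs_nonneg _)]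
        refine Real.rpow_le_rpow (norm_nonneg _) ((hv _).trans (le_of_eq ?_)) hp0.le
        simp_rw [hd y hyL]
      have h2 := Real.rpow_sum_le_const_mul_sum_rpow (s := Finset.univ) (fun i => d i y) hp.le
      rw [Finset.card_univ, Fintype.card_fin] at h2
      calc _ ≤ C * (C ^ p * ((n : ℝ) ^ (p - 1) * ∑ i, |d i y| ^ p)) := by
            refine mul_le_mul hD (h1.trans ?_) (by positivity) hC.le
            exact mul_le_mul_of_nonneg_left h2 (by positivity)
        _ = _ := by ring
    · have : X (c.symm y) = 0 := hX0 _ fun ⟨z, hz, hzy⟩ => hyL (by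
        rwa [c.symm.injOn (hLc hz) hy hzy] at hz)
      rw [this, norm_zero, abs_zero, Real.zero_rpow hp0.ne', mul_zero]
      positivity
  have hint : IntegrableOn (fun y => chartDensity φ c y * |‖X (c.symm y)‖| ^ p) c.target := by
    refine ((hsum.const_mul (C * (C ^ p * (n : ℝ) ^ (p - 1)))).integrableOn).mono' ?_ ?_
    · refine ((continuousOn_chartDensity hφ hc).aestronglyMeasurable
        c.open_target.measurableSet).mul ?_
      exact (aestronglyMeasurable_source_iff (f := fun x => |‖X x‖| ^ p) hφ hc).1 hm2.restrict
    · filter_upwards [ae_restrict_mem c.open_target.measurableSet] with y hy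
      rw [Real.norm_of_nonneg (mul_nonneg (chartDensity_nonneg φ c y) (by positivity))]
      exact hle y hy
  have hint' := (integrableOn_source_iff hφ hc hm2.restrict).2 hint
  have hz : ∀ x ∉ c.source, |‖X x‖| ^ p = 0 := fun x hx => by
    rw [hs x hx, norm_zero, abs_zero, Real.zero_rpow hp0.ne']
  refine ⟨⟨hm, ?_⟩, ?_⟩
  · exact (integrableOn_iff_integrable_of_support_subset fun x hx => by
      by_contra h
      exact hx (hz x h)).1 hint'
  · rw [← setIntegral_eq_integral_of_forall_compl_eq_zero hz, setIntegral_source hφ hc hm2.restrict,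
      ← integral_finsetSum _ fun i _ => hdi i, ← integral_const_mul]
    refine (setIntegral_mono_on hint (hsum.const_mul _).integrableOn c.open_target.measurableSet
      hle).trans ?_
    refine setIntegral_le_integral (hsum.const_mul _) (Eventually.of_forall fun y => ?_)
    have h0 : 0 ≤ ∑ i, |d i y| ^ p := Finset.sum_nonneg fun i _ => by positivity
    simp only [Pi.zero_apply]
    positivity

theorem integrable_rpow_mul_inner (hφ : Continuous φ) (hp : 1 < p)
    (hG : PowIntegrable (weightedVolume n φ) p (fun x => ‖G x‖))
    (hGm : ∀ c ∈ atlas (EuclideanSpace ℝ (Fin n)) M, MeasurableInChart c G)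
    (hXm : ∀ c ∈ atlas (EuclideanSpace ℝ (Fin n)) M, MeasurableInChart c X)
    (hX : PowIntegrable (weightedVolume n φ) p (fun x => ‖X x‖)) :
    Integrable (fun x => ‖G x‖ ^ (p - 2) * inner ℝ (G x) (X x)) (weightedVolume n φ) := by
  refine (hG.integrable_rpow_sub_one_mul hp hX).mono' ?_ (Eventually.of_forall fun x => ?_)
  · exact ((aestronglyMeasurable_norm hφ hGm).aemeasurable.pow_const _).aestronglyMeasurable.mul
      (aestronglyMeasurable_inner hφ hGm hXm)
  · simpa using abs_rpow_mul_inner_le (G x) (X x) p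

/-- The weak formulation for bounded test functions with `p`-integrable weak gradient and compact
support in a chart. -/
theorem HasWeakPLaplacian.integral_eq_of_chart (hφ : Continuous φ)
    (hc : c ∈ atlas (EuclideanSpace ℝ (Fin n)) M) (hp : 1 < p) (hF : HasWeakPLaplacian φ p G F)
    (hG : PowIntegrable (weightedVolume n φ) p (fun x => ‖G x‖))
    (hGm : ∀ c ∈ atlas (EuclideanSpace ℝ (Fin n)) M, MeasurableInChart c G)
    (hXm : ∀ c ∈ atlas (EuclideanSpace ℝ (Fin n)) M, MeasurableInChart c X)
    (hX : PowIntegrable (weightedVolume n φ) p (fun x => ‖X x‖))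
    (hK : IsCompact K) (hKc : K ⊆ c.source) (hfK : ∀ x ∉ K, f x = 0) (hXK : ∀ x ∉ K, X x = 0)
    {B : ℝ} (hfB : ∀ x, |f x| ≤ B)
    (hw : ∀ o : Option (Fin n), HasWeakDeriv c.target (direction o) (fun y => f (c.symm y))
        (fun y => inner ℝ (X (c.symm y)) (frame c y (direction o)))) :
    ∫ x, F x * f x ∂(weightedVolume n φ) =
      -∫ x, ‖G x‖ ^ (p - 2) * inner ℝ (G x) (X x) ∂(weightedVolume n φ) := by
  set μ := weightedVolume n φ with hμ
  have : IsLocallyFiniteMeasure μ := isLocallyFiniteMeasure_weightedVolume hφ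
  have hp0 : 0 < p := by linarith
  have hK' : IsCompact (c '' K) := hK.image_of_continuousOn (c.continuousOn.mono hKc)
  have hKt : c '' K ⊆ c.target := by
    rintro _ ⟨x, hx, rfl⟩
    exact c.map_source (hKc hx)
  have hKnot : ∀ y ∈ c.target, y ∉ c '' K → c.symm y ∉ K := fun y hy h h' =>
    h ⟨_, h', c.right_inv hy⟩
  set f' : EuclideanSpace ℝ (Fin n) → ℝ := c.target.indicator (fun y => f (c.symm y)) with hf'
  set g : Fin n → EuclideanSpace ℝ (Fin n) → ℝ := fun i => c.target.indicator
    (fun y => (inner ℝ (X (c.symm y)) (coordVec c y i) : ℝ)) with hg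
  have hwe := fun o => (hw o).indicator c.open_target hK' hKt
    (fun y hy h => hfK _ (hKnot y hy h)) (fun y hy h => by rw [hXK _ (hKnot y hy h), inner_zero_left])
  have hf'i : Integrable f' := (hwe none).1
  have hgw : ∀ i, HasWeakDeriv univ (EuclideanSpace.single i (1 : ℝ)) f' (g i) := fun i =>
    (hwe (some i)).2.2
  have hgp : ∀ i, Integrable (fun y => |g i y| ^ p) := fun i =>
    integrable_component_rpow hφ hc hp hX hK hKc hXK i (hXm c hc)
  have hgi : ∀ i, Integrable (g i) := fun i => (hwe (some i)).2.1
  have hf't : tsupport f' ⊆ c '' K := by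
    refine closure_minimal (fun y hy => ?_) hK'.isClosed
    by_contra h
    by_cases hyt : y ∈ c.target
    · exact hy (by rw [hf', indicator_of_mem hyt, hfK _ (hKnot y hyt h)])
    · exact hy (indicator_of_notMem hyt _)
  have hf'B : ∀ y, |f' y| ≤ |B| := fun y => by
    by_cases hyt : y ∈ c.target
    · rw [hf', indicator_of_mem hyt]; exact (hfB _).trans (le_abs_self B)
    · rw [hf', indicator_of_notMem hyt, abs_zero]
      exact abs_nonneg B
  obtain ⟨δ, hδ, hδt⟩ := hK'.exists_cthickening_subset_open c.open_target hKt
  set L := Metric.cthickening δ (c '' K) with hL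
  have hLc : IsCompact L := hK'.cthickening
  -- Starting the sequence at k₀ confines all mollifications to one compact subset of the chart
  -- domain.
  obtain ⟨k₀, hk₀⟩ := exists_nat_one_div_lt hδ
  set fk : ℕ → EuclideanSpace ℝ (Fin n) → ℝ := fun k => mollify (k + k₀) f' with hfk
  have hfkt : ∀ k, tsupport (fk k) ⊆ L := by
    intro k
    refine (tsupport_mollify_subset _ _).trans ?_
    refine (Metric.cthickening_mono ?_ _).trans (Metric.cthickening_subset_of_subset _ hf't)
    refine le_trans ?_ hk₀.le
    push_cast
    gcongr
    linarith [(Nat.cast_nonneg k : (0 : ℝ) ≤ k)]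
  have hfks : ∀ k, ContDiff ℝ ∞ (fk k) := fun k => contDiff_mollify _ hf'i.locallyIntegrable
  set ψ : ℕ → M → ℝ := fun k => transplant c (fk k) with hψ
  have hψt : ∀ k, IsTestFunction n (ψ k) := fun k =>
    isTestFunction_transplant hc (hfks k) hLc hδt (hfkt k)
  have hψsupp : ∀ k, tsupport (ψ k) ⊆ c.symm '' L := fun k =>
    tsupport_transplant_subset hLc hδt (hfkt k)
  have hψB : ∀ k x, |ψ k x| ≤ |B| := fun k x => by
    by_cases hx : x ∈ c.source
    · rw [hψ]
      simp only [transplant, indicator_of_mem hx]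
      exact abs_mollify_le _ hf'B _
    · simp [hψ, transplant, hx]
  have htest := fun k => hF.2.2 (ψ k) (hψt k)
  -- convergence of the left-hand sides
  have hZ : IsCompact (c.symm '' L) := isCompact_symm_image hLc hδt
  have hlim1 : Tendsto (fun k => ∫ x, F x * ψ k x ∂μ) atTop (𝓝 (∫ x, F x * f x ∂μ)) := by
    have hFi : IntegrableOn F (c.symm '' L) μ := hF.1.integrableOn_isCompact hZ
    refine tendsto_integral_of_dominated_convergence
      ((c.symm '' L).indicator fun x => |F x| * |B|) (fun k => ?_) ?_ (fun k => ?_) ?_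
    · exact hF.1.aestronglyMeasurable.mul (hψt k).1.continuous.aestronglyMeasurable
    · rw [integrable_indicator_iff hZ.measurableSet]
      exact hFi.abs.mul_const _
    · refine Eventually.of_forall fun x => ?_
      by_cases hx : x ∈ c.symm '' L
      · rw [indicator_of_mem hx, norm_mul, Real.norm_eq_abs, Real.norm_eq_abs]
        exact mul_le_mul_of_nonneg_left (hψB k x) (abs_nonneg _)
      · rw [indicator_of_notMem hx, image_eq_zero_of_notMem_tsupport fun h => hx (hψsupp k h)]
        simp
    · have h1 : ∀ᵐ x ∂μ, x ∈ c.source → Tendsto (fun k => ψ k x) atTop (𝓝 (f x)) := by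
        rw [ae_source_iff hφ hc]
        filter_upwards [ae_tendsto_mollify hf'i.locallyIntegrable] with y hy hyt
        have e : ∀ k, ψ k (c.symm y) = mollify (k + k₀) f' y := fun k => transplant_symm hyt
        simp_rw [e]
        have := hy.comp (tendsto_add_atTop_nat k₀)
        rwa [hf', indicator_of_mem hyt] at this
      filter_upwards [h1] with x hx
      by_cases hxs : x ∈ c.source
      · exact (hx hxs).const_mul _
      · have e : ∀ k, ψ k x = f x := fun k => by
          rw [hfK x fun h => hxs (hKc h)]
          exact indicator_of_notMem hxs _
        simp_rw [e]
        exact tendsto_const_nhds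
  -- convergence of the gradients
  set Y : ℕ → (x : M) → TangentSpace (𝓡 n) x := fun k x => grad (ψ k) x + (-1 : ℝ) • X x with hY
  have hgradm : ∀ k, ∀ c ∈ atlas (EuclideanSpace ℝ (Fin n)) M, MeasurableInChart c (grad (ψ k)) :=
    fun k c hc => measurableInChart_grad_of_contMDiff hc (hψt k).1
  have hYm : ∀ k, ∀ c ∈ atlas (EuclideanSpace ℝ (Fin n)) M, MeasurableInChart c (Y k) :=
    fun k c hc => (hgradm k c hc).add ((hXm c hc).smul aestronglyMeasurable_const)
  set d : ℕ → Fin n → EuclideanSpace ℝ (Fin n) → ℝ := fun k i y => mollify (k + k₀) (g i) y - g i y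
    with hd
  have hdi : ∀ k i, Integrable (fun y => |d k i y| ^ p) := by
    intro k i
    have h1 : AEStronglyMeasurable (mollify (k + k₀) (g i)) volume := (integrable_mollify _ (hgi i)).1
    have h2 : PowIntegrable volume p (mollify (k + k₀) (g i)) := by
      refine ⟨h1, (integrable_mollify (k + k₀) (hgp i)).mono' ?_ (Eventually.of_forall fun y => ?_)⟩
      · exact (h1.norm.aemeasurable.pow_const p).aestronglyMeasurable
      · rw [Real.norm_of_nonneg (by positivity)]
        exact abs_mollify_rpow_le _ hp.le (hgi i).locallyIntegrable (hgp i).locallyIntegrable y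
    exact (h2.sub hp0.le ⟨(hgi i).1, hgp i⟩).2
  have hKL : K ⊆ c.symm '' L := fun x hx =>
    ⟨c x, Metric.self_subset_cthickening _ ⟨x, hx, rfl⟩, c.left_inv (hKc hx)⟩
  obtain ⟨C, hC⟩ := integral_norm_rpow_le (φ := φ) hφ hc hp hLc hδt
  have hY0 : ∀ k, ∀ x ∉ c.symm '' L, Y k x = 0 := fun k x hx => by
    rw [hY]
    simp only
    rw [grad_eq_zero_of_notMem_tsupport fun h => hx (hψsupp k h), hXK x fun h => hx (hKL h)]
    simp
  have hYd : ∀ k, ∀ y ∈ L, ∀ i, (inner ℝ (Y k (c.symm y)) (coordVec c y i) : ℝ) = d k i y := by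
    intro k y hy i
    have hyt := hδt hy
    have h1 : inner ℝ (grad (ψ k) (c.symm y)) (coordVec c y i) =
        fderiv ℝ (fun z => ψ k (c.symm z)) y (EuclideanSpace.single i (1 : ℝ)) :=
      inner_grad_frame hc hyt ((hψt k).1.mdifferentiableAt (by simp)) _
    have h2 : (fun z => ψ k (c.symm z)) =ᶠ[𝓝 y] fk k := by
      filter_upwards [c.open_target.mem_nhds hyt] with z hz using transplant_symm hz
    rw [h2.fderiv_eq, (hgw i).fderiv_mollify] at h1
    simp only [hY, hd, inner_add_left, inner_smul_left]
    rw [h1]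
    simp [hg, hyt]
    ring
  have hYb := fun k => hC (Y k) (d k) (hYm k c hc) (hY0 k) (hYd k) (hdi k)
  have hYlim : Tendsto (fun k => ∫ x, |‖Y k x‖| ^ p ∂μ) atTop (𝓝 0) := by
    have h1 : Tendsto (fun k => C * ∑ i, ∫ y, |d k i y| ^ p) atTop (𝓝 (C * ∑ i : Fin n, (0 : ℝ))) :=
      (tendsto_finsetSum _ fun i _ => (tendsto_integral_mollify_sub hp.le
        (hgi i).locallyIntegrable (hgp i)).comp (tendsto_add_atTop_nat k₀)).const_mul C
    rw [Finset.sum_const_zero, mul_zero] at h1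
    exact squeeze_zero (fun k => integral_nonneg fun x => by positivity) (fun k => (hYb k).2) h1
  have hlim2 : Tendsto (fun k => ∫ x, |‖G x‖| ^ (p - 1) * |‖Y k x‖| ∂μ) atTop (𝓝 0) := by
    have h1 := (hYlim.rpow_const (p := 1 / p) (Or.inr (by positivity))).const_mul
      ((∫ x, |‖G x‖| ^ p ∂μ) ^ (1 / ((p - 1)⁻¹ + 1)))
    rw [Real.zero_rpow (by positivity), mul_zero] at h1
    exact squeeze_zero (fun k => integral_nonneg fun x => by positivity)
      (fun k => hG.integral_rpow_sub_one_mul_le hp (hYb k).1) h1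
  have heq : ∀ k, ∫ x, F x * ψ k x ∂μ + ∫ x, ‖G x‖ ^ (p - 2) * inner ℝ (G x) (X x) ∂μ =
      -∫ x, ‖G x‖ ^ (p - 2) * inner ℝ (G x) (Y k x) ∂μ := by
    intro k
    have e : ∀ x, ‖G x‖ ^ (p - 2) * inner ℝ (G x) (grad (ψ k) x) =
        ‖G x‖ ^ (p - 2) * inner ℝ (G x) (Y k x) + ‖G x‖ ^ (p - 2) * inner ℝ (G x) (X x) := by
      intro x
      simp only [hY, inner_add_right, inner_smul_right]
      ring
    rw [htest k]
    simp_rw [e]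
    rw [integral_add (integrable_rpow_mul_inner hφ hp hG hGm (hYm k) (hYb k).1)
      (integrable_rpow_mul_inner hφ hp hG hGm hXm hX)]
    ring
  have hlim3 : Tendsto (fun k => ∫ x, ‖G x‖ ^ (p - 2) * inner ℝ (G x) (Y k x) ∂μ) atTop (𝓝 0) := by
    refine squeeze_zero_norm (fun k => ?_) hlim2
    rw [Real.norm_eq_abs]
    refine abs_integral_le_integral_abs.trans (integral_mono_of_nonneg
      (Eventually.of_forall fun x => abs_nonneg _)
      (hG.integrable_rpow_sub_one_mul hp (hYb k).1) (Eventually.of_forall fun x => ?_))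
    simpa using abs_rpow_mul_inner_le (G x) (Y k x) p
  have h1 := hlim1.add_const (∫ x, ‖G x‖ ^ (p - 2) * inner ℝ (G x) (X x) ∂μ)
  simp_rw [heq] at h1
  have h2 := tendsto_nhds_unique h1 hlim3.neg
  linarith

end Local

end ParabolicFrequency

namespace ParabolicFrequency

set_option linter.unusedSectionVars false

theorem HasWeakDeriv.congr_right {X : Type*} [NormedAddCommGroup X] [NormedSpace ℝ X]
    [FiniteDimensional ℝ X] [MeasureSpace X] [BorelSpace X] [(volume : Measure X).IsAddHaarMeasure]
    {Ω : Set X} {v : X} {f g g' : X → ℝ} (hΩ : IsOpen Ω) (hf : HasWeakDeriv Ω v f g)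
    (h : ∀ᵐ y, y ∈ Ω → g y = g' y) : HasWeakDeriv Ω v f g' := by
  have : ProperSpace X := FiniteDimensional.proper ℝ X
  refine ⟨hf.1, ?_, fun ψ h1 h2 h3 => ?_⟩
  · have h0 := hf.2.1
    rw [locallyIntegrableOn_iff hΩ.isLocallyClosed] at h0 ⊢
    refine fun k hk hkc => (h0 k hk hkc).congr ?_
    rw [EventuallyEq, ae_restrict_iff' hkc.measurableSet]
    exact h.mono fun y hy hyk => hy (hk hyk)
  · rw [hf.2.2 ψ h1 h2 h3]
    congr 1
    refine integral_congr_ae (h.mono fun y hy => ?_)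
    by_cases hyΩ : y ∈ Ω
    · simp only [hy hyΩ]
    · simp [image_eq_zero_of_notMem_tsupport fun h => hyΩ (h3 h)]

/-! ### Lipschitz cutoffs and the global weak formulation. -/

section Lipschitz

variable {n : ℕ} {M : Type*} [MetricSpace M] [ChartedSpace (EuclideanSpace ℝ (Fin n)) M]
  {c : OpenPartialHomeomorph M (EuclideanSpace ℝ (Fin n))} {y : EuclideanSpace ℝ (Fin n)}
  [IsManifold (𝓡 n) ∞ M] [RiemannianBundle (fun x : M => TangentSpace (𝓡 n) x)]
  [IsContMDiffRiemannianBundle (𝓡 n) ∞ (EuclideanSpace ℝ (Fin n))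
      (fun x : M => TangentSpace (𝓡 n) x)] [IsRiemannianManifold (𝓡 n) M]
  {χ : M → ℝ} {Λ : NNReal}

/-- Testing the differential in the direction of the gradient gives |∇χ|² ≤ Λ|∇χ|. Where χ is not
differentiable, the gradient is zero by convention. -/
theorem norm_grad_le (hχ : LipschitzWith Λ χ) (x : M) :
    ‖(grad χ x : TangentSpace (𝓡 n) x)‖ ≤ Λ := by
  by_cases hd : MDifferentiableAt (𝓡 n) 𝓘(ℝ, ℝ) χ x
  · obtain ⟨c, hc, hxc⟩ : ∃ c ∈ atlas (EuclideanSpace ℝ (Fin n)) M, x ∈ c.source :=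
      ⟨_, chart_mem_atlas _ x, mem_chart_source _ x⟩
    obtain ⟨y, hy, rfl⟩ : ∃ y ∈ c.target, c.symm y = x := ⟨c x, c.map_source hxc, c.left_inv hxc⟩
    obtain ⟨v, hv⟩ := (frame_bijective hc hy).2 (grad χ (c.symm y))
    have hd' : DifferentiableAt ℝ (fun z => χ (c.symm z)) y :=
      (hd.comp y (mdifferentiableAt_symm hc hy)).differentiableAt
    have h1 := abs_fderiv_comp_symm_le hc hχ hy hd' v
    rw [← inner_grad_frame hc hy hd, hv, real_inner_self_eq_norm_sq, abs_of_nonneg (sq_nonneg _),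
      sq] at h1
    by_contra! h
    have h0 : 0 ≤ (Λ : ℝ) := Λ.2
    nlinarith
  · have h0 : mvfderiv (𝓡 n) χ x = 0 := by
      unfold mvfderiv
      rw [mfderiv_zero_of_not_mdifferentiableAt hd]
      ext v
      rfl
    have : (grad χ x : TangentSpace (𝓡 n) x) = 0 := by
      unfold grad
      rw [h0]
      exact map_zero _
    rw [this, norm_zero]
    exact Λ.2

theorem ae_inner_grad_frame (hc : c ∈ atlas (EuclideanSpace ℝ (Fin n)) M) (hχ : LipschitzWith Λ χ)
    (v : EuclideanSpace ℝ (Fin n)) : ∀ᵐ y, y ∈ c.target →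
      fderiv ℝ (fun z => χ (c.symm z)) y v = inner ℝ (grad χ (c.symm y)) (frame c y v) := by
  filter_upwards [(HasWeakDeriv.of_locallyLipschitzOn c.open_target
    (locallyLipschitzOn_comp_symm hc hχ) v).2] with y hy hyt
  exact (inner_grad_frame hc hyt (mdifferentiableAt_of_comp_symm hc hyt (hy hyt)) v).symm

theorem measurableInChart_grad_of_lipschitz (hc : c ∈ atlas (EuclideanSpace ℝ (Fin n)) M)
    (hχ : LipschitzWith Λ χ) : MeasurableInChart c (grad χ) := by
  intro i
  refine (HasWeakDeriv.of_locallyLipschitzOn c.open_target (locallyLipschitzOn_comp_symm hc hχ)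
    (EuclideanSpace.single i (1 : ℝ))).1.aestronglyMeasurable_right.congr ?_
  rw [EventuallyEq, ae_restrict_iff' c.open_target.measurableSet]
  exact ae_inner_grad_frame hc hχ _

end Lipschitz

section Cutoff

variable {n : ℕ} {M : Type*} [MetricSpace M] [ChartedSpace (EuclideanSpace ℝ (Fin n)) M]
  {c : OpenPartialHomeomorph M (EuclideanSpace ℝ (Fin n))}
  [IsManifold (𝓡 n) ∞ M] [RiemannianBundle (fun x : M => TangentSpace (𝓡 n) x)]
  [IsContMDiffRiemannianBundle (𝓡 n) ∞ (EuclideanSpace ℝ (Fin n))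
      (fun x : M => TangentSpace (𝓡 n) x)] [IsRiemannianManifold (𝓡 n) M]
  [MeasurableSpace M] [BorelSpace M] [SecondCountableTopology M]
  {φ F w χ ρ : M → ℝ} {W G : (x : M) → TangentSpace (𝓡 n) x} {p : ℝ} {Λ : NNReal} {T : ℝ → ℝ}
  {K : Set M} {B B' : ℝ}

theorem HasWeakGradient.aestronglyMeasurable (hφ : Continuous φ) (hw : HasWeakGradient w W) :
    AEStronglyMeasurable w (weightedVolume n φ) :=
  aestronglyMeasurable_of_forall_source fun c hc => (aestronglyMeasurable_source_iff hφ hc).2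
    (hasWeakGradient_iff.1 hw c hc none).aestronglyMeasurable_left

theorem exists_norm_grad_le (hc : c ∈ atlas (EuclideanSpace ℝ (Fin n)) M)
    (hρ : ContMDiff (𝓡 n) 𝓘(ℝ, ℝ) ∞ ρ) (hK : IsCompact K) (hKc : K ⊆ c.source) :
    ∃ A : ℝ, 0 ≤ A ∧ ∀ x ∈ K, ‖(grad ρ x : TangentSpace (𝓡 n) x)‖ ≤ A := by
  have hK' : IsCompact (c '' K) := hK.image_of_continuousOn (c.continuousOn.mono hKc)
  have hKt : c '' K ⊆ c.target := by
    rintro _ ⟨x, hx, rfl⟩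
    exact c.map_source (hKc hx)
  obtain ⟨C, hC, hb⟩ := exists_chart_bounds (φ := fun _ : M => (0 : ℝ)) continuous_const hc hK' hKt
  have h1 : ContDiffOn ℝ ∞ (fun y => ρ (c.symm y)) c.target := by
    rw [← contMDiffOn_iff_contDiffOn]
    exact hρ.comp_contMDiffOn (contMDiffOn_symm_of_mem hc)
  choose A hA using fun i : Fin n => hK'.exists_bound_of_continuousOn
    (((h1.continuousOn_fderiv_of_isOpen c.open_target (by simp)).clm_apply
      (continuousOn_const (c := EuclideanSpace.single i (1 : ℝ)))).mono hKt)
  refine ⟨C * ∑ i, |A i|, by positivity, fun x hx => ?_⟩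
  have hxt : c x ∈ c '' K := ⟨x, hx, rfl⟩
  obtain ⟨y, hy, rfl⟩ : ∃ y ∈ c '' K, c.symm y = x := ⟨c x, hxt, c.left_inv (hKc hx)⟩
  refine ((hb y hy).2.2.2 _).trans (mul_le_mul_of_nonneg_left (Finset.sum_le_sum fun i _ => ?_) hC.le)
  have h2 : inner ℝ (grad ρ (c.symm y)) (coordVec c y i) =
      fderiv ℝ (fun z => ρ (c.symm z)) y (EuclideanSpace.single i (1 : ℝ)) :=
    inner_grad_frame hc (hKt hy) (hρ.mdifferentiableAt (by simp)) _
  rw [h2]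
  exact (hA i y hy).trans (le_abs_self _)

/-- The weak gradient of the product of a truncated function, a Lipschitz cutoff and a member of a
partition of unity. -/
noncomputable def cutoffGradient (T : ℝ → ℝ) (w χ ρ : M → ℝ) (W : (x : M) → TangentSpace (𝓡 n) x)
    (x : M) : TangentSpace (𝓡 n) x :=
  ρ x • (χ x • deriv T (w x) • W x + T (w x) • grad χ x) + (T (w x) * χ x) • grad ρ x

theorem hasWeakDeriv_cutoff (hc : c ∈ atlas (EuclideanSpace ℝ (Fin n)) M)
    (hw : HasWeakGradient w W) (hT : ContDiff ℝ ∞ T) (hTB : ∀ s, |T s| ≤ B)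
    (hTB' : ∀ s, |deriv T s| ≤ B') (hχ : LipschitzWith Λ χ) {A : ℝ} (hχ1 : ∀ x, |χ x| ≤ A)
    (hρ : ContMDiff (𝓡 n) 𝓘(ℝ, ℝ) ∞ ρ) (o : Option (Fin n)) :
    HasWeakDeriv c.target (direction o) (fun y => ρ (c.symm y) * (T (w (c.symm y)) * χ (c.symm y)))
      (fun y => inner ℝ (cutoffGradient T w χ ρ W (c.symm y)) (frame c y (direction o))) := by
  have h1 := (hasWeakGradient_iff.1 hw c hc o).comp c.open_target hT hTB hTB'
  have h2 := (HasWeakDeriv.of_locallyLipschitzOn c.open_target (locallyLipschitzOn_comp_symm hc hχ)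
    (direction o)).1
  have h3 := h1.mul_of_bounded c.open_target h2 (fun y => hTB _) (fun y => hχ1 _)
  have hρ' : ContDiffOn ℝ ∞ (fun y => ρ (c.symm y)) c.target := by
    rw [← contMDiffOn_iff_contDiffOn]
    exact hρ.comp_contMDiffOn (contMDiffOn_symm_of_mem hc)
  refine (h3.smooth_mul c.open_target hρ').congr_right c.open_target ?_
  filter_upwards [ae_inner_grad_frame hc hχ (direction o)] with y hy hyt
  have h4 := inner_grad_frame hc hyt (hρ.mdifferentiableAt (by simp) (x := c.symm y)) (direction o)
  simp only [cutoffGradient, inner_add_left, inner_smul_left, conj_trivial]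
  rw [h4, hy hyt]
  ring

theorem measurableInChart_cutoffGradient (hc : c ∈ atlas (EuclideanSpace ℝ (Fin n)) M)
    (hw : HasWeakGradient w W) (hT : ContDiff ℝ ∞ T) (hχ : LipschitzWith Λ χ)
    (hρ : ContMDiff (𝓡 n) 𝓘(ℝ, ℝ) ∞ ρ) : MeasurableInChart c (cutoffGradient T w χ ρ W) := by
  have hwm : AEStronglyMeasurable (fun y => w (c.symm y)) (volume.restrict c.target) :=
    (hasWeakGradient_iff.1 hw c hc none).aestronglyMeasurable_left
  have hcm : ∀ {g : M → ℝ}, Continuous g →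
      AEStronglyMeasurable (fun y => g (c.symm y)) (volume.restrict c.target) := fun hg =>
    (hg.comp_continuousOn c.continuousOn_symm).aestronglyMeasurable c.open_target.measurableSet
  have hTm := hT.continuous.comp_aestronglyMeasurable hwm
  have hT'm := (hT.continuous_deriv (by simp)).comp_aestronglyMeasurable hwm
  exact ((((hw.measurableInChart hc).smul hT'm).smul (hcm hχ.continuous)).add
    ((measurableInChart_grad_of_lipschitz hc hχ).smul hTm)).smul (hcm hρ.continuous) |>.add
    ((measurableInChart_grad_of_contMDiff hc hρ).smul (hTm.mul (hcm hχ.continuous)))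

theorem powIntegrable_cutoffGradient (hφ : Continuous φ) (hc : c ∈ atlas (EuclideanSpace ℝ (Fin n)) M)
    (hp : 1 < p) (hw : HasWeakGradient w W)
    (hW : PowIntegrable (weightedVolume n φ) p (fun x => ‖W x‖)) (hT : ContDiff ℝ ∞ T)
    (hTB : ∀ s, |T s| ≤ B) (hTB' : ∀ s, |deriv T s| ≤ B') (hχ : LipschitzWith Λ χ)
    (hχ1 : ∀ x, |χ x| ≤ 1) (hρ : ContMDiff (𝓡 n) 𝓘(ℝ, ℝ) ∞ ρ) (hρ1 : ∀ x, |ρ x| ≤ 1)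
    (hK : IsCompact K) (hKc : K ⊆ c.source) (hK0 : ∀ x ∉ K, cutoffGradient T w χ ρ W x = 0) :
    PowIntegrable (weightedVolume n φ) p (fun x => ‖cutoffGradient T w χ ρ W x‖) := by
  have : IsLocallyFiniteMeasure (weightedVolume n φ) := isLocallyFiniteMeasure_weightedVolume hφ
  have hp0 : 0 < p := by linarith
  obtain ⟨A, hA0, hA⟩ := exists_norm_grad_le hc hρ hK hKc
  have hB0 : 0 ≤ B := (abs_nonneg _).trans (hTB 0)
  have hB0' : 0 ≤ B' := (abs_nonneg _).trans (hTB' 0)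
  have hind : PowIntegrable (weightedVolume n φ) p (K.indicator fun _ => B * Λ + B * A) := by
    refine (memLp_iff_powIntegrable hp0).1 (memLp_indicator_const _ hK.measurableSet _ (Or.inr ?_))
    exact hK.measure_lt_top.ne
  have hm : AEStronglyMeasurable (fun x => ‖cutoffGradient T w χ ρ W x‖) (weightedVolume n φ) :=
    aestronglyMeasurable_norm hφ fun c hc => measurableInChart_cutoffGradient hc hw hT hχ hρ
  have hsum := (hW.const_mul hp0.le B').abs_add hp0.le hind
  refine hsum.mono hp0.le hm zero_le_one (Eventually.of_forall fun x => ?_)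
  rw [abs_norm, one_mul, abs_of_nonneg (add_nonneg (abs_nonneg _) (abs_nonneg _))]
  by_cases hx : x ∈ K
  · rw [indicator_of_mem hx, abs_of_nonneg (by positivity), abs_of_nonneg (by positivity)]
    have e1 : ‖ρ x • (χ x • deriv T (w x) • W x + T (w x) • grad χ x)‖ ≤
        1 * (1 * (B' * ‖W x‖) + B * Λ) := by
      rw [norm_smul]
      refine mul_le_mul (hρ1 x) ((norm_add_le _ _).trans (add_le_add ?_ ?_)) (norm_nonneg _) zero_le_one
      · rw [norm_smul, norm_smul]
        exact mul_le_mul (hχ1 x) (mul_le_mul_of_nonneg_right (hTB' _) (norm_nonneg _))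
          (by positivity) zero_le_one
      · rw [norm_smul]
        exact mul_le_mul (hTB _) (norm_grad_le hχ x) (norm_nonneg _) hB0
    have e2 : ‖(T (w x) * χ x) • (grad ρ x : TangentSpace (𝓡 n) x)‖ ≤ B * A := by
      rw [norm_smul, Real.norm_eq_abs, abs_mul]
      refine mul_le_mul ?_ (hA x hx) (norm_nonneg _) hB0
      exact (mul_le_mul (hTB _) (hχ1 x) (abs_nonneg _) hB0).trans (mul_one B).le
    refine (norm_add_le _ _).trans ((add_le_add e1 e2).trans (le_of_eq ?_))
    ring
  · rw [hK0 x hx, norm_zero]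
    positivity

/-- The weak formulation for truncations with a Lipschitz cutoff. -/
theorem HasWeakPLaplacian.integral_eq_of_cutoff (hφ : Continuous φ) (hp : 1 < p)
    (hF : HasWeakPLaplacian φ p G F)
    (hG : PowIntegrable (weightedVolume n φ) p (fun x => ‖G x‖))
    (hGm : ∀ c ∈ atlas (EuclideanSpace ℝ (Fin n)) M, MeasurableInChart c G)
    (hw : HasWeakGradient w W) (hW : PowIntegrable (weightedVolume n φ) p (fun x => ‖W x‖))
    (hT : ContDiff ℝ ∞ T) (hTB : ∀ s, |T s| ≤ B) (hTB' : ∀ s, |deriv T s| ≤ B')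
    (hχ : LipschitzWith Λ χ) (hχ1 : ∀ x, |χ x| ≤ 1) (hK : IsCompact K) (hχK : ∀ x ∉ K, χ x = 0) :
    ∫ x, F x * (T (w x) * χ x) ∂(weightedVolume n φ) =
      -∫ x, ‖G x‖ ^ (p - 2) * inner ℝ (G x) (χ x • deriv T (w x) • W x + T (w x) • grad χ x)
        ∂(weightedVolume n φ) := by
  set μ := weightedVolume n φ with hμ
  have : IsLocallyFiniteMeasure μ := isLocallyFiniteMeasure_weightedVolume hφ
  have : LocallyCompactSpace M := ChartedSpace.locallyCompactSpace (EuclideanSpace ℝ (Fin n)) M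
  -- The partition of unity must sum to one on a neighbourhood of K, so that the gradients of its
  -- members cancel on K.
  obtain ⟨K₁, hK₁, hKK₁⟩ := exists_compact_superset hK
  obtain ⟨t, ht⟩ := hK₁.elim_finite_subcover
    (fun x : M => (chartAt (EuclideanSpace ℝ (Fin n)) x).source)
    (fun x => (chartAt (EuclideanSpace ℝ (Fin n)) x).open_source)
    (fun x _ => mem_iUnion.2 ⟨x, mem_chart_source _ x⟩)
  obtain ⟨ρ, hρ⟩ := SmoothPartitionOfUnity.exists_isSubordinate (𝓡 n) hK₁.isClosed
    (fun x : t => (chartAt (EuclideanSpace ℝ (Fin n)) (x : M)).source)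
    (fun x => (chartAt (EuclideanSpace ℝ (Fin n)) (x : M)).open_source)
    (fun x hx => by
      obtain ⟨z, hz, hxz⟩ := mem_iUnion₂.1 (ht hx)
      exact mem_iUnion.2 ⟨⟨z, hz⟩, hxz⟩)
  have hsum1 : ∀ x ∈ K₁, ∑ i, ρ i x = 1 := fun x hx => by
    rw [← finsum_eq_sum_of_fintype]
    exact ρ.sum_eq_one hx
  have hρs : ∀ i, ContMDiff (𝓡 n) 𝓘(ℝ, ℝ) ∞ (ρ i) := fun i => (ρ i).contMDiff
  have hρ1 : ∀ i x, |ρ i x| ≤ 1 := fun i x => by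
    rw [abs_of_nonneg (ρ.nonneg i x)]
    exact ρ.le_one i x
  have hgradχ : ∀ x ∉ K, grad χ x = (0 : TangentSpace (𝓡 n) x) := fun x hx => by
    refine grad_eq_zero_of_notMem_tsupport fun h => hx ?_
    refine closure_minimal (fun z hz => ?_) hK.isClosed h
    by_contra hzK
    exact hz (hχK z hzK)
  have hK0 : ∀ i, ∀ x ∉ K ∩ tsupport (ρ i), cutoffGradient T w χ (ρ i) W x = 0 := by
    intro i x hx
    by_cases hxK : x ∈ K
    · have hxρ : x ∉ tsupport (ρ i) := fun h => hx ⟨hxK, h⟩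
      rw [cutoffGradient, image_eq_zero_of_notMem_tsupport hxρ, grad_eq_zero_of_notMem_tsupport hxρ]
      simp
    · rw [cutoffGradient, hχK x hxK, hgradχ x hxK]
      simp
  have hKi : ∀ i, IsCompact (K ∩ tsupport (ρ i)) := fun i => hK.inter_right (isClosed_tsupport _)
  have hpow := fun i : t => powIntegrable_cutoffGradient hφ (chart_mem_atlas _ (i : M)) hp hw hW hT hTB
    hTB' hχ hχ1 (hρs i) (hρ1 i) (hKi i) (inter_subset_right.trans (hρ i)) (hK0 i)
  have hmeas := fun (i : t) (c) (hc : c ∈ atlas (EuclideanSpace ℝ (Fin n)) M) =>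
    measurableInChart_cutoffGradient hc hw hT hχ (hρs i)
  have hfB : ∀ i x, |ρ i x * (T (w x) * χ x)| ≤ B := fun i x => by
    have hB0 : 0 ≤ B := (abs_nonneg _).trans (hTB 0)
    rw [abs_mul, abs_mul]
    calc _ ≤ 1 * (B * 1) := mul_le_mul (hρ1 i x)
          (mul_le_mul (hTB _) (hχ1 x) (abs_nonneg _) hB0) (by positivity) zero_le_one
      _ = B := by ring
  have hf0 : ∀ i, ∀ x ∉ K ∩ tsupport (ρ i), ρ i x * (T (w x) * χ x) = 0 := by
    intro i x hx
    by_cases hxK : x ∈ K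
    · rw [image_eq_zero_of_notMem_tsupport fun h => hx ⟨hxK, h⟩, zero_mul]
    · rw [hχK x hxK, mul_zero, mul_zero]
  have key := fun i : t => hF.integral_eq_of_chart hφ (chart_mem_atlas _ (i : M)) hp hG hGm (hmeas i)
    (hpow i) (hKi i) (inter_subset_right.trans (hρ i)) (hf0 i) (hK0 i) (hfB i)
    (hasWeakDeriv_cutoff (chart_mem_atlas _ (i : M)) hw hT hTB hTB' hχ hχ1 (hρs i))
  have hwm := hw.aestronglyMeasurable hφ
  have hFi : ∀ i, Integrable (fun x => F x * (ρ i x * (T (w x) * χ x))) μ := by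
    intro i
    refine (integrableOn_iff_integrable_of_support_subset fun x hx => ?_).1
      ((hF.1.integrableOn_isCompact hK).mul_bdd (c := B)
        (g := fun x => ρ i x * (T (w x) * χ x)) ?_ (Eventually.of_forall (hfB i)))
    · by_contra h
      refine hx ?_
      simp only
      rw [hf0 i x fun h' => h h'.1, mul_zero]
    · exact ((hρs i).continuous.aestronglyMeasurable.mul ((hT.continuous.comp_aestronglyMeasurable
        hwm).mul hχ.continuous.aestronglyMeasurable)).restrict
  have e1 : ∀ x, F x * (T (w x) * χ x) = ∑ i, F x * (ρ i x * (T (w x) * χ x)) := by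
    intro x
    rw [← Finset.mul_sum, ← Finset.sum_mul]
    by_cases hx : x ∈ K
    · rw [hsum1 x (interior_subset (hKK₁ hx)), one_mul]
    · rw [hχK x hx]; ring
  have e2 : ∀ x, χ x • deriv T (w x) • W x + T (w x) • grad χ x =
      ∑ i, cutoffGradient T w χ (ρ i) W x := by
    intro x
    simp only [cutoffGradient, Finset.sum_add_distrib, ← Finset.sum_smul, ← Finset.smul_sum]
    by_cases hx : x ∈ K
    · have h1 := hKK₁ hx
      have h2 : ∑ i, (grad (ρ i) x : TangentSpace (𝓡 n) x) = 0 := by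
        rw [← (grad_sum Finset.univ fun i _ => (hρs i).mdifferentiableAt (by simp)).2,
          ← grad_const (n := n) 1 x]
        refine grad_congr ?_
        filter_upwards [mem_interior_iff_mem_nhds.1 h1] with z hz using hsum1 z hz
      rw [hsum1 x (interior_subset h1), h2, one_smul, smul_zero, add_zero]
    · rw [hχK x hx, hgradχ x hx]
      simp
  have e3 : ∀ x, ‖G x‖ ^ (p - 2) * inner ℝ (G x) (χ x • deriv T (w x) • W x + T (w x) • grad χ x) =
      ∑ i, ‖G x‖ ^ (p - 2) * inner ℝ (G x) (cutoffGradient T w χ (ρ i) W x) := fun x => by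
    rw [e2, inner_sum, Finset.mul_sum]
  simp_rw [e1, e3]
  rw [integral_finsetSum _ fun i _ => hFi i, integral_finsetSum _ fun i _ =>
    integrable_rpow_mul_inner hφ hp hG hGm (hmeas i) (hpow i), ← Finset.sum_neg_distrib]
  exact Finset.sum_congr rfl fun i _ => key i

end Cutoff

end ParabolicFrequency

namespace ParabolicFrequency

set_option linter.unusedSectionVars false

/-! ### Truncations and distance cutoffs. -/

section Truncation

/-- A smooth truncation at height `k`. -/
noncomputable def truncation (k s : ℝ) : ℝ := k * Real.arctan (k⁻¹ * s)

variable {k : ℝ}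

theorem contDiff_truncation (k : ℝ) : ContDiff ℝ ∞ (truncation k) :=
  contDiff_const.mul (Real.contDiff_arctan.comp (contDiff_const.mul contDiff_id))

theorem hasDerivAt_truncation (hk : 0 < k) (s : ℝ) :
    HasDerivAt (truncation k) (1 / (1 + (k⁻¹ * s) ^ 2)) s := by
  have h := (((hasDerivAt_id s).const_mul k⁻¹).arctan).const_mul k
  refine h.congr_deriv ?_
  simp only [id]
  field_simp

theorem abs_deriv_truncation_le (hk : 0 < k) (s : ℝ) : |deriv (truncation k) s| ≤ 1 := by
  rw [(hasDerivAt_truncation hk s).deriv, abs_of_nonneg (by positivity), div_le_one (by positivity)]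
  linarith [sq_nonneg (k⁻¹ * s)]

theorem abs_truncation_le (hk : 0 < k) (s : ℝ) : |truncation k s| ≤ k * 2 := by
  rw [truncation, abs_mul, abs_of_pos hk]
  refine mul_le_mul_of_nonneg_left ?_ hk.le
  rw [abs_le]
  have h1 := Real.arctan_lt_pi_div_two (k⁻¹ * s)
  have h2 := Real.neg_pi_div_two_lt_arctan (k⁻¹ * s)
  have := Real.pi_le_four
  constructor <;> linarith

theorem abs_truncation_le_abs (hk : 0 < k) (s : ℝ) : |truncation k s| ≤ |s| := by
  have h := Convex.norm_image_sub_le_of_norm_deriv_le (f := truncation k) (C := 1) (s := univ)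
    (x := 0) (y := s) (fun x _ => (hasDerivAt_truncation hk x).differentiableAt)
    (fun x _ => abs_deriv_truncation_le hk x) convex_univ (mem_univ _) (mem_univ _)
  simpa [truncation] using h

theorem tendsto_inv_add_one_mul (s : ℝ) :
    Tendsto (fun k : ℕ => ((k : ℝ) + 1)⁻¹ * s) atTop (𝓝 0) := by
  have := tendsto_one_div_add_atTop_nhds_zero_nat (𝕜 := ℝ)
  simpa using this.mul_const s

theorem tendsto_deriv_truncation (s : ℝ) :
    Tendsto (fun k : ℕ => deriv (truncation ((k : ℝ) + 1)) s) atTop (𝓝 1) := by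
  have e : ∀ k : ℕ, deriv (truncation ((k : ℝ) + 1)) s = 1 / (1 + (((k : ℝ) + 1)⁻¹ * s) ^ 2) :=
    fun k => (hasDerivAt_truncation (by positivity) s).deriv
  simp_rw [e]
  have h := (((tendsto_inv_add_one_mul s).pow 2).const_add 1)
  have := (tendsto_const_nhds (x := (1 : ℝ))).div h (by norm_num)
  simpa [Pi.div_def] using this

theorem tendsto_truncation (s : ℝ) :
    Tendsto (fun k : ℕ => truncation ((k : ℝ) + 1) s) atTop (𝓝 s) := by
  rcases eq_or_ne s 0 with rfl | hs
  · simp [truncation]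
  have h1 : Tendsto (fun k : ℕ => ((k : ℝ) + 1)⁻¹ * s) atTop (𝓝[≠] 0) := by
    refine tendsto_nhdsWithin_iff.2 ⟨tendsto_inv_add_one_mul s, Eventually.of_forall fun k => ?_⟩
    have : ((k : ℝ) + 1)⁻¹ ≠ 0 := by positivity
    exact mul_ne_zero this hs
  have h2 := ((Real.hasDerivAt_arctan 0).tendsto_slope_zero.comp h1).mul_const s
  simp only [ne_eq, OfNat.ofNat_ne_zero, not_false_eq_true, zero_pow, add_zero, div_one, one_mul] at h2
  refine h2.congr fun k => ?_
  have : ((k : ℝ) + 1) ≠ 0 := by positivity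
  simp only [Function.comp, zero_add, Real.arctan_zero, sub_zero, smul_eq_mul, truncation, mul_inv,
    inv_inv]
  field_simp

/-- A Lipschitz cutoff function. -/
noncomputable def lipschitzCutoff {M : Type*} [MetricSpace M] (x₀ : M) (k : ℕ) (x : M) : ℝ :=
  max 0 (min 1 (2 - dist x x₀ / ((k : ℝ) + 1)))

variable {M : Type*} [MetricSpace M] (x₀ : M)

theorem lipschitzWith_lipschitzCutoff (k : ℕ) :
    LipschitzWith (Real.toNNReal (1 / ((k : ℝ) + 1))) (lipschitzCutoff x₀ k) := by
  have h : LipschitzWith (Real.toNNReal (1 / ((k : ℝ) + 1)))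
      (fun x => 2 - dist x x₀ / ((k : ℝ) + 1)) := by
    refine LipschitzWith.of_dist_le_mul fun x y => ?_
    rw [Real.coe_toNNReal _ (by positivity), Real.dist_eq]
    have e : 2 - dist x x₀ / ((k : ℝ) + 1) - (2 - dist y x₀ / ((k : ℝ) + 1)) =
        1 / ((k : ℝ) + 1) * (dist y x₀ - dist x x₀) := by ring
    rw [e, abs_mul, abs_of_pos (by positivity)]
    refine mul_le_mul_of_nonneg_left ?_ (by positivity)
    rw [dist_comm x y]
    exact abs_dist_sub_le y x x₀
  exact (h.const_min 1).const_max 0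

theorem abs_lipschitzCutoff_le (k : ℕ) (x : M) : |lipschitzCutoff x₀ k x| ≤ 1 := by
  rw [lipschitzCutoff, abs_of_nonneg (le_max_left _ _)]
  exact max_le zero_le_one (min_le_left _ _)

theorem lipschitzCutoff_eq_zero (k : ℕ) {x : M} (hx : x ∉ Metric.closedBall x₀ (2 * ((k : ℝ) + 1))) :
    lipschitzCutoff x₀ k x = 0 := by
  rw [Metric.mem_closedBall, not_le] at hx
  have : 2 - dist x x₀ / ((k : ℝ) + 1) ≤ 0 := by
    rw [sub_nonpos, le_div_iff₀ (by positivity)]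
    exact hx.le
  exact max_eq_left ((min_le_right _ _).trans this)

theorem tendsto_lipschitzCutoff (x : M) :
    Tendsto (fun k => lipschitzCutoff x₀ k x) atTop (𝓝 1) := by
  have h1 : Tendsto (fun k : ℕ => 2 - dist x x₀ / ((k : ℝ) + 1)) atTop (𝓝 2) := by
    simpa [div_eq_inv_mul] using (tendsto_inv_add_one_mul (dist x x₀)).const_sub 2
  have := (tendsto_const_nhds (x := (0 : ℝ))).max ((tendsto_const_nhds (x := (1 : ℝ))).min h1)
  norm_num at this
  exact this

end Truncation

/-! ### Integration by parts for functions of finite energy. -/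

section IntegrationByParts

variable {n : ℕ} {M : Type*} [MetricSpace M] [ChartedSpace (EuclideanSpace ℝ (Fin n)) M]
  [IsManifold (𝓡 n) ∞ M] [RiemannianBundle (fun x : M => TangentSpace (𝓡 n) x)]
  [IsContMDiffRiemannianBundle (𝓡 n) ∞ (EuclideanSpace ℝ (Fin n))
      (fun x : M => TangentSpace (𝓡 n) x)] [IsRiemannianManifold (𝓡 n) M]
  [MeasurableSpace M] [BorelSpace M] [ProperSpace M]
  {φ F w : M → ℝ} {W G : (x : M) → TangentSpace (𝓡 n) x} {p q : ℝ} {T : ℝ → ℝ} {B B' : ℝ}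

/-- The cutoffs exhaust M and have compact support because closed balls are compact. Their gradients
are at most 1/(k+1) while |G|^{p-1}|T(w)| is integrable, so the extra term disappears; this is why
T(w) must lie in L^p. -/
theorem HasWeakPLaplacian.integral_eq_of_truncation (hφ : Continuous φ) (hp : 1 < p)
    (hF : HasWeakPLaplacian φ p G F)
    (hG : PowIntegrable (weightedVolume n φ) p (fun x => ‖G x‖))
    (hGm : ∀ c ∈ atlas (EuclideanSpace ℝ (Fin n)) M, MeasurableInChart c G)
    (hw : HasWeakGradient w W) (hW : PowIntegrable (weightedVolume n φ) p (fun x => ‖W x‖))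
    (hT : ContDiff ℝ ∞ T) (hTB : ∀ s, |T s| ≤ B) (hTB' : ∀ s, |deriv T s| ≤ B')
    (hTp : PowIntegrable (weightedVolume n φ) p (fun x => T (w x)))
    (hFT : Integrable (fun x => F x * T (w x)) (weightedVolume n φ)) :
    ∫ x, F x * T (w x) ∂(weightedVolume n φ) =
      -∫ x, ‖G x‖ ^ (p - 2) * (deriv T (w x) * inner ℝ (G x) (W x)) ∂(weightedVolume n φ) := by
  rcases isEmpty_or_nonempty M with hM | ⟨⟨x₀⟩⟩
  · simp [Measure.eq_zero_of_isEmpty]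
  set μ := weightedVolume n φ with hμ
  set χ := lipschitzCutoff x₀ with hχ
  have hχL := lipschitzWith_lipschitzCutoff x₀
  have hχ1 := abs_lipschitzCutoff_le x₀
  have key := fun k => hF.integral_eq_of_cutoff hφ hp hG hGm hw hW hT hTB hTB' (hχL k) (hχ1 k)
    (isCompact_closedBall x₀ (2 * ((k : ℝ) + 1))) (fun x hx => lipschitzCutoff_eq_zero x₀ k hx)
  have hwm := hw.aestronglyMeasurable hφ
  have hTm := hT.continuous.comp_aestronglyMeasurable hwm
  have hT'm := (hT.continuous_deriv (by simp)).comp_aestronglyMeasurable hwm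
  have hGn := aestronglyMeasurable_norm (φ := φ) hφ hGm
  have hGp : AEStronglyMeasurable (fun x => ‖G x‖ ^ (p - 2)) μ :=
    (hGn.aemeasurable.pow_const _).aestronglyMeasurable
  have hGW : AEStronglyMeasurable (fun x => (inner ℝ (G x) (W x) : ℝ)) μ :=
    aestronglyMeasurable_inner hφ hGm fun c hc => hw.measurableInChart hc
  have hGχ : ∀ k, AEStronglyMeasurable (fun x => (inner ℝ (G x) (grad (χ k) x) : ℝ)) μ := fun k =>
    aestronglyMeasurable_inner hφ hGm fun c hc => measurableInChart_grad_of_lipschitz hc (hχL k)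
  have e : ∀ k x, ‖G x‖ ^ (p - 2) *
      inner ℝ (G x) (χ k x • deriv T (w x) • W x + T (w x) • grad (χ k) x) =
      ‖G x‖ ^ (p - 2) * (χ k x * (deriv T (w x) * inner ℝ (G x) (W x)) +
        T (w x) * inner ℝ (G x) (grad (χ k) x)) := fun k x => by
    simp only [inner_add_right, inner_smul_right]
  have hgradle : ∀ k x, ‖(grad (χ k) x : TangentSpace (𝓡 n) x)‖ ≤ 1 / ((k : ℝ) + 1) := fun k x => by
    have := norm_grad_le (n := n) (hχL k) x
    rwa [Real.coe_toNNReal _ (by positivity)] at this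
  have hlim1 : Tendsto (fun k => ∫ x, F x * (T (w x) * χ k x) ∂μ) atTop
      (𝓝 (∫ x, F x * T (w x) ∂μ)) := by
    refine tendsto_integral_of_dominated_convergence (fun x => |F x * T (w x)|) (fun k => ?_)
      hFT.abs (fun k => Eventually.of_forall fun x => ?_) (Eventually.of_forall fun x => ?_)
    · simp_rw [← mul_assoc]
      exact hFT.1.mul (hχL k).continuous.aestronglyMeasurable
    · rw [← mul_assoc, norm_mul, Real.norm_eq_abs]
      exact mul_le_of_le_one_right (abs_nonneg _) (hχ1 k x)
    · have := ((tendsto_lipschitzCutoff x₀ x).const_mul (T (w x))).const_mul (F x)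
      rwa [mul_one] at this
  have hlim2 : Tendsto (fun k => ∫ x, ‖G x‖ ^ (p - 2) *
      inner ℝ (G x) (χ k x • deriv T (w x) • W x + T (w x) • grad (χ k) x) ∂μ) atTop
      (𝓝 (∫ x, ‖G x‖ ^ (p - 2) * (deriv T (w x) * inner ℝ (G x) (W x)) ∂μ)) := by
    simp_rw [e]
    refine tendsto_integral_of_dominated_convergence
      (fun x => B' * (|‖G x‖| ^ (p - 1) * |‖W x‖|) + |‖G x‖| ^ (p - 1) * |T (w x)|) (fun k => ?_)
      (((hG.integrable_rpow_sub_one_mul hp hW).const_mul B').add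
        (hG.integrable_rpow_sub_one_mul hp hTp)) (fun k => Eventually.of_forall fun x => ?_)
      (Eventually.of_forall fun x => ?_)
    · exact hGp.mul (((hχL k).continuous.aestronglyMeasurable.mul (hT'm.mul hGW)).add
        (hTm.mul (hGχ k)))
    · have h1 := abs_rpow_mul_inner_le (G x) (W x) p
      have h2 := abs_rpow_mul_inner_le (G x) (grad (χ k) x) p
      rw [abs_norm, abs_norm, Real.norm_eq_abs]
      have e3 : ‖G x‖ ^ (p - 2) * (χ k x * (deriv T (w x) * inner ℝ (G x) (W x)) +
          T (w x) * inner ℝ (G x) (grad (χ k) x)) =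
          χ k x * deriv T (w x) * (‖G x‖ ^ (p - 2) * inner ℝ (G x) (W x)) +
          T (w x) * (‖G x‖ ^ (p - 2) * inner ℝ (G x) (grad (χ k) x)) := by ring
      rw [e3]
      refine (abs_add_le _ _).trans (add_le_add ?_ ?_)
      · rw [abs_mul, abs_mul]
        refine mul_le_mul ?_ h1 (abs_nonneg _) ((abs_nonneg _).trans (hTB' 0))
        exact (mul_le_mul (hχ1 k x) (hTB' _) (abs_nonneg _) zero_le_one).trans (one_mul B').le
      · rw [abs_mul, mul_comm]
        refine mul_le_mul_of_nonneg_right (h2.trans ?_) (abs_nonneg _)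
        refine mul_le_of_le_one_right (by positivity) ((hgradle k x).trans ?_)
        rw [div_le_one (by positivity)]
        linarith [(Nat.cast_nonneg k : (0 : ℝ) ≤ k)]
    · have h1 : Tendsto (fun k => (inner ℝ (G x) (grad (χ k) x) : ℝ)) atTop (𝓝 0) := by
        refine squeeze_zero_norm (fun k => (norm_inner_le_norm _ _).trans
          (mul_le_mul_of_nonneg_left (hgradle k x) (norm_nonneg _))) ?_
        simpa using (tendsto_one_div_add_atTop_nhds_zero_nat (𝕜 := ℝ)).const_mul ‖G x‖
      have h2 := (((tendsto_lipschitzCutoff x₀ x).mul_const (deriv T (w x) * inner ℝ (G x) (W x))).add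
        (h1.const_mul (T (w x)))).const_mul (‖G x‖ ^ (p - 2))
      rwa [one_mul, mul_zero, add_zero] at h2
  refine tendsto_nhds_unique hlim1 ?_
  exact hlim2.neg.congr fun k => (key k).symm

/-- Integration by parts for the weak `p`-Laplacian. -/
theorem HasWeakPLaplacian.integral_mul_eq (hφ : Continuous φ) (hp : 1 < p) (hq : 0 < q)
    (hpq : q + 1 ≤ q * p) (hF : HasWeakPLaplacian φ p G F)
    (hFq : PowIntegrable (weightedVolume n φ) (q + 1) F)
    (hG : PowIntegrable (weightedVolume n φ) p (fun x => ‖G x‖))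
    (hGm : ∀ c ∈ atlas (EuclideanSpace ℝ (Fin n)) M, MeasurableInChart c G)
    (hw : HasWeakGradient w W) (hW : PowIntegrable (weightedVolume n φ) p (fun x => ‖W x‖))
    (hwq : PowIntegrable (weightedVolume n φ) (q⁻¹ + 1) w) :
    ∫ x, w x * F x ∂(weightedVolume n φ) =
      -∫ x, ‖G x‖ ^ (p - 2) * inner ℝ (G x) (W x) ∂(weightedVolume n φ) := by
  set μ := weightedVolume n φ with hμ
  have hwF := hwq.integrable_mul hq hFq
  -- Another use of δ ≥ 0: a bounded truncation of w in L^{1+1/q} lies in L^p, as the cutoff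
  -- argument requires.
  have hr : q⁻¹ + 1 ≤ p := by
    rw [inv_eq_one_div, div_add_one hq.ne', div_le_iff₀ hq]
    linarith
  have hr0 : 0 < q⁻¹ + 1 := by positivity
  have hTm : ∀ k : ℝ, AEStronglyMeasurable (fun x => truncation k (w x)) μ := fun k =>
    (contDiff_truncation k).continuous.comp_aestronglyMeasurable hwq.1
  have hT'm : ∀ k : ℝ, AEStronglyMeasurable (fun x => deriv (truncation k) (w x)) μ := fun k =>
    ((contDiff_truncation k).continuous_deriv (by simp)).comp_aestronglyMeasurable hwq.1
  have hTp : ∀ k : ℝ, 0 < k → PowIntegrable μ p (fun x => truncation k (w x)) := fun k hk => by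
    refine ⟨hTm k, (hwq.2.const_mul ((k * 2) ^ (p - (q⁻¹ + 1)))).mono' ?_
      (Eventually.of_forall fun x => ?_)⟩
    · exact ((hTm k).norm.aemeasurable.pow_const p).aestronglyMeasurable
    · rw [Real.norm_of_nonneg (by positivity)]
      have e : |truncation k (w x)| ^ p = |truncation k (w x)| ^ (p - (q⁻¹ + 1)) *
          |truncation k (w x)| ^ (q⁻¹ + 1) := by
        rw [← Real.rpow_add_of_nonneg (abs_nonneg _) (by linarith) hr0.le, sub_add_cancel]
      rw [e]
      exact mul_le_mul
        (Real.rpow_le_rpow (abs_nonneg _) (abs_truncation_le hk _) (by linarith))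
        (Real.rpow_le_rpow (abs_nonneg _) (abs_truncation_le_abs hk _) hr0.le)
        (by positivity) (by positivity)
  have hle : ∀ k : ℝ, 0 < k → ∀ x, ‖F x * truncation k (w x)‖ ≤ |w x * F x| := fun k hk x => by
    rw [norm_mul, abs_mul, mul_comm]
    exact mul_le_mul_of_nonneg_right (abs_truncation_le_abs hk _) (abs_nonneg _)
  have hFT : ∀ k : ℝ, 0 < k → Integrable (fun x => F x * truncation k (w x)) μ := fun k hk =>
    hwF.abs.mono' (hFq.1.mul (hTm k)) (Eventually.of_forall (hle k hk))
  have hk0 : ∀ k : ℕ, (0 : ℝ) < k + 1 := fun k => by positivity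
  have key := fun k : ℕ => hF.integral_eq_of_truncation hφ hp hG hGm hw hW
    (contDiff_truncation ((k : ℝ) + 1)) (abs_truncation_le (hk0 k)) (abs_deriv_truncation_le (hk0 k))
    (hTp _ (hk0 k)) (hFT _ (hk0 k))
  have hlim1 : Tendsto (fun k : ℕ => ∫ x, F x * truncation ((k : ℝ) + 1) (w x) ∂μ) atTop
      (𝓝 (∫ x, w x * F x ∂μ)) := by
    refine tendsto_integral_of_dominated_convergence (fun x => |w x * F x|)
      (fun k => hFq.1.mul (hTm _)) hwF.abs (fun k => Eventually.of_forall (hle _ (hk0 k)))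
      (Eventually.of_forall fun x => ?_)
    rw [mul_comm (w x)]
    exact (tendsto_truncation (w x)).const_mul (F x)
  have hI := integrable_rpow_mul_inner hφ hp hG hGm (fun c hc => hw.measurableInChart hc) hW
  have hlim2 : Tendsto (fun k : ℕ => ∫ x, ‖G x‖ ^ (p - 2) *
      (deriv (truncation ((k : ℝ) + 1)) (w x) * inner ℝ (G x) (W x)) ∂μ) atTop
      (𝓝 (∫ x, ‖G x‖ ^ (p - 2) * inner ℝ (G x) (W x) ∂μ)) := by
    simp_rw [mul_left_comm (‖G _‖ ^ (p - 2))]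
    refine tendsto_integral_of_dominated_convergence
      (fun x => |‖G x‖ ^ (p - 2) * inner ℝ (G x) (W x)|) (fun k => (hT'm _).mul hI.1) hI.abs
      (fun k => Eventually.of_forall fun x => ?_) (Eventually.of_forall fun x => ?_)
    · rw [norm_mul, Real.norm_eq_abs]
      exact mul_le_of_le_one_left (abs_nonneg _) (abs_deriv_truncation_le (hk0 k) _)
    · have := (tendsto_deriv_truncation (w x)).mul_const (‖G x‖ ^ (p - 2) * inner ℝ (G x) (W x))
      rwa [one_mul] at this
  refine tendsto_nhds_unique hlim1 ?_
  exact hlim2.neg.congr fun k => (key k).symm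

end IntegrationByParts

end ParabolicFrequency

namespace ParabolicFrequency

set_option linter.unusedSectionVars false

/-! ### The p-energy and the verification of the abstract hypotheses. -/

section Norm

variable {α : Type*} [MeasurableSpace α] {μ : Measure α} {r q : ℝ}

theorem PowIntegrable.integral_eq_toReal_eLpNorm_rpow (hr : 0 < r) {f : α → ℝ}
    (hf : PowIntegrable μ r f) :
    ∫ x, |f x| ^ r ∂μ = (eLpNorm f (ENNReal.ofReal r) μ).toReal ^ r := by
  have h0 : 0 ≤ ∫ x, |f x| ^ r ∂μ := integral_nonneg fun x => by positivity
  rw [((memLp_iff_powIntegrable hr).2 hf).eLpNorm_eq_integral_rpow_norm (by simpa using hr)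
    ENNReal.ofReal_ne_top, ENNReal.toReal_ofReal hr.le, ENNReal.toReal_ofReal (by
      simp only [Real.norm_eq_abs]; positivity), ← Real.rpow_mul (by simpa using h0),
    inv_mul_cancel₀ hr.ne', Real.rpow_one]
  simp only [Real.norm_eq_abs]

theorem PowIntegrable.eq_zero_iff (hr : 0 < r) {f : α → ℝ} (hf : PowIntegrable μ r f) :
    ∫ x, |f x| ^ r ∂μ = 0 ↔ f =ᵐ[μ] 0 := by
  rw [integral_eq_zero_iff_of_nonneg (fun x => by positivity) hf.2]
  refine ⟨fun h => h.mono fun x hx => ?_, fun h => h.mono fun x hx => ?_⟩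
  · simpa using ((Real.rpow_eq_zero (abs_nonneg _) hr.ne').1 hx)
  · simp only [Pi.zero_apply] at hx ⊢
    rw [hx, abs_zero, Real.zero_rpow hr.ne']

end Norm

section Energy

variable {n : ℕ} {M : Type*} [MetricSpace M] [ChartedSpace (EuclideanSpace ℝ (Fin n)) M]
  [IsManifold (𝓡 n) ∞ M] [RiemannianBundle (fun x : M => TangentSpace (𝓡 n) x)]
  [IsContMDiffRiemannianBundle (𝓡 n) ∞ (EuclideanSpace ℝ (Fin n))
      (fun x : M => TangentSpace (𝓡 n) x)]
  [MeasurableSpace M] [BorelSpace M]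

open Classical in
/-- The `p`-energy `(1/p) ∫ |∇v|^p e^{-φ} dV`. -/
noncomputable def energy (n : ℕ) {M : Type*} [TopologicalSpace M]
    [ChartedSpace (EuclideanSpace ℝ (Fin n)) M]
    [RiemannianBundle (fun x : M => TangentSpace (𝓡 n) x)] [MeasurableSpace M]
    (φ : M → ℝ) (p : ℝ) (v : M → ℝ) : ℝ :=
  if h : ∃ W : (x : M) → TangentSpace (𝓡 n) x, HasWeakGradient v W then
    p⁻¹ * ∫ x, |‖h.choose x‖| ^ p ∂(weightedVolume n φ) else 0

/-- The functions of finite `p`-energy in `L^{1+1/q}`. -/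
def energySpace (n : ℕ) {M : Type*} [TopologicalSpace M]
    [ChartedSpace (EuclideanSpace ℝ (Fin n)) M]
    [RiemannianBundle (fun x : M => TangentSpace (𝓡 n) x)] [MeasurableSpace M]
    (φ : M → ℝ) (p q : ℝ) : Set (M → ℝ) :=
  {v | PowIntegrable (weightedVolume n φ) (q⁻¹ + 1) v ∧
    ∃ W : (x : M) → TangentSpace (𝓡 n) x, HasWeakGradient v W ∧
      PowIntegrable (weightedVolume n φ) p (fun x => ‖W x‖)}

section
variable [SecondCountableTopology M]
  {φ v : M → ℝ} {W G : (x : M) → TangentSpace (𝓡 n) x} {p q : ℝ}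

/-- Almost everywhere uniqueness of weak gradients makes the choice in the definition immaterial. -/
theorem energy_eq (hφ : Continuous φ) (hv : HasWeakGradient v W) :
    energy n φ p v = p⁻¹ * ∫ x, |‖W x‖| ^ p ∂(weightedVolume n φ) := by
  have h : ∃ W : (x : M) → TangentSpace (𝓡 n) x, HasWeakGradient v W := ⟨W, hv⟩
  rw [energy, dif_pos h]
  congr 1
  refine integral_congr_ae ?_
  filter_upwards [h.choose_spec.ae_eq hφ hv EventuallyEq.rfl] with x hx
  rw [hx]

theorem hasWeakGradient_zero :
    HasWeakGradient (fun _ : M => (0 : ℝ)) (fun x => (0 : TangentSpace (𝓡 n) x)) := by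
  rw [hasWeakGradient_iff]
  intro c _ o
  simp only [inner_zero_left]
  exact ⟨locallyIntegrableOn_zero, locallyIntegrableOn_zero, by simp⟩

theorem isEnergy_energy (hφ : Continuous φ) (hp : 1 < p) (hq : 0 < q) :
    IsEnergy (weightedVolume n φ) p q (energySpace n φ p q) (energy n φ p) := by
  have hp0 : 0 < p := by linarith
  have hr0 : 0 < q⁻¹ + 1 := by positivity
  refine ⟨fun v hv => hv.1, ⟨fun _ => 0, ?_, _, hasWeakGradient_zero, ?_⟩, ?_, ?_, ?_⟩
  · refine ⟨aestronglyMeasurable_const, ?_⟩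
    simp [Real.zero_rpow hr0.ne']
  · refine ⟨by simpa using aestronglyMeasurable_const, ?_⟩
    simp [Real.zero_rpow hp0.ne']
  · rintro v ⟨-, W, hW, -⟩
    rw [energy_eq hφ hW]
    exact mul_nonneg (by positivity) (integral_nonneg fun x => by positivity)
  · rintro v ⟨hv, W, hW, hWp⟩ z ⟨hz, Z, hZ, hZp⟩ τ h0 h1
    have e1 : (fun x => v x + τ * (z x - v x)) = fun x => (1 - τ) * v x + τ * z x := by
      ext x; ring
    rw [e1]
    have hg := (hW.const_mul (1 - τ)).add (hZ.const_mul τ)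
    have hle : ∀ x, ‖(1 - τ) • W x + τ • Z x‖ ≤ (1 - τ) * ‖W x‖ + τ * ‖Z x‖ := fun x => by
      refine (norm_add_le _ _).trans (le_of_eq ?_)
      rw [norm_smul, norm_smul, Real.norm_of_nonneg h0, Real.norm_of_nonneg (by linarith)]
    have hm : AEStronglyMeasurable (fun x => ‖(1 - τ) • W x + τ • Z x‖) (weightedVolume n φ) :=
      aestronglyMeasurable_norm hφ fun c hc => hg.measurableInChart hc
    have hpow : PowIntegrable (weightedVolume n φ) p (fun x => ‖(1 - τ) • W x + τ • Z x‖) := by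
      refine (hWp.abs_add hp0.le hZp).mono hp0.le hm zero_le_one (Eventually.of_forall fun x => ?_)
      simp only [abs_norm]
      rw [one_mul, abs_of_nonneg (by positivity)]
      refine (hle x).trans (add_le_add ?_ ?_)
      · exact mul_le_of_le_one_left (norm_nonneg _) (by linarith)
      · exact mul_le_of_le_one_left (norm_nonneg _) h1
    refine ⟨⟨(hv.const_mul hr0.le _).add hr0.le (hz.const_mul hr0.le _), _, hg, hpow⟩, ?_⟩
    rw [energy_eq hφ hg, energy_eq hφ hW, energy_eq hφ hZ]
    have h2 : ∫ x, |‖(1 - τ) • W x + τ • Z x‖| ^ p ∂(weightedVolume n φ) ≤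
        ∫ x, ((1 - τ) * |‖W x‖| ^ p + τ * |‖Z x‖| ^ p) ∂(weightedVolume n φ) := by
      refine integral_mono hpow.2 ((hWp.2.const_mul _).add (hZp.2.const_mul _)) fun x => ?_
      simp only [abs_norm]
      refine (Real.rpow_le_rpow (norm_nonneg _) (hle x) hp0.le).trans ?_
      exact (convexOn_rpow hp.le).2 (norm_nonneg (W x)) (norm_nonneg (Z x)) (by linarith) h0 (by ring)
    rw [integral_add (hWp.2.const_mul _) (hZp.2.const_mul _), integral_const_mul,
      integral_const_mul] at h2
    have h3 := mul_le_mul_of_nonneg_left h2 (inv_nonneg.2 hp0.le)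
    linarith
  · rintro v ⟨hv, W, hW, hWp⟩ τ h0
    have hg := hW.const_mul τ
    have e : ∀ x, |‖τ • W x‖| ^ p = τ ^ p * |‖W x‖| ^ p := fun x => by
      rw [norm_smul, Real.norm_of_nonneg h0, abs_norm, abs_of_nonneg (by positivity),
        Real.mul_rpow h0 (norm_nonneg _)]
    refine ⟨⟨hv.const_mul hr0.le _, _, hg,
      aestronglyMeasurable_norm hφ fun c hc => hg.measurableInChart hc, ?_⟩, ?_⟩
    · simp_rw [e]
      exact hWp.2.const_mul _
    · rw [energy_eq hφ hg, energy_eq hφ hW]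
      simp_rw [e]
      rw [integral_const_mul]
      ring

end

theorem rpow_mul_inner_self {E : Type*} [NormedAddCommGroup E] [InnerProductSpace ℝ E] (v : E)
    {p : ℝ} (hp : p ≠ 0) : ‖v‖ ^ (p - 2) * inner ℝ v v = ‖v‖ ^ p := by
  rcases eq_or_ne v 0 with rfl | hv
  · simp [Real.zero_rpow hp]
  · rw [real_inner_self_eq_norm_sq, ← Real.rpow_natCast, ← Real.rpow_add (norm_pos_iff.2 hv)]
    congr 1
    push_cast
    ring

theorem rpow_mul_inner_le {E : Type*} [NormedAddCommGroup E] [InnerProductSpace ℝ E] (v w : E)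
    {p : ℝ} (hp : 1 < p) :
    ‖v‖ ^ (p - 2) * inner ℝ v w ≤ p⁻¹ * ‖w‖ ^ p + (1 - p⁻¹) * ‖v‖ ^ p := by
  have hc : (p / (p - 1)).HolderConjugate p := (Real.HolderConjugate.conjExponent hp).symm
  have h1 := Real.young_inequality_of_nonneg (a := ‖v‖ ^ (p - 1)) (b := ‖w‖) (by positivity)
    (norm_nonneg _) hc
  have hp' : p - 1 ≠ 0 := by linarith
  rw [← Real.rpow_mul (norm_nonneg _), mul_div_cancel₀ _ hp'] at h1
  refine ((le_abs_self _).trans (abs_rpow_mul_inner_le v w p)).trans (h1.trans (le_of_eq ?_))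
  have : p ≠ 0 := by linarith
  field_simp
  ring

variable [IsRiemannianManifold (𝓡 n) M] [ProperSpace M]
  {φ u ut : M → ℝ} {p q C : ℝ}

theorem StandingAssumption.powIntegrable (hq : 0 < q) (h : StandingAssumption n φ p q u ut) :
    PowIntegrable (weightedVolume n φ) (q + 1) u ∧ PowIntegrable (weightedVolume n φ) (q + 1) ut := by
  obtain ⟨⟨_, -, h1, -⟩, ⟨_, -, h2, -⟩, -⟩ := h
  exact ⟨(memLp_iff_powIntegrable (by positivity)).1 h1, (memLp_iff_powIntegrable (by positivity)).1 h2⟩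

/-- Solutions of the perturbed inequality satisfy the abstract hypotheses. -/
theorem exists_isSlice (hφ : Continuous φ) (hp : 1 < p) (hq : 0 < q) (hpq : q + 1 ≤ q * p)
    (hC : 0 ≤ C) (hA : StandingAssumption n φ p q u ut) (hE : PerturbedInequality n φ p q C u ut) :
    ∃ F h, IsSlice (weightedVolume n φ) p q C (energySpace n φ p q) (energy n φ p) u ut F h := by
  have hp0 : 0 < p := by linarith
  have hq1 : 0 < q + 1 := by linarith
  obtain ⟨hu, hut⟩ := hA.powIntegrable hq
  obtain ⟨-, -, G₀, hG₀, hG₀p⟩ := hA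
  obtain ⟨G, F, hG, hF, herr⟩ := hE
  set μ := weightedVolume n φ with hμ
  have hGm : ∀ c ∈ atlas (EuclideanSpace ℝ (Fin n)) M, MeasurableInChart c G :=
    fun c hc => hG.measurableInChart hc
  have hGn : AEStronglyMeasurable (fun x => ‖G x‖) μ := aestronglyMeasurable_norm hφ hGm
  -- The weak gradient in the equation agrees almost everywhere with the p-integrable one of the
  -- standing assumption.
  have hGp : PowIntegrable μ p (fun x => ‖G x‖) := by
    refine ((memLp_iff_powIntegrable hp0).1 hG₀p).mono hp0.le hGn zero_le_one ?_
    filter_upwards [hG.ae_eq hφ hG₀ EventuallyEq.rfl] with x hx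
    rw [hx, one_mul]
  set h : M → ℝ := fun x => ‖G x‖ ^ (p / (q + 1)) with hh
  have hh0 : ∀ x, 0 ≤ h x := fun x => by positivity
  have hhe : ∀ x, h x ^ (q + 1) = ‖G x‖ ^ p := fun x => by
    rw [hh, ← Real.rpow_mul (norm_nonneg _), div_mul_cancel₀ _ hq1.ne']
  have hhp : PowIntegrable μ (q + 1) h := by
    refine ⟨(hGn.aemeasurable.pow_const _).aestronglyMeasurable, ?_⟩
    have := hGp.2
    simp only [abs_norm] at this
    simpa only [abs_of_nonneg (hh0 _), hhe] using this
  have herr' : ∀ᵐ x ∂μ, |ut x - F x| ≤ errorMajorant q C (u x) (h x) := by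
    filter_upwards [herr] with x hx
    rwa [errorBound_eq _ _ _ _ _ (norm_nonneg _)] at hx
  -- The operator term inherits integrability from u_t and the error bound; it can then be paired
  -- with functions in L^{1+1/q}.
  have hFp : PowIntegrable μ (q + 1) F := by
    have h1 : PowIntegrable μ (q + 1) (fun x => |ut x| + |(2 * C) * (|u x| + |h x|)|) :=
      hut.abs_add hq1.le ((hu.abs_add hq1.le hhp).const_mul hq1.le (2 * C))
    refine h1.mono hq1.le hF.1.aestronglyMeasurable zero_le_one ?_
    filter_upwards [herr'] with x hx
    have h2 := hx.trans (errorMajorant_le (q := q) (s := u x) hC (hh0 x))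
    have h3 : |F x| ≤ |ut x| + |ut x - F x| := by
      have := abs_sub (ut x) (ut x - F x)
      rwa [sub_sub_cancel] at this
    have h4 : 0 ≤ 2 * C * (|u x| + |h x|) := by positivity
    rw [one_mul, abs_of_nonneg h4, abs_of_nonneg (add_nonneg (abs_nonneg _) h4),
      abs_of_nonneg (hh0 x)]
    linarith
  have hvp := hu.spow hq
  have hmem : (fun x => spow q (u x)) ∈ energySpace n φ p q := ⟨hvp, G, hG, hGp⟩
  have hibp := fun (w : M → ℝ) (W : (x : M) → TangentSpace (𝓡 n) x) (h1 : HasWeakGradient w W)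
    (h2 : PowIntegrable μ p (fun x => ‖W x‖)) (h3 : PowIntegrable μ (q⁻¹ + 1) w) =>
    hF.integral_mul_eq hφ hp hq hpq hFp hGp hGm h1 h2 h3
  have hself : ∫ x, ‖G x‖ ^ (p - 2) * inner ℝ (G x) (G x) ∂μ = ∫ x, |‖G x‖| ^ p ∂μ := by
    refine integral_congr_ae (Eventually.of_forall fun x => ?_)
    simp only
    rw [rpow_mul_inner_self _ hp0.ne', abs_norm]
  have hEu : p * energy n φ p (fun x => spow q (u x)) = ∫ x, |‖G x‖| ^ p ∂μ := by
    rw [energy_eq hφ hG, mul_inv_cancel_left₀ hp0.ne']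
  have hpair := hibp _ G hG hGp hvp
  rw [hself] at hpair
  refine ⟨F, h, hC, hu, hut, hFp, hhp, hh0, hmem, ?_, ?_, ?_, herr'⟩
  · rw [hEu]
    simp only [hhe, abs_norm]
  · rintro v ⟨hv, W, hW, hWp⟩
    have h1 := hibp v W hW hWp hv
    have e : ∀ x, (v x - spow q (u x)) * F x = v x * F x - spow q (u x) * F x := fun x => by ring
    simp_rw [e]
    rw [integral_sub (hv.integrable_mul hq hFp) (hvp.integrable_mul hq hFp), h1, hpair,
      energy_eq hφ hG, energy_eq hφ hW]
    -- Young's inequality for the p-energy density, which after integration by parts is the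
    -- subgradient inequality.
    have h2 : ∫ x, ‖G x‖ ^ (p - 2) * inner ℝ (G x) (W x) ∂μ ≤
        ∫ x, (p⁻¹ * |‖W x‖| ^ p + (1 - p⁻¹) * |‖G x‖| ^ p) ∂μ := by
      refine integral_mono (integrable_rpow_mul_inner hφ hp hGp hGm
        (fun c hc => hW.measurableInChart hc) hWp)
        ((hWp.2.const_mul _).add (hGp.2.const_mul _)) fun x => ?_
      simp only [abs_norm]
      exact rpow_mul_inner_le _ _ hp
    rw [integral_add (hWp.2.const_mul _) (hGp.2.const_mul _), integral_const_mul,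
      integral_const_mul] at h2
    linarith
  · rw [hEu, hpair, neg_neg]

end Energy

section Curve

variable {n : ℕ} {M : Type*} [MetricSpace M] [ChartedSpace (EuclideanSpace ℝ (Fin n)) M]
  [RiemannianBundle (fun x : M => TangentSpace (𝓡 n) x)]
  [MeasurableSpace M] {φ : M → ℝ} {q t : ℝ} {u : ℝ → M → ℝ} {ut : M → ℝ} {T T' : Set ℝ}

theorem HasTimeDerivAt.hasPowDerivAt (h : HasTimeDerivAt n φ (q + 1) u ut T t) (hq : 0 < q)
    (hT : T' ⊆ T) (hu : ∀ s ∈ T', PowIntegrable (weightedVolume n φ) (q + 1) (u s)) (ht : t ∈ T')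
    (hut : PowIntegrable (weightedVolume n φ) (q + 1) ut) :
    HasPowDerivAt (weightedVolume n φ) q u ut T' t := by
  have hq1 : 0 < q + 1 := by linarith
  unfold HasTimeDerivAt at h
  have h1 := h.mono_left (nhdsWithin_mono t (sdiff_subset_sdiff_left (t := {t}) hT))
  have h2 := ((ENNReal.tendsto_toReal ENNReal.zero_ne_top).comp h1).rpow_const (p := q + 1)
    (Or.inr hq1.le)
  rw [ENNReal.toReal_zero, Real.zero_rpow hq1.ne'] at h2
  refine h2.congr' ?_
  filter_upwards [self_mem_nhdsWithin] with s hs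
  exact (((powIntegrable_slope hq hu ht hs.1).sub hq1.le hut).integral_eq_toReal_eLpNorm_rpow
    hq1).symm

end Curve

end ParabolicFrequency

/-! ### Conclusion. -/

namespace ParabolicFrequency

set_option linter.unusedSectionVars false

/-- Backward uniqueness on a compact time interval inside of which the coefficient is continuous. -/
theorem norm_eq_zero_of_perturbedInequality {n : ℕ} {M : Type*} [MetricSpace M]
    [ChartedSpace (EuclideanSpace ℝ (Fin n)) M] [IsManifold (𝓡 n) ∞ M]
    [RiemannianBundle (fun x : M => TangentSpace (𝓡 n) x)]
    [IsContMDiffRiemannianBundle (𝓡 n) ∞ (EuclideanSpace ℝ (Fin n))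
      (fun x : M => TangentSpace (𝓡 n) x)]
    [IsRiemannianManifold (𝓡 n) M] [ProperSpace M] [MeasurableSpace M] [BorelSpace M]
    {φ : M → ℝ} (hφ : Continuous φ) {p q : ℝ} (hp : 1 < p) (hq : 0 < q) (hpq : q + 1 ≤ q * p)
    {t₀ b : ℝ} (htb : t₀ < b) {C : ℝ → ℝ} {S : Set ℝ} (hS : IsOpen S) (hSI : Ico t₀ b ⊆ S)
    (hC : ContinuousOn C S) (hC0 : ∀ t ∈ Ico t₀ b, 0 ≤ C t)
    (hC2 : IntegrableOn (fun s => C s ^ 2) S) {u ut : ℝ → M → ℝ} {T : Set ℝ} (hT : Icc t₀ b ⊆ T)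
    (hut : ∀ t ∈ Icc t₀ b, HasTimeDerivAt n φ (q + 1) u (ut t) T t)
    (hA : ∀ t ∈ Icc t₀ b, StandingAssumption n φ p q (u t) (ut t))
    (hE : ∀ t ∈ Ico t₀ b, PerturbedInequality n φ p q (C t) (u t) (ut t))
    (hb : ∫ x, |u b x| ^ (q + 1) ∂(weightedVolume n φ) = 0) :
    ∫ x, |u t₀ x| ^ (q + 1) ∂(weightedVolume n φ) = 0 := by
  have hU : IsSolution (weightedVolume n φ) p q (energySpace n φ p q) (energy n φ p) u ut C t₀ b := by
    refine ⟨fun t ht => ((hA t ht).powIntegrable hq).1, fun t ht => ((hA t ht).powIntegrable hq).2,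
      fun t ht => ?_, fun t ht => ?_, hC.mono hSI⟩
    · exact (hut t ht).hasPowDerivAt hq hT (fun s hs => ((hA s hs).powIntegrable hq).1) ht
        ((hA t ht).powIntegrable hq).2
    · exact exists_isSlice hφ hp hq hpq (hC0 t ht) (hA t (Ico_subset_Icc_self ht)) (hE t ht)
  have hint : IntegrableOn (fun s => C s ^ 2) (Icc t₀ b) := by
    rw [integrableOn_Icc_iff_integrableOn_Ico]
    exact hC2.mono_set hSI
  have hint' : ∀ s ∈ Icc t₀ b, ∀ t ∈ Icc t₀ b,
      IntervalIntegrable (fun s => C s ^ 2) volume s t := fun s hs t ht =>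
    (hint.mono_set (ordConnected_Icc.uIcc_subset hs ht)).intervalIntegrable
  have ht₀ : t₀ ∈ Icc t₀ b := ⟨le_rfl, htb.le⟩
  -- The primitive is differentiable also at t₀, because C is continuous on an open set containing
  -- t₀.
  refine hU.norm_eq_zero (P := fun t => ∫ s in t₀..t, C s ^ 2) hp hq hpq (isEnergy_energy hφ hp hq)
    htb.le (fun t ht => ?_) ?_ intervalIntegral.integral_same (fun s hs t ht hst => ?_) hb
  · have hc : ContinuousOn (fun s => C s ^ 2) S := hC.pow 2
    refine (intervalIntegral.integral_hasDerivAt_right (hint' _ ht₀ _ (Ico_subset_Icc_self ht))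
      ?_ (hc.continuousAt (hS.mem_nhds (hSI ht)))).hasDerivWithinAt
    exact hc.stronglyMeasurableAtFilter hS t (hSI ht)
  · have := intervalIntegral.continuousOn_primitive_interval (a := t₀) (b := b)
      (f := fun s => C s ^ 2) (μ := volume) (by rwa [uIcc_of_le htb.le])
    rwa [uIcc_of_le htb.le] at this
  · have h1 := intervalIntegral.integral_add_adjacent_intervals (hint' _ ht₀ _ hs) (hint' _ hs _ ht)
    have h2 : 0 ≤ ∫ r in s..t, C r ^ 2 :=
      intervalIntegral.integral_nonneg hst fun r _ => sq_nonneg _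
    simp only
    linarith

end ParabolicFrequency

theorem corollary5 {n : ℕ} {M : Type*} [MetricSpace M]
    [ChartedSpace (EuclideanSpace ℝ (Fin n)) M] [IsManifold (𝓡 n) ∞ M]
    [RiemannianBundle (fun x : M => TangentSpace (𝓡 n) x)]
    [IsContMDiffRiemannianBundle (𝓡 n) ∞ (EuclideanSpace ℝ (Fin n))
      (fun x : M => TangentSpace (𝓡 n) x)]
    [IsRiemannianManifold (𝓡 n) M] [CompleteSpace M] [MeasurableSpace M] [BorelSpace M]
    (φ : M → ℝ) (hφ : ContMDiff (𝓡 n) 𝓘(ℝ, ℝ) ∞ φ)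
    (p q : ℝ) (hp : 1 < p) (hq : 0 < q) (hδ : 0 ≤ q * (p - 1) - 1)
    (a : EReal) (b : ℝ) (hab : a < (b : EReal))
    (C : ℝ → ℝ) (hC : ContDiffOn ℝ ∞ C {t : ℝ | a < (t : EReal) ∧ t < b})
    (hC0 : ∀ t : ℝ, a < (t : EReal) → t < b → 0 ≤ C t)
    (hC2 : IntegrableOn (fun s => C s ^ 2) {t : ℝ | a < (t : EReal) ∧ t < b})
    (u ut : ℝ → M → ℝ)
    (hut : ∀ t : ℝ, a ≤ (t : EReal) → t ≤ b →
      ParabolicFrequency.HasTimeDerivAt n φ (q + 1) u (ut t)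
        {s : ℝ | a ≤ (s : EReal) ∧ s ≤ b} t)
    (hA : ∀ t : ℝ, a ≤ (t : EReal) → t ≤ b →
      ParabolicFrequency.StandingAssumption n φ p q (u t) (ut t))
    (hE : ∀ t : ℝ, a < (t : EReal) → t < b →
      ParabolicFrequency.PerturbedInequality n φ p q (C t) (u t) (ut t))
    (hb : u b =ᵐ[ParabolicFrequency.riemannianVolume n M] 0) :
    ∀ t : ℝ, a ≤ (t : EReal) → t ≤ b →
      u t =ᵐ[ParabolicFrequency.riemannianVolume n M] 0 := by
  have : ProperSpace M := ParabolicFrequency.properSpace_of_isRiemannianManifold n M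
  have hφc := hφ.continuous
  have hpq : q + 1 ≤ q * p := by linarith
  have hq1 : 0 < q + 1 := by linarith
  have hzero : ∀ {f : M → ℝ}, f =ᵐ[ParabolicFrequency.riemannianVolume n M] 0 ↔
      f =ᵐ[ParabolicFrequency.weightedVolume n φ] 0 := fun {f} =>
    (ParabolicFrequency.ae_weightedVolume_iff (P := fun x => f x = 0) hφc).symm
  have hpow : ∀ t : ℝ, a ≤ (t : EReal) → t ≤ b → ParabolicFrequency.PowIntegrable
      (ParabolicFrequency.weightedVolume n φ) (q + 1) (u t) := fun t h1 h2 =>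
    ((hA t h1 h2).powIntegrable hq).1
  have hS : IsOpen {t : ℝ | a < (t : EReal) ∧ t < b} :=
    (isOpen_lt continuous_const continuous_coe_real_ereal).inter (isOpen_lt continuous_id continuous_const)
  have hbz : ∫ x, |u b x| ^ (q + 1) ∂(ParabolicFrequency.weightedVolume n φ) = 0 :=
    ((hpow b hab.le le_rfl).eq_zero_iff hq1).2 (hzero.1 hb)
  -- Each interior time t is the left end of an interval [t, b), on which C is continuous; this also
  -- covers a = -∞.
  have hint : ∀ t : ℝ, a < (t : EReal) → t < b →
      ∫ x, |u t x| ^ (q + 1) ∂(ParabolicFrequency.weightedVolume n φ) = 0 := by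
    intro t hat htb
    have hmem : ∀ s : ℝ, t ≤ s → a < (s : EReal) := fun s hs =>
      hat.trans_le (EReal.coe_le_coe_iff.2 hs)
    exact ParabolicFrequency.norm_eq_zero_of_perturbedInequality hφc hp hq hpq htb hS
      (fun s hs => ⟨hmem s hs.1, hs.2⟩) hC.continuousOn (fun s hs => hC0 s (hmem s hs.1) hs.2) hC2
      (T := {s : ℝ | a ≤ (s : EReal) ∧ s ≤ b}) (fun s hs => ⟨(hmem s hs.1).le, hs.2⟩)
      (fun s hs => hut s (hmem s hs.1).le hs.2)
      (fun s hs => hA s (hmem s hs.1).le hs.2) (fun s hs => hE s (hmem s hs.1) hs.2) hbz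
  intro t hat htb
  rw [hzero, ← (hpow t hat htb).eq_zero_iff hq1]
  rcases htb.eq_or_lt with rfl | htb
  · exact hbz
  rcases hat.eq_or_lt with rfl | hat
  -- At a finite left end point C may be singular, so the value there is obtained from the interior
  -- by continuity of the norm.
  · have hmem : ∀ s ∈ Icc t b, (t : EReal) ≤ (s : EReal) ∧ s ≤ b := fun s hs =>
      ⟨EReal.coe_le_coe_iff.2 hs.1, hs.2⟩
    have htm : t ∈ Icc t b := ⟨le_rfl, htb.le⟩
    have hpow' : ∀ s ∈ Icc t b, ParabolicFrequency.PowIntegrable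
        (ParabolicFrequency.weightedVolume n φ) (q + 1) (u s) := fun s hs =>
      hpow s (hmem s hs).1 (hmem s hs).2
    have hutp := ((hA t le_rfl htb.le).powIntegrable hq).2
    have hcont := (((hut t le_rfl htb.le).hasPowDerivAt hq hmem hpow' htm hutp).hasDerivWithinAt
      hq hpow' hutp htm).continuousWithinAt
    have hlim := hcont.tendsto.mono_left (nhdsWithin_mono t Ioo_subset_Icc_self)
    have : (𝓝[Ioo t b] t).NeBot := left_nhdsWithin_Ioo_neBot htb
    refine tendsto_nhds_unique hlim (tendsto_const_nhds.congr' ?_)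
    filter_upwards [self_mem_nhdsWithin] with s hs
    exact (hint s (EReal.coe_lt_coe_iff.2 hs.1) hs.2).symm
  · exact hint t hat htb
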